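/- Let $(M^{n+1},g)$ be a closed smooth Riemannian manifold. An $n$-varifold on $M$ is a finite Borel measure on the Grassmann bundle $G_n(TM)$, with the weak topology; $\mathcal V_n(M)$ denotes the closure of the set of integral $n$-varifolds. Fix a distance on $G_n(TM)$ inducing its topology and let $$\mathbf F(V,W)=\sup\Big\{\int f\,dV-\int f\,dW\;:\;|f|\le 1,\ \mathrm{Lip}(f)\le 1\Big\}.$$ A stationary varifold $\Sigma\in\mathcal V_n(M)$ is called \emph{$k$-unstable} if there are $\varepsilon>0$, $0<c_0<1$ and a smooth family $\{F_v\}_{v\in\overline B^k}\subset\mathrm{Diff}(M)$, indexed by the closed unit ball $\overline B^k\subset\mathbb R^k$, with $F_0=\mathrm{Id}$ and $F_{-v}=F_v^{-1}$ for all $v$, such that for every $V\in\mathcal V_n(M)$ with $\mathbf F(V,\Sigma)\le 2\varepsilon$ the function $A^V(v)=\|(F_v)_\#V\|(M)$ is smooth on $\overline B^k$, has a unique maximum, located at a point of the open ball $B^k_{c_0/\sqrt{10}}(0)$, and satisfies $-\frac1{c_0}\mathrm{Id}\le D^2A^V(v)\le -c_0\,\mathrm{Id}$ for all $v\in\overline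 B^k$. It is called \emph{stable} if it is not $1$-unstable. A \emph{minimal hypersurface with optimal regularity} is a stationary varifold in $\mathcal V_n(M)$ such that the singular set $\mathrm{Sing}(\Sigma)$ of its support $\Sigma$ (the set of points of $\Sigma$ near which $\Sigma$ is not a smooth embedded hypersurface) satisfies $\mathcal H^s(\mathrm{Sing}(\Sigma))=0$ for all $s>n-7$; we denote the varifold by $\Sigma$ as well. \textbf{Lemma.} Let $\Sigma$ be a minimal hypersurface with optimal regularity in $(M^{n+1},g)$ whose regular part carries a continuous unit normal field $\nu$. Let $S\supset\mathrm{Sing}(\Sigma)$ be a closed set with $\mathcal H^s(S)=0$ for all $s>n-7$, and suppose that there is a smooth positive function $u$ on $\Sigma\setminus S$ which solves the Jacobi equation $$L_\Sigma u:=-\Delta_\Sigma u-\big(\mathrm{Ric}^M(\nu,\nu)+|A_\Sigma|^2\big)u=0\quad\text{in }\Sigma\setminus S .$$ Then $\Sigma$ is stable. -/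

import Mathlib

open Set Filter Topology MeasureTheory Manifold Bundle
open scoped ENNReal ContDiff

noncomputable section

/-- Euclidean space `ℝᵐ`. -/
abbrev Euc (m : ℕ) : Type := EuclideanSpace ℝ (Fin m)

/-! ### Local Riemannian geometry in coordinates

A metric in coordinates is a matrix-valued function `g` on `ℝᵐ`. -/

section Coordinates

variable {m : ℕ}

/-- The partial derivative `∂ᵢ f (y)`. -/
def pd (i : Fin m) (f : Euc m → ℝ) (y : Euc m) : ℝ :=
  fderiv ℝ f y (EuclideanSpace.single i 1)

/-- Christoffel symbols of the Levi-Civita connection,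
`Γᵏᵢⱼ = ½ gᵏˡ (∂ᵢ gₗⱼ + ∂ⱼ gₗᵢ - ∂ₗ gᵢⱼ)`. -/
def christoffel (g : Euc m → Matrix (Fin m) (Fin m) ℝ) (k i j : Fin m) (y : Euc m) : ℝ :=
  (1 / 2 : ℝ) * ∑ l, (g y)⁻¹ k l *
    (pd i (fun x => g x l j) y + pd j (fun x => g x l i) y - pd l (fun x => g x i j) y)

/-- The Ricci tensor in coordinates,
`Ricᵢⱼ = ∂ₖ Γᵏᵢⱼ - ∂ⱼ Γᵏᵢₖ + Γᵏₖₗ Γˡᵢⱼ - Γᵏⱼₗ Γˡᵢₖ`. -/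
def ricciCoord (g : Euc m → Matrix (Fin m) (Fin m) ℝ) (i j : Fin m) (y : Euc m) : ℝ :=
  (∑ k, (pd k (christoffel g k i j) y - pd j (christoffel g k i k) y)) +
  ∑ k, ∑ l, (christoffel g k k l y * christoffel g l i j y
    - christoffel g k j l y * christoffel g l i k y)

/-- The Laplace-Beltrami operator in coordinates,
`Δ f = (det h)^(-1/2) ∂ᵢ ((det h)^(1/2) hⁱʲ ∂ⱼ f)`. -/
def laplaceBeltrami (h : Euc m → Matrix (Fin m) (Fin m) ℝ) (f : Euc m → ℝ) (z : Euc m) : ℝ :=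
  (Real.sqrt (h z).det)⁻¹ *
    ∑ i, pd i (fun w => Real.sqrt (h w).det * ∑ j, (h w)⁻¹ i j * pd j f w) z

end Coordinates

/-! ### The ambient manifold -/

section Ambient

variable {n : ℕ} {M : Type*} [EMetricSpace M] [ChartedSpace (Euc (n + 1)) M]

section Varifolds

variable [IsManifold (𝓡 (n + 1)) ∞ M]
  [RiemannianBundle (fun x : M => TangentSpace (𝓡 (n + 1)) x)]

instance tangentFiniteDimensional (p : M) :
    FiniteDimensional ℝ (TangentSpace (𝓡 (n + 1)) p) :=
  inferInstanceAs (FiniteDimensional ℝ (Euc (n + 1)))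

variable (n M) in
/-- The Grassmann bundle `Gₙ(TM)` of unoriented tangent hyperplanes of the
`(n+1)`-dimensional manifold `M`. -/
def Gr : Type _ :=
  Σ p : M, {P : Submodule ℝ (TangentSpace (𝓡 (n + 1)) p) // Module.finrank ℝ P = n}

variable (n M) in
/-- The total space of the bundle of endomorphisms of the tangent spaces. -/
abbrev EndBundle : Type _ :=
  TotalSpace (Euc (n + 1) →L[ℝ] Euc (n + 1))
    (fun p : M => TangentSpace (𝓡 (n + 1)) p →L[ℝ] TangentSpace (𝓡 (n + 1)) p)

/-- A tangent plane, viewed as the orthogonal projection onto it. -/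
def Gr.proj (ξ : Gr n M) : EndBundle n M := ⟨ξ.1, ξ.2.1.starProjection⟩

/-- The topology of the Grassmann bundle as a subspace of the endomorphism bundle. -/
instance Gr.topology : TopologicalSpace (Gr n M) :=
  TopologicalSpace.induced Gr.proj inferInstance

instance Gr.measurableSpace : MeasurableSpace (Gr n M) := borel _

instance Gr.borelSpace : BorelSpace (Gr n M) := ⟨rfl⟩

variable (n M) in
/-- An `n`-varifold in the compact manifold `M`: a finite Borel measure on `Gₙ(TM)`, with the
topology of weak convergence. -/
abbrev Varifold : Type _ := FiniteMeasure (Gr n M)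

/-- The action of a diffeomorphism on tangent planes, `(p, P) ↦ (F p, dF_p P)`. -/
def Gr.mapDiffeo (F : M ≃ₘ^∞⟮𝓡 (n + 1), 𝓡 (n + 1)⟯ M) (ξ : Gr n M) : Gr n M :=
  ⟨F ξ.1,
    ⟨ξ.2.1.map
        (F.mfderivToContinuousLinearEquiv (by simp) ξ.1).toLinearEquiv.toLinearMap,
      by
        rw [LinearEquiv.finrank_map_eq]
        exact ξ.2.2⟩⟩

/-- The Jacobian of a diffeomorphism along a tangent plane, `J_P F = |Λₙ (dF_p|_P)|`. -/
def Gr.jacobian (F : M ≃ₘ^∞⟮𝓡 (n + 1), 𝓡 (n + 1)⟯ M) (ξ : Gr n M) : ℝ :=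
  LinearMap.normDet
    ((mfderiv (𝓡 (n + 1)) (𝓡 (n + 1)) F ξ.1).toLinearMap ∘ₗ ξ.2.1.subtype)

/-- The push-forward `F_# V` of a varifold. -/
def Varifold.push (F : M ≃ₘ^∞⟮𝓡 (n + 1), 𝓡 (n + 1)⟯ M) (V : Varifold n M) :
    Measure (Gr n M) :=
  (((V : Measure (Gr n M)).withDensity fun ξ => ENNReal.ofReal (Gr.jacobian F ξ))).map
    (Gr.mapDiffeo F)

/-- The total mass `‖F_# V‖(M)`. -/
def Varifold.pushMass (F : M ≃ₘ^∞⟮𝓡 (n + 1), 𝓡 (n + 1)⟯ M) (V : Varifold n M) : ℝ :=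
  (V.push F univ).toReal

/-- A varifold is stationary if the first derivative of mass vanishes along every smooth
one-parameter family of diffeomorphisms through the identity. -/
def Varifold.IsStationary (V : Varifold n M) : Prop :=
  ∀ F : ℝ → (M ≃ₘ^∞⟮𝓡 (n + 1), 𝓡 (n + 1)⟯ M),
    ContMDiffOn (𝓘(ℝ, ℝ).prod (𝓡 (n + 1))) (𝓡 (n + 1)) ∞
      (fun x : ℝ × M => F x.1 x.2) (Ioo (-1) 1 ×ˢ univ) →
    F 0 = Diffeomorph.refl (𝓡 (n + 1)) M ∞ →
    HasDerivAt (fun t => V.pushMass (F t)) 0 0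

/-- The varifold measure of a Borel piece `φ(B)` of a `C¹` hypersurface parametrized by `φ`,
whose tangent plane at `φ y` is `τ y`. By the area formula this is `ℋⁿ` restricted to `φ(B)`,
lifted to the tangent planes. -/
def pieceMeasure (φ : Euc n → M) (τ : Euc n → Gr n M) (B : Set (Euc n)) : Measure (Gr n M) :=
  ((volume.restrict B).withDensity fun y => ENNReal.ofReal
    (LinearMap.normDet (U := Euc n) (V := TangentSpace (𝓡 (n + 1)) (φ y))
      (mfderiv (𝓡 n) (𝓡 (n + 1)) φ y).toLinearMap)).map τ

/-- `V` is an integral varifold: a countable sum of multiplicity-one varifolds of Borel pieces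
of `C¹` hypersurfaces. -/
def Varifold.IsIntegral (V : Varifold n M) : Prop :=
  ∃ (φ : ℕ → Euc n → M) (τ : ℕ → Euc n → Gr n M) (B : ℕ → Set (Euc n)),
    (∀ j, ContMDiff (𝓡 n) (𝓡 (n + 1)) 1 (φ j) ∧ Function.Injective (φ j) ∧
      (∀ y, Function.Injective (mfderiv (𝓡 n) (𝓡 (n + 1)) (φ j) y)) ∧
      MeasurableSet (B j) ∧
      ∀ y, ∃ hy : Module.finrank ℝ
          (LinearMap.range (mfderiv (𝓡 n) (𝓡 (n + 1)) (φ j) y).toLinearMap) = n,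
        τ j y = ⟨φ j y, ⟨_, hy⟩⟩) ∧
    (V : Measure (Gr n M)) = Measure.sum fun j => pieceMeasure (φ j) (τ j) (B j)

variable (n M) in
/-- The space `𝒱ₙ(M)`: the closure of the integral varifolds among all varifolds. -/
def varifoldSpace : Set (Varifold n M) := closure {V | V.IsIntegral}

/-- The distance `𝐅(V, W) = sup {V(f) - W(f) : |f| ≤ 1, Lip f ≤ 1}`, where Lipschitz constants are
taken with respect to a distance `d` on the Grassmann bundle. -/
def Varifold.distF (d : MetricSpace (Gr n M)) (V W : Varifold n M) : ℝ :=
  sSup {r : ℝ | ∃ f : Gr n M → ℝ, (∀ ξ, |f ξ| ≤ 1) ∧ (∀ ξ η, |f ξ - f η| ≤ d.dist ξ η) ∧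
    r = ∫ ξ, f ξ ∂(V : Measure (Gr n M)) - ∫ ξ, f ξ ∂(W : Measure (Gr n M))}

/-- `k`-unstability of a (stationary) varifold. -/
def Varifold.IsUnstable (d : MetricSpace (Gr n M)) (k : ℕ) (V : Varifold n M) : Prop :=
  ∃ (ε c₀ : ℝ) (F : Euc k → (M ≃ₘ^∞⟮𝓡 (n + 1), 𝓡 (n + 1)⟯ M)),
    0 < ε ∧ 0 < c₀ ∧ c₀ < 1 ∧
    ContMDiffOn ((𝓡 k).prod (𝓡 (n + 1))) (𝓡 (n + 1)) ∞
      (fun x : Euc k × M => F x.1 x.2) (Metric.closedBall 0 1 ×ˢ univ) ∧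
    F 0 = Diffeomorph.refl (𝓡 (n + 1)) M ∞ ∧
    (∀ v ∈ Metric.closedBall (0 : Euc k) 1, F (-v) = (F v).symm) ∧
    ∀ W ∈ varifoldSpace n M, Varifold.distF d W V ≤ 2 * ε →
      ContDiffOn ℝ ∞ (fun v => W.pushMass (F v)) (Metric.closedBall 0 1) ∧
      (∃ v₀ ∈ Metric.ball (0 : Euc k) (c₀ / Real.sqrt 10),
        ∀ v ∈ Metric.closedBall (0 : Euc k) 1, v ≠ v₀ → W.pushMass (F v) < W.pushMass (F v₀)) ∧
      ∀ v ∈ Metric.closedBall (0 : Euc k) 1, ∀ w : Euc k,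
        -(1 / c₀) * ‖w‖ ^ 2 ≤
          iteratedFDerivWithin ℝ 2 (fun v => W.pushMass (F v)) (Metric.closedBall 0 1) v ![w, w] ∧
        iteratedFDerivWithin ℝ 2 (fun v => W.pushMass (F v)) (Metric.closedBall 0 1) v ![w, w] ≤
          -c₀ * ‖w‖ ^ 2

/-- A stationary varifold is stable if it is not `1`-unstable. -/
def Varifold.IsStable (d : MetricSpace (Gr n M)) (V : Varifold n M) : Prop :=
  ¬ V.IsUnstable d 1

/-- The support of the mass measure `‖V‖` of a varifold. -/
def Varifold.spt [MeasurableSpace M] (V : Varifold n M) : Set M :=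
  ((V : Measure (Gr n M)).map (fun ξ : Gr n M => ξ.1)).support

end Varifolds

/-! ### Regular and singular part of a subset -/

/-- A smooth chart of `M` in which `A` is the slice on which the last coordinate vanishes. -/
def IsSliceChart (A : Set M) (e : OpenPartialHomeomorph M (Euc (n + 1))) : Prop :=
  e ∈ IsManifold.maximalAtlas (𝓡 (n + 1)) ∞ M ∧ ∀ q ∈ e.source, q ∈ A ↔ e q (Fin.last n) = 0

variable (n) in
/-- The points of `A` near which `A` is a smooth embedded hypersurface. -/
def regPart (A : Set M) : Set M :=
  {p ∈ A | ∃ e : OpenPartialHomeomorph M (Euc (n + 1)), IsSliceChart A e ∧ p ∈ e.source}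

variable (n) in
/-- The singular set of `A`. -/
def singPart (A : Set M) : Set M := A \ regPart n A

/-- A set has codimension at least `7` in an `n`-dimensional hypersurface: `ℋˢ` of it vanishes
for every `s > n - 7`. -/
def HasCodimSeven (n : ℕ) {X : Type*} [EMetricSpace X] [MeasurableSpace X] [BorelSpace X]
    (S : Set X) : Prop :=
  ∀ s : ℝ, (n : ℝ) - 7 < s → μH[s] S = 0

/-- A minimal hypersurface with optimal regularity: a stationary `n`-varifold whose singular
set has codimension at least `7`. -/
structure Varifold.IsMinimalOptimal [IsManifold (𝓡 (n + 1)) ∞ M]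
    [RiemannianBundle (fun x : M => TangentSpace (𝓡 (n + 1)) x)]
    [MeasurableSpace M] [BorelSpace M] (V : Varifold n M) : Prop where
  mem : V ∈ varifoldSpace n M
  stationary : V.IsStationary
  codim_sing : HasCodimSeven n (singPart n V.spt)

/-! ### The Jacobi equation -/

section Jacobi

variable [IsManifold (𝓡 (n + 1)) ∞ M] [RiemannianBundle (fun x : M => TangentSpace (𝓡 (n + 1)) x)]

/-- The coordinate vector field `∂ᵢ` of a chart, at the point with coordinates `y`. -/
def coordVec (e : OpenPartialHomeomorph M (Euc (n + 1))) (i : Fin (n + 1)) (y : Euc (n + 1)) :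
    TangentSpace (𝓡 (n + 1)) (e.symm y) :=
  mfderiv (𝓡 (n + 1)) (𝓡 (n + 1)) e.symm y (EuclideanSpace.single i (1 : ℝ) : Euc (n + 1))

/-- The metric of `M` in a chart. -/
def metricCoord (e : OpenPartialHomeomorph M (Euc (n + 1))) (y : Euc (n + 1)) :
    Matrix (Fin (n + 1)) (Fin (n + 1)) ℝ :=
  Matrix.of fun i j => inner ℝ (coordVec e i y) (coordVec e j y)

/-- The inclusion `z ↦ (z, 0)` of `ℝⁿ` in `ℝⁿ⁺¹`. -/
def sliceIncl (z : Euc n) : Euc (n + 1) :=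
  WithLp.toLp 2 (Fin.snoc (α := fun _ => ℝ) (fun i => z i) 0)

/-- The metric induced on the hypersurface `{last coordinate = 0}` of a chart. -/
def inducedMetric (e : OpenPartialHomeomorph M (Euc (n + 1))) (z : Euc n) :
    Matrix (Fin n) (Fin n) ℝ :=
  (metricCoord e (sliceIncl z)).submatrix Fin.castSucc Fin.castSucc

/-- `ν` is a unit normal on the regular part of `A`. -/
structure IsUnitNormal (A : Set M) (ν : (p : M) → TangentSpace (𝓡 (n + 1)) p) : Prop where
  continuousOn : ContinuousOn (fun p => (⟨p, ν p⟩ : TangentBundle (𝓡 (n + 1)) M)) (regPart n A)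
  norm_eq_one : ∀ p ∈ regPart n A, ‖ν p‖ = 1
  normal : ∀ e : OpenPartialHomeomorph M (Euc (n + 1)), IsSliceChart A e →
    ∀ z : Euc n, sliceIncl z ∈ e.target → ∀ i : Fin n,
      inner ℝ (coordVec e i.castSucc (sliceIncl z)) (ν (e.symm (sliceIncl z))) = 0

/-- The second fundamental form `Aᵢⱼ = ⟨∇_{∂ᵢ} ∂ⱼ, ν⟩` in a slice chart. -/
def secondFF (e : OpenPartialHomeomorph M (Euc (n + 1)))
    (ν : (p : M) → TangentSpace (𝓡 (n + 1)) p) (z : Euc n) (i j : Fin n) : ℝ :=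
  ∑ k, christoffel (metricCoord e) k i.castSucc j.castSucc (sliceIncl z) *
    inner ℝ (coordVec e k (sliceIncl z)) (ν (e.symm (sliceIncl z)))

/-- `|A|² = hⁱᵏ hʲˡ Aᵢⱼ Aₖₗ`. -/
def secondFFNormSq (e : OpenPartialHomeomorph M (Euc (n + 1)))
    (ν : (p : M) → TangentSpace (𝓡 (n + 1)) p) (z : Euc n) : ℝ :=
  ∑ i, ∑ j, ∑ k, ∑ l, (inducedMetric e z)⁻¹ i k * (inducedMetric e z)⁻¹ j l *
    secondFF e ν z i j * secondFF e ν z k l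

/-- The component `νⁱ = gⁱʲ ⟨∂ⱼ, ν⟩` of a vector field in a chart. -/
def vecComp (e : OpenPartialHomeomorph M (Euc (n + 1)))
    (ν : (p : M) → TangentSpace (𝓡 (n + 1)) p) (y : Euc (n + 1)) (i : Fin (n + 1)) : ℝ :=
  ∑ j, (metricCoord e y)⁻¹ i j * inner ℝ (coordVec e j y) (ν (e.symm y))

/-- `Ric(ν, ν)` at the point with coordinates `y`. -/
def ricciNormal (e : OpenPartialHomeomorph M (Euc (n + 1)))
    (ν : (p : M) → TangentSpace (𝓡 (n + 1)) p) (y : Euc (n + 1)) : ℝ :=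
  ∑ i, ∑ j, ricciCoord (metricCoord e) i j y * vecComp e ν y i * vecComp e ν y j

/-- The function `u` on the hypersurface, in the coordinates of a slice chart. -/
def sliceFun (e : OpenPartialHomeomorph M (Euc (n + 1))) (u : M → ℝ) (z : Euc n) : ℝ :=
  u (e.symm (sliceIncl z))

/-- The Jacobi operator `L u = -Δ u - (Ric(ν, ν) + |A|²) u` in a slice chart. -/
def jacobiOp (e : OpenPartialHomeomorph M (Euc (n + 1)))
    (ν : (p : M) → TangentSpace (𝓡 (n + 1)) p) (u : M → ℝ) (z : Euc n) : ℝ :=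
  -laplaceBeltrami (inducedMetric e) (sliceFun e u) z
    - (ricciNormal e ν (sliceIncl z) + secondFFNormSq e ν z) * sliceFun e u z

/-- The part of a slice chart lying outside `S`. -/
def sliceDomain (e : OpenPartialHomeomorph M (Euc (n + 1))) (S : Set M) : Set (Euc n) :=
  {z | sliceIncl z ∈ e.target ∧ e.symm (sliceIncl z) ∉ S}

/-- `u` is a smooth positive solution of the Jacobi equation on `A \ S`, where `S` contains the
singular set of `A`, so that `A \ S` is covered by slice charts. -/
structure IsPositiveJacobi (A S : Set M) (ν : (p : M) → TangentSpace (𝓡 (n + 1)) p)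
    (u : M → ℝ) : Prop where
  smooth : ∀ e : OpenPartialHomeomorph M (Euc (n + 1)), IsSliceChart A e →
    ContDiffOn ℝ ∞ (sliceFun e u) (sliceDomain e S)
  pos : ∀ p ∈ A \ S, 0 < u p
  jacobi : ∀ e : OpenPartialHomeomorph M (Euc (n + 1)), IsSliceChart A e →
    ∀ z ∈ sliceDomain e S, jacobiOp e ν u z = 0

end Jacobi

end Ambient

end

set_option linter.unusedSectionVars false
set_option linter.unusedSimpArgs false
set_option linter.unusedVariables false

open Set Filter Topology MeasureTheory Manifold Bundle
open scoped ENNReal ContDiff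

noncomputable section

/-- The charts of an `(n + 1)`-dimensional manifold. -/
abbrev Chart (n : ℕ) (M : Type*) [TopologicalSpace M] := OpenPartialHomeomorph M (Euc (n + 1))

/-- The smooth charts of an `(n + 1)`-dimensional manifold. -/
abbrev smoothAtlas (n : ℕ) (M : Type*) [TopologicalSpace M] [ChartedSpace (Euc (n + 1)) M] :
    Set (Chart n M) := IsManifold.maximalAtlas (𝓡 (n + 1)) ∞ M

/-! ### Determinants and norm determinants -/

section LinearAlgebra

/-- The determinant as a continuous multilinear function of the rows. -/
def detCML (n : ℕ) : ContinuousMultilinearMap ℝ (fun _ : Fin n => Fin n → ℝ) ℝ where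
  toMultilinearMap := (Matrix.detRowAlternating (R := ℝ) (n := Fin n)).toMultilinearMap
  cont := by
    change Continuous fun A : Matrix (Fin n) (Fin n) ℝ => A.det
    exact continuous_id.matrix_det

theorem hasDerivAt_det {n : ℕ} {A : ℝ → Matrix (Fin n) (Fin n) ℝ} {A' : Matrix (Fin n) (Fin n) ℝ}
    {t : ℝ} (h : ∀ i j, HasDerivAt (fun s => A s i j) (A' i j) t) :
    HasDerivAt (fun s => (A s).det) ((A t).adjugate * A').trace t := by
  have h1 : HasDerivAt (fun s => (fun i j => A s i j : Fin n → Fin n → ℝ)) (fun i j => A' i j) t :=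
    hasDerivAt_pi.2 fun i => hasDerivAt_pi.2 fun j => h i j
  have h2 := ((detCML n).hasFDerivAt (fun i j => A t i j)).comp_hasDerivAt t h1
  refine h2.congr_deriv ?_
  symm
  rw [ContinuousMultilinearMap.linearDeriv_apply, Matrix.trace_mul_comm, Matrix.trace]
  refine Finset.sum_congr rfl fun i _ => ?_
  have : (A t).adjugate.transpose.mulVec (A' i) i = ((A t).updateRow i (A' i)).det := by
    rw [Matrix.adjugate_transpose, ← Matrix.cramer_eq_adjugate_mulVec,
      Matrix.cramer_transpose_apply]
  rw [Matrix.diag_apply, Matrix.mul_apply]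
  refine Eq.trans ?_ this
  simp [Matrix.mulVec, dotProduct, mul_comm]

theorem contDiffAt_det {n : ℕ} {X : Type*} [NormedAddCommGroup X] [NormedSpace ℝ X] {k : WithTop ℕ∞}
    {A : X → Matrix (Fin n) (Fin n) ℝ} {x : X} (h : ∀ i j, ContDiffAt ℝ k (fun s => A s i j) x) :
    ContDiffAt ℝ k (fun s => (A s).det) x := by
  have h1 : ContDiffAt ℝ k (fun s => (fun i j => A s i j : Fin n → Fin n → ℝ)) x :=
    contDiffAt_pi.2 fun i => contDiffAt_pi.2 fun j => h i j
  exact (detCML n).contDiff.contDiffAt.comp x h1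

theorem gram_mulVec_basis {n : ℕ} {U V : Type*} [NormedAddCommGroup U] [InnerProductSpace ℝ U]
    [NormedAddCommGroup V] [InnerProductSpace ℝ V] (f : U →ₗ[ℝ] V) (o b : Fin n → U)
    (A : Matrix (Fin n) (Fin n) ℝ) (hb : ∀ i, b i = ∑ k, A k i • o k) :
    Matrix.gram ℝ (fun i => f (b i)) = A.transpose * Matrix.gram ℝ (fun i => f (o i)) * A := by
  ext i j
  simp only [Matrix.gram_apply, hb, map_sum, map_smul, Matrix.mul_apply, sum_inner, inner_sum,
    real_inner_smul_left, real_inner_smul_right, Matrix.transpose_apply, Finset.sum_mul,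
    Finset.mul_sum]
  refine Finset.sum_congr rfl fun l _ => Finset.sum_congr rfl fun k _ => ?_
  ring

/-- The norm determinant computed from an arbitrary family of vectors. -/
theorem normDet_sq_mul_det_gram {n : ℕ} {U V : Type*} [NormedAddCommGroup U]
    [InnerProductSpace ℝ U] [FiniteDimensional ℝ U]
    [NormedAddCommGroup V] [InnerProductSpace ℝ V] (hn : Module.finrank ℝ U = n) (f : U →ₗ[ℝ] V)
    (b : Fin n → U) :
    f.normDet ^ 2 * (Matrix.gram ℝ b).det = (Matrix.gram ℝ (fun i => f (b i))).det := by
  subst hn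
  let o := stdOrthonormalBasis ℝ U
  let A : Matrix _ _ ℝ := Matrix.of fun k i => o.repr (b i) k
  have hb : ∀ i, b i = ∑ k, A k i • o k := fun i => (o.sum_repr (b i)).symm
  have h1 := gram_mulVec_basis f o b A hb
  have h2 := gram_mulVec_basis LinearMap.id o b A hb
  have h3 : Matrix.gram ℝ (fun i => o i) = 1 := Matrix.gram_eq_one_iff_orthonormal.2 o.orthonormal
  have h4 := f.normDet_sq_eq_det_gram o
  simp only [LinearMap.id_apply] at h2
  rw [h1, show Matrix.gram ℝ b = _ from h2, h3]
  simp only [Matrix.det_mul, Matrix.det_transpose, Matrix.det_one]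
  rw [← h4]
  simp; ring

end LinearAlgebra

/-! ### Uniform Taylor expansion -/

section Taylor

theorem norm_sub_le_of_hasDerivAt_ball {f f' : ℝ → ℝ} {ε C : ℝ}
    (hf : ∀ t, |t| < ε → HasDerivAt f (f' t) t) (hC : ∀ t, |t| < ε → |f' t| ≤ C) {t : ℝ}
    (ht : |t| < ε) : |f t - f 0| ≤ C * |t| := by
  have h0 : (0 : ℝ) < ε := (abs_nonneg t).trans_lt ht
  have := (convex_ball (0 : ℝ) ε).norm_image_sub_le_of_norm_hasDerivWithin_le (f := f) (f' := f')
    (C := C) (x := 0) (y := t) (fun x hx => (hf x (by simpa using hx)).hasDerivWithinAt)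
    (fun x hx => by simpa using hC x (by simpa using hx)) (by simpa using h0) (by simpa using ht)
  simpa using this

theorem taylor_two_bound {f f1 f2 f3 : ℝ → ℝ} {ε C : ℝ}
    (h1 : ∀ t, |t| < ε → HasDerivAt f (f1 t) t) (h2 : ∀ t, |t| < ε → HasDerivAt f1 (f2 t) t)
    (h3 : ∀ t, |t| < ε → HasDerivAt f2 (f3 t) t) (hC : ∀ t, |t| < ε → |f3 t| ≤ C) {t : ℝ}
    (ht : |t| < ε) : |f t - f 0 - t * f1 0 - t ^ 2 / 2 * f2 0| ≤ C * |t| ^ 3 := by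
  have hC0 : 0 ≤ C := (abs_nonneg _).trans (hC t ht)
  have a1 : ∀ s, |s| < ε → |f2 s - f2 0| ≤ C * |s| := fun s hs =>
    norm_sub_le_of_hasDerivAt_ball h3 hC hs
  have a2 : ∀ s, |s| < ε → |f1 s - f1 0 - s * f2 0| ≤ C * |s| ^ 2 := by
    intro s hs
    rcases eq_or_ne s 0 with rfl | hs0
    · simp
    have e1 : ∀ x, |x| < ε → HasDerivAt (fun y => f1 y - y * f2 0) (f2 x - 1 * f2 0) x :=
      fun x hx => (h2 x hx).sub ((hasDerivAt_id x).mul_const _)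
    have := (convex_Icc (-|s|) |s|).norm_image_sub_le_of_norm_hasDerivWithin_le
      (f := fun y => f1 y - y * f2 0) (f' := fun x => f2 x - 1 * f2 0)
      (C := C * |s|) (x := 0) (y := s)
      (fun x hx => (e1 x ((abs_le.2 ⟨hx.1, hx.2⟩).trans_lt hs)).hasDerivWithinAt)
      (fun x hx => by
        have hx' := abs_le.2 ⟨hx.1, hx.2⟩
        rw [one_mul]
        exact (a1 x (hx'.trans_lt hs)).trans (by gcongr))
      ⟨by simp, by simp⟩ ⟨neg_abs_le s, le_abs_self s⟩
    calc _ = ‖f1 s - s * f2 0 - (f1 0 - 0 * f2 0)‖ := by rw [Real.norm_eq_abs]; congr 1; ring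
      _ ≤ _ := this
      _ = _ := by rw [Real.norm_eq_abs, sub_zero]; ring
  have e1 : ∀ x, |x| < ε → HasDerivAt (fun y => f y - y * f1 0 - y ^ 2 / 2 * f2 0)
      (f1 x - f1 0 - x * f2 0) x := fun x hx => by
    refine (((h1 x hx).sub ((hasDerivAt_id x).mul_const (f1 0))).sub
      ((((hasDerivAt_id x).pow 2).div_const 2).mul_const (f2 0))).congr_deriv ?_
    simp
  have := (convex_Icc (-|t|) |t|).norm_image_sub_le_of_norm_hasDerivWithin_le
      (f := fun y => f y - y * f1 0 - y ^ 2 / 2 * f2 0) (f' := fun x => f1 x - f1 0 - x * f2 0)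
      (C := C * |t| ^ 2) (x := 0) (y := t)
      (fun x hx => (e1 x ((abs_le.2 ⟨hx.1, hx.2⟩).trans_lt ht)).hasDerivWithinAt)
      (fun x hx => by
        have hx' := abs_le.2 ⟨hx.1, hx.2⟩
        exact (a2 x (hx'.trans_lt ht)).trans (by gcongr))
      ⟨by simp, by simp⟩ ⟨neg_abs_le t, le_abs_self t⟩
  calc _ = ‖f t - t * f1 0 - t ^ 2 / 2 * f2 0 - (f 0 - 0 * f1 0 - 0 ^ 2 / 2 * f2 0)‖ := by
        rw [Real.norm_eq_abs]; congr 1; ring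
    _ ≤ _ := this
    _ = _ := by rw [Real.norm_eq_abs, sub_zero]; ring

variable {X : Type*} [NormedAddCommGroup X] [NormedSpace ℝ X]

theorem hasDerivAt_slice {f : ℝ × X → ℝ} {t : ℝ} {k : X} (h : DifferentiableAt ℝ f (t, k)) :
    HasDerivAt (fun s => f (s, k)) (fderiv ℝ f (t, k) (1, 0)) t := by
  have h1 : HasDerivAt (fun s : ℝ => (s, k)) ((1 : ℝ), (0 : X)) t :=
    (hasDerivAt_id t).prodMk (hasDerivAt_const t k)
  exact h.hasFDerivAt.comp_hasDerivAt t h1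

theorem taylor_two_uniform_at {f : ℝ × X → ℝ} {k₀ : X} (hf : ContDiffAt ℝ 3 f (0, k₀)) :
    ∃ C > 0, ∃ ε > 0, ∃ U ∈ 𝓝 k₀, ∀ k ∈ U, ∀ t : ℝ, |t| < ε →
      |f (t, k) - f (0, k) - t * deriv (fun s => f (s, k)) 0
        - t ^ 2 / 2 * deriv (deriv fun s => f (s, k)) 0| ≤ C * |t| ^ 3 ∧
      |deriv (fun s => f (s, k)) 0| ≤ C ∧ |deriv (deriv fun s => f (s, k)) 0| ≤ C := by
  let D : (ℝ × X → ℝ) → ℝ × X → ℝ := fun g p => fderiv ℝ g p (1, 0)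
  have hD : ∀ (g : ℝ × X → ℝ) (a b : ℕ) (_ : a + 1 ≤ b) (p : ℝ × X), ContDiffAt ℝ b g p →
      ContDiffAt ℝ a (D g) p := fun g a b hab p hg =>
    (hg.fderiv_right (m := a) (by exact_mod_cast hab)).clm_apply contDiffAt_const
  have c0 : ContDiffAt ℝ (3 : ℕ) f (0, k₀) := hf
  have c1 := hD f 2 3 le_rfl _ c0
  have c2 := hD _ 1 2 le_rfl _ c1
  have c3 := hD _ 0 1 le_rfl _ c2
  have b : ∀ g : ℝ × X → ℝ, ContinuousAt g (0, k₀) → ∀ᶠ p in 𝓝 ((0 : ℝ), k₀),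
      |g p| ≤ |g (0, k₀)| + 1 := fun g hg =>
    (hg.abs.eventually (gt_mem_nhds (lt_add_one _))).mono fun p hp => hp.le
  have ev := (((c0.eventually (by simp)).and (c1.eventually (by simp))).and
    ((c2.eventually (by simp)).and (b _ c3.continuousAt))).and
    ((b _ c1.continuousAt).and (b _ c2.continuousAt))
  rw [nhds_prod_eq] at ev
  obtain ⟨P, hP, Q, hQ, hPQ⟩ := Filter.eventually_prod_iff.1 ev
  obtain ⟨ε, hε, hPε⟩ := Metric.eventually_nhds_iff.1 hP
  refine ⟨|D (D (D f)) (0, k₀)| + |D f (0, k₀)| + |D (D f) (0, k₀)| + 1, by positivity, ε, hε,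
    {k | Q k}, hQ, fun k hk t ht => ?_⟩
  have hh : ∀ s : ℝ, |s| < ε → _ := fun s hs => hPQ (hPε (by simpa using hs)) hk
  have d0 : ∀ s : ℝ, |s| < ε → HasDerivAt (fun s => f (s, k)) (D f (s, k)) s := fun s hs =>
    hasDerivAt_slice ((hh s hs).1.1.1.differentiableAt (by simp))
  have d1 : ∀ s : ℝ, |s| < ε → HasDerivAt (fun s => D f (s, k)) (D (D f) (s, k)) s := fun s hs =>
    hasDerivAt_slice ((hh s hs).1.1.2.differentiableAt (by simp))
  have d2 : ∀ s : ℝ, |s| < ε → HasDerivAt (fun s => D (D f) (s, k)) (D (D (D f)) (s, k)) s :=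
    fun s hs => hasDerivAt_slice ((hh s hs).1.2.1.differentiableAt (by simp))
  have z : |(0 : ℝ)| < ε := by simpa using hε
  have e1 : deriv (fun s => f (s, k)) 0 = D f (0, k) := (d0 0 z).deriv
  have e2 : deriv (deriv fun s => f (s, k)) 0 = D (D f) (0, k) := by
    have : deriv (fun s => f (s, k)) =ᶠ[𝓝 0] fun s => D f (s, k) := by
      filter_upwards [Metric.ball_mem_nhds (0 : ℝ) hε] with s hs
      exact (d0 s (by simpa using hs)).deriv
    rw [this.deriv_eq, (d1 0 z).deriv]
  have p1 := abs_nonneg (D f (0, k₀))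
  have p2 := abs_nonneg (D (D f) (0, k₀))
  have p3 := abs_nonneg (D (D (D f)) (0, k₀))
  rw [e1, e2]
  refine ⟨taylor_two_bound d0 d1 d2 (fun s hs => (hh s hs).1.2.2.trans (by linarith)) ht,
    (hh 0 z).2.1.trans (by linarith), (hh 0 z).2.2.trans (by linarith)⟩

theorem taylor_two_uniform {f : ℝ × X → ℝ} {K : Set X} (hK : IsCompact K)
    (hf : ∀ k ∈ K, ContDiffAt ℝ 3 f (0, k)) :
    ∃ C > 0, ∃ ε > 0, ∃ U ∈ 𝓝ˢ K, ∀ k ∈ U, ∀ t : ℝ, |t| < ε →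
      |f (t, k) - f (0, k) - t * deriv (fun s => f (s, k)) 0
        - t ^ 2 / 2 * deriv (deriv fun s => f (s, k)) 0| ≤ C * |t| ^ 3 ∧
      |deriv (fun s => f (s, k)) 0| ≤ C ∧ |deriv (deriv fun s => f (s, k)) 0| ≤ C := by
  refine hK.induction_on (p := fun S => ∃ C > 0, ∃ ε > 0, ∃ U ∈ 𝓝ˢ S, ∀ k ∈ U, ∀ t : ℝ, |t| < ε →
      |f (t, k) - f (0, k) - t * deriv (fun s => f (s, k)) 0
        - t ^ 2 / 2 * deriv (deriv fun s => f (s, k)) 0| ≤ C * |t| ^ 3 ∧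
      |deriv (fun s => f (s, k)) 0| ≤ C ∧ |deriv (deriv fun s => f (s, k)) 0| ≤ C)
    ⟨1, one_pos, 1, one_pos, ∅, by simp, by simp⟩ ?_ ?_ ?_
  · rintro S T hST ⟨C, hC, ε, hε, U, hU, h⟩
    exact ⟨C, hC, ε, hε, U, nhdsSet_mono hST hU, h⟩
  · rintro S T ⟨C, hC, ε, hε, U, hU, h⟩ ⟨C', hC', ε', hε', U', hU', h'⟩
    refine ⟨max C C', by positivity, min ε ε', by positivity, U ∪ U', union_mem_nhdsSet hU hU', ?_⟩
    rintro k (hk | hk) t ht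
    · obtain ⟨a, b, c⟩ := h k hk t (ht.trans_le (min_le_left _ _))
      exact ⟨a.trans (by gcongr; exact le_max_left _ _), b.trans (le_max_left _ _),
        c.trans (le_max_left _ _)⟩
    · obtain ⟨a, b, c⟩ := h' k hk t (ht.trans_le (min_le_right _ _))
      exact ⟨a.trans (by gcongr; exact le_max_right _ _), b.trans (le_max_right _ _),
        c.trans (le_max_right _ _)⟩
  · intro k hk
    obtain ⟨C, hC, ε, hε, U, hU, h⟩ := taylor_two_uniform_at (hf k hk)
    obtain ⟨V, hVU, hVo, hkV⟩ := mem_nhds_iff.1 hU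
    refine ⟨V, mem_nhdsWithin_of_mem_nhds (hVo.mem_nhds hkV), C, hC, ε, hε, V,
      hVo.mem_nhdsSet.2 Subset.rfl, fun k hk => h k (hVU hk)⟩

end Taylor

/-! ### Charts and frames -/

section Frames

/-- The bilinear form with matrix `g`. -/
def quad {m : ℕ} (g : Matrix (Fin m) (Fin m) ℝ) (v w : Euc m) : ℝ := ∑ i, ∑ j, v i * g i j * w j

/-- The Gram matrix of a family of vectors with respect to the matrix `g`. -/
def frameGram {m k : ℕ} (g : Matrix (Fin m) (Fin m) ℝ) (b : Fin k → Euc m) :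
    Matrix (Fin k) (Fin k) ℝ := Matrix.of fun i j => quad g (b i) (b j)

theorem quad_single {m : ℕ} (g : Matrix (Fin m) (Fin m) ℝ) (i j : Fin m) :
    quad g (EuclideanSpace.single i 1) (EuclideanSpace.single j 1) = g i j := by
  simp [quad, PiLp.single_apply, Finset.sum_ite_eq]

theorem quad_add_left {m : ℕ} (g : Matrix (Fin m) (Fin m) ℝ) (v v' w : Euc m) :
    quad g (v + v') w = quad g v w + quad g v' w := by
  simp [quad, add_mul, Finset.sum_add_distrib]

theorem quad_smul_left {m : ℕ} (g : Matrix (Fin m) (Fin m) ℝ) (c : ℝ) (v w : Euc m) :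
    quad g (c • v) w = c * quad g v w := by
  simp [quad, Finset.mul_sum, mul_assoc]

theorem quad_add_right {m : ℕ} (g : Matrix (Fin m) (Fin m) ℝ) (v w w' : Euc m) :
    quad g v (w + w') = quad g v w + quad g v w' := by
  simp [quad, mul_add, Finset.sum_add_distrib]

theorem quad_smul_right {m : ℕ} (g : Matrix (Fin m) (Fin m) ℝ) (c : ℝ) (v w : Euc m) :
    quad g v (c • w) = c * quad g v w := by
  simp only [quad, Finset.mul_sum, PiLp.smul_apply, smul_eq_mul]
  exact Finset.sum_congr rfl fun i _ => Finset.sum_congr rfl fun j _ => by ring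

theorem ContDiffAt.quad {m : ℕ} {X : Type*} [NormedAddCommGroup X] [NormedSpace ℝ X]
    {k : WithTop ℕ∞} {g : X → Matrix (Fin m) (Fin m) ℝ} {v w : X → Euc m} {x : X}
    (hg : ∀ i j, ContDiffAt ℝ k (fun s => g s i j) x) (hv : ContDiffAt ℝ k v x)
    (hw : ContDiffAt ℝ k w x) : ContDiffAt ℝ k (fun s => _root_.quad (g s) (v s) (w s)) x := by
  unfold _root_.quad
  exact ContDiffAt.sum fun i _ => ContDiffAt.sum fun j _ =>
    ((contDiffAt_euclidean.1 hv i).mul (hg i j)).mul (contDiffAt_euclidean.1 hw j)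

end Frames

section Charts

variable {n : ℕ} {M : Type*} [EMetricSpace M] [ChartedSpace (Euc (n + 1)) M]
  [IsManifold (𝓡 (n + 1)) ∞ M]
  [RiemannianBundle (fun x : M => TangentSpace (𝓡 (n + 1)) x)]

/-- The tangent vector with components `v` in a chart. -/
def chartVec (e : Chart n M) (y v : Euc (n + 1)) :
    TangentSpace (𝓡 (n + 1)) (e.symm y) :=
  mfderiv (𝓡 (n + 1)) (𝓡 (n + 1)) e.symm y v

theorem chartVec_eq_sum (e : Chart n M) (y v : Euc (n + 1)) :
    chartVec e y v = ∑ i, v i • coordVec e i y := by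
  have : v = ∑ i, v i • (EuclideanSpace.single i (1 : ℝ) : Euc (n + 1)) := by
    ext j; simp [Finset.sum_apply, Pi.single_apply]
  conv_lhs => rw [this]
  exact (map_sum (mfderiv (𝓡 (n + 1)) (𝓡 (n + 1)) e.symm y) _ _).trans
    (Finset.sum_congr rfl fun i _ => map_smul _ _ _)

theorem chartVec_smul (e : Chart n M) (y v : Euc (n + 1)) (c : ℝ) :
    chartVec e y (c • v) = c • chartVec e y v := map_smul _ _ _

theorem inner_chartVec (e : Chart n M) (y v w : Euc (n + 1)) :
    inner ℝ (chartVec e y v) (chartVec e y w) = quad (metricCoord e y) v w := by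
  simp only [chartVec_eq_sum, sum_inner, inner_sum, real_inner_smul_left, real_inner_smul_right,
    quad, metricCoord, Matrix.of_apply]
  rw [Finset.sum_comm]
  exact Finset.sum_congr rfl fun i _ => Finset.sum_congr rfl fun j _ => by ring

theorem metricCoord_symm (e : Chart n M) (y : Euc (n + 1))
    (i j : Fin (n + 1)) : metricCoord e y i j = metricCoord e y j i := by
  simp only [metricCoord, Matrix.of_apply]; exact real_inner_comm _ _

theorem quad_symm {m : ℕ} {g : Matrix (Fin m) (Fin m) ℝ} (hg : ∀ i j, g i j = g j i)
    (v w : Euc m) : quad g v w = quad g w v := by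
  unfold quad
  rw [Finset.sum_comm]
  exact Finset.sum_congr rfl fun i _ => Finset.sum_congr rfl fun j _ => by rw [hg]; ring

theorem mem_atlas_contMDiffOn {e : Chart n M}
    (he : e ∈ smoothAtlas n M) :
    ContMDiffOn (𝓡 (n + 1)) (𝓡 (n + 1)) ∞ e e.source :=
  contMDiffOn_of_mem_maximalAtlas he

theorem mem_atlas_contMDiffOn_symm {e : Chart n M}
    (he : e ∈ smoothAtlas n M) :
    ContMDiffOn (𝓡 (n + 1)) (𝓡 (n + 1)) ∞ e.symm e.target :=
  contMDiffOn_symm_of_mem_maximalAtlas he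

theorem mdiffAt_chart {e : Chart n M}
    (he : e ∈ smoothAtlas n M) {p : M} (hp : p ∈ e.source) :
    MDifferentiableAt (𝓡 (n + 1)) (𝓡 (n + 1)) e p :=
  ((mem_atlas_contMDiffOn he).contMDiffAt (e.open_source.mem_nhds hp)).mdifferentiableAt (by simp)

theorem mdiffAt_chart_symm {e : Chart n M}
    (he : e ∈ smoothAtlas n M) {y : Euc (n + 1)} (hy : y ∈ e.target) :
    MDifferentiableAt (𝓡 (n + 1)) (𝓡 (n + 1)) e.symm y :=
  ((mem_atlas_contMDiffOn_symm he).contMDiffAt (e.open_target.mem_nhds hy)).mdifferentiableAt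
    (by simp)

/-- The components in a chart of a tangent vector. -/
def chartComp (e : Chart n M) (y : Euc (n + 1))
    (v : TangentSpace (𝓡 (n + 1)) (e.symm y)) : Euc (n + 1) :=
  mfderiv (𝓡 (n + 1)) (𝓡 (n + 1)) e (e.symm y) v

theorem chartComp_chartVec {e : Chart n M}
    (he : e ∈ smoothAtlas n M) {y : Euc (n + 1)} (hy : y ∈ e.target)
    (v : Euc (n + 1)) : chartComp e y (chartVec e y v) = v := by
  have h1 : (e ∘ e.symm) =ᶠ[𝓝 y] id := by
    filter_upwards [e.open_target.mem_nhds hy] with z hz using e.right_inv hz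
  have h2 := mfderiv_comp y (mdiffAt_chart he (e.map_target hy)) (mdiffAt_chart_symm he hy)
  rw [h1.mfderiv_eq, mfderiv_id] at h2
  exact (congrArg (fun f : Euc (n + 1) →L[ℝ] Euc (n + 1) => f v) h2).symm

theorem chartVec_chartComp {e : Chart n M}
    (he : e ∈ smoothAtlas n M) {y : Euc (n + 1)} (hy : y ∈ e.target)
    (v : TangentSpace (𝓡 (n + 1)) (e.symm y)) : chartVec e y (chartComp e y v) = v := by
  have h1 : (e.symm ∘ e) =ᶠ[𝓝 (e.symm y)] id := by
    filter_upwards [e.open_source.mem_nhds (e.map_target hy)] with z hz using e.left_inv hz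
  have hs : MDifferentiableAt (𝓡 (n + 1)) (𝓡 (n + 1)) e.symm (e (e.symm y)) := by
    rw [e.right_inv hy]; exact mdiffAt_chart_symm he hy
  have h2 := mfderiv_comp (e.symm y) hs (mdiffAt_chart he (e.map_target hy))
  rw [h1.mfderiv_eq, mfderiv_id, e.right_inv hy] at h2
  exact (congrArg (fun f : Euc (n + 1) →L[ℝ] Euc (n + 1) => f v) h2).symm

theorem chartVec_injective {e : Chart n M}
    (he : e ∈ smoothAtlas n M) {y : Euc (n + 1)} (hy : y ∈ e.target) :
    Function.Injective (chartVec e y) := fun v w h => by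
  rw [← chartComp_chartVec he hy v, h, chartComp_chartVec he hy w]

theorem quad_metric_pos {e : Chart n M}
    (he : e ∈ smoothAtlas n M) {y : Euc (n + 1)} (hy : y ∈ e.target)
    {v : Euc (n + 1)} (hv : v ≠ 0) : 0 < quad (metricCoord e y) v v := by
  rw [← inner_chartVec]
  refine real_inner_self_pos.2 fun h => hv ?_
  rw [← chartComp_chartVec he hy v, h]
  exact map_zero _

theorem frameGram_eq_gram (e : Chart n M) (y : Euc (n + 1)) {k : ℕ}
    (b : Fin k → Euc (n + 1)) :
    frameGram (metricCoord e y) b = Matrix.gram ℝ (fun i => chartVec e y (b i)) := by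
  ext i j; rw [Matrix.gram_apply, inner_chartVec]; rfl

theorem det_frameGram_pos {e : Chart n M}
    (he : e ∈ smoothAtlas n M) {y : Euc (n + 1)} (hy : y ∈ e.target)
    {k : ℕ} {b : Fin k → Euc (n + 1)} (hb : LinearIndependent ℝ b) :
    0 < (frameGram (metricCoord e y) b).det := by
  rw [frameGram_eq_gram]
  refine (Matrix.posDef_gram_of_linearIndependent ?_).det_pos
  exact hb.map' (mfderiv (𝓡 (n + 1)) (𝓡 (n + 1)) e.symm y).toLinearMap
    (LinearMap.ker_eq_bot.2 (chartVec_injective he hy))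

theorem contDiffAt_metricCoord [IsContMDiffRiemannianBundle (𝓡 (n + 1)) ∞ (Euc (n + 1))
      (fun x : M => TangentSpace (𝓡 (n + 1)) x)]
    {e : Chart n M}
    (he : e ∈ smoothAtlas n M) {y : Euc (n + 1)} (hy : y ∈ e.target)
    (i j : Fin (n + 1)) : ContDiffAt ℝ ∞ (fun x => metricCoord e x i j) y := by
  have h1 := (mem_atlas_contMDiffOn_symm he).contMDiffOn_tangentMapWithin (m := ∞) (by simp)
    e.open_target.uniqueMDiffOn
  have h2 : ∀ k : Fin (n + 1), ContMDiffOn (𝓡 (n + 1)) ((𝓡 (n + 1)).prod 𝓘(ℝ, Euc (n + 1))) ∞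
      (fun x => (⟨e.symm x, coordVec e k x⟩ : TangentBundle (𝓡 (n + 1)) M)) e.target := by
    intro k
    have h3 : ContMDiff (𝓡 (n + 1)) ((𝓡 (n + 1)).prod 𝓘(ℝ, Euc (n + 1))) ∞
        (fun x : Euc (n + 1) => (⟨x, EuclideanSpace.single k (1 : ℝ)⟩ :
          TangentBundle (𝓡 (n + 1)) (Euc (n + 1)))) := by
      exact contMDiff_vectorSpace_iff_contDiff
        (V := fun _ : Euc (n + 1) => EuclideanSpace.single k (1 : ℝ)).2 contDiff_const
    refine (h1.comp h3.contMDiffOn fun x hx => hx).congr fun x hx => ?_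
    simp only [Function.comp_apply, tangentMapWithin]
    rw [mfderivWithin_of_isOpen e.open_target hx]
    rfl
  have h4 := (h2 i).inner_bundle (h2 j)
  exact (contMDiffOn_iff_contDiffOn.1 h4).contDiffAt (e.open_target.mem_nhds hy)

theorem inner_tangent_congr {q q' : M} (h : q = q') (v w : Euc (n + 1)) :
    @inner ℝ (TangentSpace (𝓡 (n + 1)) q) _ v w = @inner ℝ (TangentSpace (𝓡 (n + 1)) q') _ v w := by
  subst h; rfl

/-- A map in coordinates. -/
def coordMap (e e' : Chart n M) (G : M → M) (y : Euc (n + 1)) :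
    Euc (n + 1) := e' (G (e.symm y))

theorem mfderiv_chartVec {e e' : Chart n M}
    (he : e ∈ smoothAtlas n M)
    (he' : e' ∈ smoothAtlas n M) {G : M → M} {y : Euc (n + 1)}
    (hy : y ∈ e.target) (hG : MDifferentiableAt (𝓡 (n + 1)) (𝓡 (n + 1)) G (e.symm y))
    (hGy : G (e.symm y) ∈ e'.source) (v : Euc (n + 1)) :
    (mfderiv (𝓡 (n + 1)) (𝓡 (n + 1)) G (e.symm y) (chartVec e y v) : Euc (n + 1)) =
      (chartVec e' (coordMap e e' G y) (fderiv ℝ (coordMap e e' G) y v) : Euc (n + 1)) := by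
  have h0 := mdiffAt_chart_symm he hy
  have h1 := mfderiv_comp y hG h0
  have h2 : MDifferentiableAt (𝓡 (n + 1)) (𝓡 (n + 1)) (coordMap e e' G) y :=
    ((mdiffAt_chart he' hGy).comp (e.symm y) hG).comp y h0
  have h3 := mfderiv_comp y (mdiffAt_chart_symm he' (e'.map_source hGy)) h2
  have h4 : (G ∘ e.symm) =ᶠ[𝓝 y] (e'.symm ∘ coordMap e e' G) := by
    have : ContinuousAt (G ∘ e.symm) y := (hG.comp y h0).continuousAt
    filter_upwards [this.preimage_mem_nhds (e'.open_source.mem_nhds hGy)] with z hz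
    exact (e'.left_inv hz).symm
  have h5 := h4.mfderiv_eq (I := 𝓡 (n + 1)) (I' := 𝓡 (n + 1))
  rw [h1, h3, mfderiv_eq_fderiv] at h5
  exact congrArg (fun f : Euc (n + 1) →L[ℝ] Euc (n + 1) => f v) h5

/-- The norm determinant of the differential of a map along a hyperplane, in coordinates. -/
theorem normDet_mfderiv_sq {e e' : Chart n M}
    (he : e ∈ smoothAtlas n M)
    (he' : e' ∈ smoothAtlas n M) {G : M → M} {y : Euc (n + 1)}
    (hy : y ∈ e.target) (hG : MDifferentiableAt (𝓡 (n + 1)) (𝓡 (n + 1)) G (e.symm y))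
    (hGy : G (e.symm y) ∈ e'.source) (P : Submodule ℝ (TangentSpace (𝓡 (n + 1)) (e.symm y)))
    (hP : Module.finrank ℝ P = n) (b : Fin n → Euc (n + 1)) (hb : ∀ i, chartVec e y (b i) ∈ P) :
    (LinearMap.normDet ((mfderiv (𝓡 (n + 1)) (𝓡 (n + 1)) G (e.symm y)).toLinearMap ∘ₗ
      P.subtype)) ^ 2 * (frameGram (metricCoord e y) b).det =
    (frameGram (metricCoord e' (coordMap e e' G y))
      (fun i => fderiv ℝ (coordMap e e' G) y (b i))).det := by
  have h := normDet_sq_mul_det_gram hP ((mfderiv (𝓡 (n + 1)) (𝓡 (n + 1)) G (e.symm y)).toLinearMap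
    ∘ₗ P.subtype) (fun i => ⟨chartVec e y (b i), hb i⟩)
  rw [frameGram_eq_gram, frameGram_eq_gram]
  refine Eq.trans h (congrArg Matrix.det ?_)
  ext i j
  rw [Matrix.gram_apply, Matrix.gram_apply]
  have h1 := mfderiv_chartVec he he' hy hG hGy
  have h2 : e'.symm (coordMap e e' G y) = G (e.symm y) := e'.left_inv hGy
  have h3 := inner_tangent_congr (n := n) h2 (chartVec e' (coordMap e e' G y)
    (fderiv ℝ (coordMap e e' G) y (b i))) (chartVec e' (coordMap e e' G y)
    (fderiv ℝ (coordMap e e' G) y (b j)))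
  refine Eq.trans ?_ h3.symm
  rw [← h1, ← h1]
  rfl

end Charts

/-! ### Variations and the expansion of the Jacobian -/

section Variation

variable {n : ℕ} {M : Type*} [EMetricSpace M] [ChartedSpace (Euc (n + 1)) M]
  [IsManifold (𝓡 (n + 1)) ∞ M]
  [RiemannianBundle (fun x : M => TangentSpace (𝓡 (n + 1)) x)]

variable (n) in
/-- A smooth one-parameter family of maps starting at the identity. -/
structure IsVariation (F : ℝ → M → M) : Prop where
  smooth : ContMDiffOn (𝓘(ℝ, ℝ).prod (𝓡 (n + 1))) (𝓡 (n + 1)) ∞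
    (fun x : ℝ × M => F x.1 x.2) (Ioo (-1) 1 ×ˢ univ)
  zero : ∀ p, F 0 p = p

/-- The map `p ↦ F (t ζ(p)) p`. -/
def deform (F : ℝ → M → M) (ζ : M → ℝ) (t : ℝ) (p : M) : M := F (t * ζ p) p

/-- The Jacobian of a map of `M` along a tangent plane. -/
def planeJac (G : M → M) (ξ : Gr n M) : ℝ :=
  LinearMap.normDet ((mfderiv (𝓡 (n + 1)) (𝓡 (n + 1)) G ξ.1).toLinearMap ∘ₗ ξ.2.1.subtype)

/-- The first derivative of the Jacobian along a deformation. -/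
def firstVar (F : ℝ → M → M) (ζ : M → ℝ) (ξ : Gr n M) : ℝ :=
  deriv (fun t => planeJac (deform F ζ t) ξ) 0

/-- The second derivative of the Jacobian along a deformation. -/
def secondVar (F : ℝ → M → M) (ζ : M → ℝ) (ξ : Gr n M) : ℝ :=
  deriv (deriv fun t => planeJac (deform F ζ t) ξ) 0

/-- A family of maps in coordinates. -/
def coordFam (e : Chart n M) (F : ℝ → M → M)
    (q : ℝ × Euc (n + 1)) : Euc (n + 1) := e (F q.1 (e.symm q.2))

theorem IsVariation.continuousAt {F : ℝ → M → M} (hF : IsVariation n F) {s : ℝ} (hs : |s| < 1)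
    (p : M) : ContMDiffAt (𝓘(ℝ, ℝ).prod (𝓡 (n + 1))) (𝓡 (n + 1)) ∞
      (fun x : ℝ × M => F x.1 x.2) (s, p) :=
  hF.smooth.contMDiffAt ((isOpen_Ioo.prod isOpen_univ).mem_nhds ⟨abs_lt.1 hs, mem_univ _⟩)

theorem IsVariation.contDiffAt_coordFam {F : ℝ → M → M} (hF : IsVariation n F)
    {e : Chart n M}
    (he : e ∈ smoothAtlas n M) {s : ℝ} (hs : |s| < 1) {y : Euc (n + 1)}
    (hy : y ∈ e.target) (hsy : F s (e.symm y) ∈ e.source) :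
    ContDiffAt ℝ ∞ (coordFam e F) (s, y) := by
  have h1 : ContMDiffAt 𝓘(ℝ, ℝ × Euc (n + 1)) (𝓘(ℝ, ℝ).prod (𝓡 (n + 1))) ∞
      (fun q : ℝ × Euc (n + 1) => (q.1, e.symm q.2)) (s, y) :=
    contDiffAt_fst.contMDiffAt.prodMk
      (((mem_atlas_contMDiffOn_symm he).contMDiffAt (e.open_target.mem_nhds hy)).comp
        (I' := 𝓡 (n + 1)) (s, y) contDiffAt_snd.contMDiffAt)
  have h2 := (hF.continuousAt hs (e.symm y)).comp (s, y) h1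
  have h3 : ContMDiffAt 𝓘(ℝ, ℝ × Euc (n + 1)) (𝓡 (n + 1)) ∞ (coordFam e F) (s, y) :=
    ContMDiffAt.comp (I' := 𝓡 (n + 1)) (s, y) (g := e)
      ((mem_atlas_contMDiffOn he).contMDiffAt (e.open_source.mem_nhds hsy)) h2
  exact h3.contDiffAt

theorem IsVariation.coordFam_zero {F : ℝ → M → M} (hF : IsVariation n F)
    {e : Chart n M} {y : Euc (n + 1)} (hy : y ∈ e.target) :
    coordFam e F (0, y) = y := by
  simp only [coordFam, hF.zero]; exact e.right_inv hy

theorem IsVariation.eventually_mem {F : ℝ → M → M} (hF : IsVariation n F)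
    {e : Chart n M}
    (he : e ∈ smoothAtlas n M) {y : Euc (n + 1)} (hy : y ∈ e.target) :
    ∀ᶠ q in 𝓝 ((0 : ℝ), y), |q.1| < 1 ∧ q.2 ∈ e.target ∧ F q.1 (e.symm q.2) ∈ e.source := by
  have h1 : ContinuousAt (fun q : ℝ × Euc (n + 1) => (q.1, e.symm q.2)) (0, y) :=
    continuousAt_fst.prodMk ((e.continuousAt_symm hy).comp continuousAt_snd)
  have h2 : ContinuousAt (fun q : ℝ × Euc (n + 1) => F q.1 (e.symm q.2)) (0, y) :=
    ContinuousAt.comp (x := ((0 : ℝ), y)) (g := fun x : ℝ × M => F x.1 x.2)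
      (hF.continuousAt (by simp) (e.symm y)).continuousAt h1
  refine ((continuousAt_fst.abs.eventually (gt_mem_nhds (by simp))).and
    ((continuousAt_snd.eventually (e.open_target.mem_nhds hy)).and
    (h2.eventually (e.open_source.mem_nhds ?_))))
  simp only [hF.zero]; exact e.map_target hy

theorem IsVariation.fderiv_coordFam {F : ℝ → M → M} (hF : IsVariation n F)
    {e : Chart n M}
    (he : e ∈ smoothAtlas n M) {y : Euc (n + 1)} (hy : y ∈ e.target)
    (c : Euc (n + 1)) : fderiv ℝ (coordFam e F) (0, y) (0, c) = c := by
  have h := (hF.contDiffAt_coordFam he (s := 0) (by simp) hy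
    (by rw [hF.zero]; exact e.map_target hy)).differentiableAt (by simp)
  have h1 : HasFDerivAt (fun x : Euc (n + 1) => ((0 : ℝ), x))
      (ContinuousLinearMap.inr ℝ ℝ (Euc (n + 1))) y := hasFDerivAt_prodMk_right 0 y
  have h2 := h.hasFDerivAt.comp y h1
  have h3 : coordFam e F ∘ (fun x : Euc (n + 1) => ((0 : ℝ), x)) =ᶠ[𝓝 y] id := by
    filter_upwards [e.open_target.mem_nhds hy] with z hz using hF.coordFam_zero hz
  have h4 := (h2.congr_of_eventuallyEq h3.symm).unique (hasFDerivAt_id y)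
  exact congrArg (fun f : Euc (n + 1) →L[ℝ] Euc (n + 1) => f c) h4

/-- The space of parameters on which the Jacobian of a deformation depends: the value and the
differential of the cutoff function, the point, and a frame of the tangent plane. -/
abbrev JacParam (n : ℕ) : Type :=
  (ℝ × (Euc (n + 1) →L[ℝ] ℝ)) × Euc (n + 1) × (Fin n → Euc (n + 1))

/-- The Jacobian of a deformation in coordinates. -/
def coordJac (e : Chart n M) (F : ℝ → M → M)
    (q : ℝ × JacParam n) : ℝ :=
  Real.sqrt ((frameGram (metricCoord e (coordFam e F (q.1 * q.2.1.1, q.2.2.1)))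
    (fun i => fderiv ℝ (coordFam e F) (q.1 * q.2.1.1, q.2.2.1)
      (q.1 * q.2.1.2 (q.2.2.2 i), q.2.2.2 i))).det /
    (frameGram (metricCoord e q.2.2.1) q.2.2.2).det)

theorem contDiffAt_coordJac [IsContMDiffRiemannianBundle (𝓡 (n + 1)) ∞ (Euc (n + 1))
      (fun x : M => TangentSpace (𝓡 (n + 1)) x)]
    {F : ℝ → M → M} (hF : IsVariation n F)
    {e : Chart n M}
    (he : e ∈ smoothAtlas n M) (k : JacParam n)
    (hy : k.2.1 ∈ e.target) (hb : LinearIndependent ℝ k.2.2) :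
    ContDiffAt ℝ ∞ (coordJac e F) (0, k) := by
  have hz : F 0 (e.symm k.2.1) ∈ e.source := by rw [hF.zero]; exact e.map_target hy
  have a1 : ContDiffAt ℝ ∞ (fun q : ℝ × JacParam n => (q.1 * q.2.1.1, q.2.2.1)) (0, k) := by
    fun_prop
  have a2 : ContDiffAt ℝ ∞ (coordFam e F)
      ((fun q : ℝ × JacParam n => (q.1 * q.2.1.1, q.2.2.1)) (0, k)) := by
    simpa using hF.contDiffAt_coordFam he (s := 0) (by simp) hy hz
  have a3 := ContDiffAt.comp (0, k) (f := fun q : ℝ × JacParam n => (q.1 * q.2.1.1, q.2.2.1)) a2 a1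
  have a4 : ContDiffAt ℝ ∞ (fun q : ℝ × JacParam n =>
      fderiv ℝ (coordFam e F) (q.1 * q.2.1.1, q.2.2.1)) (0, k) :=
    ContDiffAt.comp (0, k) (f := fun q : ℝ × JacParam n => (q.1 * q.2.1.1, q.2.2.1))
      (a2.fderiv_right (m := ∞) (by simp)) a1
  have a5 : ∀ i : Fin n, ContDiffAt ℝ ∞ (fun q : ℝ × JacParam n =>
      fderiv ℝ (coordFam e F) (q.1 * q.2.1.1, q.2.2.1)
      (q.1 * q.2.1.2 (q.2.2.2 i), q.2.2.2 i)) (0, k) := by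
    intro i
    refine a4.clm_apply ?_
    have b1 : ContDiffAt ℝ ∞ (fun q : ℝ × JacParam n => q.2.2.2 i) (0, k) :=
      contDiffAt_pi.1 (by fun_prop : ContDiffAt ℝ ∞ (fun q : ℝ × JacParam n => q.2.2.2) (0, k)) i
    have b2 : ContDiffAt ℝ ∞ (fun q : ℝ × JacParam n => q.2.1.2) (0, k) := by fun_prop
    exact (contDiffAt_fst.mul (b2.clm_apply b1)).prodMk b1
  have b0 : ∀ i : Fin n, ContDiffAt ℝ ∞ (fun q : ℝ × JacParam n => q.2.2.2 i) (0, k) := fun i =>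
    contDiffAt_pi.1 (by fun_prop : ContDiffAt ℝ ∞ (fun q : ℝ × JacParam n => q.2.2.2) (0, k)) i
  have hm : coordFam e F (0 * k.1.1, k.2.1) = k.2.1 := by rw [zero_mul]; exact hF.coordFam_zero hy
  have a6 := contDiffAt_det (X := ℝ × JacParam n) (k := ∞) (x := (0, k))
    (A := fun q => frameGram (metricCoord e (coordFam e F (q.1 * q.2.1.1, q.2.2.1)))
    (fun i => fderiv ℝ (coordFam e F) (q.1 * q.2.1.1, q.2.2.1)
      (q.1 * q.2.1.2 (q.2.2.2 i), q.2.2.2 i))) fun i j => by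
      refine ContDiffAt.quad (fun i' j' => ?_) (a5 i) (a5 j)
      refine ContDiffAt.comp (0, k) (g := fun x => metricCoord e x i' j')
        (f := fun q : ℝ × JacParam n => coordFam e F (q.1 * q.2.1.1, q.2.2.1)) ?_ a3
      simp only [hm]
      exact contDiffAt_metricCoord he hy i' j'
  have a7 := contDiffAt_det (X := ℝ × JacParam n) (k := ∞) (x := (0, k))
    (A := fun q => frameGram (metricCoord e q.2.2.1) q.2.2.2) fun i j => by
      refine ContDiffAt.quad (fun i' j' => ?_) (b0 i) (b0 j)
      exact ContDiffAt.comp (0, k) (g := fun x => metricCoord e x i' j')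
        (f := fun q : ℝ × JacParam n => q.2.2.1) (contDiffAt_metricCoord he hy i' j') (by fun_prop)
  have pos := det_frameGram_pos he hy hb
  refine (a6.div a7 pos.ne').sqrt ?_
  have : (fun i => fderiv ℝ (coordFam e F) (0 * k.1.1, k.2.1) (0 * k.1.2 (k.2.2 i), k.2.2 i)) =
      k.2.2 := by
    ext1 i; rw [zero_mul, zero_mul, hF.fderiv_coordFam he hy]
  simp only [Pi.div_apply, hm, this]
  exact (div_pos pos pos).ne'

theorem coordJac_zero {F : ℝ → M → M} (hF : IsVariation n F)
    {e : Chart n M}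
    (he : e ∈ smoothAtlas n M) (k : JacParam n)
    (hy : k.2.1 ∈ e.target) (hb : LinearIndependent ℝ k.2.2) : coordJac e F (0, k) = 1 := by
  have hm : coordFam e F (0 * k.1.1, k.2.1) = k.2.1 := by rw [zero_mul]; exact hF.coordFam_zero hy
  have : (fun i => fderiv ℝ (coordFam e F) (0 * k.1.1, k.2.1) (0 * k.1.2 (k.2.2 i), k.2.2 i)) =
      k.2.2 := by
    ext1 i; rw [zero_mul, zero_mul, hF.fderiv_coordFam he hy]
  simp only [coordJac, hm, this, div_self (det_frameGram_pos he hy hb).ne', Real.sqrt_one]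

theorem contDiffAt_comp_chart_symm {e : Chart n M}
    (he : e ∈ smoothAtlas n M) {ζ : M → ℝ} {y : Euc (n + 1)}
    (hζ : ContMDiffAt (𝓡 (n + 1)) 𝓘(ℝ, ℝ) ∞ ζ (e.symm y)) (hy : y ∈ e.target) :
    ContDiffAt ℝ ∞ (ζ ∘ e.symm) y := by
  have h : ContMDiffAt (𝓡 (n + 1)) 𝓘(ℝ, ℝ) ∞ (ζ ∘ e.symm) y := hζ.comp y
    ((mem_atlas_contMDiffOn_symm he).contMDiffAt (e.open_target.mem_nhds hy))
  exact h.contDiffAt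

theorem planeJac_deform_eq {F : ℝ → M → M} (hF : IsVariation n F)
    {e : Chart n M}
    (he : e ∈ smoothAtlas n M) {ζ : M → ℝ}
    (hζ : ContMDiff (𝓡 (n + 1)) 𝓘(ℝ, ℝ) ∞ ζ) {y : Euc (n + 1)} (hy : y ∈ e.target) {t : ℝ}
    (ht : |t * ζ (e.symm y)| < 1) (hm : F (t * ζ (e.symm y)) (e.symm y) ∈ e.source)
    (P : {P : Submodule ℝ (TangentSpace (𝓡 (n + 1)) (e.symm y)) // Module.finrank ℝ P = n})
    {b : Fin n → Euc (n + 1)} (hb : LinearIndependent ℝ b) (hbP : ∀ i, chartVec e y (b i) ∈ P.1) :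
    planeJac (deform F ζ t) (⟨e.symm y, P⟩ : Gr n M) =
      coordJac e F (t, (ζ (e.symm y), fderiv ℝ (ζ ∘ e.symm) y), y, b) := by
  have hζ1 := contDiffAt_comp_chart_symm he hζ.contMDiffAt hy
  have hG : MDifferentiableAt (𝓡 (n + 1)) (𝓡 (n + 1)) (deform F ζ t) (e.symm y) := by
    have h1 : ContMDiffAt (𝓡 (n + 1)) (𝓘(ℝ, ℝ).prod (𝓡 (n + 1))) ∞
        (fun p : M => (t * ζ p, p)) (e.symm y) :=
      (contMDiffAt_const.mul hζ.contMDiffAt).prodMk contMDiffAt_id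
    exact (ContMDiffAt.comp (e.symm y) (g := fun x : ℝ × M => F x.1 x.2)
      (f := fun p : M => (t * ζ p, p)) (hF.continuousAt ht _) h1).mdifferentiableAt (by simp)
  have h := normDet_mfderiv_sq (G := deform F ζ t) he he hy hG hm P.1 P.2 b hbP
  have pos := det_frameGram_pos he hy hb
  have hc : coordMap e e (deform F ζ t) = fun x => coordFam e F (t * (ζ ∘ e.symm) x, x) := rfl
  have hd : ∀ c, fderiv ℝ (coordMap e e (deform F ζ t)) y c =
      fderiv ℝ (coordFam e F) (t * ζ (e.symm y), y) (t * fderiv ℝ (ζ ∘ e.symm) y c, c) := by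
    intro c
    have h1 : HasFDerivAt (fun x => (t * (ζ ∘ e.symm) x, x))
        ((t • fderiv ℝ (ζ ∘ e.symm) y).prod (ContinuousLinearMap.id ℝ (Euc (n + 1)))) y :=
      ((hζ1.differentiableAt (by simp)).hasFDerivAt.const_mul t).prodMk (hasFDerivAt_id y)
    have h2 := HasFDerivAt.comp y (f := fun x => (t * (ζ ∘ e.symm) x, x))
      ((hF.contDiffAt_coordFam he ht hy hm).differentiableAt (by simp)).hasFDerivAt h1
    rw [hc]
    exact (congrArg (fun f : Euc (n + 1) →L[ℝ] Euc (n + 1) => f c) h2.fderiv)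
  have h3 : coordMap e e (deform F ζ t) y = coordFam e F (t * ζ (e.symm y), y) := rfl
  simp only [hd, h3] at h
  have h4 := congrArg Real.sqrt ((eq_div_iff pos.ne').2 h)
  rw [Real.sqrt_sq (LinearMap.normDet_nonneg _)] at h4
  exact h4

theorem exists_frame {e : Chart n M}
    (he : e ∈ smoothAtlas n M) {y : Euc (n + 1)} (hy : y ∈ e.target)
    (P : {P : Submodule ℝ (TangentSpace (𝓡 (n + 1)) (e.symm y)) // Module.finrank ℝ P = n}) :
    ∃ b : Fin n → Euc (n + 1), Orthonormal ℝ b ∧ ∀ i, chartVec e y (b i) ∈ P.1 := by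
  let Ef : Euc (n + 1) →ₗ[ℝ] TangentSpace (𝓡 (n + 1)) (e.symm y) :=
    (mfderiv (𝓡 (n + 1)) (𝓡 (n + 1)) e.symm y).toLinearMap
  let E : Euc (n + 1) ≃ₗ[ℝ] TangentSpace (𝓡 (n + 1)) (e.symm y) :=
    LinearEquiv.ofBijective Ef
      ⟨chartVec_injective he hy, fun v => ⟨chartComp e y v, chartVec_chartComp he hy v⟩⟩
  let P' : Submodule ℝ (Euc (n + 1)) := P.1.map E.symm.toLinearMap
  have hP' : Module.finrank ℝ P' = n := by rw [LinearEquiv.finrank_map_eq, P.2]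
  let o := (stdOrthonormalBasis ℝ P').reindex (finCongr hP')
  refine ⟨fun i => o i, ?_, fun i => ?_⟩
  · exact o.orthonormal.comp_linearIsometry P'.subtypeₗᵢ
  · obtain ⟨v, hv, hv'⟩ := (o i).2
    have : chartVec e y (o i : Euc (n + 1)) = v := by
      rw [← hv']; exact E.apply_symm_apply v
    rw [this]; exact hv

end Variation

section Expansion

variable {n : ℕ} {M : Type*} [EMetricSpace M] [ChartedSpace (Euc (n + 1)) M]
  [IsManifold (𝓡 (n + 1)) ∞ M]
  [RiemannianBundle (fun x : M => TangentSpace (𝓡 (n + 1)) x)]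

/-- The differential of a function on `M`. -/
def dfun (ζ : M → ℝ) (p : M) (v : TangentSpace (𝓡 (n + 1)) p) : ℝ :=
  mfderiv (𝓡 (n + 1)) 𝓘(ℝ, ℝ) ζ p v

variable (n) in
/-- The function and its differential are bounded by `l` at `p`. -/
def JetBound (ζ : M → ℝ) (p : M) (l : ℝ) : Prop :=
  |ζ p| ≤ l ∧ ∀ v : TangentSpace (𝓡 (n + 1)) p, |dfun ζ p v| ≤ l * ‖v‖

theorem dfun_chartVec {e : Chart n M}
    (he : e ∈ smoothAtlas n M) {ζ : M → ℝ} {y : Euc (n + 1)}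
    (hζ : MDifferentiableAt (𝓡 (n + 1)) 𝓘(ℝ, ℝ) ζ (e.symm y)) (hy : y ∈ e.target)
    (v : Euc (n + 1)) : dfun ζ (e.symm y) (chartVec e y v) = fderiv ℝ (ζ ∘ e.symm) y v := by
  have h := mfderiv_comp y hζ (mdiffAt_chart_symm he hy)
  rw [mfderiv_eq_fderiv] at h
  exact (congrArg (fun f : Euc (n + 1) →L[ℝ] ℝ => f v) h).symm

theorem exists_chartVec_bound [IsContMDiffRiemannianBundle (𝓡 (n + 1)) ∞ (Euc (n + 1))
      (fun x : M => TangentSpace (𝓡 (n + 1)) x)]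
    {e : Chart n M}
    (he : e ∈ smoothAtlas n M) {y₀ : Euc (n + 1)} (hy : y₀ ∈ e.target) :
    ∃ L ≥ (1 : ℝ), ∀ᶠ y in 𝓝 y₀, ∀ v, ‖chartVec e y v‖ ≤ L * ‖v‖ := by
  have h1 : ∀ᶠ y in 𝓝 y₀, ∀ i j, |metricCoord e y i j| ≤ |metricCoord e y₀ i j| + 1 := by
    refine Filter.eventually_all.2 fun i => Filter.eventually_all.2 fun j => ?_
    have := (contDiffAt_metricCoord he hy i j).continuousAt.abs
    exact (this.eventually (gt_mem_nhds (lt_add_one _))).mono fun _ h => h.le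
  set S := ∑ i, ∑ j, (|metricCoord e y₀ i j| + 1) with hS
  have hS0 : 0 ≤ S := Finset.sum_nonneg fun i _ => Finset.sum_nonneg fun j _ => by positivity
  refine ⟨S + 1, by linarith, h1.mono fun y hy v => ?_⟩
  have h2 : ‖chartVec e y v‖ ^ 2 ≤ S * ‖v‖ ^ 2 := by
    rw [← real_inner_self_eq_norm_sq, inner_chartVec, quad, hS, Finset.sum_mul]
    refine Finset.sum_le_sum fun i _ => ?_
    rw [Finset.sum_mul]
    refine Finset.sum_le_sum fun j _ => (le_abs_self _).trans ?_
    rw [abs_mul, abs_mul]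
    have hi : |v i| ≤ ‖v‖ := by simpa using PiLp.norm_apply_le v i
    have hj : |v j| ≤ ‖v‖ := by simpa using PiLp.norm_apply_le v j
    calc |v i| * |metricCoord e y i j| * |v j|
        ≤ ‖v‖ * (|metricCoord e y₀ i j| + 1) * ‖v‖ := by gcongr; exact hy i j
      _ = _ := by ring
  refine le_of_sq_le_sq ?_ (by positivity)
  calc _ ≤ _ := h2
    _ ≤ (S + 1) ^ 2 * ‖v‖ ^ 2 := by gcongr; nlinarith
    _ = _ := by ring

theorem isCompact_orthonormal (n m : ℕ) : IsCompact {b : Fin n → Euc m | Orthonormal ℝ b} := by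
  refine Metric.isCompact_of_isClosed_isBounded ?_ ?_
  · simp only [orthonormal_iff_ite, ofPred_forall]
    exact isClosed_iInter fun i => isClosed_iInter fun j =>
      isClosed_eq (by fun_prop) continuous_const
  · refine (Metric.isBounded_closedBall (x := (0 : Fin n → Euc m)) (r := 1)).subset fun b hb => ?_
    rw [mem_closedBall_zero_iff, pi_norm_le_iff_of_nonneg zero_le_one]
    exact fun i => (hb.1 i).le

theorem coordJac_scale (e : Chart n M) (F : ℝ → M → M) (t l σ : ℝ)
    (w : Euc (n + 1) →L[ℝ] ℝ) (y : Euc (n + 1)) (b : Fin n → Euc (n + 1)) :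
    coordJac e F (t, (l * σ, l • w), y, b) = coordJac e F (l * t, (σ, w), y, b) := by
  have h1 : t * (l * σ) = l * t * σ := by ring
  have h2 : ∀ c, t * (l * w c) = l * t * w c := fun c => by ring
  simp only [coordJac, smul_apply, smul_eq_mul, h1, h2]

variable [IsContMDiffRiemannianBundle (𝓡 (n + 1)) ∞ (Euc (n + 1))
      (fun x : M => TangentSpace (𝓡 (n + 1)) x)]

/-- The expansion of the Jacobian of a deformation, uniform in the cutoff function. -/
def JacExpansion (F : ℝ → M → M) (U : Set M) (C ε : ℝ) : Prop :=
  ∀ ζ : M → ℝ, ContMDiff (𝓡 (n + 1)) 𝓘(ℝ, ℝ) ∞ ζ → ∀ ξ : Gr n M, ξ.1 ∈ U → ∀ l > 0,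
    JetBound n ζ ξ.1 l →
    |firstVar F ζ ξ| ≤ C * l ∧ |secondVar F ζ ξ| ≤ C * l ^ 2 ∧ ∀ t : ℝ, |t| * l < ε →
      |planeJac (deform F ζ t) ξ - 1 - t * firstVar F ζ ξ - t ^ 2 / 2 * secondVar F ζ ξ| ≤
        C * (|t| * l) ^ 3

theorem exists_jacExpansion_nhds {F : ℝ → M → M} (hF : IsVariation n F) (p₀ : M) :
    ∃ U ∈ 𝓝 p₀, ∃ C > 0, ∃ ε > 0, JacExpansion (n := n) F U C ε := by
  let e := chartAt (Euc (n + 1)) p₀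
  have he : e ∈ smoothAtlas n M := IsManifold.chart_mem_maximalAtlas p₀
  have hp₀ : p₀ ∈ e.source := mem_chart_source _ p₀
  have hy₀ : e p₀ ∈ e.target := e.map_source hp₀
  obtain ⟨L, hL, hLb⟩ := exists_chartVec_bound he hy₀
  have hev := hF.eventually_mem he hy₀
  rw [nhds_prod_eq] at hev
  obtain ⟨A, hA, B, hB, hAB⟩ := Filter.eventually_prod_iff.1 hev
  obtain ⟨ε₀, hε₀, hAε⟩ := Metric.eventually_nhds_iff.1 hA
  obtain ⟨r, hr, hBr⟩ := Metric.nhds_basis_closedBall.mem_iff.1 (hB.and hLb)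
  have hA' : ∀ s : ℝ, |s| < ε₀ → A s := fun s hs => hAε (by simpa using hs)
  let K : Set (JacParam n) := Metric.closedBall 0 1 ×ˢ Metric.closedBall (e p₀) r ×ˢ
    {b | Orthonormal ℝ b}
  have : ProperSpace (ℝ × (Euc (n + 1) →L[ℝ] ℝ)) := FiniteDimensional.proper ℝ _
  have hK : IsCompact K := (isCompact_closedBall _ _).prod
    ((isCompact_closedBall _ _).prod (isCompact_orthonormal n (n + 1)))
  have htar : ∀ y ∈ Metric.closedBall (e p₀) r, y ∈ e.target := fun y hy =>
    (hAB (hA' 0 (by simpa using hε₀)) (hBr hy).1).2.1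
  obtain ⟨C, hC, ε, hε, W, hW, hT⟩ := taylor_two_uniform (f := coordJac e F) hK fun k hk =>
    contDiffAt_infty.1 (contDiffAt_coordJac hF he k (htar _ hk.2.1) hk.2.2.linearIndependent) 3
  refine ⟨e.source ∩ e ⁻¹' Metric.closedBall (e p₀) r,
    inter_mem (e.open_source.mem_nhds hp₀)
      ((e.continuousAt hp₀).preimage_mem_nhds (Metric.closedBall_mem_nhds _ hr)),
    C * L ^ 3, by positivity, min ε ε₀ / L, by positivity, ?_⟩
  rintro ζ hζ ⟨p, P⟩ ⟨hp, hpr⟩ l hl ⟨hj1, hj2⟩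
  obtain ⟨y, hy, rfl⟩ : ∃ y, y ∈ e.target ∧ e.symm y = p := ⟨e p, e.map_source hp, e.left_inv hp⟩
  have hyr : y ∈ Metric.closedBall (e p₀) r := by
    simpa [mem_preimage, e.right_inv hy] using hpr
  obtain ⟨b, hb, hbP⟩ := exists_frame he hy P
  have hl' : 0 < l * L := by positivity
  set k : JacParam n := (((l * L)⁻¹ * ζ (e.symm y), (l * L)⁻¹ • fderiv ℝ (ζ ∘ e.symm) y), y, b)
    with hk
  have hL1 : l ≤ l * L := le_mul_of_one_le_right hl.le hL
  have hkK : k ∈ K := by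
    refine ⟨?_, hyr, hb⟩
    rw [mem_closedBall_zero_iff, Prod.norm_def, max_le_iff]
    constructor
    · rw [norm_mul, norm_inv, Real.norm_of_nonneg hl'.le, inv_mul_le_iff₀ hl', mul_one]
      exact hj1.trans hL1
    · rw [norm_smul, norm_inv, Real.norm_of_nonneg hl'.le, inv_mul_le_iff₀ hl', mul_one]
      refine ContinuousLinearMap.opNorm_le_bound _ hl'.le fun v => ?_
      rw [← dfun_chartVec he (hζ.mdifferentiableAt (by simp)) hy]
      calc _ ≤ l * ‖chartVec e y v‖ := hj2 _
        _ ≤ l * (L * ‖v‖) := by gcongr; exact (hBr hyr).2 v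
        _ = _ := by ring
  have hJ : ∀ t : ℝ, |t| * l < ε₀ → planeJac (deform F ζ t) (⟨e.symm y, P⟩ : Gr n M) =
      coordJac e F (l * L * t, k) := by
    intro t ht
    have h1 : |t * ζ (e.symm y)| < ε₀ := by
      rw [abs_mul]; exact lt_of_le_of_lt (by gcongr) ht
    have h2 := hAB (hA' _ h1) (hBr hyr).1
    rw [planeJac_deform_eq hF he hζ hy h2.1 h2.2.2 P hb.linearIndependent hbP, hk,
      ← coordJac_scale, mul_inv_cancel_left₀ hl'.ne', smul_inv_smul₀ hl'.ne']
  have hJe : (fun t => planeJac (deform F ζ t) (⟨e.symm y, P⟩ : Gr n M)) =ᶠ[𝓝 0]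
      fun t => coordJac e F (l * L * t, k) := by
    filter_upwards [Metric.ball_mem_nhds (0 : ℝ) (ε := ε₀ / l) (by positivity)] with t ht
    refine hJ t ?_
    rw [mem_ball_zero_iff, Real.norm_eq_abs, lt_div_iff₀ hl] at ht
    exact ht
  have d1 : ∀ x, deriv (fun t => coordJac e F (l * L * t, k)) x =
      l * L * deriv (fun s => coordJac e F (s, k)) (l * L * x) := fun x => by
    rw [deriv_comp_mul_left (l * L) (fun s => coordJac e F (s, k)) x, smul_eq_mul]
  have e1 : firstVar F ζ (⟨e.symm y, P⟩ : Gr n M) =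
      l * L * deriv (fun s => coordJac e F (s, k)) 0 := by
    refine hJe.deriv_eq.trans ?_
    rw [d1, mul_zero]
  have e2 : secondVar F ζ (⟨e.symm y, P⟩ : Gr n M) =
      (l * L) ^ 2 * deriv (deriv fun s => coordJac e F (s, k)) 0 := by
    refine hJe.deriv.deriv_eq.trans ?_
    rw [funext d1, deriv_const_mul_field,
      deriv_comp_mul_left (l * L) (deriv fun s => coordJac e F (s, k)) 0, smul_eq_mul, mul_zero]
    ring
  have hTk := hT k (subset_of_mem_nhdsSet hW hkK)
  obtain ⟨-, b1, b2⟩ := hTk 0 (by simpa using hε)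
  have hLL : L ≤ L ^ 3 := le_self_pow₀ hL (by norm_num)
  have hLL2 : L ^ 2 ≤ L ^ 3 := pow_le_pow_right₀ hL (by norm_num)
  refine ⟨?_, ?_, fun t ht => ?_⟩
  · rw [e1, abs_mul, abs_of_pos hl']
    calc _ ≤ l * L * C := by gcongr
      _ ≤ l * L ^ 3 * C := by gcongr
      _ = _ := by ring
  · rw [e2, abs_mul, abs_of_pos (by positivity)]
    calc _ ≤ (l * L) ^ 2 * C := by gcongr
      _ = l ^ 2 * L ^ 2 * C := by ring
      _ ≤ l ^ 2 * L ^ 3 * C := by gcongr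
      _ = _ := by ring
  · have ht' : |t| * l * L < min ε ε₀ := (lt_div_iff₀ (by positivity)).1 ht
    have ht2 : |t| * l ≤ |t| * l * L := le_mul_of_one_le_right (by positivity) hL
    have h3 := (hTk (l * L * t) (by
      rw [abs_mul, abs_of_pos hl']
      calc l * L * |t| = |t| * l * L := by ring
        _ < ε := ht'.trans_le (min_le_left _ _))).1
    rw [hJ t (ht2.trans_lt (ht'.trans_le (min_le_right _ _))), e1, e2]
    rw [coordJac_zero hF he k hy hb.linearIndependent, abs_mul, abs_of_pos hl'] at h3
    calc _ = _ := by congr 1; ring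
      _ ≤ _ := h3
      _ = _ := by ring

theorem exists_jacExpansion [CompactSpace M] {F : ℝ → M → M} (hF : IsVariation n F) :
    ∃ C > 0, ∃ ε > 0, JacExpansion (n := n) F univ C ε := by
  refine isCompact_univ.induction_on (p := fun S => ∃ C > 0, ∃ ε > 0,
    JacExpansion (n := n) F S C ε) ⟨1, one_pos, 1, one_pos, fun _ _ _ h => h.elim⟩ ?_ ?_ ?_
  · rintro S T hST ⟨C, hC, ε, hε, h⟩
    exact ⟨C, hC, ε, hε, fun ζ hζ ξ hξ => h ζ hζ ξ (hST hξ)⟩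
  · have mono : ∀ S : Set M, ∀ C C' ε ε', 0 < C → C ≤ C' → ε' ≤ ε → JacExpansion (n := n) F S C ε →
        JacExpansion (n := n) F S C' ε' := by
      intro S C C' ε ε' hC hCC hε h ζ hζ ξ hξ l hl hj
      obtain ⟨h1, h2, h3⟩ := h ζ hζ ξ hξ l hl hj
      exact ⟨h1.trans (by gcongr), h2.trans (by gcongr),
        fun t ht => (h3 t (ht.trans_le hε)).trans (by gcongr)⟩
    rintro S T ⟨C, hC, ε, hε, h⟩ ⟨C', hC', ε', hε', h'⟩
    refine ⟨max C C', by positivity, min ε ε', by positivity, ?_⟩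
    rintro ζ hζ ξ (hξ | hξ)
    · exact mono S C _ ε _ hC (le_max_left _ _) (min_le_left _ _) h ζ hζ ξ hξ
    · exact mono T C' _ ε' _ hC' (le_max_right _ _) (min_le_right _ _) h' ζ hζ ξ hξ
  · intro p _
    obtain ⟨U, hU, C, hC, ε, hε, h⟩ := exists_jacExpansion_nhds hF p
    exact ⟨U, mem_nhdsWithin_of_mem_nhds hU, C, hC, ε, hε, h⟩

end Expansion

theorem starProjection_eq_sum {V : Type*} [NormedAddCommGroup V] [InnerProductSpace ℝ V]
    [FiniteDimensional ℝ V] {k : ℕ} (P : Submodule ℝ V) (hP : Module.finrank ℝ P = k)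
    {c : Fin k → V} (hc : ∀ i, c i ∈ P) (hdet : (Matrix.gram ℝ c).det ≠ 0) (w : V) :
    P.starProjection w = ∑ i, ∑ j, ((Matrix.gram ℝ c)⁻¹ i j * inner ℝ (c j) w) • c i := by
  have hli := Matrix.linearIndependent_of_det_gram_ne_zero hdet
  have hspan : Submodule.span ℝ (range c) = P := by
    refine Submodule.eq_of_le_of_finrank_eq (Submodule.span_le.2 ?_) ?_
    · rintro _ ⟨i, rfl⟩; exact hc i
    · rw [finrank_span_eq_card hli, hP, Fintype.card_fin]
  have hmem : ∑ i, ∑ j, ((Matrix.gram ℝ c)⁻¹ i j * inner ℝ (c j) w) • c i ∈ P :=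
    Submodule.sum_mem _ fun i _ => Submodule.sum_mem _ fun j _ => P.smul_mem _ (hc i)
  refine Submodule.eq_starProjection_of_mem_of_inner_eq_zero hmem ?_
  intro x hx
  rw [← hspan] at hx
  induction hx using Submodule.span_induction with
  | zero => simp
  | add x y _ _ hx hy => rw [inner_add_right, hx, hy, add_zero]
  | smul a x _ hx => rw [inner_smul_right, hx, mul_zero]
  | mem x hx =>
    obtain ⟨l, rfl⟩ := hx
    have h1 : ∀ j, ∑ i, (Matrix.gram ℝ c)⁻¹ i j * Matrix.gram ℝ c l i = if l = j then 1 else 0 := by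
      intro j
      have := congrFun (congrFun (Matrix.mul_nonsing_inv (Matrix.gram ℝ c)
        (isUnit_iff_ne_zero.2 hdet)) l) j
      rw [Matrix.mul_apply, Matrix.one_apply] at this
      rw [← this]; exact Finset.sum_congr rfl fun i _ => mul_comm _ _
    have h2 : inner ℝ (∑ i, ∑ j, ((Matrix.gram ℝ c)⁻¹ i j * inner ℝ (c j) w) • c i) (c l) =
        ∑ j, inner ℝ (c j) w * ∑ i, (Matrix.gram ℝ c)⁻¹ i j * Matrix.gram ℝ c l i := by
      simp only [sum_inner, real_inner_smul_left, Finset.mul_sum, Matrix.gram_apply]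
      rw [Finset.sum_comm]
      refine Finset.sum_congr rfl fun j _ => Finset.sum_congr rfl fun i _ => ?_
      rw [real_inner_comm (c l) (c i)]; ring
    rw [inner_sub_left, h2]
    simp only [h1, mul_ite, mul_one, mul_zero, Finset.sum_ite_eq, Finset.mem_univ, if_true]
    rw [real_inner_comm, sub_self]

section Plane

variable {n : ℕ} {M : Type*} [EMetricSpace M] [ChartedSpace (Euc (n + 1)) M]
  [IsManifold (𝓡 (n + 1)) ∞ M]
  [RiemannianBundle (fun x : M => TangentSpace (𝓡 (n + 1)) x)]

/-- The orthogonal projection onto a tangent plane, in coordinates. -/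
def planeCoord (e : Chart n M) (ξ : Gr n M) (v : Euc (n + 1)) :
    Euc (n + 1) :=
  mfderiv (𝓡 (n + 1)) (𝓡 (n + 1)) e ξ.1
    (ξ.2.1.starProjection (mfderiv (𝓡 (n + 1)) (𝓡 (n + 1)) e.symm (e ξ.1) v :
      TangentSpace (𝓡 (n + 1)) (e.symm (e ξ.1))))

theorem planeCoord_mk {e : Chart n M} {y : Euc (n + 1)}
    (hy : y ∈ e.target)
    (P : {P : Submodule ℝ (TangentSpace (𝓡 (n + 1)) (e.symm y)) // Module.finrank ℝ P = n})
    (v : Euc (n + 1)) : planeCoord e (⟨e.symm y, P⟩ : Gr n M) v =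
      chartComp e y (P.1.starProjection (chartVec e y v)) := by
  have : (mfderiv (𝓡 (n + 1)) (𝓡 (n + 1)) e.symm (e (e.symm y)) v : Euc (n + 1)) =
      (mfderiv (𝓡 (n + 1)) (𝓡 (n + 1)) e.symm y v : Euc (n + 1)) := by rw [e.right_inv hy]
  exact congrArg (fun w : Euc (n + 1) => (chartComp e y (P.1.starProjection w) : Euc (n + 1))) this

theorem inCoordinates_eq_planeCoord {p : M} (ξ : Gr n M)
    (hp : ξ.1 ∈ (chartAt (Euc (n + 1)) p).source) (v : Euc (n + 1)) :
    ContinuousLinearMap.inCoordinates (Euc (n + 1)) (fun q : M => TangentSpace (𝓡 (n + 1)) q)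
      (Euc (n + 1)) (fun q : M => TangentSpace (𝓡 (n + 1)) q) p ξ.1 p ξ.1 ξ.2.1.starProjection v =
      planeCoord (chartAt (Euc (n + 1)) p) ξ v := by
  have h1 := TangentBundle.continuousLinearMapAt_trivializationAt (I := 𝓡 (n + 1)) hp
  have h2 := TangentBundle.symmL_trivializationAt (I := 𝓡 (n + 1)) hp
  simp only [ContinuousLinearMap.inCoordinates, ContinuousLinearMap.comp_apply]
  rw [h1, h2]
  simp only [modelWithCornersSelf_coe, range_id, mfderivWithin_univ]
  rfl

theorem Gr.continuous_fst : Continuous (fun ξ : Gr n M => ξ.1) :=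
  (FiberBundle.continuous_proj (Euc (n + 1) →L[ℝ] Euc (n + 1))
    (fun p : M => TangentSpace (𝓡 (n + 1)) p →L[ℝ] TangentSpace (𝓡 (n + 1)) p)).comp
    (continuous_induced_dom (f := (Gr.proj : Gr n M → EndBundle n M)))

theorem Gr.continuousAt_planeCoord (ξ₀ : Gr n M) (v : Euc (n + 1)) :
    ContinuousAt (fun ξ : Gr n M => planeCoord (chartAt (Euc (n + 1)) ξ₀.1) ξ v) ξ₀ := by
  have h : ContinuousAt (Gr.proj : Gr n M → EndBundle n M) ξ₀ :=
    continuous_induced_dom.continuousAt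
  have h2 := (continuousAt_clm_apply.1 ((continuousAt_hom_bundle _ _).1 h).2) v
  refine h2.congr ?_
  filter_upwards [Gr.continuous_fst.continuousAt.preimage_mem_nhds
    ((chartAt (Euc (n + 1)) ξ₀.1).open_source.mem_nhds (mem_chart_source _ ξ₀.1))] with ξ hξ
  exact inCoordinates_eq_planeCoord ξ hξ v

theorem Gr.continuousAt_of_planeCoord {X : Type*} [TopologicalSpace X] {H : X → Gr n M} {x₀ : X}
    (h1 : ContinuousAt (fun x => (H x).1) x₀)
    (h2 : ∀ v, ContinuousAt (fun x => planeCoord (chartAt (Euc (n + 1)) (H x₀).1) (H x) v) x₀) :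
    ContinuousAt H x₀ := by
  refine (IsInducing.continuousAt_iff (g := (Gr.proj : Gr n M → EndBundle n M)) ⟨rfl⟩).2 ((continuousAt_hom_bundle _ _).2 ⟨h1, ?_⟩)
  refine continuousAt_clm_apply.2 fun v => (h2 v).congr ?_
  filter_upwards [h1.preimage_mem_nhds
    ((chartAt (Euc (n + 1)) (H x₀).1).open_source.mem_nhds (mem_chart_source _ (H x₀).1))] with x hx
  exact (inCoordinates_eq_planeCoord (H x) hx v).symm

/-- The coordinate vector `c` is tangent to the plane `ξ`. -/
def InPlane (e : Chart n M) (ξ : Gr n M) (c : Euc (n + 1)) : Prop :=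
  ∃ w ∈ ξ.2.1, (mfderiv (𝓡 (n + 1)) (𝓡 (n + 1)) e ξ.1 w : Euc (n + 1)) = c

theorem inPlane_planeCoord (e : Chart n M) (ξ : Gr n M)
    (v : Euc (n + 1)) : InPlane e ξ (planeCoord e ξ v) :=
  ⟨_, Submodule.starProjection_apply_mem _ _, rfl⟩

theorem InPlane.chartVec_mem {e : Chart n M}
    (he : e ∈ smoothAtlas n M) {y : Euc (n + 1)} (hy : y ∈ e.target)
    {P : {P : Submodule ℝ (TangentSpace (𝓡 (n + 1)) (e.symm y)) // Module.finrank ℝ P = n}}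
    {c : Euc (n + 1)} (h : InPlane e (⟨e.symm y, P⟩ : Gr n M) c) : chartVec e y c ∈ P.1 := by
  obtain ⟨w, hw, rfl⟩ := h
  have h1 : chartVec e y (chartComp e y w) = w := chartVec_chartComp he hy w
  change chartVec e y (chartComp e y w) ∈ P.1
  rw [h1]; exact hw

theorem Gr.exists_eq_mk {e : Chart n M} {ξ : Gr n M}
    (h : ξ.1 ∈ e.source) : ∃ y ∈ e.target,
      ∃ P : {P : Submodule ℝ (TangentSpace (𝓡 (n + 1)) (e.symm y)) // Module.finrank ℝ P = n},
        ξ = ⟨e.symm y, P⟩ := by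
  obtain ⟨p, P⟩ := ξ
  obtain ⟨y, hy, rfl⟩ : ∃ y, y ∈ e.target ∧ e.symm y = p :=
    ⟨e p, e.map_source h, e.left_inv h⟩
  exact ⟨y, hy, P, rfl⟩

theorem planeCoord_eq_sum {e : Chart n M}
    (he : e ∈ smoothAtlas n M) {ξ : Gr n M} (hξ : ξ.1 ∈ e.source)
    {c : Fin n → Euc (n + 1)} (hc : ∀ i, InPlane e ξ (c i))
    (hdet : (frameGram (metricCoord e (e ξ.1)) c).det ≠ 0) (v : Euc (n + 1)) :
    planeCoord e ξ v = ∑ i, ∑ j, ((frameGram (metricCoord e (e ξ.1)) c)⁻¹ i j *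
      quad (metricCoord e (e ξ.1)) (c j) v) • c i := by
  obtain ⟨y, hy, P, rfl⟩ := Gr.exists_eq_mk hξ
  simp only [e.right_inv hy] at hdet ⊢
  rw [frameGram_eq_gram] at hdet ⊢
  rw [planeCoord_mk hy, starProjection_eq_sum P.1 P.2 (fun i => (hc i).chartVec_mem he hy) hdet]
  have h1 : ∀ (w : Fin n → Fin n → TangentSpace (𝓡 (n + 1)) (e.symm y)),
      chartComp e y (∑ i, ∑ j, w i j) = ∑ i, ∑ j, chartComp e y (w i j) := fun w =>
    (map_sum (mfderiv (𝓡 (n + 1)) (𝓡 (n + 1)) e (e.symm y)) _ _).trans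
      (Finset.sum_congr rfl fun i _ => map_sum _ _ _)
  rw [h1]
  refine Finset.sum_congr rfl fun i _ => Finset.sum_congr rfl fun j _ => ?_
  rw [inner_chartVec]
  have h2 : ∀ (a : ℝ) (w : TangentSpace (𝓡 (n + 1)) (e.symm y)),
      chartComp e y (a • w) = a • chartComp e y w := fun a w => map_smul _ _ _
  rw [h2, chartComp_chartVec he hy]

variable [IsContMDiffRiemannianBundle (𝓡 (n + 1)) ∞ (Euc (n + 1))
  (fun x : M => TangentSpace (𝓡 (n + 1)) x)]

theorem ContinuousAt.quad_metricCoord {X : Type*} [TopologicalSpace X] {x₀ : X}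
    {e : Chart n M}
    (he : e ∈ smoothAtlas n M) {f v w : X → Euc (n + 1)}
    (hf : ContinuousAt f x₀) (h0 : f x₀ ∈ e.target) (hv : ContinuousAt v x₀)
    (hw : ContinuousAt w x₀) : ContinuousAt (fun x => quad (metricCoord e (f x)) (v x) (w x)) x₀ := by
  unfold quad
  have h : ∀ i j, ContinuousAt (fun x => metricCoord e (f x) i j) x₀ := fun i j =>
    ContinuousAt.comp (f := f) (g := fun y => metricCoord e y i j)
      (contDiffAt_metricCoord he h0 i j).continuousAt hf
  have hp : ∀ (u : X → Euc (n + 1)), ContinuousAt u x₀ → ∀ i, ContinuousAt (fun x => u x i) x₀ :=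
    fun u hu i => (EuclideanSpace.proj i : Euc (n + 1) →L[ℝ] ℝ).continuous.continuousAt.comp hu
  exact tendsto_finsetSum _ fun i _ => tendsto_finsetSum _ fun j _ =>
    ((hp v hv i).mul (h i j)).mul (hp w hw j)

theorem ContinuousAt.frameGram_metricCoord {X : Type*} [TopologicalSpace X] {x₀ : X}
    {e : Chart n M}
    (he : e ∈ smoothAtlas n M) {f : X → Euc (n + 1)} {k : ℕ}
    {c : X → Fin k → Euc (n + 1)} (hf : ContinuousAt f x₀) (h0 : f x₀ ∈ e.target)
    (hc : ∀ i, ContinuousAt (fun x => c x i) x₀) :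
    ContinuousAt (fun x => frameGram (metricCoord e (f x)) (c x)) x₀ :=
  continuousAt_pi.2 fun i => continuousAt_pi.2 fun j => .quad_metricCoord he hf h0 (hc i) (hc j)

theorem ContinuousAt.det_frameGram {X : Type*} [TopologicalSpace X] {x₀ : X}
    {e : Chart n M}
    (he : e ∈ smoothAtlas n M) {f : X → Euc (n + 1)} {k : ℕ}
    {c : X → Fin k → Euc (n + 1)} (hf : ContinuousAt f x₀) (h0 : f x₀ ∈ e.target)
    (hc : ∀ i, ContinuousAt (fun x => c x i) x₀) :
    ContinuousAt (fun x => (frameGram (metricCoord e (f x)) (c x)).det) x₀ :=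
  (Continuous.matrix_det continuous_id).continuousAt.comp (.frameGram_metricCoord he hf h0 hc)

theorem Gr.exists_local_frame (ξ₀ : Gr n M) {e : Chart n M}
    (he : e = chartAt (Euc (n + 1)) ξ₀.1) :
    ∃ b : Gr n M → Fin n → Euc (n + 1), (∀ i, ContinuousAt (fun ξ => b ξ i) ξ₀) ∧
      (∀ ξ i, InPlane e ξ (b ξ i)) ∧
      ∀ᶠ ξ in 𝓝 ξ₀, 0 < (frameGram (metricCoord e (e ξ.1)) (b ξ)).det := by
  have hm : e ∈ smoothAtlas n M :=
    he ▸ IsManifold.chart_mem_maximalAtlas ξ₀.1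
  have hs : ξ₀.1 ∈ e.source := he ▸ mem_chart_source _ ξ₀.1
  obtain ⟨b₀, hb₀, hb₀P⟩ : ∃ b₀ : Fin n → Euc (n + 1), LinearIndependent ℝ b₀ ∧
      ∀ i, planeCoord e ξ₀ (b₀ i) = b₀ i := by
    clear he
    obtain ⟨y, hy, P, rfl⟩ := Gr.exists_eq_mk hs
    obtain ⟨b, hb, hbP⟩ := exists_frame hm hy P
    refine ⟨b, hb.linearIndependent, fun i => ?_⟩
    rw [planeCoord_mk hy, Submodule.starProjection_eq_self_iff.2 (hbP i), chartComp_chartVec hm hy]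
  have hc : ∀ i, ContinuousAt (fun ξ => planeCoord e ξ (b₀ i)) ξ₀ := fun i => by
    rw [he]; exact Gr.continuousAt_planeCoord ξ₀ (b₀ i)
  refine ⟨fun ξ i => planeCoord e ξ (b₀ i), hc, fun ξ i => inPlane_planeCoord e ξ _, ?_⟩
  have hcont := ContinuousAt.det_frameGram (f := fun ξ : Gr n M => e ξ.1)
    (c := fun ξ i => planeCoord e ξ (b₀ i)) hm
    (ContinuousAt.comp (f := fun ξ : Gr n M => ξ.1) (e.continuousAt hs)
      Gr.continuous_fst.continuousAt) (e.map_source hs) hc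
  refine continuousAt_const.eventually_lt hcont ?_
  simp only [hb₀P]
  exact det_frameGram_pos hm (e.map_source hs) hb₀

theorem ContMDiffAt.contDiffAt_coordMap {e e' : Chart n M}
    (he : e ∈ smoothAtlas n M)
    (he' : e' ∈ smoothAtlas n M) {G : M → M} {y : Euc (n + 1)}
    (hy : y ∈ e.target) (hG : ContMDiffAt (𝓡 (n + 1)) (𝓡 (n + 1)) ∞ G (e.symm y))
    (hGy : G (e.symm y) ∈ e'.source) : ContDiffAt ℝ ∞ (coordMap e e' G) y := by
  have h1 : ContMDiffAt (𝓡 (n + 1)) (𝓡 (n + 1)) ∞ (fun x => G (e.symm x)) y :=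
    hG.comp y ((mem_atlas_contMDiffOn_symm he).contMDiffAt (e.open_target.mem_nhds hy))
  have h2 : ContMDiffAt (𝓡 (n + 1)) (𝓡 (n + 1)) ∞ (coordMap e e' G) y :=
    ContMDiffAt.comp (f := fun x => G (e.symm x)) y
    ((mem_atlas_contMDiffOn he').contMDiffAt (e'.open_source.mem_nhds hGy)) h1
  exact h2.contDiffAt

/-- The coordinates of the image frame depend continuously on the plane. -/
theorem Gr.continuousAt_fderiv_coordMap {e e' : Chart n M}
    (he : e ∈ smoothAtlas n M)
    (he' : e' ∈ smoothAtlas n M) {G : M → M}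
    (hG : ContMDiff (𝓡 (n + 1)) (𝓡 (n + 1)) ∞ G) {ξ₀ : Gr n M} (hs : ξ₀.1 ∈ e.source)
    (hGs : G ξ₀.1 ∈ e'.source) {b : Gr n M → Euc (n + 1)} (hb : ContinuousAt b ξ₀) :
    ContinuousAt (fun ξ : Gr n M => coordMap e e' G (e ξ.1)) ξ₀ ∧
    ContinuousAt (fun ξ : Gr n M => fderiv ℝ (coordMap e e' G) (e ξ.1) (b ξ)) ξ₀ := by
  have h0 : ContinuousAt (fun ξ : Gr n M => e ξ.1) ξ₀ :=
    ContinuousAt.comp (f := fun ξ : Gr n M => ξ.1) (e.continuousAt hs)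
      Gr.continuous_fst.continuousAt
  have h1 : ContDiffAt ℝ ∞ (coordMap e e' G) (e ξ₀.1) :=
    ContMDiffAt.contDiffAt_coordMap he he' (e.map_source hs) (hG _)
      (by rw [e.left_inv hs]; exact hGs)
  refine ⟨ContinuousAt.comp (f := fun ξ : Gr n M => e ξ.1) h1.continuousAt h0, ?_⟩
  have h2 : ContinuousAt (fderiv ℝ (coordMap e e' G)) (e ξ₀.1) :=
    (h1.fderiv_right (m := 0) (by simp)).continuousAt
  exact (ContinuousAt.comp (f := fun ξ : Gr n M => e ξ.1) h2 h0).clm_apply hb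

theorem planeJac_eq_sqrt {e e' : Chart n M}
    (hm : e ∈ smoothAtlas n M)
    (hm' : e' ∈ smoothAtlas n M) {G : M → M} {ξ : Gr n M}
    (hs : ξ.1 ∈ e.source) (hGs : G ξ.1 ∈ e'.source)
    (hG : MDifferentiableAt (𝓡 (n + 1)) (𝓡 (n + 1)) G ξ.1) {b : Fin n → Euc (n + 1)}
    (hb : ∀ i, InPlane e ξ (b i)) (hdet : 0 < (frameGram (metricCoord e (e ξ.1)) b).det) :
    planeJac G ξ = Real.sqrt ((frameGram (metricCoord e' (coordMap e e' G (e ξ.1)))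
      (fun i => fderiv ℝ (coordMap e e' G) (e ξ.1) (b i))).det /
        (frameGram (metricCoord e (e ξ.1)) b).det) := by
  obtain ⟨y, hy, P, rfl⟩ := Gr.exists_eq_mk hs
  have hR : e (e.symm y) = y := e.right_inv hy
  simp only [hR] at hdet ⊢
  rw [← normDet_mfderiv_sq hm hm' hy hG hGs P.1 P.2 _
    (fun i => (hb i).chartVec_mem hm hy), mul_div_assoc, div_self hdet.ne', mul_one,
    Real.sqrt_sq (LinearMap.normDet_nonneg _)]
  rfl

theorem Gr.continuous_planeJac {G : M → M} (hG : ContMDiff (𝓡 (n + 1)) (𝓡 (n + 1)) ∞ G) :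
    Continuous (fun ξ : Gr n M => planeJac G ξ) := by
  refine continuous_iff_continuousAt.2 fun ξ₀ => ?_
  set e := chartAt (Euc (n + 1)) ξ₀.1 with he
  set e' := chartAt (Euc (n + 1)) (G ξ₀.1) with he'
  have hm : e ∈ smoothAtlas n M := IsManifold.chart_mem_maximalAtlas _
  have hm' : e' ∈ smoothAtlas n M := IsManifold.chart_mem_maximalAtlas _
  have hs : ξ₀.1 ∈ e.source := mem_chart_source _ ξ₀.1
  have hs' : G ξ₀.1 ∈ e'.source := mem_chart_source _ _
  obtain ⟨b, hb, hbP, hdet⟩ := Gr.exists_local_frame ξ₀ he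
  have hc := fun i => (Gr.continuousAt_fderiv_coordMap hm hm' hG hs hs' (hb i)).2
  have hf := (Gr.continuousAt_fderiv_coordMap hm hm' hG hs hs'
    (b := fun _ => 0) continuousAt_const).1
  have h0 : ContinuousAt (fun ξ : Gr n M => e ξ.1) ξ₀ :=
    ContinuousAt.comp (f := fun ξ : Gr n M => ξ.1) (e.continuousAt hs)
      Gr.continuous_fst.continuousAt
  have hA := ContinuousAt.det_frameGram (c := fun ξ i => fderiv ℝ (coordMap e e' G) (e ξ.1) (b ξ i))
    hm' hf (by
      change e' (G (e.symm (e ξ₀.1))) ∈ e'.target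
      rw [e.left_inv hs]; exact e'.map_source hs') hc
  have hB := ContinuousAt.det_frameGram hm h0 (e.map_source hs) hb
  refine ContinuousAt.congr (f := fun ξ : Gr n M =>
    Real.sqrt ((frameGram (metricCoord e' (coordMap e e' G (e ξ.1)))
      (fun i => fderiv ℝ (coordMap e e' G) (e ξ.1) (b ξ i))).det /
        (frameGram (metricCoord e (e ξ.1)) (b ξ)).det))
    (Real.continuous_sqrt.continuousAt.comp (hA.div hB hdet.self_of_nhds.ne')) ?_
  filter_upwards [hdet, Gr.continuous_fst.continuousAt.preimage_mem_nhds (e.open_source.mem_nhds hs),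
    (hG.continuous.comp Gr.continuous_fst).continuousAt.preimage_mem_nhds
      (e'.open_source.mem_nhds hs')] with ξ h1 h2 h3
  exact (planeJac_eq_sqrt hm hm' h2 h3 ((hG _).mdifferentiableAt (by simp)) (hbP ξ) h1).symm

theorem Gr.continuous_mapDiffeo (F : M ≃ₘ^∞⟮𝓡 (n + 1), 𝓡 (n + 1)⟯ M) :
    Continuous (Gr.mapDiffeo (n := n) F) := by
  refine continuous_iff_continuousAt.2 fun ξ₀ => ?_
  have hG : ContMDiff (𝓡 (n + 1)) (𝓡 (n + 1)) ∞ F := F.contMDiff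
  refine Gr.continuousAt_of_planeCoord
    ((hG.continuous.comp Gr.continuous_fst).continuousAt) fun v => ?_
  have hq : (Gr.mapDiffeo F ξ₀).1 = F ξ₀.1 := rfl
  rw [hq]
  set e := chartAt (Euc (n + 1)) ξ₀.1 with he
  set e' := chartAt (Euc (n + 1)) (F ξ₀.1) with he'
  have hm : e ∈ smoothAtlas n M := IsManifold.chart_mem_maximalAtlas _
  have hm' : e' ∈ smoothAtlas n M := IsManifold.chart_mem_maximalAtlas _
  have hs : ξ₀.1 ∈ e.source := mem_chart_source _ ξ₀.1
  have hs' : F ξ₀.1 ∈ e'.source := mem_chart_source _ _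
  obtain ⟨b, hb, hbP, hdet⟩ := Gr.exists_local_frame ξ₀ he
  have hc := fun i => (Gr.continuousAt_fderiv_coordMap hm hm' hG hs hs' (hb i)).2
  have hf := (Gr.continuousAt_fderiv_coordMap hm hm' hG hs hs'
    (b := fun _ => 0) continuousAt_const).1
  have hy' : coordMap e e' F (e ξ₀.1) ∈ e'.target := by
    change e' (F (e.symm (e ξ₀.1))) ∈ e'.target
    rw [e.left_inv hs]; exact e'.map_source hs'
  have hA := ContinuousAt.det_frameGram (c := fun ξ i => fderiv ℝ (coordMap e e' F) (e ξ.1) (b ξ i))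
    hm' hf hy' hc
  have hAm := ContinuousAt.frameGram_metricCoord
    (c := fun ξ i => fderiv ℝ (coordMap e e' F) (e ξ.1) (b ξ i)) hm' hf hy' hc
  have hplane : ∀ ξ : Gr n M, ξ.1 ∈ e.source → F ξ.1 ∈ e'.source → ∀ i,
      InPlane e' (Gr.mapDiffeo F ξ) (fderiv ℝ (coordMap e e' F) (e ξ.1) (b ξ i)) := by
    intro ξ h2 h3 i
    obtain ⟨w, hw, hwb⟩ := hbP ξ i
    refine ⟨mfderiv (𝓡 (n + 1)) (𝓡 (n + 1)) F ξ.1 w, Submodule.mem_map_of_mem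
      (f := (F.mfderivToContinuousLinearEquiv (by simp) ξ.1).toLinearEquiv.toLinearMap) hw, ?_⟩
    have hd := (hG ξ.1).mdifferentiableAt (n := ∞) (by simp)
    have hcm : ContDiffAt ℝ ∞ (coordMap e e' F) (e ξ.1) :=
      ContMDiffAt.contDiffAt_coordMap hm hm' (e.map_source h2) (hG _)
        (by rw [e.left_inv h2]; exact h3)
    have hd2 := (hcm.differentiableAt (by simp)).mdifferentiableAt
    have e1 := mfderiv_comp (I := 𝓡 (n + 1)) (I' := 𝓡 (n + 1)) (I'' := 𝓡 (n + 1)) ξ.1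
      (mdiffAt_chart hm' (p := F ξ.1) h3) hd
    have e2 := mfderiv_comp (I := 𝓡 (n + 1)) (I' := 𝓡 (n + 1)) (I'' := 𝓡 (n + 1)) ξ.1 hd2
      (mdiffAt_chart hm h2)
    have e3 : (coordMap e e' F ∘ e) =ᶠ[𝓝 ξ.1] (e' ∘ F) := by
      filter_upwards [e.open_source.mem_nhds h2] with x hx
      simp [coordMap, e.left_inv hx]
    rw [e3.mfderiv_eq, e1, mfderiv_eq_fderiv] at e2
    have e4 := congrArg (fun f : Euc (n + 1) →L[ℝ] Euc (n + 1) => f w) e2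
    refine Eq.trans e4 ?_
    rw [← hwb]; rfl
  have hgood : ∀ᶠ ξ in 𝓝 ξ₀, ξ.1 ∈ e.source ∧ F ξ.1 ∈ e'.source ∧
      0 < (frameGram (metricCoord e (e ξ.1)) (b ξ)).det := by
    filter_upwards [hdet,
      Gr.continuous_fst.continuousAt.preimage_mem_nhds (e.open_source.mem_nhds hs),
      (hG.continuous.comp Gr.continuous_fst).continuousAt.preimage_mem_nhds
        (e'.open_source.mem_nhds hs')] with ξ h1 h2 h3 using ⟨h2, h3, h1⟩
  have hpos : ∀ ξ : Gr n M, ξ.1 ∈ e.source → F ξ.1 ∈ e'.source →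
      0 < (frameGram (metricCoord e (e ξ.1)) (b ξ)).det →
      0 < (frameGram (metricCoord e' (coordMap e e' F (e ξ.1)))
        (fun i => fderiv ℝ (coordMap e e' F) (e ξ.1) (b ξ i))).det := by
    intro ξ h2 h3 h1
    clear_value e
    obtain ⟨y, hy, P, rfl⟩ := Gr.exists_eq_mk h2
    simp only [e.right_inv hy] at h1 ⊢
    have := normDet_mfderiv_sq hm hm' hy ((hG _).mdifferentiableAt (by simp)) h3 P.1 P.2 _
      (fun i => (hbP _ i).chartVec_mem hm hy)
    rw [← this]
    refine mul_pos (pow_pos ((LinearMap.normDet_nonneg _).lt_of_ne' ?_) 2) h1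
    rw [Ne, LinearMap.normDet_eq_zero_iff_ker_ne_bot, not_not]
    refine LinearMap.ker_eq_bot.2 ?_
    rw [LinearMap.coe_comp]
    exact (F.mfderivToContinuousLinearEquiv (by simp) (e.symm y)).injective.comp
      Subtype.val_injective
  have hinv : ContinuousAt (fun ξ : Gr n M => (frameGram (metricCoord e' (coordMap e e' F (e ξ.1)))
      (fun i => fderiv ℝ (coordMap e e' F) (e ξ.1) (b ξ i)))⁻¹) ξ₀ := by
    simp only [Matrix.inv_def, Ring.inverse_eq_inv']
    exact (hA.inv₀ (by
      have h := hgood.self_of_nhds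
      exact (hpos ξ₀ h.1 h.2.1 h.2.2).ne')).smul
      ((Continuous.matrix_adjugate continuous_id).continuousAt.comp hAm)
  refine ContinuousAt.congr (f := fun ξ => ∑ i, ∑ j,
    ((frameGram (metricCoord e' (coordMap e e' F (e ξ.1)))
      (fun i => fderiv ℝ (coordMap e e' F) (e ξ.1) (b ξ i)))⁻¹ i j *
      quad (metricCoord e' (coordMap e e' F (e ξ.1)))
        (fderiv ℝ (coordMap e e' F) (e ξ.1) (b ξ j)) v) •
          fderiv ℝ (coordMap e e' F) (e ξ.1) (b ξ i)) ?_ ?_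
  · refine tendsto_finsetSum _ fun i _ => tendsto_finsetSum _ fun j _ => ?_
    refine Filter.Tendsto.smul (Filter.Tendsto.mul ?_ ?_) (hc i)
    · exact continuousAt_pi.1 (continuousAt_pi.1 hinv i) j
    · exact ContinuousAt.quad_metricCoord hm' hf hy' (hc j) continuousAt_const
  · filter_upwards [hgood] with ξ h
    have hcm : coordMap e e' F (e ξ.1) = e' (Gr.mapDiffeo F ξ).1 := by
      change e' (F (e.symm (e ξ.1))) = e' (F ξ.1)
      rw [e.left_inv h.1]
    have hp := hpos ξ h.1 h.2.1 h.2.2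
    rw [planeCoord_eq_sum hm' (ξ := Gr.mapDiffeo F ξ) h.2.1 (hplane ξ h.1 h.2.1)
      (by rw [← hcm]; exact hp.ne'), ← hcm]

theorem Varifold.pushMass_eq_integral (F : M ≃ₘ^∞⟮𝓡 (n + 1), 𝓡 (n + 1)⟯ M) (V : Varifold n M) :
    V.pushMass F = ∫ ξ, planeJac F ξ ∂(V : Measure (Gr n M)) := by
  have hJ : Continuous (fun ξ : Gr n M => planeJac F ξ) := Gr.continuous_planeJac F.contMDiff
  rw [integral_eq_lintegral_of_nonneg_ae (f := fun ξ : Gr n M => planeJac F ξ)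
    (ae_of_all _ fun ξ => (LinearMap.normDet_nonneg _ : 0 ≤ planeJac F ξ)) hJ.aestronglyMeasurable]
  unfold Varifold.pushMass Varifold.push
  rw [Measure.map_apply (Gr.continuous_mapDiffeo F).measurable MeasurableSet.univ, preimage_univ,
    withDensity_apply _ MeasurableSet.univ, Measure.restrict_univ]
  rfl

end Plane

section Taylor

variable {E : Type*} [NormedAddCommGroup E] [NormedSpace ℝ E]

theorem taylor_two_isLittleO {f : ℝ → E} (hf : ContDiffAt ℝ 2 f 0) :
    (fun t => f t - f 0 - t • deriv f 0 - (t ^ 2 / 2) • deriv (deriv f) 0) =o[𝓝 0]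
      fun t : ℝ => t ^ 2 := by
  have hd : ∀ᶠ t in 𝓝 (0 : ℝ), DifferentiableAt ℝ f t := by
    filter_upwards [hf.eventually (by simp)] with t ht using ht.differentiableAt (by simp)
  have h2 : HasDerivAt (deriv f) (deriv (deriv f) 0) 0 := by
    have h : ContDiffAt ℝ 1 (fderiv ℝ f) 0 := hf.fderiv_right (by norm_num)
    have h' : DifferentiableAt ℝ (deriv f) 0 :=
      (h.differentiableAt (by simp)).clm_apply (differentiableAt_const (1 : ℝ))
    exact h'.hasDerivAt
  rw [Asymptotics.isLittleO_iff]
  intro c hc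
  have h3 := (hasDerivAt_iff_isLittleO.1 h2).def hc
  obtain ⟨δ, hδ, hball⟩ := Metric.eventually_nhds_iff_ball.1 (hd.and h3)
  filter_upwards [Metric.ball_mem_nhds 0 hδ] with t ht
  have hcv : Convex ℝ (Metric.closedBall (0 : ℝ) |t|) := convex_closedBall _ _
  have hsub : ∀ s ∈ Metric.closedBall (0 : ℝ) |t|, s ∈ Metric.ball (0 : ℝ) δ := fun s hs => by
    simp only [mem_closedBall_zero_iff, mem_ball_zero_iff, Real.norm_eq_abs] at *
    exact hs.trans_lt ht
  have hder : ∀ s ∈ Metric.closedBall (0 : ℝ) |t|, HasDerivWithinAt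
      (fun t => f t - f 0 - t • deriv f 0 - (t ^ 2 / 2) • deriv (deriv f) 0)
      (deriv f s - deriv f 0 - s • deriv (deriv f) 0) (Metric.closedBall (0 : ℝ) |t|) s := by
    intro s hs
    have h4 := (hball s (hsub s hs)).1.hasDerivAt
    have h5 : HasDerivAt (fun t : ℝ => t • deriv f 0) ((1 : ℝ) • deriv f 0) s :=
      (hasDerivAt_id s).smul_const _
    have h6 : HasDerivAt (fun t : ℝ => (t ^ 2 / 2) • deriv (deriv f) 0)
        (s • deriv (deriv f) 0) s := by
      refine (((hasDerivAt_pow 2 s).div_const 2).smul_const (deriv (deriv f) 0)).congr_deriv ?_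
      congr 1; simp
    refine (((h4.sub_const _).sub h5).sub h6).hasDerivWithinAt.congr_deriv ?_
    rw [one_smul]
  have := hcv.norm_image_sub_le_of_norm_hasDerivWithin_le (C := c * |t|) hder (fun s hs => by
    have := (hball s (hsub s hs)).2
    rw [sub_zero] at this
    refine this.trans (mul_le_mul_of_nonneg_left ?_ hc.le)
    simpa using hs) (x := 0) (y := t) (by simp) (by simp)
  simp only [sub_self, zero_smul, sub_zero, ne_eq, OfNat.ofNat_ne_zero, not_false_eq_true,
    zero_pow, zero_div] at this
  refine this.trans (le_of_eq ?_)
  rw [norm_pow, Real.norm_eq_abs]; ring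

theorem eq_zero_of_quadratic_isLittleO {a b c : E}
    (h : (fun t : ℝ => a + t • b + t ^ 2 • c) =o[𝓝 0] fun t : ℝ => t ^ 2) :
    a = 0 ∧ b = 0 ∧ c = 0 := by
  have hlim : ∀ (f : ℝ → E) (k : ℕ) (v : E), Continuous f → f 0 = v →
      (∀ t, a + t • b + t ^ 2 • c = t ^ k • f t) → k ≤ 2 → v = 0 := by
    intro f k v hf h0 hk hk2
    have h1 : (fun t : ℝ => t ^ k • f t) =o[𝓝[≠] 0] fun t : ℝ => t ^ 2 := by
      simp only [← hk]; exact h.mono nhdsWithin_le_nhds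
    have h2 : (fun t : ℝ => t ^ k • f t) =o[𝓝[≠] 0] fun t : ℝ => t ^ k := by
      refine h1.trans_isBigO ?_
      have : (fun t : ℝ => t ^ 2) = fun t : ℝ => t ^ k * t ^ (2 - k) := by
        funext t; rw [← pow_add]; congr 1; omega
      rw [this]
      refine ((Asymptotics.isBigO_refl (fun t : ℝ => t ^ k) _).mul
        (((continuous_pow (2 - k)).continuousAt (x := (0 : ℝ))).isBigO_one ℝ |>.mono
          nhdsWithin_le_nhds)).trans (by simp [Asymptotics.isBigO_refl])
    have h3 : f =o[𝓝[≠] 0] fun _ : ℝ => (1 : ℝ) := by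
      refine Asymptotics.isLittleO_iff.2 fun ε hε => ?_
      filter_upwards [h2.def hε, self_mem_nhdsWithin] with t ht hne
      rw [norm_smul, norm_pow] at ht
      have hp : 0 < ‖t‖ ^ k := pow_pos (norm_pos_iff.2 hne) k
      rw [norm_one, mul_one]
      exact le_of_mul_le_mul_left (by linarith) hp
    have h4 : Tendsto f (𝓝[≠] 0) (𝓝 0) := (Asymptotics.isLittleO_one_iff ℝ).1 h3
    have h5 : Tendsto f (𝓝[≠] 0) (𝓝 v) := h0 ▸ (hf.tendsto 0).mono_left nhdsWithin_le_nhds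
    exact tendsto_nhds_unique h5 h4
  have ha : a = 0 := hlim (fun t => a + t • b + t ^ 2 • c) 0 a (by fun_prop) (by simp)
    (fun t => by simp) (by norm_num)
  subst ha
  have hb : b = 0 := hlim (fun t => b + t • c) 1 b (by fun_prop) (by simp)
    (fun t => by simp only [zero_add, pow_one, smul_add, smul_smul, sq]) (by norm_num)
  subst hb
  exact ⟨rfl, rfl, hlim (fun t => c) 2 c (by fun_prop) rfl (fun t => by simp) le_rfl⟩

/-- The second order expansion of a function determines its first two derivatives. -/
theorem deriv_eq_of_expansion {f : ℝ → E} (hf : ContDiffAt ℝ 2 f 0) {a b c : E}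
    (h : (fun t : ℝ => f t - (a + t • b + (t ^ 2 / 2) • c)) =o[𝓝 0] fun t : ℝ => t ^ 2) :
    f 0 = a ∧ deriv f 0 = b ∧ deriv (deriv f) 0 = c := by
  have h1 := h.sub (taylor_two_isLittleO hf)
  have h2 : (fun t : ℝ => (f 0 - a) + t • (deriv f 0 - b) +
      t ^ 2 • ((1 / 2 : ℝ) • (deriv (deriv f) 0 - c))) =o[𝓝 0] fun t : ℝ => t ^ 2 := by
    refine h1.congr_left fun t => ?_
    simp only [smul_sub, smul_smul]
    rw [show t ^ 2 * (1 / 2 : ℝ) = t ^ 2 / 2 by ring]; abel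
  obtain ⟨h3, h4, h5⟩ := eq_zero_of_quadratic_isLittleO h2
  exact ⟨sub_eq_zero.1 h3, sub_eq_zero.1 h4, sub_eq_zero.1 ((smul_eq_zero.1 h5).resolve_left
    (by norm_num))⟩

theorem hasDerivAt_of_expansion {f : ℝ → E} {a b c : E}
    (h : (fun t : ℝ => f t - (a + t • b + (t ^ 2 / 2) • c)) =o[𝓝 0] fun t : ℝ => t ^ 2) :
    HasDerivAt f b 0 := by
  have h0 : f 0 = a := by
    have := (h.def one_pos).self_of_nhds
    simpa [sub_eq_zero] using this
  have h3 : (fun t : ℝ => t ^ 2) =o[𝓝 0] fun t : ℝ => t := by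
    simpa using Asymptotics.isLittleO_pow_pow (𝕜 := ℝ) (m := 1) (n := 2) (by norm_num)
  have h4 : (fun t : ℝ => (t ^ 2 / 2) • c) =o[𝓝 0] fun t : ℝ => t := by
    refine Asymptotics.IsBigO.trans_isLittleO (.of_bound ‖c‖ (.of_forall fun t => ?_)) h3
    rw [norm_smul, norm_div, mul_comm, Real.norm_two]
    exact mul_le_mul_of_nonneg_left (half_le_self (norm_nonneg _)) (norm_nonneg _)
  refine hasDerivAt_iff_isLittleO.2 ?_
  simp only [sub_zero]
  refine ((h.trans h3).add h4).congr_left fun t => ?_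
  rw [h0]; abel

end Taylor

section Variations

variable {n : ℕ} {M : Type*} [EMetricSpace M] [ChartedSpace (Euc (n + 1)) M]
  [IsManifold (𝓡 (n + 1)) ∞ M]
  [RiemannianBundle (fun x : M => TangentSpace (𝓡 (n + 1)) x)]
  [IsContMDiffRiemannianBundle (𝓡 (n + 1)) ∞ (Euc (n + 1))
    (fun x : M => TangentSpace (𝓡 (n + 1)) x)]

theorem exists_chartVec_lower_bound {e : Chart n M}
    (he : e ∈ smoothAtlas n M) {y₀ : Euc (n + 1)} (hy : y₀ ∈ e.target) :
    ∃ L ≥ (1 : ℝ), ∀ᶠ y in 𝓝 y₀, ∀ v, ‖v‖ ≤ L * ‖chartVec e y v‖ := by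
  have hc : ∀ v, ContinuousAt (fun q : Euc (n + 1) × Euc (n + 1) => quad (metricCoord e q.1) q.2 q.2)
      (y₀, v) := fun v => ContinuousAt.quad_metricCoord he continuousAt_fst hy continuousAt_snd
        continuousAt_snd
  have hK : IsCompact (Metric.sphere (0 : Euc (n + 1)) 1) := isCompact_sphere _ _
  have hcK : ContinuousOn (fun v => quad (metricCoord e y₀) v v) (Metric.sphere 0 1) := fun v _ =>
    (ContinuousAt.comp (f := fun v => (y₀, v)) (hc v) (by fun_prop)).continuousWithinAt
  obtain ⟨v₀, hv₀, hmin⟩ := hK.exists_isMinOn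
    ⟨EuclideanSpace.single 0 1, by simp⟩ hcK
  set c := quad (metricCoord e y₀) v₀ v₀ with hcdef
  have hcpos : 0 < c := quad_metric_pos he hy (fun h => by simp [h] at hv₀)
  have hev := hK.eventually_forall_of_forall_eventually (x₀ := y₀)
    (P := fun y v => c / 2 < quad (metricCoord e y) v v) (fun v hv =>
      (hc v).eventually (lt_mem_nhds (lt_of_lt_of_le (by linarith) (hmin hv))))
  refine ⟨max 1 (Real.sqrt (c / 2))⁻¹, le_max_left _ _, ?_⟩
  filter_upwards [hev] with y hy v
  rcases eq_or_ne v 0 with rfl | hv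
  · simp only [norm_zero]; positivity
  have hvn : 0 < ‖v‖ := norm_pos_iff.2 hv
  have h1 := hy (‖v‖⁻¹ • v) (by simp [norm_smul, hvn.ne'])
  rw [quad_smul_left, quad_smul_right, ← inner_chartVec, real_inner_self_eq_norm_sq] at h1
  have h2 : Real.sqrt (c / 2) ≤ ‖v‖⁻¹ * ‖chartVec e y v‖ := by
    refine Real.sqrt_le_iff.2 ⟨by positivity, ?_⟩
    rw [mul_pow]; nlinarith
  have hs : 0 < Real.sqrt (c / 2) := Real.sqrt_pos.2 (by linarith)
  have h3 : ‖v‖ ≤ (Real.sqrt (c / 2))⁻¹ * ‖chartVec e y v‖ := by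
    rw [inv_mul_eq_div, le_div_iff₀ hs]
    calc ‖v‖ * Real.sqrt (c / 2) ≤ ‖v‖ * (‖v‖⁻¹ * ‖chartVec e y v‖) :=
          mul_le_mul_of_nonneg_left h2 hvn.le
      _ = ‖chartVec e y v‖ := by rw [← mul_assoc, mul_inv_cancel₀ hvn.ne', one_mul]
  exact h3.trans (mul_le_mul_of_nonneg_right (le_max_right _ _) (norm_nonneg _))

variable [CompactSpace M]

theorem exists_jetBound {ζ : M → ℝ} (hζ : ContMDiff (𝓡 (n + 1)) 𝓘(ℝ, ℝ) ∞ ζ) :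
    ∃ l > 0, ∀ p, JetBound n ζ p l := by
  have := isCompact_univ.induction_on (p := fun S : Set M => ∃ l > 0, ∀ p ∈ S, JetBound n ζ p l)
    ⟨1, one_pos, fun _ h => h.elim⟩
    (fun S T hST ⟨l, hl, h⟩ => ⟨l, hl, fun p hp => h p (hST hp)⟩)
    (by
      rintro S T ⟨l, hl, h⟩ ⟨l', hl', h'⟩
      have mono : ∀ p a, a ≤ l + l' → JetBound n ζ p a → JetBound n ζ p (l + l') := fun p a ha hb =>
        ⟨hb.1.trans ha, fun v => (hb.2 v).trans (mul_le_mul_of_nonneg_right ha (norm_nonneg _))⟩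
      refine ⟨l + l', by positivity, fun p hp => hp.elim (fun hp => mono p l (by linarith) (h p hp))
        fun hp => mono p l' (by linarith) (h' p hp)⟩)
    (fun p₀ _ => by
      set e := chartAt (Euc (n + 1)) p₀
      have he : e ∈ smoothAtlas n M := IsManifold.chart_mem_maximalAtlas p₀
      have hp₀ : p₀ ∈ e.source := mem_chart_source _ p₀
      obtain ⟨L, hL, hLb⟩ := exists_chartVec_lower_bound he (e.map_source hp₀)
      have hc : ContDiffAt ℝ ∞ (ζ ∘ e.symm) (e p₀) :=
        contDiffAt_comp_chart_symm he (hζ _) (e.map_source hp₀)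
      have hb := (hc.fderiv_right (m := 0) (by simp)).continuousAt.norm.eventually
        (gt_mem_nhds (lt_add_one _))
      have hz := hζ.continuous.abs.continuousAt.eventually (gt_mem_nhds (lt_add_one |ζ p₀|))
      set D := ‖fderiv ℝ (ζ ∘ e.symm) (e p₀)‖ + 1
      refine ⟨_, mem_nhdsWithin_of_mem_nhds (inter_mem (inter_mem
        (e.open_source.mem_nhds hp₀) hz)
        ((e.continuousAt hp₀).eventually (hb.and hLb))), |ζ p₀| + 1 + D * L, by positivity, ?_⟩
      rintro p ⟨⟨hp, hp1⟩, hp2⟩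
      obtain ⟨y, hy, rfl⟩ : ∃ y, y ∈ e.target ∧ e.symm y = p :=
        ⟨e p, e.map_source hp, e.left_inv hp⟩
      have hp3 : ‖fderiv ℝ (ζ ∘ e.symm) y‖ < D ∧ ∀ v, ‖v‖ ≤ L * ‖chartVec e y v‖ := by
        have h : ‖fderiv ℝ (ζ ∘ e.symm) (e (e.symm y))‖ < D ∧
          ∀ v, ‖v‖ ≤ L * ‖chartVec e (e (e.symm y)) v‖ := hp2
        rw [e.right_inv hy] at h
        exact h
      have hD : 0 ≤ D * L := by positivity
      refine ⟨hp1.le.trans (by linarith), fun v => ?_⟩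
      rw [← chartVec_chartComp he hy v, dfun_chartVec he ((hζ _).mdifferentiableAt (by simp)) hy]
      calc |fderiv ℝ (ζ ∘ e.symm) y (chartComp e y v)|
          ≤ ‖fderiv ℝ (ζ ∘ e.symm) y‖ * ‖chartComp e y v‖ :=
            (fderiv ℝ (ζ ∘ e.symm) y).le_opNorm (chartComp e y v)
        _ ≤ D * (L * ‖chartVec e y (chartComp e y v)‖) :=
          mul_le_mul hp3.1.le (hp3.2 _) (norm_nonneg _) (by positivity)
        _ ≤ _ := by
          rw [← mul_assoc]
          exact mul_le_mul_of_nonneg_right (by linarith [abs_nonneg (ζ p₀)]) (norm_nonneg _))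
  obtain ⟨l, hl, h⟩ := this
  exact ⟨l, hl, fun p => h p (mem_univ p)⟩


theorem IsVariation.contMDiff_deform {F : ℝ → M → M} (hF : IsVariation n F) {ζ : M → ℝ}
    (hζ : ContMDiff (𝓡 (n + 1)) 𝓘(ℝ, ℝ) ∞ ζ) {t : ℝ} (ht : ∀ p, |t * ζ p| < 1) :
    ContMDiff (𝓡 (n + 1)) (𝓡 (n + 1)) ∞ (deform F ζ t) := fun p =>
  ContMDiffAt.comp (f := fun p => (t * ζ p, p)) (g := fun x : ℝ × M => F x.1 x.2) p
    (hF.continuousAt (ht p) p)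
    ((contMDiffAt_const.mul (hζ p)).prodMk contMDiffAt_id)

theorem abs_mul_lt_one_of_jetBound {ζ : M → ℝ} {l : ℝ} (hl : ∀ p, JetBound n ζ p l) {t : ℝ}
    (ht : |t| * l < 1) (p : M) : |t * ζ p| < 1 := by
  rw [abs_mul]; exact (mul_le_mul_of_nonneg_left (hl p).1 (abs_nonneg t)).trans_lt ht

theorem measurable_firstVar_secondVar {F : ℝ → M → M} (hF : IsVariation n F) {ζ : M → ℝ}
    (hζ : ContMDiff (𝓡 (n + 1)) 𝓘(ℝ, ℝ) ∞ ζ) :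
    Measurable (firstVar (n := n) F ζ) ∧ Measurable (secondVar (n := n) F ζ) := by
  obtain ⟨C, hC, ε, hε, hexp⟩ := exists_jacExpansion hF
  obtain ⟨l, hl, hjet⟩ := exists_jetBound hζ
  have hm : ∀ᶠ t in 𝓝 (0 : ℝ), Measurable (fun ξ : Gr n M => planeJac (deform F ζ t) ξ) := by
    have : ∀ᶠ t in 𝓝 (0 : ℝ), |t| * l < 1 :=
      (by fun_prop : Continuous fun t : ℝ => |t| * l).continuousAt.eventually
        (gt_mem_nhds (by simp))
    filter_upwards [this] with t ht
    exact (Gr.continuous_planeJac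
      (hF.contMDiff_deform hζ (abs_mul_lt_one_of_jetBound hjet ht))).measurable
  have hE : ∀ᶠ t in 𝓝 (0 : ℝ), |t| * l < ε :=
    (by fun_prop : Continuous fun t : ℝ => |t| * l).continuousAt.eventually
      (gt_mem_nhds (by simpa using hε))
  have hu : Tendsto (fun k : ℕ => 1 / ((k : ℝ) + 1)) atTop (𝓝 0) := tendsto_one_div_add_atTop_nhds_zero_nat
  obtain ⟨K, hK⟩ := eventually_atTop.1 (hu.eventually (hm.and hE))
  let u : ℕ → ℝ := fun k => 1 / (((k + K : ℕ) : ℝ) + 1)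
  have hupos : ∀ k, 0 < u k := fun k => by positivity
  have hu0 : Tendsto u atTop (𝓝 0) := hu.comp (tendsto_add_atTop_nat K)
  have hum : ∀ k, Measurable (fun ξ : Gr n M => planeJac (deform F ζ (u k)) ξ) := fun k =>
    (hK (k + K) (by omega)).1
  have hbd : ∀ (k : ℕ) (ξ : Gr n M), |planeJac (deform F ζ (u k)) ξ - 1 - u k * firstVar F ζ ξ -
      u k ^ 2 / 2 * secondVar F ζ ξ| ≤ C * (u k * l) ^ 3 := fun k ξ => by
    have := (hexp ζ hζ ξ (mem_univ _) l hl (hjet _)).2.2 (u k) (hK (k + K) (by omega)).2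
    rwa [abs_of_pos (hupos k)] at this
  have h2 : ∀ ξ : Gr n M, |secondVar F ζ ξ| ≤ C * l ^ 2 := fun ξ =>
    (hexp ζ hζ ξ (mem_univ _) l hl (hjet _)).2.1
  have hfirst : Measurable (firstVar (n := n) F ζ) := by
    refine measurable_of_tendsto_metrizable
      (f := fun k (ξ : Gr n M) => (planeJac (deform F ζ (u k)) ξ - 1) / u k)
      (fun k => ((hum k).sub_const 1).div_const _) (tendsto_pi_nhds.2 fun ξ => ?_)
    refine tendsto_iff_norm_sub_tendsto_zero.2 (squeeze_zero (fun _ => norm_nonneg _)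
      (g := fun k => u k / 2 * |secondVar F ζ ξ| + C * l ^ 3 * u k ^ 2) (fun k => ?_) ?_)
    · have e1 : (planeJac (deform F ζ (u k)) ξ - 1) / u k - firstVar F ζ ξ =
          u k / 2 * secondVar F ζ ξ + (planeJac (deform F ζ (u k)) ξ - 1 - u k * firstVar F ζ ξ -
            u k ^ 2 / 2 * secondVar F ζ ξ) / u k := by
        field_simp [(hupos k).ne']; ring
      rw [e1, Real.norm_eq_abs]
      refine (abs_add_le _ _).trans (add_le_add ?_ ?_)
      · rw [abs_mul, abs_of_pos (half_pos (hupos k))]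
      · rw [abs_div, abs_of_pos (hupos k), div_le_iff₀ (hupos k)]
        refine (hbd k ξ).trans (le_of_eq ?_); ring
    · have : Tendsto (fun k => u k / 2 * |secondVar F ζ ξ| + C * l ^ 3 * u k ^ 2) atTop
          (𝓝 (0 / 2 * |secondVar F ζ ξ| + C * l ^ 3 * 0 ^ 2)) :=
        ((hu0.div_const 2).mul_const _).add ((hu0.pow 2).const_mul _)
      simpa using this
  refine ⟨hfirst, ?_⟩
  refine measurable_of_tendsto_metrizable
    (f := fun k (ξ : Gr n M) => (planeJac (deform F ζ (u k)) ξ - 1 - u k * firstVar F ζ ξ) /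
      (u k ^ 2 / 2))
    (fun k => (((hum k).sub_const 1).sub (hfirst.const_mul _)).div_const _)
    (tendsto_pi_nhds.2 fun ξ => ?_)
  refine tendsto_iff_norm_sub_tendsto_zero.2 (squeeze_zero (fun _ => norm_nonneg _)
    (g := fun k => 2 * C * l ^ 3 * u k) (fun k => ?_) ?_)
  · have e1 : (planeJac (deform F ζ (u k)) ξ - 1 - u k * firstVar F ζ ξ) / (u k ^ 2 / 2) -
        secondVar F ζ ξ = (planeJac (deform F ζ (u k)) ξ - 1 - u k * firstVar F ζ ξ -
          u k ^ 2 / 2 * secondVar F ζ ξ) / (u k ^ 2 / 2) := by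
      field_simp [(hupos k).ne']
    have hp : 0 < u k ^ 2 / 2 := by have := hupos k; positivity
    rw [e1, Real.norm_eq_abs, abs_div, abs_of_pos hp, div_le_iff₀ hp]
    refine (hbd k ξ).trans (le_of_eq ?_); ring
  · simpa using hu0.const_mul (2 * C * l ^ 3)

theorem integrable_firstVar_secondVar {F : ℝ → M → M} (hF : IsVariation n F) {ζ : M → ℝ}
    (hζ : ContMDiff (𝓡 (n + 1)) 𝓘(ℝ, ℝ) ∞ ζ) (V : Varifold n M) :
    Integrable (firstVar (n := n) F ζ) (V : Measure (Gr n M)) ∧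
      Integrable (secondVar (n := n) F ζ) (V : Measure (Gr n M)) := by
  obtain ⟨C, hC, ε, hε, hexp⟩ := exists_jacExpansion hF
  obtain ⟨l, hl, hjet⟩ := exists_jetBound hζ
  obtain ⟨h1, h2⟩ := measurable_firstVar_secondVar hF hζ
  exact ⟨.of_bound h1.aestronglyMeasurable (C * l) (ae_of_all _ fun ξ =>
    (hexp ζ hζ ξ (mem_univ _) l hl (hjet _)).1), .of_bound h2.aestronglyMeasurable (C * l ^ 2)
    (ae_of_all _ fun ξ => (hexp ζ hζ ξ (mem_univ _) l hl (hjet _)).2.1)⟩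

/-- The second order expansion of the mass along a deformation. -/
theorem integral_planeJac_isLittleO {F : ℝ → M → M} (hF : IsVariation n F) {ζ : M → ℝ}
    (hζ : ContMDiff (𝓡 (n + 1)) 𝓘(ℝ, ℝ) ∞ ζ) (V : Varifold n M) :
    (fun t : ℝ => ∫ ξ, planeJac (deform F ζ t) ξ ∂(V : Measure (Gr n M)) -
      ((V : Measure (Gr n M)).real univ + t • ∫ ξ, firstVar F ζ ξ ∂(V : Measure (Gr n M)) +
        (t ^ 2 / 2) • ∫ ξ, secondVar F ζ ξ ∂(V : Measure (Gr n M)))) =o[𝓝 0]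
      fun t : ℝ => t ^ 2 := by
  obtain ⟨C, hC, ε, hε, hexp⟩ := exists_jacExpansion hF
  obtain ⟨l, hl, hjet⟩ := exists_jetBound hζ
  obtain ⟨h1, h2⟩ := integrable_firstVar_secondVar hF hζ V
  have hE : ∀ᶠ t in 𝓝 (0 : ℝ), |t| * l < min ε 1 :=
    (by fun_prop : Continuous fun t : ℝ => |t| * l).continuousAt.eventually
      (gt_mem_nhds (by simp [hε]))
  set m := (V : Measure (Gr n M)).real univ
  refine Asymptotics.IsBigO.trans_isLittleO (g := fun t : ℝ => t ^ 3) ?_ ?_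
  swap
  · exact Asymptotics.isLittleO_pow_pow (by norm_num)
  refine Asymptotics.IsBigO.of_bound (C * l ^ 3 * m) ?_
  filter_upwards [hE] with t ht
  have hcont : Continuous (fun ξ : Gr n M => planeJac (deform F ζ t) ξ) := Gr.continuous_planeJac
    (hF.contMDiff_deform hζ (abs_mul_lt_one_of_jetBound hjet (ht.trans_le (min_le_right _ _))))
  have hb : ∀ ξ : Gr n M, ‖planeJac (deform F ζ t) ξ - (1 + t * firstVar F ζ ξ +
      t ^ 2 / 2 * secondVar F ζ ξ)‖ ≤ C * l ^ 3 * |t| ^ 3 := fun ξ => by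
    have := (hexp ζ hζ ξ (mem_univ _) l hl (hjet _)).2.2 t (ht.trans_le (min_le_left _ _))
    rw [Real.norm_eq_abs]
    calc _ = _ := by congr 1; ring
      _ ≤ _ := this
      _ = _ := by ring
  have hi2 : Integrable (fun ξ => 1 + t * firstVar F ζ ξ + t ^ 2 / 2 * secondVar F ζ ξ)
      (V : Measure (Gr n M)) :=
    ((integrable_const (1 : ℝ)).add (h1.const_mul t)).add (h2.const_mul _)
  have hi3 : Integrable (fun ξ => planeJac (deform F ζ t) ξ - (1 + t * firstVar F ζ ξ +
      t ^ 2 / 2 * secondVar F ζ ξ)) (V : Measure (Gr n M)) :=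
    .of_bound (hcont.aestronglyMeasurable.sub hi2.aestronglyMeasurable) _ (ae_of_all _ hb)
  have hi1 : Integrable (fun ξ => planeJac (deform F ζ t) ξ) (V : Measure (Gr n M)) := by
    refine (hi3.add hi2).congr (ae_of_all _ fun ξ => ?_)
    simp
  have e1 : m + t • ∫ ξ, firstVar F ζ ξ ∂(V : Measure (Gr n M)) +
        (t ^ 2 / 2) • ∫ ξ, secondVar F ζ ξ ∂(V : Measure (Gr n M)) =
      ∫ ξ, (1 + t * firstVar F ζ ξ + t ^ 2 / 2 * secondVar F ζ ξ) ∂(V : Measure (Gr n M)) := by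
    rw [integral_add (f := fun ξ => 1 + t * firstVar F ζ ξ)
        ((integrable_const (1 : ℝ)).add (h1.const_mul t)) (h2.const_mul _),
      integral_add (integrable_const (1 : ℝ)) (h1.const_mul t), integral_const_mul,
      integral_const_mul, integral_const]
    simp [m]
  rw [e1, ← integral_sub hi1 hi2]
  refine (norm_integral_le_of_norm_le_const (ae_of_all _ hb)).trans (le_of_eq ?_)
  rw [norm_pow, Real.norm_eq_abs]; ring

theorem planeJac_deform_one (F : ℝ → M → M) (t : ℝ) (ξ : Gr n M) :
    planeJac (deform F (fun _ => 1) t) ξ = planeJac (F t) ξ := by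
  have : deform F (fun _ => 1) t = F t := by funext p; simp [deform]
  rw [this]

/-- A stationary varifold has vanishing first variation. -/
theorem Varifold.IsStationary.integral_firstVar {V : Varifold n M} (hV : V.IsStationary)
    {F : ℝ → (M ≃ₘ^∞⟮𝓡 (n + 1), 𝓡 (n + 1)⟯ M)}
    (hF : ContMDiffOn (𝓘(ℝ, ℝ).prod (𝓡 (n + 1))) (𝓡 (n + 1)) ∞
      (fun x : ℝ × M => F x.1 x.2) (Ioo (-1) 1 ×ˢ univ))
    (h0 : F 0 = Diffeomorph.refl (𝓡 (n + 1)) M ∞) :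
    ∫ ξ, firstVar (fun t => F t) (fun _ => 1) ξ ∂(V : Measure (Gr n M)) = 0 := by
  have hv : IsVariation n (fun t => (F t : M → M)) := ⟨hF, fun p => by simp [h0]⟩
  have h1 := integral_planeJac_isLittleO hv (ζ := fun _ => 1) contMDiff_const V
  simp only [planeJac_deform_one, ← Varifold.pushMass_eq_integral] at h1
  exact (hasDerivAt_of_expansion h1).unique (hV F hF h0)

/-- An unstable varifold has a variation with negative second variation. -/
theorem Varifold.IsUnstable.exists_variation {d : MetricSpace (Gr n M)} {V : Varifold n M}
    (hV : V ∈ varifoldSpace n M) (h : V.IsUnstable d 1) : ∃ F : ℝ → M → M, IsVariation n F ∧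
      ∫ ξ, secondVar F (fun _ => 1) ξ ∂(V : Measure (Gr n M)) < 0 := by
  obtain ⟨ε, c₀, F, hε, hc₀, -, hsm, hF0, -, hW⟩ := h
  have hself : Varifold.distF d V V ≤ 2 * ε := by
    refine (Real.sSup_le ?_ (by positivity) : _ ≤ 2 * ε)
    rintro r ⟨f, -, -, rfl⟩
    rw [sub_self]; positivity
  obtain ⟨hcd, -, hbd⟩ := hW V hV hself
  let v₀ : Euc 1 := EuclideanSpace.single 0 1
  have hv₀ : ‖v₀‖ = 1 := by simp [v₀]
  have hv : IsVariation n (fun t => (F (t • v₀) : M → M)) := by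
    refine ⟨?_, fun p => by simp [hF0]⟩
    refine ContMDiffOn.comp (g := fun x : Euc 1 × M => F x.1 x.2)
      (f := fun x : ℝ × M => (x.1 • v₀, x.2)) hsm ?_ ?_
    · have h1 : ContMDiff 𝓘(ℝ, ℝ) (𝓡 1) ∞ (fun t : ℝ => t • v₀) :=
        (contDiff_id.smul contDiff_const : ContDiff ℝ ∞ (fun t : ℝ => t • v₀)).contMDiff
      exact ((h1.comp contMDiff_fst).prodMk contMDiff_snd).contMDiffOn
    · rintro ⟨t, p⟩ ⟨ht, -⟩
      refine ⟨?_, mem_univ _⟩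
      rw [mem_closedBall_zero_iff, norm_smul, hv₀, mul_one]
      exact (abs_lt.2 ht).le
  refine ⟨_, hv, ?_⟩
  set f : Euc 1 → ℝ := fun v => V.pushMass (F v) with hf
  have hcf : ContDiffAt ℝ ∞ f 0 := hcd.contDiffAt (Metric.closedBall_mem_nhds _ one_pos)
  have hexp := integral_planeJac_isLittleO hv (ζ := fun _ => 1) contMDiff_const V
  simp only [planeJac_deform_one, ← Varifold.pushMass_eq_integral] at hexp
  have hlin : HasFDerivAt (fun t : ℝ => t • v₀) ((ContinuousLinearMap.id ℝ ℝ).smulRight v₀) 0 :=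
    (ContinuousLinearMap.id ℝ ℝ).hasFDerivAt.smul_const v₀
  have hcA : ContDiffAt ℝ 2 (fun t : ℝ => f (t • v₀)) 0 := by
    have hl : ContDiff ℝ 2 (fun t : ℝ => t • v₀) := contDiff_id.smul contDiff_const
    refine ContDiffAt.comp (f := fun t : ℝ => t • v₀) (g := f) (0 : ℝ) ?_ hl.contDiffAt
    rw [zero_smul]; exact contDiffAt_infty.1 hcf 2
  obtain ⟨-, -, h2⟩ := deriv_eq_of_expansion hcA hexp
  rw [← h2]
  have hd1 : deriv (fun t : ℝ => f (t • v₀)) =ᶠ[𝓝 0] fun t => fderiv ℝ f (t • v₀) v₀ := by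
    have hev : ∀ᶠ t in 𝓝 (0 : ℝ), ContDiffAt ℝ 1 f (t • v₀) := by
      have : Tendsto (fun t : ℝ => t • v₀) (𝓝 0) (𝓝 ((0 : ℝ) • v₀)) :=
        (continuous_id.smul continuous_const : Continuous fun t : ℝ => t • v₀).tendsto 0
      rw [zero_smul] at this
      exact this.eventually ((contDiffAt_infty.1 hcf 1).eventually (by simp))
    filter_upwards [hev] with t ht
    have h3 : HasDerivAt (fun t : ℝ => t • v₀) ((1 : ℝ) • v₀) t := (hasDerivAt_id t).smul_const v₀
    rw [one_smul] at h3
    exact ((ht.differentiableAt (by simp)).hasFDerivAt.comp_hasDerivAt t h3).deriv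
  have hd2 : deriv (deriv fun t : ℝ => f (t • v₀)) 0 = fderiv ℝ (fderiv ℝ f) 0 v₀ v₀ := by
    rw [hd1.deriv_eq]
    have h3 : HasDerivAt (fun t : ℝ => t • v₀) ((1 : ℝ) • v₀) 0 := (hasDerivAt_id 0).smul_const v₀
    rw [one_smul] at h3
    have h4 : DifferentiableAt ℝ (fderiv ℝ f) ((0 : ℝ) • v₀) := by
      rw [zero_smul]
      exact ((contDiffAt_infty.1 hcf 2).fderiv_right (m := 1) (by norm_num)).differentiableAt (by simp)
    have h5 := h4.hasFDerivAt.comp_hasDerivAt (0 : ℝ) h3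
    have h6 := h5.clm_apply (hasDerivAt_const (0 : ℝ) v₀)
    refine h6.deriv.trans ?_
    rw [zero_smul]; simp
  rw [hd2]
  have h7 := (hbd 0 (by simp) v₀).2
  rw [iteratedFDerivWithin_eq_iteratedFDeriv
    (uniqueDiffOn_convex (convex_closedBall _ _) ⟨0, by
      rw [interior_closedBall _ one_ne_zero]; simp⟩)
    (contDiffAt_infty.1 hcf 2) (by simp), iteratedFDeriv_two_apply, hv₀] at h7
  simp only [Matrix.cons_val_zero, Matrix.cons_val_one] at h7
  linarith

end Variations

/-- A small perturbation of the identity of `ℝᵐ` is a diffeomorphism. -/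
theorem exists_homeomorph_id_add {m : ℕ} {Y : Euc (m + 1) → Euc (m + 1)} (hY : ContDiff ℝ ∞ Y)
    (hb : ∀ y, ‖fderiv ℝ Y y‖ ≤ 1 / 2) : ∃ φ : Euc (m + 1) ≃ₜ Euc (m + 1),
      (∀ y, φ y = y + Y y) ∧ ContDiff ℝ ∞ φ.symm := by
  have hd : Differentiable ℝ Y := hY.differentiable (by simp)
  have hL : LipschitzWith (1 / 2) Y := lipschitzWith_of_nnnorm_fderiv_le hd fun y => by
    rw [← NNReal.coe_le_coe]; simpa using hb y
  have happ : ApproximatesLinearOn (fun y => y + Y y)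
      ((ContinuousLinearEquiv.refl ℝ (Euc (m + 1)) : Euc (m + 1) ≃L[ℝ] Euc (m + 1)) :
        Euc (m + 1) →L[ℝ] Euc (m + 1)) univ (1 / 2) := by
    refine ApproximatesLinearOn.approximatesLinearOn_iff_lipschitzOnWith.2 ?_
    have : ((fun y => y + Y y) - ⇑((ContinuousLinearEquiv.refl ℝ (Euc (m + 1)) :
        Euc (m + 1) ≃L[ℝ] Euc (m + 1)) : Euc (m + 1) →L[ℝ] Euc (m + 1))) = Y := by
      funext y; simp
    rw [this]; exact hL.lipschitzOnWith
  have hN : (1 / 2 : NNReal) < ‖((ContinuousLinearEquiv.refl ℝ (Euc (m + 1))).symm :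
      Euc (m + 1) →L[ℝ] Euc (m + 1))‖₊⁻¹ := by
    have : ((ContinuousLinearEquiv.refl ℝ (Euc (m + 1))).symm :
      Euc (m + 1) →L[ℝ] Euc (m + 1)) = ContinuousLinearMap.id ℝ _ := rfl
    rw [this, ContinuousLinearMap.nnnorm_id, inv_one]
    exact NNReal.half_lt_self one_ne_zero
  refine ⟨happ.toHomeomorph _ (Or.inr hN), fun y => rfl, ?_⟩
  have hu : ∀ a, ‖-fderiv ℝ Y a‖ < 1 := fun a => by
    rw [norm_neg]; exact (hb a).trans_lt (by norm_num)
  refine Homeomorph.contDiff_symm _ (f₀' := fun a => ContinuousLinearEquiv.ofUnit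
    (Units.oneSub _ (hu a))) (fun a => ?_) (contDiff_id.add hY)
  have h1 : HasFDerivAt (fun y => y + Y y) (ContinuousLinearMap.id ℝ _ + fderiv ℝ Y a) a :=
    (hasFDerivAt_id a).add (hd a).hasFDerivAt
  refine h1.congr_fderiv ?_
  ext1 v
  change v + fderiv ℝ Y a v = ((1 : Euc (m + 1) →L[ℝ] Euc (m + 1)) - -fderiv ℝ Y a) v
  simp

section Glue

variable {n : ℕ} {M : Type*} [EMetricSpace M] [ChartedSpace (Euc (n + 1)) M]

open Classical in
/-- The map of `M` given by `φ` in a chart and by the identity outside of it. -/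
def chartGlue (e : Chart n M) (φ : Euc (n + 1) → Euc (n + 1)) (p : M) :
    M := if p ∈ e.source then e.symm (φ (e p)) else p

theorem chartGlue_of_mem {e : Chart n M}
    (φ : Euc (n + 1) → Euc (n + 1)) {p : M} (hp : p ∈ e.source) :
    chartGlue e φ p = e.symm (φ (e p)) := if_pos hp

theorem chartGlue_comp {e : Chart n M}
    {φ ψ : Euc (n + 1) → Euc (n + 1)} (hφ : MapsTo φ e.target e.target) (h : ∀ y, ψ (φ y) = y)
    (p : M) : chartGlue e ψ (chartGlue e φ p) = p := by
  by_cases hp : p ∈ e.source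
  · have h1 := hφ (e.map_source hp)
    rw [chartGlue_of_mem φ hp, chartGlue_of_mem ψ (e.map_target h1), e.right_inv h1, h,
      e.left_inv hp]
  · simp [chartGlue, hp]

theorem contMDiffOn_chartGlue [IsManifold (𝓡 (n + 1)) ∞ M]
    {e : Chart n M}
    (he : e ∈ smoothAtlas n M) {K : Set (Euc (n + 1))} (hK : IsCompact K)
    (hKe : K ⊆ e.target) {I : Set ℝ} (hI : IsOpen I) {Φ : ℝ × Euc (n + 1) → Euc (n + 1)}
    (hΦ : ContDiff ℝ ∞ Φ) (hid : ∀ s ∈ I, ∀ y ∉ K, Φ (s, y) = y)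
    (hmaps : ∀ s ∈ I, ∀ y ∈ e.target, Φ (s, y) ∈ e.target) :
    ContMDiffOn (𝓘(ℝ, ℝ).prod (𝓡 (n + 1))) (𝓡 (n + 1)) ∞
      (fun x : ℝ × M => chartGlue e (fun y => Φ (x.1, y)) x.2) (I ×ˢ univ) := by
  rintro ⟨s, p⟩ ⟨hs, -⟩
  refine ContMDiffAt.contMDiffWithinAt ?_
  by_cases hp : p ∈ e.source
  · have h1 : ContMDiffAt (𝓘(ℝ, ℝ).prod (𝓡 (n + 1))) (𝓡 (n + 1)) ∞
        (fun x : ℝ × M => e x.2) (s, p) :=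
      ContMDiffAt.comp (f := fun x : ℝ × M => x.2) (s, p)
        ((contMDiffOn_of_mem_maximalAtlas he).contMDiffAt (e.open_source.mem_nhds hp)) contMDiffAt_snd
    have h2 : ContMDiffAt (𝓘(ℝ, ℝ).prod (𝓡 (n + 1))) 𝓘(ℝ, ℝ × Euc (n + 1)) ∞
        (fun x : ℝ × M => (x.1, e x.2)) (s, p) := contMDiffAt_fst.prodMk_space h1
    have h3 : ContMDiffAt (𝓘(ℝ, ℝ).prod (𝓡 (n + 1))) (𝓡 (n + 1)) ∞
        (fun x : ℝ × M => Φ (x.1, e x.2)) (s, p) :=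
      ContMDiffAt.comp (f := fun x : ℝ × M => (x.1, e x.2)) (s, p)
        (hΦ.contDiffAt.contMDiffAt) h2
    have h4 : ContMDiffAt (𝓘(ℝ, ℝ).prod (𝓡 (n + 1))) (𝓡 (n + 1)) ∞
        (fun x : ℝ × M => e.symm (Φ (x.1, e x.2))) (s, p) :=
      ContMDiffAt.comp (f := fun x : ℝ × M => Φ (x.1, e x.2)) (s, p)
        ((contMDiffOn_symm_of_mem_maximalAtlas he).contMDiffAt
          (e.open_target.mem_nhds (hmaps s hs _ (e.map_source hp)))) h3
    refine h4.congr_of_eventuallyEq ?_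
    filter_upwards [(e.open_source.preimage continuous_snd).mem_nhds (show (s, p).2 ∈ e.source from hp)]
      with x hx using chartGlue_of_mem _ hx
  · have hc : IsClosed (e.symm '' K) :=
      (hK.image_of_continuousOn (e.continuousOn_symm.mono hKe)).isClosed
    have hpc : p ∉ e.symm '' K := by
      rintro ⟨y, hy, rfl⟩; exact hp (e.map_target (hKe hy))
    refine (contMDiffAt_snd (I := 𝓘(ℝ, ℝ)) (J := 𝓡 (n + 1))).congr_of_eventuallyEq ?_
    filter_upwards [(hI.prod hc.isOpen_compl).mem_nhds ⟨hs, hpc⟩] with x hx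
    by_cases hx2 : x.2 ∈ e.source
    · rw [chartGlue_of_mem _ hx2, hid _ hx.1 _ fun h => hx.2 ⟨e x.2, h, e.left_inv hx2⟩,
        e.left_inv hx2]
    · exact if_neg hx2

theorem exists_diffeo_chartGlue [IsManifold (𝓡 (n + 1)) ∞ M]
    {e : Chart n M}
    (he : e ∈ smoothAtlas n M) {Y : Euc (n + 1) → Euc (n + 1)}
    (hY : ContDiff ℝ ∞ Y) (hc : HasCompactSupport Y) (hYe : tsupport Y ⊆ e.target) :
    ∃ c > (0 : ℝ), ∃ F : ℝ → (M ≃ₘ^∞⟮𝓡 (n + 1), 𝓡 (n + 1)⟯ M),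
      ContMDiffOn (𝓘(ℝ, ℝ).prod (𝓡 (n + 1))) (𝓡 (n + 1)) ∞
        (fun x : ℝ × M => F x.1 x.2) (Ioo (-1) 1 ×ˢ univ) ∧
      F 0 = Diffeomorph.refl (𝓡 (n + 1)) M ∞ ∧
      ∀ t ∈ Ioo (-1 : ℝ) 1, ∀ p, F t p = chartGlue e (fun y => y + (t * c) • Y y) p := by
  obtain ⟨B, hB⟩ := (hY.continuous_fderiv (by simp)).bounded_above_of_compact_support
    (hc.fderiv ℝ)
  have hB0 : 0 ≤ B := (norm_nonneg _).trans (hB 0)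
  set c : ℝ := 1 / (2 * (B + 1)) with hcdef
  have hcpos : 0 < c := by positivity
  have hKe := hYe
  set K := tsupport Y with hKdef
  have hK : IsCompact K := hc
  have hid : ∀ a : ℝ, ∀ y ∉ K, y + a • Y y = y := fun a y hy => by
    rw [image_eq_zero_of_notMem_tsupport hy]; simp
  have hex : ∀ t ∈ Ioo (-1 : ℝ) 1, ∃ φ : Euc (n + 1) ≃ₜ Euc (n + 1),
      (∀ y, φ y = y + (t * c) • Y y) ∧ ContDiff ℝ ∞ φ.symm := by
    intro t ht
    refine exists_homeomorph_id_add (hY.const_smul (t * c)) fun y => ?_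
    rw [fderiv_fun_const_smul (hY.differentiable (by simp) y), norm_smul, norm_mul,
      Real.norm_eq_abs, Real.norm_eq_abs, abs_of_pos hcpos]
    have h1 : |t| ≤ 1 := (abs_lt.2 ht).le
    calc |t| * c * ‖fderiv ℝ Y y‖ ≤ 1 * c * (B + 1) := by
          gcongr; exact (hB y).trans (by linarith)
      _ = 1 / 2 := by rw [hcdef]; field_simp
  have hmapsK : ∀ t ∈ Ioo (-1 : ℝ) 1, MapsTo (fun y => y + (t * c) • Y y) e.target e.target := by
    intro t ht y hy
    obtain ⟨φ, hφ, -⟩ := hex t ht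
    by_cases hyK : y ∈ K
    · by_contra hno
      have h1 : (y + (t * c) • Y y) ∉ K := fun h => hno (hKe h)
      have h2 := hid (t * c) _ h1
      rw [← hφ, ← hφ] at h2
      have h3 := φ.injective h2
      rw [← hφ, h3] at h1
      exact h1 hyK
    · change y + (t * c) • Y y ∈ e.target
      rw [hid _ _ hyK]; exact hy
  have hsm : ContMDiffOn (𝓘(ℝ, ℝ).prod (𝓡 (n + 1))) (𝓡 (n + 1)) ∞
      (fun x : ℝ × M => chartGlue e (fun y => y + (x.1 * c) • Y y) x.2) (Ioo (-1) 1 ×ˢ univ) :=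
    contMDiffOn_chartGlue he hK hKe isOpen_Ioo
      (Φ := fun q : ℝ × Euc (n + 1) => q.2 + (q.1 * c) • Y q.2)
      (contDiff_snd.add ((contDiff_fst.mul contDiff_const).smul (hY.comp contDiff_snd)))
      (fun s _ y hy => hid _ y hy) (fun s hs y hy => hmapsK s hs hy)
  have hD : ∀ t ∈ Ioo (-1 : ℝ) 1, ∃ D : M ≃ₘ^∞⟮𝓡 (n + 1), 𝓡 (n + 1)⟯ M,
      ∀ p, D p = chartGlue e (fun y => y + (t * c) • Y y) p := by
    intro t ht
    obtain ⟨φ, hφ, hφs⟩ := hex t ht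
    have hfun : (fun y => y + (t * c) • Y y) = φ := funext fun y => (hφ y).symm
    have hsid : ∀ y ∉ K, φ.symm y = y := fun y hy => by
      rw [φ.symm_apply_eq, hφ, hid _ _ hy]
    have hsmaps : MapsTo φ.symm e.target e.target := by
      intro y hy
      by_contra hno
      have h1 : φ.symm y ∉ K := fun h => hno (hKe h)
      have h2 := hid (t * c) _ h1
      rw [← hφ, φ.apply_symm_apply] at h2
      exact hno (h2 ▸ hy)
    have hpair : ContMDiff (𝓡 (n + 1)) (𝓘(ℝ, ℝ).prod (𝓡 (n + 1))) ∞ (fun p : M => (t, p)) :=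
      contMDiff_const.prodMk contMDiff_id
    have hφmaps : MapsTo φ e.target e.target := by rw [← hfun]; exact hmapsK t ht
    refine ⟨⟨⟨chartGlue e φ, chartGlue e φ.symm,
      chartGlue_comp hφmaps φ.symm_apply_apply,
      chartGlue_comp hsmaps φ.apply_symm_apply⟩, ?_, ?_⟩, fun p => (by rw [hfun] :
        chartGlue e φ p = chartGlue e (fun y => y + (t * c) • Y y) p)⟩
    · have := hsm.comp_contMDiff hpair fun p => ⟨ht, mem_univ _⟩
      refine this.congr fun p => ?_
      simp only [Function.comp_apply, hfun]; rfl
    · have h1 := contMDiffOn_chartGlue he hK hKe isOpen_univ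
        (Φ := fun q : ℝ × Euc (n + 1) => φ.symm q.2) (hφs.comp contDiff_snd)
        (fun s _ y hy => hsid y hy) (fun s hs y hy => hsmaps hy)
      exact h1.comp_contMDiff hpair fun p => ⟨mem_univ _, mem_univ _⟩
  have : Nonempty (M ≃ₘ^∞⟮𝓡 (n + 1), 𝓡 (n + 1)⟯ M) := ⟨Diffeomorph.refl _ _ _⟩
  choose! D hDD using hD
  refine ⟨c, hcpos, D, ?_, ?_, hDD⟩
  · exact hsm.congr fun x hx => hDD x.1 hx.1 x.2
  · ext p
    rw [hDD 0 (by simp)]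
    by_cases hp : p ∈ e.source
    · simp [chartGlue_of_mem _ hp, e.left_inv hp]
    · simp [chartGlue, hp]

end Glue

/-- The derivative of a matrix-valued function in the direction `v`. -/
def dirMatrix {m : ℕ} (g : Euc m → Matrix (Fin m) (Fin m) ℝ) (y v : Euc m) :
    Matrix (Fin m) (Fin m) ℝ := Matrix.of fun k l => fderiv ℝ (fun x => g x k l) y v

/-- The divergence of the vector field `Y` along the plane with orthonormal frame `β`. -/
def frameDiv {m k : ℕ} (g : Euc m → Matrix (Fin m) (Fin m) ℝ) (Y : Euc m → Euc m) (y : Euc m)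
    (β : Fin k → Euc m) : ℝ :=
  ∑ i, (quad (g y) (fderiv ℝ Y y (β i)) (β i) + 1 / 2 * quad (dirMatrix g y (Y y)) (β i) (β i))

theorem HasDerivAt.quad {m : ℕ} {g : ℝ → Matrix (Fin m) (Fin m) ℝ} {g' : Matrix (Fin m) (Fin m) ℝ}
    {v w : ℝ → Euc m} {v' w' : Euc m} {t : ℝ} (hg : ∀ i j, HasDerivAt (fun s => g s i j) (g' i j) t)
    (hv : HasDerivAt v v' t) (hw : HasDerivAt w w' t) :
    HasDerivAt (fun s => _root_.quad (g s) (v s) (w s))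
      (_root_.quad g' (v t) (w t) + _root_.quad (g t) v' (w t) + _root_.quad (g t) (v t) w') t := by
  have hp : ∀ (u : ℝ → Euc m) u', HasDerivAt u u' t → ∀ i, HasDerivAt (fun s => u s i) (u' i) t :=
    fun u u' hu i =>
    (EuclideanSpace.proj i : Euc m →L[ℝ] ℝ).hasFDerivAt.comp_hasDerivAt t hu
  have h : HasDerivAt (fun s => ∑ i, ∑ j, v s i * g s i j * w s j)
      (∑ i, ∑ j, ((v' i * g t i j + v t i * g' i j) * w t j + v t i * g t i j * w' j)) t :=
    HasDerivAt.fun_sum fun i _ => HasDerivAt.fun_sum fun j _ =>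
      ((hp v v' hv i).mul (hg i j)).mul (hp w w' hw j)
  refine h.congr_deriv ?_
  simp only [_root_.quad, ← Finset.sum_add_distrib]
  exact Finset.sum_congr rfl fun i _ => Finset.sum_congr rfl fun j _ => by ring

section FirstVariation

variable {n : ℕ} {M : Type*} [EMetricSpace M] [ChartedSpace (Euc (n + 1)) M]
  [IsManifold (𝓡 (n + 1)) ∞ M]
  [RiemannianBundle (fun x : M => TangentSpace (𝓡 (n + 1)) x)]

/-- `β` is an orthonormal frame of the plane `ξ`, in coordinates. -/
structure IsFrame (e : Chart n M) (ξ : Gr n M)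
    (β : Fin n → Euc (n + 1)) : Prop where
  mem : ∀ i, InPlane e ξ (β i)
  gram : frameGram (metricCoord e (e ξ.1)) β = 1

theorem exists_isFrame {e : Chart n M}
    (he : e ∈ smoothAtlas n M) {ξ : Gr n M} (hξ : ξ.1 ∈ e.source) :
    ∃ β : Fin n → Euc (n + 1), IsFrame e ξ β := by
  obtain ⟨y, hy, P, rfl⟩ := Gr.exists_eq_mk hξ
  let o := (stdOrthonormalBasis ℝ P.1).reindex (finCongr P.2)
  refine ⟨fun i => chartComp e y (o i), fun i => ⟨_, (o i).2, rfl⟩, ?_⟩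
  simp only [e.right_inv hy]
  rw [frameGram_eq_gram]
  ext i j
  rw [Matrix.gram_apply, chartVec_chartComp he hy, chartVec_chartComp he hy, Matrix.one_apply]
  exact orthonormal_iff_ite.1 o.orthonormal i j

variable [IsContMDiffRiemannianBundle (𝓡 (n + 1)) ∞ (Euc (n + 1))
    (fun x : M => TangentSpace (𝓡 (n + 1)) x)]

theorem hasDerivAt_planeJac_chartGlue {e : Chart n M}
    (he : e ∈ smoothAtlas n M) {Y : Euc (n + 1) → Euc (n + 1)}
    (hY : ContDiff ℝ ∞ Y) {c : ℝ} {F : ℝ → M → M}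
    (hFs : ∀ᶠ t in 𝓝 (0 : ℝ), MDifferentiable (𝓡 (n + 1)) (𝓡 (n + 1)) (F t))
    (hF : ∀ᶠ t in 𝓝 (0 : ℝ), ∀ p, F t p = chartGlue e (fun y => y + (t * c) • Y y) p)
    {ξ : Gr n M} (hξ : ξ.1 ∈ e.source) {β : Fin n → Euc (n + 1)} (hβ : IsFrame e ξ β) :
    HasDerivAt (fun t => planeJac (F t) ξ) (c * frameDiv (metricCoord e) Y (e ξ.1) β) 0 := by
  set y := e ξ.1 with hydef
  have hy : y ∈ e.target := e.map_source hξ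
  have hline : HasDerivAt (fun t : ℝ => y + (t * c) • Y y) (c • Y y) 0 := by
    have h1 : HasDerivAt (fun t : ℝ => t * c) c 0 := by simpa using (hasDerivAt_id (0 : ℝ)).mul_const c
    exact (h1.smul_const (Y y)).const_add y
  have h0 : y + ((0 : ℝ) * c) • Y y = y := by simp
  have hmem : ∀ᶠ t in 𝓝 (0 : ℝ), y + (t * c) • Y y ∈ e.target :=
    hline.continuousAt.preimage_mem_nhds (by rw [h0]; exact e.open_target.mem_nhds hy)
  let w : ℝ → Fin n → Euc (n + 1) := fun t i => β i + (t * c) • fderiv ℝ Y y (β i)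
  let A : ℝ → Matrix (Fin n) (Fin n) ℝ := fun t =>
    frameGram (metricCoord e (y + (t * c) • Y y)) (w t)
  have hcm : ∀ᶠ t in 𝓝 (0 : ℝ), planeJac (F t) ξ = Real.sqrt (A t).det := by
    filter_upwards [hFs, hF, hmem] with t h1 h2 h3
    have hm : F t ξ.1 = e.symm (y + (t * c) • Y y) := by rw [h2, chartGlue_of_mem _ hξ]
    have hev : coordMap e e (F t) =ᶠ[𝓝 y] fun x => x + (t * c) • Y x := by
      have hcont : ContinuousAt (fun x => x + (t * c) • Y x) y := by
        have := hY.continuous; fun_prop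
      filter_upwards [e.open_target.mem_nhds hy,
        hcont.preimage_mem_nhds (e.open_target.mem_nhds h3)] with x hx hx2
      rw [coordMap, h2, chartGlue_of_mem _ (e.map_target hx), e.right_inv hx, e.right_inv hx2]
    have hfd : ∀ v, fderiv ℝ (coordMap e e (F t)) y v = v + (t * c) • fderiv ℝ Y y v := fun v => by
      have h4 : HasFDerivAt (fun x => x + (t * c) • Y x)
          (ContinuousLinearMap.id ℝ _ + (t * c) • fderiv ℝ Y y) y :=
        (hasFDerivAt_id y).add (((hY.differentiable (by simp)) y).hasFDerivAt.const_smul (t * c))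
      rw [hev.fderiv_eq, h4.fderiv]; rfl
    rw [planeJac_eq_sqrt he he hξ (by rw [hm]; exact e.map_target h3) (h1 ξ.1) hβ.mem
      (by rw [hβ.gram]; simp), hβ.gram, Matrix.det_one, div_one, ← hydef, hev.eq_of_nhds]
    simp only [hfd]
    rfl
  have hg : ∀ k l, HasDerivAt (fun t : ℝ => metricCoord e (y + (t * c) • Y y) k l)
      ((c • dirMatrix (metricCoord e) y (Y y)) k l) 0 := fun k l => by
    have h1 := ((contDiffAt_metricCoord he hy k l).differentiableAt (by simp)).hasFDerivAt
    rw [← h0] at h1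
    have h2 := h1.comp_hasDerivAt (0 : ℝ) hline
    rw [h0] at h2
    refine h2.congr_deriv ?_
    rw [map_smul]; rfl
  have hw : ∀ i, HasDerivAt (fun t => w t i) (c • fderiv ℝ Y y (β i)) 0 := fun i => by
    have h1 : HasDerivAt (fun t : ℝ => t * c) c 0 := by simpa using (hasDerivAt_id (0 : ℝ)).mul_const c
    exact (h1.smul_const (fderiv ℝ Y y (β i))).const_add (β i)
  have hw0 : w 0 = β := by funext i; simp [w]
  have hA0 : A 0 = 1 := by
    change frameGram (metricCoord e (y + ((0 : ℝ) * c) • Y y)) (w 0) = 1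
    rw [h0, hw0]; exact hβ.gram
  have hdet := hasDerivAt_det (A := A) (t := 0) (A' := Matrix.of fun i j =>
    quad (c • dirMatrix (metricCoord e) y (Y y)) (w 0 i) (w 0 j) +
      quad (metricCoord e (y + ((0 : ℝ) * c) • Y y)) (c • fderiv ℝ Y y (β i)) (w 0 j) +
      quad (metricCoord e (y + ((0 : ℝ) * c) • Y y)) (w 0 i) (c • fderiv ℝ Y y (β j)))
    fun i j => HasDerivAt.quad hg (hw i) (hw j)
  have hs := hdet.sqrt (by rw [hA0]; simp)
  refine (hs.congr_of_eventuallyEq hcm).congr_deriv ?_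
  rw [hA0, Matrix.adjugate_one, one_mul, Matrix.det_one, Real.sqrt_one, mul_one, Matrix.trace,
    frameDiv, Finset.mul_sum, Finset.sum_div]
  refine Finset.sum_congr rfl fun i _ => ?_
  simp only [Matrix.diag_apply, Matrix.of_apply, h0, hw0]
  rw [quad_smul_left, quad_smul_right, quad_symm (fun i j => metricCoord_symm e y i j) (β i)
    (fderiv ℝ Y y (β i))]
  have : quad (c • dirMatrix (metricCoord e) y (Y y)) (β i) (β i) =
      c * quad (dirMatrix (metricCoord e) y (Y y)) (β i) (β i) := by
    simp only [quad, Finset.mul_sum, Matrix.smul_apply, smul_eq_mul]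
    exact Finset.sum_congr rfl fun i _ => Finset.sum_congr rfl fun j _ => by ring
  rw [this]; ring

theorem planeJac_eq_one_of_eventuallyEq {G : M → M} {ξ : Gr n M} (h : G =ᶠ[𝓝 ξ.1] id) :
    planeJac G ξ = 1 := by
  let e := chartAt (Euc (n + 1)) ξ.1
  have he : e ∈ smoothAtlas n M := IsManifold.chart_mem_maximalAtlas _
  have hξ : ξ.1 ∈ e.source := mem_chart_source _ ξ.1
  obtain ⟨β, hβ⟩ := exists_isFrame he hξ
  have hy := e.map_source hξ
  have hev : coordMap e e G =ᶠ[𝓝 (e ξ.1)] id := by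
    have h1 := e.tendsto_symm hξ
    filter_upwards [e.open_target.mem_nhds hy, h1.eventually h] with x hx hx2
    rw [coordMap, hx2, id, e.right_inv hx, id]
  rw [planeJac_eq_sqrt he he hξ (by rw [h.eq_of_nhds]; exact hξ)
    (mdifferentiableAt_id.congr_of_eventuallyEq h) hβ.mem (by rw [hβ.gram]; simp),
    hβ.gram, hev.eq_of_nhds, hev.fderiv_eq, fderiv_id]
  change Real.sqrt ((frameGram (metricCoord e (e ξ.1)) β).det / _) = 1
  rw [hβ.gram]; simp

/-- The first variation formula. -/
theorem Varifold.IsStationary.exists_integral_frameDiv [CompactSpace M] {V : Varifold n M}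
    (hV : V.IsStationary) {e : Chart n M}
    (he : e ∈ smoothAtlas n M) {Y : Euc (n + 1) → Euc (n + 1)}
    (hY : ContDiff ℝ ∞ Y) (hc : HasCompactSupport Y) (hYe : tsupport Y ⊆ e.target) :
    ∃ D : Gr n M → ℝ, Measurable D ∧ Integrable D (V : Measure (Gr n M)) ∧
      ∫ ξ, D ξ ∂(V : Measure (Gr n M)) = 0 ∧ (∀ ξ : Gr n M, ξ.1 ∈ e.source →
        ∀ β, IsFrame e ξ β → D ξ = frameDiv (metricCoord e) Y (e ξ.1) β) ∧
      ∀ ξ : Gr n M, ξ.1 ∉ e.symm '' tsupport Y → D ξ = 0 := by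
  obtain ⟨c, hcpos, F, hFs, hF0, hF⟩ := exists_diffeo_chartGlue he hY hc hYe
  have hv : IsVariation n (fun t => (F t : M → M)) := ⟨hFs, fun p => by simp [hF0]⟩
  have hint := hV.integral_firstVar hFs hF0
  have hdef : ∀ ξ : Gr n M, firstVar (fun t => (F t : M → M)) (fun _ => 1) ξ =
      deriv (fun t => planeJac (F t) ξ) 0 := fun ξ => by
    simp only [firstVar, planeJac_deform_one]
  have hI : Ioo (-1 : ℝ) 1 ∈ 𝓝 (0 : ℝ) := Ioo_mem_nhds (by norm_num) (by norm_num)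
  refine ⟨fun ξ => c⁻¹ * firstVar (fun t => (F t : M → M)) (fun _ => 1) ξ,
    (measurable_firstVar_secondVar hv contMDiff_const).1.const_mul _,
    (integrable_firstVar_secondVar hv contMDiff_const V).1.const_mul _, ?_, ?_, ?_⟩
  · rw [integral_const_mul, hint, mul_zero]
  · intro ξ hξ β hβ
    have := hasDerivAt_planeJac_chartGlue he hY (c := c) (F := fun t => F t)
      (.of_forall fun t => (F t).contMDiff.mdifferentiable (by simp))
      (by filter_upwards [hI] with t ht using hF t ht) hξ hβ
    simp only [hdef]
    rw [this.deriv, ← mul_assoc, inv_mul_cancel₀ hcpos.ne', one_mul]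
  · intro ξ hξ
    have hcl : IsClosed (e.symm '' tsupport Y) :=
      (IsCompact.image_of_continuousOn hc (e.continuousOn_symm.mono hYe)).isClosed
    have : (fun t => planeJac (F t) ξ) =ᶠ[𝓝 0] fun _ => 1 := by
      filter_upwards [hI] with t ht
      refine planeJac_eq_one_of_eventuallyEq ?_
      filter_upwards [hcl.isOpen_compl.mem_nhds hξ] with p hp
      rw [hF t ht]
      by_cases hps : p ∈ e.source
      · rw [chartGlue_of_mem _ hps, image_eq_zero_of_notMem_tsupport fun h =>
          hp ⟨e p, h, e.left_inv hps⟩, smul_zero, add_zero, e.left_inv hps]; rfl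
      · exact if_neg hps
    simp only [hdef]
    rw [this.deriv_eq]; simp

end FirstVariation

theorem quad_sub_matrix {m : ℕ} (g h : Matrix (Fin m) (Fin m) ℝ) (v w : Euc m) :
    quad (g - h) v w = quad g v w - quad h v w := by
  simp [quad, mul_sub, sub_mul, Finset.sum_sub_distrib]

theorem abs_quad_le {m : ℕ} {A : Matrix (Fin m) (Fin m) ℝ} {c : ℝ} (hA : ∀ i j, |A i j| ≤ c)
    (v w : Euc m) : |quad A v w| ≤ (m * m * c) * ‖v‖ * ‖w‖ := by
  have hv : ∀ (u : Euc m) i, |u i| ≤ ‖u‖ := fun u i => PiLp.norm_apply_le u i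
  unfold quad
  calc |∑ i, ∑ j, v i * A i j * w j| ≤ ∑ i, |∑ j, v i * A i j * w j| := Finset.abs_sum_le_sum_abs _ _
    _ ≤ ∑ i : Fin m, ∑ j : Fin m, ‖v‖ * c * ‖w‖ := by
      refine Finset.sum_le_sum fun i _ => (Finset.abs_sum_le_sum_abs _ _).trans
        (Finset.sum_le_sum fun j _ => ?_)
      rw [abs_mul, abs_mul]
      have hc : 0 ≤ c := (abs_nonneg _).trans (hA i j)
      exact mul_le_mul (mul_le_mul (hv v i) (hA i j) (abs_nonneg _) (norm_nonneg _)) (hv w j)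
        (abs_nonneg _) (by positivity)
    _ = _ := by simp; ring

theorem fderiv_eq_of_hasDerivAt_line {E F : Type*} [NormedAddCommGroup E] [NormedSpace ℝ E]
    [NormedAddCommGroup F] [NormedSpace ℝ F] {f : E → F} {y v : E} {z : F}
    (hf : DifferentiableAt ℝ f y) (h : HasDerivAt (fun t : ℝ => f (y + t • v)) z 0) :
    fderiv ℝ f y v = z := by
  rw [← hf.lineDeriv_eq_fderiv]; exact h.deriv

section MassBound

variable {n : ℕ} {M : Type*} [EMetricSpace M] [ChartedSpace (Euc (n + 1)) M]
  [IsManifold (𝓡 (n + 1)) ∞ M]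
  [RiemannianBundle (fun x : M => TangentSpace (𝓡 (n + 1)) x)]
  [IsContMDiffRiemannianBundle (𝓡 (n + 1)) ∞ (Euc (n + 1))
    (fun x : M => TangentSpace (𝓡 (n + 1)) x)]

theorem exists_metric_bounds {e : Chart n M}
    (he : e ∈ smoothAtlas n M) {y₀ : Euc (n + 1)} (hy : y₀ ∈ e.target) :
    ∃ L ≥ (1 : ℝ), ∀ ε > 0, ∀ᶠ y in 𝓝 y₀, y ∈ e.target ∧
      (∀ v, ‖chartVec e y v‖ ≤ L * ‖v‖) ∧ (∀ v, ‖v‖ ≤ L * ‖chartVec e y v‖) ∧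
      (∀ v w, |quad (metricCoord e y) v w - quad (metricCoord e y₀) v w| ≤ ε * ‖v‖ * ‖w‖) ∧
      ∀ x v w, |quad (dirMatrix (metricCoord e) y x) v w| ≤ L * ‖x‖ * ‖v‖ * ‖w‖ := by
  obtain ⟨L₁, hL₁, h1⟩ := exists_chartVec_bound he hy
  obtain ⟨L₂, hL₂, h2⟩ := exists_chartVec_lower_bound he hy
  set N : ℝ := ((n + 1 : ℕ) : ℝ) * ((n + 1 : ℕ) : ℝ) with hN
  have hNpos : 0 < N := by positivity
  set B : ℝ := ∑ i, ∑ j, (‖fderiv ℝ (fun x => metricCoord e x i j) y₀‖ + 1) with hB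
  have hB0 : ∀ i j, ‖fderiv ℝ (fun x => metricCoord e x i j) y₀‖ + 1 ≤ B := fun i j =>
    (Finset.single_le_sum (f := fun j => ‖fderiv ℝ (fun x => metricCoord e x i j) y₀‖ + 1)
      (fun _ _ => by positivity) (Finset.mem_univ j)).trans
      (Finset.single_le_sum (f := fun i => ∑ j, (‖fderiv ℝ (fun x => metricCoord e x i j) y₀‖ + 1))
      (fun _ _ => Finset.sum_nonneg fun _ _ => by positivity) (Finset.mem_univ i))
  have h3 : ∀ᶠ y in 𝓝 y₀, ∀ i j, ‖fderiv ℝ (fun x => metricCoord e x i j) y‖ ≤ B := by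
    refine Filter.eventually_all.2 fun i => Filter.eventually_all.2 fun j => ?_
    have hc := (((contDiffAt_metricCoord he hy i j).fderiv_right (m := 0)
      (by simp)).continuousAt.norm).eventually (gt_mem_nhds (lt_add_one _))
    filter_upwards [hc] with y hy using hy.le.trans (hB0 i j)
  have hBpos : 0 ≤ B := by
    refine Finset.sum_nonneg fun i _ => Finset.sum_nonneg fun j _ => by positivity
  refine ⟨L₁ + L₂ + N * B, by nlinarith [mul_nonneg hNpos.le hBpos], fun ε hε => ?_⟩
  have h4 : ∀ᶠ y in 𝓝 y₀, ∀ i j, |metricCoord e y i j - metricCoord e y₀ i j| ≤ ε / N := by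
    refine Filter.eventually_all.2 fun i => Filter.eventually_all.2 fun j => ?_
    have hc : ContinuousAt (fun y => |metricCoord e y i j - metricCoord e y₀ i j|) y₀ :=
      ((contDiffAt_metricCoord he hy i j).continuousAt.sub continuousAt_const).abs
    have hpos : |metricCoord e y₀ i j - metricCoord e y₀ i j| < ε / N := by
      rw [sub_self, abs_zero]; positivity
    filter_upwards [hc.eventually (gt_mem_nhds hpos)] with y hy using hy.le
  filter_upwards [h1, h2, h3, h4, e.open_target.mem_nhds hy] with y g1 g2 g3 g4 g5
  have hNB := mul_nonneg hNpos.le hBpos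
  refine ⟨g5, fun v => (g1 v).trans (mul_le_mul_of_nonneg_right (by linarith) (norm_nonneg _)),
    fun v => (g2 v).trans (mul_le_mul_of_nonneg_right (by linarith) (norm_nonneg _)),
    fun v w => ?_, fun x v w => ?_⟩
  · rw [← quad_sub_matrix]
    refine (abs_quad_le (c := ε / N) (fun i j => g4 i j) v w).trans (le_of_eq ?_)
    rw [mul_div_cancel₀ _ hNpos.ne']
  · refine (abs_quad_le (c := B * ‖x‖) (fun i j => ?_) v w).trans ?_
    · exact ((fderiv ℝ (fun x => metricCoord e x i j) y).le_opNorm x).trans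
        (mul_le_mul_of_nonneg_right (g3 i j) (norm_nonneg _))
    · rw [← hN, ← mul_assoc N B]
      gcongr
      linarith

/-- The radial test field. -/
def radialField (g₀ : Matrix (Fin (n + 1)) (Fin (n + 1)) ℝ) (χ : Euc (n + 1) → ℝ) (k : ℕ)
    (q : Euc (n + 1)) (σ : ℝ) (y : Euc (n + 1)) : Euc (n + 1) :=
  (χ y * (quad g₀ (y - q) (y - q) + σ ^ 2) ^ (-(k : ℝ) / 2)) • (y - q)

theorem contDiff_radialField {g₀ : Matrix (Fin (n + 1)) (Fin (n + 1)) ℝ}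
    (hpos : ∀ v, 0 ≤ quad g₀ v v) {χ : Euc (n + 1) → ℝ} (hχ : ContDiff ℝ ∞ χ) (k : ℕ)
    (q : Euc (n + 1)) {σ : ℝ} (hσ : 0 < σ) : ContDiff ℝ ∞ (radialField g₀ χ k q σ) := by
  refine contDiff_iff_contDiffAt.2 fun y => ?_
  have h1 : ContDiffAt ℝ ∞ (fun y : Euc (n + 1) => y - q) y := contDiffAt_id.sub contDiffAt_const
  have h2 : ContDiffAt ℝ ∞ (fun y => quad g₀ (y - q) (y - q) + σ ^ 2) y :=
    (ContDiffAt.quad (g := fun _ => g₀) (fun _ _ => contDiffAt_const) h1 h1).add contDiffAt_const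
  exact (hχ.contDiffAt.mul (h2.rpow_const_of_ne (by have := hpos (y - q); positivity))).smul h1

theorem fderiv_radialField {g₀ : Matrix (Fin (n + 1)) (Fin (n + 1)) ℝ}
    (hpos : ∀ v, 0 ≤ quad g₀ v v) (hsymm : ∀ i j, g₀ i j = g₀ j i)
    {χ : Euc (n + 1) → ℝ} (hχ : ContDiff ℝ ∞ χ) (k : ℕ)
    (q : Euc (n + 1)) {σ : ℝ} (hσ : 0 < σ) (y v : Euc (n + 1)) :
    fderiv ℝ (radialField g₀ χ k q σ) y v =
      (χ y * (quad g₀ (y - q) (y - q) + σ ^ 2) ^ (-(k : ℝ) / 2)) • v +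
      (fderiv ℝ χ y v * (quad g₀ (y - q) (y - q) + σ ^ 2) ^ (-(k : ℝ) / 2) -
        χ y * (k * (quad g₀ (y - q) (y - q) + σ ^ 2) ^ (-(k : ℝ) / 2) /
          (quad g₀ (y - q) (y - q) + σ ^ 2) * quad g₀ (y - q) v)) • (y - q) := by
  refine fderiv_eq_of_hasDerivAt_line
    ((contDiff_radialField hpos hχ k q hσ).differentiable (by simp) y) ?_
  have hQ : 0 < quad g₀ (y - q) (y - q) + σ ^ 2 := by have := hpos (y - q); positivity
  have hl : HasDerivAt (fun t : ℝ => y + t • v - q) v 0 := by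
    have : HasDerivAt (fun t : ℝ => t • v) ((1 : ℝ) • v) 0 := (hasDerivAt_id 0).smul_const v
    rw [one_smul] at this
    exact (this.const_add y).sub_const q
  have hl' : HasDerivAt (fun t : ℝ => y + t • v) v 0 := by
    simpa using hl.add_const q
  have h0 : y + (0 : ℝ) • v = y := by simp
  have hq := (HasDerivAt.quad (g := fun _ => g₀) (g' := 0) (t := 0)
    (fun i j => hasDerivAt_const _ _) hl hl).add_const (σ ^ 2)
  have hr := hq.rpow_const (p := -(k : ℝ) / 2) (Or.inl (by simp only [h0]; exact hQ.ne'))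
  have hχ' : HasDerivAt (fun t : ℝ => χ (y + t • v)) (fderiv ℝ χ y v) 0 := by
    have := ((hχ.differentiable (by simp)) y).hasFDerivAt
    rw [← h0] at this
    have h2 := this.comp_hasDerivAt (0 : ℝ) hl'
    rwa [h0] at h2
  refine ((hχ'.mul hr).smul hl).congr_deriv ?_
  simp only [h0, Pi.mul_apply]
  congr 2
  have e1 : quad (0 : Matrix (Fin (n + 1)) (Fin (n + 1)) ℝ) (y - q) (y - q) = 0 := by simp [quad]
  rw [e1, quad_symm hsymm v (y - q), Real.rpow_sub_one hQ.ne']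
  field_simp
  ring

theorem IsFrame.orthonormal {e : Chart n M} {ξ : Gr n M}
    {β : Fin n → Euc (n + 1)} (h : IsFrame e ξ β) :
    Orthonormal ℝ (fun i => chartVec e (e ξ.1) (β i)) := by
  have := h.gram
  rw [frameGram_eq_gram] at this
  rw [orthonormal_iff_ite]
  intro i j
  have h2 := congrFun (congrFun this i) j
  rw [Matrix.gram_apply, Matrix.one_apply] at h2
  exact h2

/-- The divergence of the radial test field along a plane. -/
theorem frameDiv_radialField_ge {e : Chart n M}
    {y₀ y q : Euc (n + 1)} {L ε r σ B : ℝ} (hL : 1 ≤ L) (hε : 0 ≤ ε) (hr : 0 < r) (hσ : 0 < σ)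
    {k : ℕ} (hk : k + 3 ≤ n) (hεk : (k : ℝ) * (ε * (1 + n * L ^ 2) * L ^ 2) ≤ 1)
    (hrL : (n : ℝ) * L ^ 3 * (4 * r) ≤ 1) (hmat : ∀ v w, |quad (metricCoord e y) v w -
      quad (metricCoord e y₀) v w| ≤ ε * ‖v‖ * ‖w‖)
    (hup : ∀ v, ‖chartVec e y v‖ ≤ L * ‖v‖) (hlo : ∀ v, ‖v‖ ≤ L * ‖chartVec e y v‖)
    (hlo₀ : ∀ v, ‖v‖ ≤ L * ‖chartVec e y₀ v‖)
    (hdir : ∀ x v w, |quad (dirMatrix (metricCoord e) y x) v w| ≤ L * ‖x‖ * ‖v‖ * ‖w‖)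
    {χ : Euc (n + 1) → ℝ} (hχ : ContDiff ℝ ∞ χ) (hχ0 : 0 ≤ χ y) (hχB : ‖fderiv ℝ χ y‖ ≤ B)
    (hχr : ‖y - y₀‖ < 2 * r → fderiv ℝ χ y = 0) (hq : ‖q - y₀‖ < r) (hy : ‖y - y₀‖ ≤ 3 * r)
    {β : Fin n → Euc (n + 1)} (hβ : Orthonormal ℝ (fun i => chartVec e y (β i))) :
    χ y * (quad (metricCoord e y₀) (y - q) (y - q) + σ ^ 2) ^ (-(k : ℝ) / 2) -
      (n * (B * L) * (L * (4 * r)) * (r ^ 2 / L ^ 2) ^ (-(k : ℝ) / 2)) ≤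
    frameDiv (metricCoord e) (radialField (metricCoord e y₀) χ k q σ) y β := by
  set g₀ := metricCoord e y₀ with hg₀
  have hpos : ∀ v, 0 ≤ quad g₀ v v := fun v => by
    rw [hg₀, ← inner_chartVec]; exact real_inner_self_nonneg
  have hsymm : ∀ i j, g₀ i j = g₀ j i := metricCoord_symm e y₀
  set w := y - q with hw
  set ρ := quad g₀ w w with hρ
  set Q := ρ + σ ^ 2 with hQ
  have hρ0 : 0 ≤ ρ := hpos w
  have hQpos : 0 < Q := by positivity
  set h := Q ^ (-(k : ℝ) / 2) with hh
  have hhpos : 0 < h := Real.rpow_pos_of_pos hQpos _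
  have hL0 : 0 < L := by linarith
  have hβn : ∀ i, ‖β i‖ ≤ L := fun i => (hlo _).trans (by rw [hβ.1 i, mul_one])
  have hwn : ‖w‖ ≤ 4 * r := by
    have : w = (y - y₀) - (q - y₀) := by rw [hw]; abel
    rw [this]; refine (norm_sub_le _ _).trans (by linarith)
  have hwρ : ‖w‖ ^ 2 ≤ L ^ 2 * ρ := by
    have h1 := hlo₀ w
    have h2 : ‖chartVec e y₀ w‖ ^ 2 = ρ := by
      rw [← real_inner_self_eq_norm_sq, inner_chartVec]
    calc ‖w‖ ^ 2 ≤ (L * ‖chartVec e y₀ w‖) ^ 2 := pow_le_pow_left₀ (norm_nonneg _) h1 2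
      _ = L ^ 2 * ρ := by rw [mul_pow, h2]
  set a : Fin n → ℝ := fun i => quad (metricCoord e y) w (β i) with ha
  set b : Fin n → ℝ := fun i => quad g₀ w (β i) with hb
  have ha_eq : ∀ i, a i = inner ℝ (chartVec e y (β i)) (chartVec e y w) := fun i => by
    rw [real_inner_comm, inner_chartVec]
  have ha_le : ∀ i, |a i| ≤ L * ‖w‖ := fun i => by
    rw [ha_eq]
    refine (abs_real_inner_le_norm _ _).trans ?_
    rw [hβ.1 i, one_mul]; exact hup w
  have hab : ∀ i, |a i - b i| ≤ ε * ‖w‖ * L := fun i => (hmat w (β i)).trans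
    (mul_le_mul_of_nonneg_left (hβn i) (by positivity))
  have hsum_a : ∑ i, a i ^ 2 ≤ ρ + ε * ‖w‖ ^ 2 := by
    have h1 := hβ.sum_inner_products_le (chartVec e y w) (s := Finset.univ)
    simp only [Real.norm_eq_abs, sq_abs, ← ha_eq] at h1
    rw [← real_inner_self_eq_norm_sq, inner_chartVec] at h1
    have h2 := (abs_le.1 (hmat w w)).2
    refine h1.trans ?_
    rw [sq, ← mul_assoc]; linarith
  have hsum_ab : ∑ i, b i * a i ≤ Q * (1 + ε * (1 + n * L ^ 2) * L ^ 2) := by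
    have h1 : ∀ i, b i * a i ≤ a i ^ 2 + L * ‖w‖ * (ε * ‖w‖ * L) := fun i => by
      have h2 : b i * a i = a i ^ 2 - a i * (a i - b i) := by ring
      have h3 : -(a i * (a i - b i)) ≤ L * ‖w‖ * (ε * ‖w‖ * L) := by
        refine (neg_le_abs _).trans ?_
        rw [abs_mul]; exact mul_le_mul (ha_le i) (hab i) (abs_nonneg _) (by positivity)
      linarith
    calc ∑ i, b i * a i ≤ ∑ i, (a i ^ 2 + L * ‖w‖ * (ε * ‖w‖ * L)) :=
          Finset.sum_le_sum fun i _ => h1 i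
      _ = ∑ i, a i ^ 2 + n * (L * ‖w‖ * (ε * ‖w‖ * L)) := by
          rw [Finset.sum_add_distrib]; simp
      _ ≤ (ρ + ε * ‖w‖ ^ 2) + n * (L * ‖w‖ * (ε * ‖w‖ * L)) := by linarith
      _ = ρ + ε * (1 + n * L ^ 2) * ‖w‖ ^ 2 := by ring
      _ ≤ ρ + ε * (1 + n * L ^ 2) * (L ^ 2 * ρ) := by gcongr
      _ ≤ Q + ε * (1 + n * L ^ 2) * (L ^ 2 * Q) := by
          have : ρ ≤ Q := by rw [hQ]; nlinarith
          gcongr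
      _ = _ := by ring
  have hterm : ∀ i, quad (metricCoord e y) (fderiv ℝ (radialField g₀ χ k q σ) y (β i)) (β i) =
      χ y * h + fderiv ℝ χ y (β i) * h * a i - χ y * h * k / Q * (b i * a i) := fun i => by
    have hii : quad (metricCoord e y) (β i) (β i) = 1 := by
      rw [← inner_chartVec, real_inner_self_eq_norm_sq, hβ.1 i]; norm_num
    rw [fderiv_radialField hpos hsymm hχ k q hσ, quad_add_left, quad_smul_left, quad_smul_left, hii]
    change χ y * h * 1 + (fderiv ℝ χ y (β i) * h - χ y * (k * h / Q * b i)) * a i = _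
    ring
  have hdirterm : ∀ i, -(χ y * h * (L ^ 3 * (4 * r))) ≤
      quad (dirMatrix (metricCoord e) y (radialField g₀ χ k q σ y)) (β i) (β i) := fun i => by
    have h1 := hdir (radialField g₀ χ k q σ y) (β i) (β i)
    have h2 : ‖radialField g₀ χ k q σ y‖ ≤ χ y * h * (4 * r) := by
      rw [radialField, norm_smul, Real.norm_eq_abs, abs_of_nonneg (mul_nonneg hχ0 hhpos.le)]
      exact mul_le_mul_of_nonneg_left hwn (mul_nonneg hχ0 hhpos.le)
    have h3 : L * ‖radialField g₀ χ k q σ y‖ * ‖β i‖ * ‖β i‖ ≤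
        L * (χ y * h * (4 * r)) * L * L := by
      have := hβn i
      have hh0 := mul_nonneg hχ0 hhpos.le
      gcongr
    have h4 := (abs_le.1 (h1.trans h3)).1
    refine le_trans (le_of_eq ?_) h4
    ring
  have hcut : -(n * (B * L) * (L * (4 * r)) * (r ^ 2 / L ^ 2) ^ (-(k : ℝ) / 2)) ≤
      ∑ i, fderiv ℝ χ y (β i) * h * a i := by
    have hB0 : 0 ≤ B := (norm_nonneg _).trans hχB
    by_cases hin : ‖y - y₀‖ < 2 * r
    · rw [hχr hin]
      simp only [zero_apply, zero_mul, Finset.sum_const_zero]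
      have : 0 ≤ (r ^ 2 / L ^ 2) ^ (-(k : ℝ) / 2) := Real.rpow_nonneg (by positivity) _
      have : 0 ≤ n * (B * L) * (L * (4 * r)) * (r ^ 2 / L ^ 2) ^ (-(k : ℝ) / 2) := by positivity
      linarith
    · have hwr : r ≤ ‖w‖ := by
        have h1 : y - y₀ = w + (q - y₀) := by rw [hw]; abel
        have h2 := norm_add_le w (q - y₀)
        rw [← h1] at h2
        linarith
      have hQr : r ^ 2 / L ^ 2 ≤ Q := by
        rw [div_le_iff₀ (by positivity)]
        have : r ^ 2 ≤ ‖w‖ ^ 2 := pow_le_pow_left₀ hr.le hwr 2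
        have h3 : 0 ≤ σ ^ 2 * L ^ 2 := by positivity
        rw [hQ]; nlinarith
      have hhr : h ≤ (r ^ 2 / L ^ 2) ^ (-(k : ℝ) / 2) :=
        Real.rpow_le_rpow_of_nonpos (by positivity) hQr (by
          have : (0 : ℝ) ≤ k := Nat.cast_nonneg k
          linarith)
      have h1 : ∀ i, |fderiv ℝ χ y (β i) * h * a i| ≤
          B * L * (r ^ 2 / L ^ 2) ^ (-(k : ℝ) / 2) * (L * (4 * r)) := fun i => by
        rw [abs_mul, abs_mul, abs_of_pos hhpos]
        have h2 : |fderiv ℝ χ y (β i)| ≤ B * L := ((fderiv ℝ χ y).le_opNorm (β i)).trans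
          (mul_le_mul hχB (hβn i) (norm_nonneg _) hB0)
        have h3 : |a i| ≤ L * (4 * r) := (ha_le i).trans (mul_le_mul_of_nonneg_left hwn hL0.le)
        exact mul_le_mul (mul_le_mul h2 hhr hhpos.le (by positivity)) h3 (abs_nonneg _)
          (mul_nonneg (by positivity) (Real.rpow_nonneg (by positivity) _))
      have h2 := (Finset.abs_sum_le_sum_abs (fun i => fderiv ℝ χ y (β i) * h * a i)
        Finset.univ).trans (Finset.sum_le_sum fun i _ => h1 i)
      rw [Finset.sum_const, Finset.card_univ, Fintype.card_fin, nsmul_eq_mul] at h2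
      have h3 := (abs_le.1 h2).1
      refine le_trans (le_of_eq ?_) h3
      ring
  have hmain : χ y * h * k / Q * ∑ i, b i * a i ≤ χ y * h * (k + 1) := by
    have hc : 0 ≤ χ y * h * k / Q := by
      have := mul_nonneg hχ0 hhpos.le
      positivity
    calc χ y * h * k / Q * ∑ i, b i * a i
        ≤ χ y * h * k / Q * (Q * (1 + ε * (1 + n * L ^ 2) * L ^ 2)) :=
          mul_le_mul_of_nonneg_left hsum_ab hc
      _ = χ y * h * (k + k * (ε * (1 + n * L ^ 2) * L ^ 2)) := by field_simp
      _ ≤ _ := mul_le_mul_of_nonneg_left (by linarith) (mul_nonneg hχ0 hhpos.le)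
  have hdirsum : -(χ y * h) ≤
      ∑ i, quad (dirMatrix (metricCoord e) y (radialField g₀ χ k q σ y)) (β i) (β i) := by
    have h1 := Finset.sum_le_sum fun i (_ : i ∈ (Finset.univ : Finset (Fin n))) => hdirterm i
    rw [Finset.sum_const, Finset.card_univ, Fintype.card_fin, nsmul_eq_mul] at h1
    refine le_trans ?_ h1
    have h2 : χ y * h * (n * L ^ 3 * (4 * r)) ≤ χ y * h * 1 :=
      mul_le_mul_of_nonneg_left hrL (mul_nonneg hχ0 hhpos.le)
    linarith
  have hexp : frameDiv (metricCoord e) (radialField g₀ χ k q σ) y β =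
      n * (χ y * h) + ∑ i, fderiv ℝ χ y (β i) * h * a i - χ y * h * k / Q * ∑ i, b i * a i +
        1 / 2 * ∑ i, quad (dirMatrix (metricCoord e) y (radialField g₀ χ k q σ y)) (β i) (β i) := by
    simp only [frameDiv, hterm, Finset.sum_add_distrib, Finset.sum_sub_distrib, Finset.mul_sum,
      Finset.sum_const, Finset.card_univ, Fintype.card_fin, nsmul_eq_mul]
  rw [hexp]
  have hkn : (k : ℝ) + 3 ≤ n := by exact_mod_cast hk
  have hp := mul_nonneg hχ0 hhpos.le
  nlinarith [mul_le_mul_of_nonneg_right hkn hp]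

end MassBound

section MassBound

variable {n : ℕ} {M : Type*} [EMetricSpace M] [ChartedSpace (Euc (n + 1)) M]
  [IsManifold (𝓡 (n + 1)) ∞ M]
  [RiemannianBundle (fun x : M => TangentSpace (𝓡 (n + 1)) x)]
  [IsContMDiffRiemannianBundle (𝓡 (n + 1)) ∞ (Euc (n + 1))
    (fun x : M => TangentSpace (𝓡 (n + 1)) x)]

theorem isOpen_gr_preimage {s : Set M} (hs : IsOpen s) : IsOpen {ξ : Gr n M | ξ.1 ∈ s} :=
  hs.preimage Gr.continuous_fst

/-- A power bound for the mass of a stationary varifold in small balls. -/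
theorem Varifold.IsStationary.exists_mass_bound [CompactSpace M] {V : Varifold n M}
    (hV : V.IsStationary) {e : Chart n M}
    (he : e ∈ smoothAtlas n M) {y₀ : Euc (n + 1)} (hy₀ : y₀ ∈ e.target)
    {k : ℕ} (hk : k + 3 ≤ n) : ∃ r > 0, ∃ C : ℝ, 0 ≤ C ∧ ∀ q, ‖q - y₀‖ < r → ∀ σ, 0 < σ → σ ≤ r →
      (V : Measure (Gr n M)).real {ξ | ξ.1 ∈ e.source ∧ ‖e ξ.1 - q‖ < σ} ≤ C * σ ^ k := by
  obtain ⟨L, hL, hbd⟩ := exists_metric_bounds he hy₀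
  have hL0 : 0 < L := by linarith
  set ε : ℝ := 1 / ((k + 1) * (1 + n * L ^ 2) * L ^ 2) with hεdef
  have hε : 0 < ε := by positivity
  obtain ⟨R, hR, hball⟩ := Metric.eventually_nhds_iff_ball.1 (hbd ε hε)
  set r : ℝ := min (R / 4) (1 / (4 * (n + 1) * L ^ 3)) with hrdef
  have hr : 0 < r := lt_min (by positivity) (by positivity)
  have hrR : 3 * r < R := by
    have := min_le_left (R / 4) (1 / (4 * (n + 1) * L ^ 3)); linarith
  have hrL : (n : ℝ) * L ^ 3 * (4 * r) ≤ 1 := by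
    have h1 : r ≤ 1 / (4 * (n + 1) * L ^ 3) := min_le_right _ _
    calc (n : ℝ) * L ^ 3 * (4 * r) ≤ (n + 1) * L ^ 3 * (4 * (1 / (4 * (n + 1) * L ^ 3))) := by
          gcongr; linarith
      _ = 1 := by field_simp
  have hεk : (k : ℝ) * (ε * (1 + n * L ^ 2) * L ^ 2) ≤ 1 := by
    calc (k : ℝ) * (ε * (1 + n * L ^ 2) * L ^ 2) ≤ (k + 1) * (ε * (1 + n * L ^ 2) * L ^ 2) := by
          gcongr; linarith
      _ = 1 := by rw [hεdef]; field_simp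
  let χ : ContDiffBump y₀ := ⟨2 * r, 3 * r, by positivity, by linarith⟩
  have hχ : ContDiff ℝ ∞ χ := χ.contDiff
  obtain ⟨B, hB⟩ := (hχ.continuous_fderiv (by simp)).bounded_above_of_compact_support
    (χ.hasCompactSupport.fderiv ℝ)
  have hB0 : 0 ≤ B := (norm_nonneg _).trans (hB 0)
  have hχr : ∀ y, ‖y - y₀‖ < 2 * r → fderiv ℝ χ y = 0 := fun y hy => by
    have h1 : (χ : Euc (n + 1) → ℝ) =ᶠ[𝓝 y] fun _ => 1 :=
      χ.eventuallyEq_one_of_mem_ball (by rw [mem_ball_iff_norm]; exact hy)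
    rw [h1.fderiv_eq, fderiv_fun_const]; rfl
  set g₀ := metricCoord e y₀ with hg₀
  have hpos : ∀ v, 0 ≤ quad g₀ v v := fun v => by
    rw [hg₀, ← inner_chartVec]; exact real_inner_self_nonneg
  set K : ℝ := n * (B * L) * (L * (4 * r)) * (r ^ 2 / L ^ 2) ^ (-(k : ℝ) / 2) with hK
  have hK0 : 0 ≤ K := by
    have : 0 ≤ (r ^ 2 / L ^ 2) ^ (-(k : ℝ) / 2) := Real.rpow_nonneg (by positivity) _
    positivity
  set m := (V : Measure (Gr n M)).real univ with hm
  refine ⟨r, hr, K * m * (L ^ 2 + 1) ^ ((k : ℝ) / 2), by positivity, fun q hq σ hσ hσr => ?_⟩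
  set Y := radialField g₀ χ k q σ with hYdef
  have hY : ContDiff ℝ ∞ Y := contDiff_radialField hpos hχ k q hσ
  have hsupp : tsupport Y ⊆ Metric.closedBall y₀ (3 * r) := by
    have h1 : tsupport Y ⊆ tsupport χ := closure_mono fun y hy => by
      rw [Function.mem_support] at hy ⊢
      intro h0; apply hy; simp [hYdef, radialField, h0]
    rw [χ.tsupport_eq] at h1; exact h1
  have hballt : ∀ y ∈ Metric.closedBall y₀ (3 * r), y ∈ Metric.ball y₀ R := fun y hy =>
    (mem_closedBall_iff_norm.1 hy).trans_lt hrR |> mem_ball_iff_norm.2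
  have hYc : HasCompactSupport Y :=
    (isCompact_closedBall y₀ (3 * r)).of_isClosed_subset (isClosed_tsupport _) hsupp
  obtain ⟨D, hDm, hDi, hD0, hDe, hDz⟩ := hV.exists_integral_frameDiv he hY hYc
    (fun y hy => (hball y (hballt y (hsupp hy))).1)
  set A : Set (Gr n M) := {ξ | ξ.1 ∈ e.source ∧ ‖e ξ.1 - q‖ < σ} with hA
  have hAo : IsOpen A := by
    have h1 := e.isOpen_inter_preimage (Metric.isOpen_ball (x := q) (ε := σ))
    convert isOpen_gr_preimage (n := n) h1 using 1
    ext ξ; simp [hA, mem_ball_iff_norm, dist_eq_norm]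
  set c : ℝ := ((L ^ 2 + 1) * σ ^ 2) ^ (-(k : ℝ) / 2) with hc
  have hcpos : 0 < c := Real.rpow_pos_of_pos (by positivity) _
  have hlow : ∀ ξ : Gr n M, A.indicator (fun _ => c) ξ - K ≤ D ξ := by
    intro ξ
    by_cases hin : ξ.1 ∈ e.source ∧ e ξ.1 ∈ Metric.closedBall y₀ (3 * r)
    · obtain ⟨hs, hcb⟩ := hin
      obtain ⟨β, hβ⟩ := exists_isFrame he hs
      obtain ⟨b1, b2, b3, b4, b5⟩ := hball _ (hballt _ hcb)
      have h0 := (hball y₀ (Metric.mem_ball_self hR)).2.2.1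
      rw [hDe ξ hs β hβ]
      refine le_trans ?_ (frameDiv_radialField_ge hL hε.le hr hσ hk hεk hrL b4 b2 b3 h0 b5 hχ
        χ.nonneg (hB _) (hχr _) hq (mem_closedBall_iff_norm.1 hcb) hβ.orthonormal)
      refine sub_le_sub_right ?_ K
      set y := e ξ.1
      have hQ0 := hpos (y - q)
      have hp0 : 0 ≤ (quad g₀ (y - q) (y - q) + σ ^ 2) ^ (-(k : ℝ) / 2) :=
        Real.rpow_nonneg (by positivity) _
      by_cases hξA : ξ ∈ A
      · rw [indicator_of_mem hξA]
        have hyq : ‖y - q‖ < σ := hξA.2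
        have hχ1 : χ y = 1 := χ.one_of_mem_closedBall (by
          rw [mem_closedBall_iff_norm]
          have : y - y₀ = (y - q) + (q - y₀) := by abel
          rw [this]
          exact (norm_add_le _ _).trans (by change _ ≤ 2 * r; linarith))
        rw [hχ1, one_mul]
        refine Real.rpow_le_rpow_of_nonpos (by positivity) ?_ (by
          have : (0 : ℝ) ≤ k := Nat.cast_nonneg k
          linarith)
        have h2 : quad g₀ (y - q) (y - q) ≤ L ^ 2 * σ ^ 2 := by
          rw [hg₀, ← inner_chartVec, real_inner_self_eq_norm_sq, ← mul_pow]
          refine pow_le_pow_left₀ (norm_nonneg _) ?_ 2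
          exact ((hball y₀ (Metric.mem_ball_self hR)).2.1 _).trans
            (mul_le_mul_of_nonneg_left hyq.le hL0.le)
        linarith
      · rw [indicator_of_notMem hξA]
        exact mul_nonneg χ.nonneg hp0
    · have hξA : ξ ∉ A := fun h => hin ⟨h.1, by
        rw [mem_closedBall_iff_norm]
        have : e ξ.1 - y₀ = (e ξ.1 - q) + (q - y₀) := by abel
        rw [this]
        exact (norm_add_le _ _).trans (by linarith [h.2])⟩
      rw [indicator_of_notMem hξA, hDz]
      · linarith
      · rintro ⟨y, hy, hyξ⟩
        have hyt := (hball y (hballt y (hsupp hy))).1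
        refine hin ⟨hyξ ▸ e.map_target hyt, ?_⟩
        rw [← hyξ, e.right_inv hyt]; exact hsupp hy
  have hint : Integrable (fun ξ => A.indicator (fun _ => c) ξ - K) (V : Measure (Gr n M)) :=
    ((integrable_const c).indicator hAo.measurableSet).sub (integrable_const K)
  have h1 := integral_mono hint hDi hlow
  rw [hD0, integral_sub ((integrable_const c).indicator hAo.measurableSet) (integrable_const K),
    integral_indicator hAo.measurableSet, setIntegral_const, integral_const, smul_eq_mul,
    smul_eq_mul, ← hm] at h1
  have h2 : (V : Measure (Gr n M)).real A ≤ K * m * c⁻¹ := by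
    rw [← div_eq_mul_inv, le_div_iff₀ hcpos]; linarith
  refine h2.trans (le_of_eq ?_)
  have h3 : c⁻¹ = ((L ^ 2 + 1) * σ ^ 2) ^ ((k : ℝ) / 2) := by
    rw [hc, neg_div, Real.rpow_neg (by positivity), inv_inv]
  have h4 : (σ ^ 2) ^ ((k : ℝ) / 2) = σ ^ k := by
    rw [← Real.rpow_natCast σ 2, ← Real.rpow_mul hσ.le, ← Real.rpow_natCast σ k]
    congr 1; push_cast; ring
  rw [h3, Real.mul_rpow (by positivity) (by positivity), h4]; ring

/-- A function with bounded differential is Lipschitz. -/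
theorem edist_le_of_dfun_le [IsRiemannianManifold (𝓡 (n + 1)) M] {f : M → ℝ}
    (hf : ContMDiff (𝓡 (n + 1)) 𝓘(ℝ, ℝ) ∞ f) {l : NNReal} (hl0 : 0 < l)
    (hl : ∀ p, ∀ v : TangentSpace (𝓡 (n + 1)) p, |dfun f p v| ≤ l * ‖v‖) (p q : M) :
    edist (f p) (f q) ≤ l * edist p q := by
  refine le_of_forall_gt fun c hc => ?_
  have hl' : (l : ℝ≥0∞) ≠ 0 := by simpa using hl0.ne'
  have h1 : edist q p < c / l := by
    rw [ENNReal.lt_div_iff_mul_lt (Or.inl hl') (Or.inl ENNReal.coe_ne_top), mul_comm, edist_comm]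
    exact hc
  rw [IsRiemannianManifold.out (I := 𝓡 (n + 1)) q p] at h1
  obtain ⟨γ, h0, h1, hγ, hlen⟩ := exists_lt_of_riemannianEDist_lt h1
  have hd : ContMDiffOn 𝓘(ℝ, ℝ) 𝓘(ℝ, ℝ) 1 (f ∘ γ) (Icc 0 1) :=
    (hf.of_le (by simp)).comp_contMDiffOn hγ
  have key (p : M) (v : TangentSpace (𝓡 (n + 1)) p) : ‖dfun f p v‖ₑ ≤ l * ‖v‖ₑ := by
    rw [← ofReal_norm, ← ofReal_norm, ← ENNReal.ofReal_coe_nnreal, ← ENNReal.ofReal_mul l.coe_nonneg]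
    exact ENNReal.ofReal_le_ofReal (hl p v)
  rw [edist_eq_enorm_sub, ← h0, ← h1]
  calc ‖(f ∘ γ) 1 - (f ∘ γ) 0‖ₑ
      ≤ ∫⁻ t in Icc (0 : ℝ) 1, ‖derivWithin (f ∘ γ) (Icc 0 1) t‖ₑ :=
        enorm_sub_le_lintegral_derivWithin_Icc_of_contDiffOn_Icc
          (contMDiffOn_iff_contDiffOn.1 hd) zero_le_one
    _ ≤ ∫⁻ t in Icc (0 : ℝ) 1, l * ‖mfderivWithin 𝓘(ℝ, ℝ) (𝓡 (n + 1)) γ (Icc 0 1) t 1‖ₑ := by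
      refine setLIntegral_mono' measurableSet_Icc fun t ht => ?_
      have h2 : mfderivWithin 𝓘(ℝ, ℝ) 𝓘(ℝ, ℝ) (f ∘ γ) (Icc 0 1) t =
          (mfderiv (𝓡 (n + 1)) 𝓘(ℝ, ℝ) f (γ t)) ∘L (mfderivWithin 𝓘(ℝ, ℝ) (𝓡 (n + 1)) γ (Icc 0 1) t) := by
        apply mfderiv_comp_mfderivWithin
        · exact hf.mdifferentiable (by simp) _
        · exact hγ.mdifferentiableOn one_ne_zero _ ht
        · rw [uniqueMDiffWithinAt_iff_uniqueDiffWithinAt]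
          exact uniqueDiffOn_Icc zero_lt_one _ ht
      have h3 : derivWithin (f ∘ γ) (Icc 0 1) t =
          dfun f (γ t) (mfderivWithin 𝓘(ℝ, ℝ) (𝓡 (n + 1)) γ (Icc 0 1) t 1) := by
        rw [← fderivWithin_derivWithin, ← mfderivWithin_eq_fderivWithin]
        exact congr($h2 1)
      rw [h3]
      exact key _ _
    _ = l * pathELength (𝓡 (n + 1)) γ 0 1 := by
      rw [lintegral_const_mul' _ _ ENNReal.coe_ne_top, pathELength_eq_lintegral_mfderivWithin_Icc]
    _ < l * (c / l) := by
      gcongr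
      exact ENNReal.coe_ne_top
    _ = c := ENNReal.mul_div_cancel hl' ENNReal.coe_ne_top

end MassBound

section ChartExtend

variable {n : ℕ} {M : Type*} [EMetricSpace M] [ChartedSpace (Euc (n + 1)) M]

/-- A function in the coordinates of a chart, extended by zero. -/
def chartExtend (e : Chart n M) (ψ : Euc (n + 1) → ℝ) (p : M) : ℝ :=
  e.source.indicator (fun p => ψ (e p)) p

variable {e : Chart n M} {ψ : Euc (n + 1) → ℝ}

theorem chartExtend_of_mem {p : M} (hp : p ∈ e.source) : chartExtend e ψ p = ψ (e p) :=
  indicator_of_mem hp _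

theorem chartExtend_symm {y : Euc (n + 1)} (hy : y ∈ e.target) :
    chartExtend e ψ (e.symm y) = ψ y := by
  rw [chartExtend_of_mem (e.map_target hy), e.right_inv hy]

theorem chartExtend_comp_symm {y : Euc (n + 1)} (hy : y ∈ e.target) :
    chartExtend e ψ ∘ e.symm =ᶠ[𝓝 y] ψ := by
  filter_upwards [e.open_target.mem_nhds hy] with x hx using chartExtend_symm hx

theorem chartExtend_ne_zero {p : M} (h : chartExtend e ψ p ≠ 0) :
    p ∈ e.source ∧ ψ (e p) ≠ 0 := by
  have hp : p ∈ e.source := by_contra fun hp => h (indicator_of_notMem hp _)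
  rw [chartExtend_of_mem hp] at h
  exact ⟨hp, h⟩

theorem isClosed_symm_image_tsupport (hc : HasCompactSupport ψ) (ht : tsupport ψ ⊆ e.target) :
    IsClosed (e.symm '' tsupport ψ) :=
  (hc.image_of_continuousOn (e.continuousOn_symm.mono ht)).isClosed

theorem chartExtend_eventuallyEq_zero (hc : HasCompactSupport ψ) (ht : tsupport ψ ⊆ e.target)
    {p : M} (hp : p ∉ e.symm '' tsupport ψ) : chartExtend e ψ =ᶠ[𝓝 p] fun _ => 0 := by
  filter_upwards [(isClosed_symm_image_tsupport hc ht).isOpen_compl.mem_nhds hp] with q hq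
  by_contra h
  obtain ⟨h1, h2⟩ := chartExtend_ne_zero h
  exact hq ⟨e q, subset_tsupport _ h2, e.left_inv h1⟩

theorem contMDiff_chartExtend [IsManifold (𝓡 (n + 1)) ∞ M]
    (he : e ∈ smoothAtlas n M) (hψ : ContDiff ℝ ∞ ψ)
    (hc : HasCompactSupport ψ) (ht : tsupport ψ ⊆ e.target) :
    ContMDiff (𝓡 (n + 1)) 𝓘(ℝ, ℝ) ∞ (chartExtend e ψ) := by
  intro p
  by_cases hp : p ∈ e.source
  · have h1 : ContMDiffAt (𝓡 (n + 1)) 𝓘(ℝ, ℝ) ∞ (fun q => ψ (e q)) p :=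
      ContMDiffAt.comp (f := e) p hψ.contDiffAt.contMDiffAt
        ((contMDiffOn_of_mem_maximalAtlas he).contMDiffAt (e.open_source.mem_nhds hp))
    refine h1.congr_of_eventuallyEq ?_
    filter_upwards [e.open_source.mem_nhds hp] with q hq using chartExtend_of_mem hq
  · refine (contMDiffAt_const (c := (0 : ℝ))).congr_of_eventuallyEq
      (chartExtend_eventuallyEq_zero hc ht ?_)
    rintro ⟨y, hy, rfl⟩
    exact hp (e.map_target (ht hy))

end ChartExtend

section Cutoff

variable {n : ℕ} {M : Type*} [EMetricSpace M] [ChartedSpace (Euc (n + 1)) M]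
  [IsManifold (𝓡 (n + 1)) ∞ M]
  [RiemannianBundle (fun x : M => TangentSpace (𝓡 (n + 1)) x)]
  [IsContMDiffRiemannianBundle (𝓡 (n + 1)) ∞ (Euc (n + 1))
    (fun x : M => TangentSpace (𝓡 (n + 1)) x)]

/-- Charts are locally Lipschitz. -/
theorem exists_chart_lipschitz [CompactSpace M] [IsRiemannianManifold (𝓡 (n + 1)) M]
    {e : Chart n M}
    (he : e ∈ smoothAtlas n M) {p₀ : M} (hp₀ : p₀ ∈ e.source) :
    ∃ L : ℝ, 1 ≤ L ∧ ∃ U ∈ 𝓝 p₀, U ⊆ e.source ∧ ∀ p ∈ U, ∀ q ∈ U, ∀ σ : ℝ, 0 ≤ σ →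
      edist p q ≤ ENNReal.ofReal σ → ‖e p - e q‖ ≤ L * σ := by
  obtain ⟨R, hR, hRt⟩ := Metric.nhds_basis_closedBall.mem_iff.1
    (e.open_target.mem_nhds (e.map_source hp₀))
  let χ : ContDiffBump (e p₀) := ⟨R / 2, R, by positivity, by linarith⟩
  let f : Fin (n + 1) → M → ℝ := fun i => chartExtend e (fun y => χ y * y i)
  have hf : ∀ i, ContMDiff (𝓡 (n + 1)) 𝓘(ℝ, ℝ) ∞ (f i) := fun i => by
    have hts : tsupport (fun y => χ y * y i) ⊆ tsupport χ := tsupport_mul_subset_left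
    have hc : HasCompactSupport (fun y => χ y * y i) := χ.hasCompactSupport.mul_right
    refine contMDiff_chartExtend he (χ.contDiff.mul (by fun_prop)) hc ?_
    exact hts.trans (χ.tsupport_eq.trans_subset hRt)
  choose l hl hlb using fun i => exists_jetBound (hf i)
  have hlip : ∀ i p q, edist (f i p) (f i q) ≤ (l i).toNNReal * edist p q := fun i p q =>
    edist_le_of_dfun_le (hf i) (Real.toNNReal_pos.2 (hl i)) (fun p v => by
      rw [Real.coe_toNNReal _ (hl i).le]; exact (hlb i p).2 v) p q
  have hone : ∀ᶠ p in 𝓝 p₀, ∀ i, f i p = e p i := by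
    have h1 := (e.continuousAt hp₀).preimage_mem_nhds
      (Metric.ball_mem_nhds (e p₀) (half_pos hR))
    filter_upwards [h1, e.open_source.mem_nhds hp₀] with p hp hps i
    have : χ (e p) = 1 := χ.one_of_mem_closedBall (Metric.ball_subset_closedBall hp)
    simp only [f]
    rw [chartExtend_of_mem hps, this, one_mul]
  refine ⟨1 + ∑ i, l i, by
    have := Finset.sum_nonneg fun i (_ : i ∈ Finset.univ) => (hl i).le
    linarith, _, inter_mem (e.open_source.mem_nhds hp₀) hone, inter_subset_left, ?_⟩
  rintro p ⟨-, hp⟩ q ⟨-, hq⟩ σ hσ hd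
  rw [mem_ofPred_eq] at hp hq
  have h1 : ∀ i, |(e p - e q) i| ≤ l i * σ := fun i => by
    have h2 := (hlip i p q).trans (mul_le_mul_right hd _)
    rw [hp, hq, edist_dist, Real.dist_eq, ← ENNReal.ofReal_coe_nnreal,
      ← ENNReal.ofReal_mul NNReal.zero_le_coe, Real.coe_toNNReal _ (hl i).le] at h2
    exact (ENNReal.ofReal_le_ofReal_iff (mul_nonneg (hl i).le hσ)).1 h2
  calc ‖e p - e q‖ ≤ ∑ i, |(e p - e q) i| := by
        have := EuclideanSpace.norm_eq (e p - e q)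
        rw [this]
        refine Real.sqrt_le_iff.2 ⟨Finset.sum_nonneg fun i _ => abs_nonneg _, ?_⟩
        simp only [Real.norm_eq_abs]
        exact Finset.sum_sq_le_sq_sum_of_nonneg fun i _ => abs_nonneg _
    _ ≤ ∑ i, l i * σ := Finset.sum_le_sum fun i _ => h1 i
    _ ≤ (1 + ∑ i, l i) * σ := by rw [← Finset.sum_mul]; nlinarith

/-- A cutoff function for a small set, with controlled gradient and controlled mass of its
support. -/
structure IsCutoff (V : Varifold n M) (k : ℕ) (C σ : ℝ) (t : Set M) (η : M → ℝ) : Prop where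
  smooth : ContMDiff (𝓡 (n + 1)) 𝓘(ℝ, ℝ) ∞ η
  eq_one : ∀ p ∈ t, ∀ᶠ q in 𝓝 p, η q = 1
  dfun_le : ∀ p, ∀ v : TangentSpace (𝓡 (n + 1)) p, |dfun η p v| ≤ C / σ * ‖v‖
  mass_le : (V : Measure (Gr n M)).real {ξ | η ξ.1 ≠ 0} ≤ C * σ ^ k

theorem IsCutoff.mono {V : Varifold n M} {k : ℕ} {C C' σ : ℝ} {t : Set M} {η : M → ℝ}
    (h : IsCutoff V k C σ t η) (hσ : 0 < σ) (hC : C ≤ C') : IsCutoff V k C' σ t η where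
  smooth := h.smooth
  eq_one := h.eq_one
  dfun_le p v := (h.dfun_le p v).trans (by gcongr)
  mass_le := h.mass_le.trans (by gcongr)

/-- Cutoff functions exist for all small sets meeting a given set. -/
def HasCutoffs (V : Varifold n M) (k : ℕ) (T : Set M) : Prop :=
  ∃ r > 0, ∃ C > 0, ∀ t : Set M, ∀ σ : ℝ, 0 < σ → σ < r → (t ∩ T).Nonempty →
    Metric.ediam t ≤ ENNReal.ofReal σ → ∃ η, IsCutoff V k C σ t η

theorem Varifold.IsStationary.hasCutoffs_nhds [CompactSpace M]
    [IsRiemannianManifold (𝓡 (n + 1)) M] {V : Varifold n M} (hV : V.IsStationary) {k : ℕ}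
    (hk : k + 3 ≤ n) (p₀ : M) : ∃ T ∈ 𝓝 p₀, HasCutoffs V k T := by
  set e := chartAt (Euc (n + 1)) p₀
  have he : e ∈ smoothAtlas n M := IsManifold.chart_mem_maximalAtlas p₀
  have hp₀ : p₀ ∈ e.source := mem_chart_source _ p₀
  set y₀ := e p₀
  have hy₀ : y₀ ∈ e.target := e.map_source hp₀
  obtain ⟨L, hL, U, hU, hUs, hlip⟩ := exists_chart_lipschitz he hp₀
  obtain ⟨L', hL', hlow⟩ := exists_chartVec_lower_bound he hy₀
  obtain ⟨r₁, hr₁, C₁, hC₁, hmass⟩ := hV.exists_mass_bound he hy₀ hk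
  obtain ⟨R, hR, hball⟩ := Metric.eventually_nhds_iff_ball.1
    (hlow.and (e.open_target.mem_nhds hy₀))
  obtain ⟨ε, hε, hεU⟩ := EMetric.mem_nhds_iff.1 hU
  obtain ⟨ρ, hρ0, hρ⟩ := ENNReal.lt_iff_exists_nnreal_btwn.1 (ENNReal.half_pos hε.ne')
  have hρ0' : 0 < ρ := by exact_mod_cast hρ0
  let ψ : ContDiffBump (0 : Euc (n + 1)) := ⟨2, 4, by norm_num, by norm_num⟩
  have hψ : ContDiff ℝ ∞ ψ := ψ.contDiff
  obtain ⟨B, hB⟩ := (hψ.continuous_fderiv (by simp)).bounded_above_of_compact_support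
    (ψ.hasCompactSupport.fderiv ℝ)
  have hB0 : 0 ≤ B := (norm_nonneg _).trans (hB 0)
  have hL0 : 0 < L := by linarith
  have hL'0 : 0 < L' := by linarith
  refine ⟨Metric.eball p₀ (ε / 2) ∩ e ⁻¹' Metric.ball y₀ (min (R / 2) r₁), inter_mem
    (Metric.eball_mem_nhds _ (ENNReal.half_pos hε.ne'))
    ((e.continuousAt hp₀).preimage_mem_nhds (Metric.ball_mem_nhds _ (by positivity))),
    min ρ (min (R / (8 * L)) (r₁ / (4 * L))), by positivity,
    B * L' + C₁ * (4 * L) ^ k + 1, by positivity, fun t σ hσ hσr ht hd => ?_⟩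
  obtain ⟨p, hpt, hpε, hpb⟩ := ht
  have hσρ : σ < ρ := hσr.trans_le (min_le_left _ _)
  have hσR : 8 * L * σ < R := by
    have := hσr.trans_le ((min_le_right _ _).trans (min_le_left _ _))
    rw [lt_div_iff₀ (by positivity)] at this; linarith
  have hσr₁ : 4 * L * σ < r₁ := by
    have := hσr.trans_le ((min_le_right _ _).trans (min_le_right _ _))
    rw [lt_div_iff₀ (by positivity)] at this; linarith
  set q := e p
  have hqb : ‖q - y₀‖ < min (R / 2) r₁ := mem_ball_iff_norm.1 hpb
  have hqR : ‖q - y₀‖ < R / 2 := hqb.trans_le (min_le_left _ _)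
  have hpU : p ∈ U := hεU (Metric.eball_subset_eball ENNReal.half_le_self hpε)
  have htU : ∀ p' ∈ t, p' ∈ U ∧ ‖e p' - q‖ ≤ L * σ := fun p' hp' => by
    have h1 : edist p' p ≤ ENNReal.ofReal σ := (Metric.edist_le_ediam_of_mem hp' hpt).trans hd
    have h2 : p' ∈ U := hεU (by
      rw [Metric.mem_eball]
      calc edist p' p₀ ≤ edist p' p + edist p p₀ := edist_triangle _ _ _
        _ < ε / 2 + ε / 2 := by
          refine ENNReal.add_lt_add (h1.trans_lt (lt_of_le_of_lt ?_ hρ)) hpε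
          rw [← ENNReal.ofReal_coe_nnreal]
          exact ENNReal.ofReal_le_ofReal hσρ.le
        _ = ε := ENNReal.add_halves ε)
    exact ⟨h2, hlip p' h2 p hpU σ hσ.le h1⟩
  let φ : Euc (n + 1) → ℝ := fun y => ψ ((L * σ)⁻¹ • (y - q))
  have hLσ : 0 < L * σ := by positivity
  have hφ : ContDiff ℝ ∞ φ := hψ.comp (by fun_prop)
  have hnorm : ∀ y, ‖(L * σ)⁻¹ • (y - q)‖ = (L * σ)⁻¹ * ‖y - q‖ := fun y => by
    rw [norm_smul, norm_inv, Real.norm_of_nonneg hLσ.le]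
  have hsupp : ∀ y, φ y ≠ 0 → ‖y - q‖ < 4 * L * σ := fun y hy => by
    have h1 : (L * σ)⁻¹ • (y - q) ∈ Function.support ψ := hy
    rw [ψ.support_eq, mem_ball_zero_iff, hnorm, inv_mul_lt_iff₀ hLσ] at h1
    change _ < L * σ * 4 at h1
    linarith
  have hts : tsupport φ ⊆ Metric.closedBall q (4 * L * σ) :=
    closure_minimal (fun y hy => mem_closedBall_iff_norm.2 (hsupp y hy).le) Metric.isClosed_closedBall
  have htR : tsupport φ ⊆ Metric.ball y₀ R := fun y hy => by
    have h1 := mem_closedBall_iff_norm.1 (hts hy)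
    rw [mem_ball_iff_norm]
    have : y - y₀ = (y - q) + (q - y₀) := by abel
    rw [this]
    exact (norm_add_le _ _).trans_lt (by linarith)
  have htt : tsupport φ ⊆ e.target := fun y hy => (hball y (htR hy)).2
  have hc : HasCompactSupport φ :=
    (isCompact_closedBall _ _).of_isClosed_subset (isClosed_tsupport _) hts
  have hfd : ∀ y v, |fderiv ℝ φ y v| ≤ B / (L * σ) * ‖v‖ := fun y v => by
    have h1 : HasFDerivAt φ ((fderiv ℝ ψ ((L * σ)⁻¹ • (y - q))).comp
        ((L * σ)⁻¹ • ContinuousLinearMap.id ℝ (Euc (n + 1)))) y :=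
      (hψ.differentiable (by simp) _).hasFDerivAt.comp y
        (HasFDerivAt.fun_const_smul ((hasFDerivAt_id y).sub_const q) _)
    rw [h1.fderiv]
    have h2 : ‖fderiv ℝ ψ ((L * σ)⁻¹ • (y - q)) ((L * σ)⁻¹ • v)‖ ≤ B * ((L * σ)⁻¹ * ‖v‖) := by
      refine ((fderiv ℝ ψ ((L * σ)⁻¹ • (y - q))).le_opNorm _).trans ?_
      rw [norm_smul, norm_inv, Real.norm_of_nonneg hLσ.le]
      exact mul_le_mul_of_nonneg_right (hB _) (by positivity)
    calc _ ≤ B * ((L * σ)⁻¹ * ‖v‖) := h2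
      _ = _ := by ring
  refine ⟨chartExtend e φ, contMDiff_chartExtend he hφ hc htt, fun p' hp' => ?_, fun p' v => ?_, ?_⟩
  · obtain ⟨h1, h2⟩ := htU p' hp'
    have h3 : ∀ᶠ x in 𝓝 p', ‖e x - q‖ < 2 * (L * σ) := by
      have : ContinuousAt (fun x => ‖e x - q‖) p' :=
        ((e.continuousAt (hUs h1)).sub continuousAt_const).norm
      exact this.eventually (gt_mem_nhds (by linarith))
    filter_upwards [h3, e.open_source.mem_nhds (hUs h1)] with x hx hxs
    rw [chartExtend_of_mem hxs]
    refine ψ.one_of_mem_closedBall ?_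
    rw [mem_closedBall_zero_iff, hnorm, inv_mul_le_iff₀ hLσ]
    change _ ≤ L * σ * 2
    linarith
  · by_cases hp' : p' ∈ e.symm '' tsupport φ
    · obtain ⟨y, hy, rfl⟩ := hp'
      have hyt := htt hy
      rw [← chartVec_chartComp he hyt v, dfun_chartVec he
        ((contMDiff_chartExtend he hφ hc htt).mdifferentiable (by simp) _) hyt,
        (chartExtend_comp_symm hyt).fderiv_eq]
      refine (hfd _ _).trans ?_
      set c := chartComp e y v
      have h1 := (hball y (htR hy)).1 c
      have h2 : B / (L * σ) ≤ B / σ := by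
        apply div_le_div_of_nonneg_left hB0 hσ; nlinarith
      calc B / (L * σ) * ‖c‖ ≤ B / σ * (L' * ‖chartVec e y c‖) := by gcongr
        _ = (B * L') / σ * ‖chartVec e y c‖ := by ring
        _ ≤ _ := by gcongr; have : 0 ≤ C₁ * (4 * L) ^ k := by positivity
                    linarith
    · have h1 := (chartExtend_eventuallyEq_zero hc htt hp').mfderiv_eq (I := 𝓡 (n + 1)) (I' := 𝓘(ℝ, ℝ))
      have h2 : dfun (chartExtend e φ) p' v = 0 := by
        rw [dfun, h1, mfderiv_const]; rfl
      rw [h2, abs_zero]; positivity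
  · have h1 := hmass q (hqb.trans_le (min_le_right _ _)) (4 * L * σ) (by positivity) hσr₁.le
    calc _ ≤ _ := measureReal_mono (fun ξ hξ => by
          obtain ⟨h2, h3⟩ := chartExtend_ne_zero hξ
          exact ⟨h2, hsupp _ h3⟩)
      _ ≤ _ := h1
      _ = C₁ * (4 * L) ^ k * σ ^ k := by rw [mul_pow, mul_assoc]
      _ ≤ _ := by gcongr; have : 0 ≤ B * L' := by positivity
                  linarith

theorem Varifold.IsStationary.hasCutoffs [CompactSpace M]
    [IsRiemannianManifold (𝓡 (n + 1)) M] {V : Varifold n M} (hV : V.IsStationary) {k : ℕ}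
    (hk : k + 3 ≤ n) {K : Set M} (hK : IsCompact K) : HasCutoffs V k K := by
  refine hK.induction_on ⟨1, one_pos, 1, one_pos, fun t σ _ _ h => by simp at h⟩ ?_ ?_ ?_
  · rintro S T hST ⟨r, hr, C, hC, h⟩
    exact ⟨r, hr, C, hC, fun t σ h1 h2 h3 => h t σ h1 h2 (h3.mono (inter_subset_inter_right _ hST))⟩
  · rintro S T ⟨r, hr, C, hC, h⟩ ⟨r', hr', C', hC', h'⟩
    refine ⟨min r r', lt_min hr hr', C + C', by positivity, fun t σ h1 h2 h3 h4 => ?_⟩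
    rw [inter_union_distrib_left, union_nonempty] at h3
    rcases h3 with h3 | h3
    · obtain ⟨η, hη⟩ := h t σ h1 (h2.trans_le (min_le_left _ _)) h3 h4
      exact ⟨η, hη.mono h1 (by linarith)⟩
    · obtain ⟨η, hη⟩ := h' t σ h1 (h2.trans_le (min_le_right _ _)) h3 h4
      exact ⟨η, hη.mono h1 (by linarith)⟩
  · intro p _
    obtain ⟨T, hT, h⟩ := hV.hasCutoffs_nhds hk p
    exact ⟨T, mem_nhdsWithin_of_mem_nhds hT, h⟩

end Cutoff

section Cover

/-- A compact null set for the `s`-dimensional Hausdorff measure has small coverings. -/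
theorem exists_small_cover {X : Type*} [EMetricSpace X] [MeasurableSpace X] [BorelSpace X]
    {S : Set X} {s : ℕ} (hs : s ≠ 0) (h : μH[(s : ℝ)] S = 0) {r ε : ℝ} (hr : 0 < r) (hε : 0 < ε) :
    ∃ (t : ℕ → Set X) (σ : ℕ → ℝ), S ⊆ ⋃ i, t i ∧ (∀ i, 0 < σ i ∧ σ i < r ∧
      Metric.ediam (t i) ≤ ENNReal.ofReal (σ i)) ∧ ∀ I : Finset ℕ, ∑ i ∈ I, σ i ^ s ≤ ε := by
  rw [Measure.hausdorffMeasure_apply] at h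
  have h1 := le_iSup₂ (f := fun (r : ℝ≥0∞) (_ : 0 < r) =>
    ⨅ (t : ℕ → Set X) (_ : S ⊆ ⋃ n, t n) (_ : ∀ n, Metric.ediam (t n) ≤ r),
      ∑' n, ⨆ _ : (t n).Nonempty, Metric.ediam (t n) ^ (s : ℝ)) (ENNReal.ofReal (r / 2))
    (ENNReal.ofReal_pos.2 (half_pos hr))
  rw [h] at h1
  have h2 := h1.trans_lt (ENNReal.ofReal_pos.2 (half_pos hε))
  simp only [iInf_lt_iff] at h2
  obtain ⟨t, hSt, htr, hsum⟩ := h2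
  set d : ℕ → ℝ := fun i => (Metric.ediam (t i)).toReal with hd
  have hfin : ∀ i, Metric.ediam (t i) ≠ ⊤ := fun i =>
    ((htr i).trans_lt ENNReal.ofReal_lt_top).ne
  have hdr : ∀ i, d i < r := fun i => by
    have := ENNReal.toReal_mono ENNReal.ofReal_ne_top (htr i)
    rw [ENNReal.toReal_ofReal (half_pos hr).le] at this
    exact this.trans_lt (half_lt_self hr)
  have hex : ∀ i : ℕ, ∃ σ, d i < σ ∧ σ < r ∧ σ ^ s < d i ^ s + ε / 2 / 2 / 2 ^ i := fun i => by
    have h3 : ∀ᶠ σ in 𝓝[>] d i, σ ^ s < d i ^ s + ε / 2 / 2 / 2 ^ i :=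
      ((continuous_pow s).continuousAt.eventually
        (gt_mem_nhds (lt_add_of_pos_right _ (by positivity)))).filter_mono nhdsWithin_le_nhds
    obtain ⟨σ, h4, h5, h6⟩ := (h3.and (Ioo_mem_nhdsGT (hdr i))).exists
    exact ⟨σ, h5, h6, h4⟩
  choose σ hσ1 hσ2 hσ3 using hex
  refine ⟨t, σ, hSt, fun i => ⟨ENNReal.toReal_nonneg.trans_lt (hσ1 i), hσ2 i, ?_⟩, fun I => ?_⟩
  · rw [← ENNReal.ofReal_toReal (hfin i)]
    exact ENNReal.ofReal_le_ofReal (hσ1 i).le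
  · have h4 : ∑ i ∈ I, d i ^ s ≤ ε / 2 := by
      have h5 : ∀ i, ENNReal.ofReal (d i ^ s) ≤
          ⨆ _ : (t i).Nonempty, Metric.ediam (t i) ^ (s : ℝ) := fun i => by
        rcases (t i).eq_empty_or_nonempty with h0 | h0
        · simp [hd, h0, hs]
        · refine le_iSup_of_le h0 (le_of_eq ?_)
          rw [ENNReal.rpow_natCast, ENNReal.ofReal_pow ENNReal.toReal_nonneg,
            ENNReal.ofReal_toReal (hfin i)]
      have h6 := (Finset.sum_le_sum fun i (_ : i ∈ I) => h5 i).trans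
        ((ENNReal.sum_le_tsum I).trans hsum.le)
      rw [← ENNReal.ofReal_sum_of_nonneg fun i _ => pow_nonneg ENNReal.toReal_nonneg s] at h6
      exact (ENNReal.ofReal_le_ofReal_iff (half_pos hε).le).1 h6
    have h7 : ∑ i ∈ I, ε / 2 / 2 / 2 ^ i ≤ ε / 2 :=
      sum_le_hasSum I (fun i _ => by positivity) (hasSum_geometric_two' (ε / 2))
    calc ∑ i ∈ I, σ i ^ s ≤ ∑ i ∈ I, (d i ^ s + ε / 2 / 2 / 2 ^ i) :=
          Finset.sum_le_sum fun i _ => (hσ3 i).le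
      _ ≤ ε := by rw [Finset.sum_add_distrib]; linarith

theorem HasCodimSeven.eq_empty {n : ℕ} {X : Type*} [EMetricSpace X] [MeasurableSpace X]
    [BorelSpace X] {S : Set X} (h : HasCodimSeven n S) (hn : n < 7) : S = ∅ := by
  by_contra hne
  have h1 := Measure.one_le_hausdorffMeasure_zero_of_nonempty (nonempty_iff_ne_empty.2 hne)
  rw [h 0 (by
    have : (n : ℝ) < 7 := by exact_mod_cast hn
    linarith)] at h1
  exact absurd h1 (by simp)

theorem exists_smoothTransition_bound : ∃ B > 0, ∀ x : ℝ, |deriv Real.smoothTransition x| ≤ B ∧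
    (1 < x → deriv Real.smoothTransition x = 0) := by
  have h1 : ∀ x : ℝ, 1 < x → deriv Real.smoothTransition x = 0 := fun x hx => by
    have : Real.smoothTransition =ᶠ[𝓝 x] fun _ => 1 := by
      filter_upwards [lt_mem_nhds hx] with y hy using Real.smoothTransition.one_of_one_le hy.le
    rw [this.deriv_eq, deriv_const]
  have h0 : ∀ x : ℝ, x < 0 → deriv Real.smoothTransition x = 0 := fun x hx => by
    have : Real.smoothTransition =ᶠ[𝓝 x] fun _ => 0 := by
      filter_upwards [gt_mem_nhds hx] with y hy using Real.smoothTransition.zero_of_nonpos hy.le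
    rw [this.deriv_eq, deriv_const]
  have hc : Continuous (deriv Real.smoothTransition) :=
    (Real.smoothTransition.contDiff (n := 1)).continuous_deriv (by simp)
  obtain ⟨B, hB⟩ := isCompact_Icc.exists_bound_of_continuousOn (hc.continuousOn (s := Icc 0 1))
  refine ⟨|B| + 1, by positivity, fun x => ⟨?_, h1 x⟩⟩
  rcases lt_or_ge x 0 with hx | hx
  · rw [h0 x hx]; simp; positivity
  rcases lt_or_ge 1 x with hx1 | hx1
  · rw [h1 x hx1]; simp; positivity
  exact (hB x ⟨hx, hx1⟩).trans ((le_abs_self B).trans (by linarith))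

end Cover

section Cutoff

variable {n : ℕ} {M : Type*} [EMetricSpace M] [ChartedSpace (Euc (n + 1)) M]
  [IsManifold (𝓡 (n + 1)) ∞ M]
  [RiemannianBundle (fun x : M => TangentSpace (𝓡 (n + 1)) x)]
  [IsContMDiffRiemannianBundle (𝓡 (n + 1)) ∞ (Euc (n + 1))
    (fun x : M => TangentSpace (𝓡 (n + 1)) x)]

/-- The Jacobian of a deformation depends only on the one-jet of the cutoff function. -/
theorem secondVar_congr {F : ℝ → M → M} (hF : IsVariation n F) {ζ ζ' : M → ℝ}
    (hζ : ContMDiff (𝓡 (n + 1)) 𝓘(ℝ, ℝ) ∞ ζ) (hζ' : ContMDiff (𝓡 (n + 1)) 𝓘(ℝ, ℝ) ∞ ζ')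
    {ξ : Gr n M} (h0 : ζ ξ.1 = ζ' ξ.1)
    (h1 : ∀ v : TangentSpace (𝓡 (n + 1)) ξ.1, dfun ζ ξ.1 v = dfun ζ' ξ.1 v) :
    secondVar F ζ ξ = secondVar F ζ' ξ := by
  set e := chartAt (Euc (n + 1)) ξ.1 with hedef
  have he : e ∈ smoothAtlas n M := IsManifold.chart_mem_maximalAtlas ξ.1
  have hs : ξ.1 ∈ e.source := mem_chart_source _ ξ.1
  clear_value e
  obtain ⟨y, hy, P, rfl⟩ := Gr.exists_eq_mk hs
  obtain ⟨b, hb, hbP⟩ := exists_frame he hy P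
  have hm := hF.eventually_mem he hy
  have hw : fderiv ℝ (ζ ∘ e.symm) y = fderiv ℝ (ζ' ∘ e.symm) y := by
    ext v
    rw [← dfun_chartVec he (hζ.mdifferentiable (by simp) _) hy,
      ← dfun_chartVec he (hζ'.mdifferentiable (by simp) _) hy]
    exact h1 _
  change ζ (e.symm y) = ζ' (e.symm y) at h0
  have hev : ∀ᶠ t in 𝓝 (0 : ℝ), |t * ζ (e.symm y)| < 1 ∧
      F (t * ζ (e.symm y)) (e.symm y) ∈ e.source := by
    have hc : Tendsto (fun t : ℝ => (t * ζ (e.symm y), y)) (𝓝 0) (𝓝 ((0 : ℝ), y)) := by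
      have : Continuous fun t : ℝ => (t * ζ (e.symm y), y) := by fun_prop
      simpa using this.tendsto 0
    exact (hc.eventually hm).mono fun t ht => ⟨ht.1, ht.2.2⟩
  have heq : (fun t => planeJac (deform F ζ t) (⟨e.symm y, P⟩ : Gr n M)) =ᶠ[𝓝 0]
      fun t => planeJac (deform F ζ' t) (⟨e.symm y, P⟩ : Gr n M) := by
    filter_upwards [hev] with t ht
    rw [planeJac_deform_eq hF he hζ hy ht.1 ht.2 P hb.linearIndependent hbP,
      planeJac_deform_eq hF he hζ' hy (h0 ▸ ht.1) (h0 ▸ ht.2) P hb.linearIndependent hbP, hw, h0]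
  exact heq.deriv.deriv_eq

/-- The differential of a smooth function of a sum of squares. -/
theorem dfun_comp_sum_sq {ι : Type*} {I : Finset ι} {η : ι → M → ℝ}
    (hη : ∀ i ∈ I, ContMDiff (𝓡 (n + 1)) 𝓘(ℝ, ℝ) ∞ (η i)) {Θ : ℝ → ℝ} (hΘ : ContDiff ℝ ∞ Θ)
    (p : M) (v : TangentSpace (𝓡 (n + 1)) p) :
    dfun (fun q => Θ (∑ i ∈ I, η i q ^ 2)) p v =
      deriv Θ (∑ i ∈ I, η i p ^ 2) * ∑ i ∈ I, 2 * η i p * dfun (η i) p v := by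
  set e := chartAt (Euc (n + 1)) p with hedef
  have he : e ∈ smoothAtlas n M := IsManifold.chart_mem_maximalAtlas p
  have hs : p ∈ e.source := mem_chart_source _ p
  clear_value e
  obtain ⟨y, hy, rfl⟩ : ∃ y, y ∈ e.target ∧ e.symm y = p := ⟨e p, e.map_source hs, e.left_inv hs⟩
  rw [← chartVec_chartComp he hy v]
  set c := chartComp e y v
  have h1 : ∀ i ∈ I, HasFDerivAt (η i ∘ e.symm) (fderiv ℝ (η i ∘ e.symm) y) y := fun i hi =>
    ((contDiffAt_comp_chart_symm he (hη i hi _) hy).differentiableAt (by simp)).hasFDerivAt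
  have h2 : HasFDerivAt (fun x => ∑ i ∈ I, (η i ∘ e.symm) x ^ 2)
      (∑ i ∈ I, (2 * (η i ∘ e.symm) y) • fderiv ℝ (η i ∘ e.symm) y) y := by
    refine HasFDerivAt.fun_sum fun i hi => ?_
    have := (h1 i hi).pow 2
    refine this.congr_fderiv ?_
    simp
  have h3 := ((hΘ.differentiable (by simp) _).hasDerivAt.comp_hasFDerivAt y h2).fderiv
  have hsm : ContMDiff (𝓡 (n + 1)) 𝓘(ℝ, ℝ) ∞ (fun q => Θ (∑ i ∈ I, η i q ^ 2)) :=
    hΘ.contMDiff.comp (contMDiff_finsetSum fun i hi => (hη i hi).pow 2)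
  rw [dfun_chartVec he (hsm.mdifferentiable (by simp) _) hy]
  have h4 := congrArg (fun f : Euc (n + 1) →L[ℝ] ℝ => f c) h3
  refine h4.trans ?_
  simp only [smul_apply, _root_.sum_apply, smul_eq_mul, Function.comp_apply]
  congr 1
  refine Finset.sum_congr rfl fun i hi => ?_
  rw [dfun_chartVec he ((hη i hi).mdifferentiable (by simp) _) hy]

/-- Cutting off near a closed set of codimension seven changes the second variation of a
stationary varifold arbitrarily little. -/
theorem Varifold.IsStationary.exists_cutoff [CompactSpace M] [MeasurableSpace M] [BorelSpace M]
    [IsRiemannianManifold (𝓡 (n + 1)) M] {V : Varifold n M} (hV : V.IsStationary)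
    {F : ℝ → M → M} (hF : IsVariation n F) {S : Set M} (hS : IsClosed S)
    (hcodim : HasCodimSeven n S) {δ : ℝ} (hδ : 0 < δ) :
    ∃ ζ : M → ℝ, ContMDiff (𝓡 (n + 1)) 𝓘(ℝ, ℝ) ∞ ζ ∧ (∀ p ∈ S, ∀ᶠ q in 𝓝 p, ζ q = 0) ∧
      |∫ ξ, secondVar F (fun _ => 1) ξ ∂(V : Measure (Gr n M)) -
        ∫ ξ, secondVar F ζ ξ ∂(V : Measure (Gr n M))| ≤ δ := by
  rcases lt_or_ge n 7 with hn | hn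
  · rw [hcodim.eq_empty hn]
    exact ⟨fun _ => 1, contMDiff_const, by simp, by simpa using hδ.le⟩
  obtain ⟨s, rfl⟩ : ∃ s, n = s + 5 := ⟨n - 5, by omega⟩
  have hs : s ≠ 0 := by omega
  obtain ⟨r, hr, C, hC, hcut⟩ := hV.hasCutoffs (k := s + 2) (by omega) hS.isCompact
  obtain ⟨C₁, hC₁, ε₁, -, hexp⟩ := exists_jacExpansion hF
  obtain ⟨B, hB, hΘB⟩ := exists_smoothTransition_bound
  set K : ℝ := C₁ * (2 + 4 * B ^ 2 * C ^ 2) with hK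
  have hK0 : 0 < K := by positivity
  obtain ⟨t, σ, hSt, hσ, hsum⟩ := exists_small_cover hs
    (hcodim s (by push_cast; linarith)) (lt_min hr one_pos) (ε := δ / (K * C)) (by positivity)
  have hη : ∀ i, ∃ η, (t i ∩ S).Nonempty → IsCutoff V (s + 2) C (σ i) (t i) η := fun i => by
    by_cases h : (t i ∩ S).Nonempty
    · obtain ⟨η, hη⟩ := hcut (t i) (σ i) (hσ i).1 ((hσ i).2.1.trans_le (min_le_left _ _)) h
        (hσ i).2.2
      exact ⟨η, fun _ => hη⟩
    · exact ⟨0, fun h' => absurd h' h⟩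
  choose η hη using hη
  obtain ⟨I', hI', hfin, hcov⟩ := hS.isCompact.elim_finite_subcover_image
    (b := {i | (t i ∩ S).Nonempty}) (c := fun i => {p | ∀ᶠ q in 𝓝 p, η i q = 1})
    (fun i _ => isOpen_setOfPred_eventually_nhds) (fun p hp => by
      obtain ⟨i, hi⟩ := mem_iUnion.1 (hSt hp)
      have hi' : (t i ∩ S).Nonempty := ⟨p, hi, hp⟩
      exact mem_iUnion₂.2 ⟨i, hi', (hη i hi').eq_one p hi⟩)
  set I := hfin.toFinset
  have hI : ∀ i ∈ I, IsCutoff V (s + 2) C (σ i) (t i) (η i) := fun i hi =>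
    hη i (hI' (hfin.mem_toFinset.1 hi))
  let Θ : ℝ → ℝ := fun x => 1 - Real.smoothTransition x
  have hΘ : ContDiff ℝ ∞ Θ := contDiff_const.sub Real.smoothTransition.contDiff
  have hΘd : ∀ x, deriv Θ x = -deriv Real.smoothTransition x := fun x => by
    simp only [Θ]; rw [deriv_const_sub]
  let ζ : M → ℝ := fun q => Θ (∑ i ∈ I, η i q ^ 2)
  have hζ : ContMDiff (𝓡 (s + 5 + 1)) 𝓘(ℝ, ℝ) ∞ ζ :=
    hΘ.contMDiff.comp (contMDiff_finsetSum fun i hi => (hI i hi).smooth.pow 2)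
  have hone : ContMDiff (𝓡 (s + 5 + 1)) 𝓘(ℝ, ℝ) ∞ (fun _ : M => (1 : ℝ)) := contMDiff_const
  have hdone : ∀ (p : M) (v : TangentSpace (𝓡 (s + 5 + 1)) p), dfun (fun _ : M => (1 : ℝ)) p v = 0 :=
    fun p v => by rw [dfun, mfderiv_const]; rfl
  have hζ01 : ∀ p, |ζ p| ≤ 1 := fun p => by
    have h1 := Real.smoothTransition.nonneg (∑ i ∈ I, η i p ^ 2)
    have h2 := Real.smoothTransition.le_one (∑ i ∈ I, η i p ^ 2)
    rw [abs_le]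
    constructor <;> simp only [ζ, Θ] <;> linarith
  refine ⟨ζ, hζ, fun p hp => ?_, ?_⟩
  · obtain ⟨i, hi, hip⟩ := mem_iUnion₂.1 (hcov hp)
    have hip' : ∀ᶠ q in 𝓝 p, η i q = 1 := hip
    filter_upwards [hip'] with q hq
    have h1 : (1 : ℝ) ≤ ∑ j ∈ I, η j q ^ 2 := by
      have := Finset.single_le_sum (f := fun j => η j q ^ 2) (fun j _ => sq_nonneg _)
        (hfin.mem_toFinset.2 hi)
      simpa [hq] using this
    simp only [ζ, Θ, Real.smoothTransition.one_of_one_le h1, sub_self]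
  set N : ℕ → Set (Gr (s + 5) M) := fun i => {ξ | η i ξ.1 ≠ 0} with hN
  have hNm : ∀ i ∈ I, MeasurableSet (N i) := fun i hi =>
    (isOpen_gr_preimage ((hI i hi).smooth.continuous.isOpen_preimage _
      isOpen_ne)).measurableSet
  have hpt : ∀ ξ : Gr (s + 5) M, |secondVar F (fun _ => 1) ξ - secondVar F ζ ξ| ≤
      ∑ i ∈ I, (N i).indicator (fun _ => K * (σ i ^ 2)⁻¹) ξ := by
    intro ξ
    classical
    set J := I.filter fun i => η i ξ.1 ≠ 0 with hJ
    have hsumJ : ∑ i ∈ I, (N i).indicator (fun _ => K * (σ i ^ 2)⁻¹) ξ =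
        ∑ i ∈ J, K * (σ i ^ 2)⁻¹ := by
      rw [hJ, Finset.sum_filter]
      exact Finset.sum_congr rfl fun i _ => by simp [hN, indicator_apply]
    rw [hsumJ]
    rcases J.eq_empty_or_nonempty with hJe | hJn
    · have hz : ∀ i ∈ I, η i ξ.1 = 0 := fun i hi => by
        by_contra h
        have : i ∈ J := Finset.mem_filter.2 ⟨hi, h⟩
        rw [hJe] at this; simp at this
      have h1 : (1 : ℝ) = ζ ξ.1 := by
        have : ∑ i ∈ I, η i ξ.1 ^ 2 = 0 := Finset.sum_eq_zero fun i hi => by rw [hz i hi]; simp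
        simp [ζ, Θ, this]
      have h2 : ∀ v : TangentSpace (𝓡 (s + 5 + 1)) ξ.1, dfun ζ ξ.1 v = 0 := fun v => by
        refine (dfun_comp_sum_sq (fun i hi => (hI i hi).smooth) hΘ _ _).trans ?_
        have h3 : ∑ i ∈ I, 2 * η i ξ.1 * dfun (η i) ξ.1 v = 0 :=
          Finset.sum_eq_zero fun i hi => by rw [hz i hi]; ring
        rw [h3, mul_zero]
      rw [secondVar_congr hF hone hζ h1 fun v => by rw [hdone, h2]]
      simp [hJe]
    · set A : ℝ := ∑ i ∈ J, (σ i ^ 2)⁻¹ with hA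
      have hA1 : 1 ≤ A := by
        obtain ⟨i, hi⟩ := hJn
        have h1 : σ i ^ 2 ≤ 1 := pow_le_one₀ (hσ i).1.le
          ((hσ i).2.1.trans_le (min_le_right _ _)).le
        calc (1 : ℝ) ≤ (σ i ^ 2)⁻¹ := (one_le_inv₀ (pow_pos (hσ i).1 2)).2 h1
          _ ≤ A := Finset.single_le_sum (f := fun i => (σ i ^ 2)⁻¹)
            (fun j _ => by positivity) hi
      have hdζ : ∀ v : TangentSpace (𝓡 (s + 5 + 1)) ξ.1, |dfun ζ ξ.1 v| ≤
          Real.sqrt (4 * B ^ 2 * C ^ 2 * A) * ‖v‖ := by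
        intro v
        refine abs_le_of_sq_le_sq ?_ (mul_nonneg (Real.sqrt_nonneg _) (norm_nonneg v))
        rw [mul_pow, Real.sq_sqrt (by positivity)]
        rw [show dfun ζ ξ.1 v = _ from dfun_comp_sum_sq (fun i hi => (hI i hi).smooth) hΘ _ _, hΘd]
        obtain ⟨hb1, hb2⟩ := hΘB (∑ i ∈ I, η i ξ.1 ^ 2)
        rcases lt_or_ge 1 (∑ i ∈ I, η i ξ.1 ^ 2) with h1 | h1
        · rw [hb2 h1]; simp; positivity
        have h2 : ∑ i ∈ I, 2 * η i ξ.1 * dfun (η i) ξ.1 v =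
            2 * ∑ i ∈ J, η i ξ.1 * dfun (η i) ξ.1 v := by
          rw [hJ, Finset.sum_filter, Finset.mul_sum]
          refine Finset.sum_congr rfl fun i _ => ?_
          split_ifs with h
          · ring
          · rw [not_not.1 h]; ring
        have h3 : (∑ i ∈ J, η i ξ.1 * dfun (η i) ξ.1 v) ^ 2 ≤ 1 * (C ^ 2 * A * ‖v‖ ^ 2) := by
          refine (Finset.sum_mul_sq_le_sq_mul_sq _ _ _).trans ?_
          refine mul_le_mul ?_ ?_ (Finset.sum_nonneg fun i _ => sq_nonneg _) zero_le_one
          · exact (Finset.sum_le_sum_of_subset_of_nonneg (Finset.filter_subset _ _)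
              fun i _ _ => sq_nonneg _).trans h1
          · rw [hA, Finset.mul_sum, Finset.sum_mul]
            refine Finset.sum_le_sum fun i hi => ?_
            have h4 := (hI i (Finset.mem_filter.1 hi).1).dfun_le ξ.1 v
            rw [← sq_abs]
            calc |dfun (η i) ξ.1 v| ^ 2 ≤ (C / σ i * ‖v‖) ^ 2 :=
                  pow_le_pow_left₀ (abs_nonneg _) h4 2
              _ = _ := by rw [mul_pow, div_pow, div_eq_mul_inv]
        have h5 : (deriv Real.smoothTransition (∑ i ∈ I, η i ξ.1 ^ 2)) ^ 2 ≤ B ^ 2 := by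
          rw [← sq_abs]; exact pow_le_pow_left₀ (abs_nonneg _) hb1 2
        rw [h2]
        calc _ = (deriv Real.smoothTransition (∑ i ∈ I, η i ξ.1 ^ 2)) ^ 2 *
              (4 * (∑ i ∈ J, η i ξ.1 * dfun (η i) ξ.1 v) ^ 2) := by ring
          _ ≤ B ^ 2 * (4 * (1 * (C ^ 2 * A * ‖v‖ ^ 2))) := by gcongr
          _ = _ := by ring
      set l := Real.sqrt (1 + 4 * B ^ 2 * C ^ 2 * A) with hl
      have hl2 : l ^ 2 = 1 + 4 * B ^ 2 * C ^ 2 * A := Real.sq_sqrt (by positivity)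
      have hl1 : 1 ≤ l := Real.one_le_sqrt.2 (by
        have : 0 ≤ 4 * B ^ 2 * C ^ 2 * A := by positivity
        linarith)
      have h6 := (hexp ζ hζ ξ (mem_univ _) l (by linarith) ⟨(hζ01 _).trans hl1, fun v =>
        (hdζ v).trans (mul_le_mul_of_nonneg_right (Real.sqrt_le_sqrt (by linarith))
          (norm_nonneg _))⟩).2.1
      have h7 := (hexp _ hone ξ (mem_univ _) 1 one_pos ⟨by simp, fun v => by
        rw [hdone, abs_zero]; positivity⟩).2.1
      rw [hl2] at h6
      rw [← Finset.mul_sum, ← hA, hK]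
      calc _ ≤ |secondVar F (fun _ => 1) ξ| + |secondVar F ζ ξ| := abs_sub _ _
        _ ≤ C₁ * 1 ^ 2 + C₁ * (1 + 4 * B ^ 2 * C ^ 2 * A) := add_le_add h7 h6
        _ ≤ _ := by nlinarith
  have hi1 := (integrable_firstVar_secondVar hF hone V).2
  have hi2 := (integrable_firstVar_secondVar hF hζ V).2
  rw [← integral_sub hi1 hi2]
  have hi3 : ∀ i ∈ I, Integrable ((N i).indicator (fun _ => K * (σ i ^ 2)⁻¹))
      (V : Measure (Gr (s + 5) M)) := fun i hi => (integrable_const _).indicator (hNm i hi)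
  calc _ ≤ ∫ ξ, |secondVar F (fun _ => 1) ξ - secondVar F ζ ξ| ∂(V : Measure (Gr (s + 5) M)) :=
        abs_integral_le_integral_abs
    _ ≤ ∫ ξ, ∑ i ∈ I, (N i).indicator (fun _ => K * (σ i ^ 2)⁻¹) ξ
          ∂(V : Measure (Gr (s + 5) M)) :=
        integral_mono (hi1.sub hi2).abs (integrable_finsetSum _ hi3) hpt
    _ = ∑ i ∈ I, (V : Measure (Gr (s + 5) M)).real (N i) * (K * (σ i ^ 2)⁻¹) := by
        rw [integral_finsetSum _ hi3]
        refine Finset.sum_congr rfl fun i hi => ?_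
        rw [integral_indicator (hNm i hi), setIntegral_const, smul_eq_mul]
    _ ≤ ∑ i ∈ I, K * C * σ i ^ s := by
        refine Finset.sum_le_sum fun i hi => ?_
        have hσ0 := (hσ i).1
        calc _ ≤ C * σ i ^ (s + 2) * (K * (σ i ^ 2)⁻¹) := by
              gcongr; exact (hI i hi).mass_le
          _ = _ := by rw [pow_add]; field_simp
    _ ≤ K * C * (δ / (K * C)) := by
        rw [← Finset.mul_sum]
        exact mul_le_mul_of_nonneg_left (hsum I) (by positivity)
    _ = δ := by field_simp

end Cutoff

section MatrixCalculus

variable {k : ℕ}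

theorem matrix_inv_apply_eq {A : Matrix (Fin k) (Fin k) ℝ} (i j : Fin k) :
    A⁻¹ i j = A.det⁻¹ * (A.updateRow j (Pi.single i 1)).det := by
  rw [Matrix.inv_def, Ring.inverse_eq_inv', Matrix.smul_apply, smul_eq_mul, Matrix.adjugate_apply]

theorem ContDiffAt.matrix_inv_apply {X : Type*} [NormedAddCommGroup X] [NormedSpace ℝ X]
    {r : WithTop ℕ∞} {A : X → Matrix (Fin k) (Fin k) ℝ} {x : X}
    (h : ∀ i j, ContDiffAt ℝ r (fun s => A s i j) x) (h0 : (A x).det ≠ 0) (i j : Fin k) :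
    ContDiffAt ℝ r (fun s => (A s)⁻¹ i j) x := by
  simp only [matrix_inv_apply_eq]
  refine ((contDiffAt_det h).inv h0).mul (contDiffAt_det fun a b => ?_)
  by_cases hab : a = j
  · subst hab; simpa using contDiffAt_const
  · simpa [Matrix.updateRow_ne hab] using h a b

theorem HasDerivAt.matrix_inv_apply {A : ℝ → Matrix (Fin k) (Fin k) ℝ}
    {A' : Matrix (Fin k) (Fin k) ℝ} {t : ℝ} (h : ∀ i j, HasDerivAt (fun s => A s i j) (A' i j) t)
    (h0 : (A t).det ≠ 0) (i j : Fin k) :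
    HasDerivAt (fun s => (A s)⁻¹ i j) (-((A t)⁻¹ * A' * (A t)⁻¹) i j) t := by
  have hd : ∀ i j, ∃ b, HasDerivAt (fun s => (A s)⁻¹ i j) b t := fun i j => by
    simp only [matrix_inv_apply_eq]
    refine ⟨_, ((hasDerivAt_det h).inv h0).mul (hasDerivAt_det
      (A' := Matrix.of fun a b => if a = j then 0 else A' a b) fun a b => ?_)⟩
    by_cases hab : a = j
    · subst hab; simpa using hasDerivAt_const t _
    · simpa [Matrix.updateRow_ne hab, hab] using h a b
  choose B' hB using hd
  have hprod : ∀ a b, ∑ c, (A' a c * (A t)⁻¹ c b + A t a c * B' c b) = 0 := fun a b => by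
    have h1 : HasDerivAt (fun s => ∑ c, A s a c * (A s)⁻¹ c b)
        (∑ c, (A' a c * (A t)⁻¹ c b + A t a c * B' c b)) t :=
      HasDerivAt.fun_sum fun c _ => (h a c).mul (hB c b)
    have h2 : (fun s => ∑ c, A s a c * (A s)⁻¹ c b) =ᶠ[𝓝 t]
        fun _ => (1 : Matrix (Fin k) (Fin k) ℝ) a b := by
      filter_upwards [(hasDerivAt_det h).continuousAt.eventually_ne h0] with s hs
      rw [← Matrix.mul_apply, Matrix.mul_nonsing_inv _ (isUnit_iff_ne_zero.2 hs)]
    exact (h1.unique ((hasDerivAt_const t _).congr_of_eventuallyEq h2))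
  have hM : A' * (A t)⁻¹ + A t * Matrix.of B' = 0 := by
    ext a b
    simpa [Matrix.mul_apply, Finset.sum_add_distrib] using hprod a b
  have hBM : Matrix.of B' = -((A t)⁻¹ * A' * (A t)⁻¹) := by
    have h3 : A t * Matrix.of B' = -(A' * (A t)⁻¹) := by rw [← add_eq_zero_iff_eq_neg']; exact hM
    calc Matrix.of B' = (A t)⁻¹ * (A t * Matrix.of B') := by
          rw [← Matrix.mul_assoc, Matrix.nonsing_inv_mul _ (isUnit_iff_ne_zero.2 h0), Matrix.one_mul]
      _ = _ := by rw [h3, Matrix.mul_neg, Matrix.mul_assoc]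
  refine (hB i j).congr_deriv ?_
  exact congrFun (congrFun hBM i) j

theorem hasDerivAt_det_of_ne_zero {A : ℝ → Matrix (Fin k) (Fin k) ℝ}
    {A' : Matrix (Fin k) (Fin k) ℝ} {t : ℝ} (h : ∀ i j, HasDerivAt (fun s => A s i j) (A' i j) t)
    (h0 : (A t).det ≠ 0) :
    HasDerivAt (fun s => (A s).det) ((A t).det * ((A t)⁻¹ * A').trace) t := by
  refine (hasDerivAt_det h).congr_deriv ?_
  rw [Matrix.inv_def, Ring.inverse_eq_inv', Matrix.smul_mul, Matrix.trace_smul, smul_eq_mul,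
    mul_inv_cancel_left₀ h0]

/-- The second derivative of a determinant. -/
theorem deriv_deriv_det {A : ℝ → Matrix (Fin k) (Fin k) ℝ} {A₁ : ℝ → Matrix (Fin k) (Fin k) ℝ}
    {A₂ : Matrix (Fin k) (Fin k) ℝ} {t : ℝ}
    (h1 : ∀ i j, ∀ᶠ x in 𝓝 t, HasDerivAt (fun s => A s i j) (A₁ x i j) x)
    (h2 : ∀ i j, HasDerivAt (fun s => A₁ s i j) (A₂ i j) t) (h0 : (A t).det ≠ 0) :
    deriv (deriv fun s => (A s).det) t = (A t).det * (((A t)⁻¹ * A₁ t).trace ^ 2 -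
      ((A t)⁻¹ * A₁ t * ((A t)⁻¹ * A₁ t)).trace + ((A t)⁻¹ * A₂).trace) := by
  have h1' : ∀ᶠ x in 𝓝 t, ∀ i j, HasDerivAt (fun s => A s i j) (A₁ x i j) x :=
    Filter.eventually_all.2 fun i => Filter.eventually_all.2 fun j => h1 i j
  have hdet := hasDerivAt_det_of_ne_zero h1'.self_of_nhds h0
  have h3 : deriv (fun s => (A s).det) =ᶠ[𝓝 t]
      fun s => (A s).det * ∑ i, ∑ j, (A s)⁻¹ i j * A₁ s j i := by
    filter_upwards [h1', hdet.continuousAt.eventually_ne h0] with s hs hs0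
    rw [(hasDerivAt_det_of_ne_zero hs hs0).deriv]
    simp [Matrix.trace, Matrix.mul_apply]
  rw [h3.deriv_eq]
  have h4 := hdet.mul (HasDerivAt.fun_sum fun i (_ : i ∈ Finset.univ) =>
    HasDerivAt.fun_sum fun j (_ : j ∈ Finset.univ) =>
      (HasDerivAt.matrix_inv_apply h1'.self_of_nhds h0 i j).mul (h2 j i))
  refine h4.deriv.trans ?_
  simp only [Pi.mul_apply]
  have e1 : ((A t)⁻¹ * A₁ t * ((A t)⁻¹ * A₁ t)).trace =
      ∑ i, ∑ j, ((A t)⁻¹ * A₁ t * (A t)⁻¹) i j * A₁ t j i := by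
    rw [← Matrix.mul_assoc, Matrix.trace]
    refine Finset.sum_congr rfl fun i _ => ?_
    rw [Matrix.diag_apply, Matrix.mul_apply]
  have e2 : ∀ B : Matrix (Fin k) (Fin k) ℝ, ((A t)⁻¹ * B).trace = ∑ i, ∑ j, (A t)⁻¹ i j * B j i :=
    fun B => by simp [Matrix.trace, Matrix.mul_apply]
  rw [e1, e2 A₂]
  have e3 := e2 (A₁ t)
  rw [← e3]
  simp only [Finset.sum_add_distrib, neg_mul, Finset.sum_neg_distrib]
  ring

/-- A perturbation of second order changes the determinant by the trace. -/
theorem det_sub_det_isLittleO {A B : ℝ → Matrix (Fin k) (Fin k) ℝ} {A₀ C : Matrix (Fin k) (Fin k) ℝ}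
    (hA : ∀ i j, Tendsto (fun t => A t i j) (𝓝 0) (𝓝 (A₀ i j)))
    (h : ∀ i j, (fun t => B t i j - A t i j - t ^ 2 * C i j) =o[𝓝 0] fun t : ℝ => t ^ 2) :
    (fun t => (B t).det - (A t).det - t ^ 2 * (A₀.adjugate * C).trace) =o[𝓝 0]
      fun t : ℝ => t ^ 2 := by
  let f : (Fin k → Fin k → ℝ) → ℝ := fun M => Matrix.det (M : Matrix (Fin k) (Fin k) ℝ)
  let u : Matrix (Fin k) (Fin k) ℝ → Fin k → Fin k → ℝ := fun M i j => M i j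
  have hf : HasStrictFDerivAt f (fderiv ℝ f (u A₀)) (u A₀) :=
    ((detCML k).contDiff (n := 1)).contDiffAt.hasStrictFDerivAt (by simp)
  have hC : fderiv ℝ f (u A₀) (u C) = (A₀.adjugate * C).trace := by
    have h1 : HasDerivAt (fun s : ℝ => u A₀ + s • u C) (u C) 0 := by
      simpa using ((hasDerivAt_id (0 : ℝ)).smul_const (u C)).const_add (u A₀)
    have h2 : HasDerivAt (fun s : ℝ => f (u A₀ + s • u C)) (fderiv ℝ f (u A₀) (u C)) 0 := by
      have h3 : HasFDerivAt f (fderiv ℝ f (u A₀)) (u A₀ + (0 : ℝ) • u C) := by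
        simpa using hf.hasFDerivAt
      exact h3.comp_hasDerivAt (0 : ℝ) h1
    have h4 := hasDerivAt_det (A := fun s : ℝ => A₀ + s • C) (A' := C) (t := 0) fun i j => by
      simpa using ((hasDerivAt_id (0 : ℝ)).mul_const (C i j)).const_add (A₀ i j)
    have h5 := h2.unique h4
    simpa using h5
  have hd : (fun t => u (B t) - u (A t) - t ^ 2 • u C) =o[𝓝 0] fun t : ℝ => t ^ 2 :=
    Asymptotics.isLittleO_pi.2 fun i => Asymptotics.isLittleO_pi.2 fun j => h i j
  have hAu : Tendsto (fun t => u (A t)) (𝓝 0) (𝓝 (u A₀)) :=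
    tendsto_pi_nhds.2 fun i => tendsto_pi_nhds.2 fun j => hA i j
  have hsq : (fun t : ℝ => t ^ 2 • u C) =O[𝓝 0] (fun t : ℝ => t ^ 2) :=
    Asymptotics.IsBigO.of_bound ‖u C‖ (Eventually.of_forall fun t => by rw [norm_smul, mul_comm])
  have hBA : (fun t => u (B t) - u (A t)) =O[𝓝 0] fun t : ℝ => t ^ 2 := by
    refine (hd.isBigO.add hsq).congr_left fun t => by abel
  have hBu : Tendsto (fun t => u (B t)) (𝓝 0) (𝓝 (u A₀)) := by
    have h0 : Tendsto (fun t => u (B t) - u (A t)) (𝓝 0) (𝓝 0) :=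
      hBA.trans_tendsto (by simpa using (continuous_pow 2).tendsto (0 : ℝ))
    simpa using h0.add hAu
  have h1 := (hf.isLittleO.comp_tendsto (hBu.prodMk_nhds hAu)).trans_isBigO hBA
  have h2 : (fun t => fderiv ℝ f (u A₀) (u (B t) - u (A t) - t ^ 2 • u C)) =o[𝓝 0]
      fun t : ℝ => t ^ 2 :=
    ((fderiv ℝ f (u A₀)).isBigO_comp _ _).trans_isLittleO hd
  refine (h1.add h2).congr_left fun t => ?_
  simp only [Function.comp_apply, map_sub, map_smul, hC, smul_eq_mul]
  change f (u (B t)) - f (u (A t)) - _ + _ = f (u (B t)) - f (u (A t)) - _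
  ring

end MatrixCalculus

section LocalDiffeo

/-- The inverse function theorem for smooth maps. -/
theorem exists_localDiffeo {m : ℕ} {Θ : Euc m → Euc m} {U : Set (Euc m)} (hU : IsOpen U)
    (hΘ : ContDiffOn ℝ ∞ Θ U) {y₀ : Euc m} (hy₀ : y₀ ∈ U) {L : Euc m ≃L[ℝ] Euc m}
    (hL : HasFDerivAt Θ (L : Euc m →L[ℝ] Euc m) y₀) :
    ∃ φ : OpenPartialHomeomorph (Euc m) (Euc m), y₀ ∈ φ.source ∧ φ.source ⊆ U ∧
      (∀ y, φ y = Θ y) ∧ ContDiffOn ℝ ∞ φ φ.source ∧ ContDiffOn ℝ ∞ φ.symm φ.target := by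
  have hat : ∀ y ∈ U, ContDiffAt ℝ ∞ Θ y := fun y hy => hΘ.contDiffAt (hU.mem_nhds hy)
  let φ₀ := (hat y₀ hy₀).toOpenPartialHomeomorph Θ hL (by simp)
  have h1 : ∀ᶠ y in 𝓝 y₀, y ∈ U ∧
      fderiv ℝ Θ y ∈ range ((↑) : (Euc m ≃L[ℝ] Euc m) → Euc m →L[ℝ] Euc m) := by
    refine Filter.Eventually.and (hU.mem_nhds hy₀) (((hat y₀ hy₀).fderiv_right (m := 0) (by simp)).continuousAt.eventually ?_)
    rw [hL.fderiv]
    exact ContinuousLinearEquiv.nhds L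
  obtain ⟨W, hW, hWo, hyW⟩ := eventually_nhds_iff.1 h1
  let φ := φ₀.restrOpen W hWo
  have hφs : φ.source ⊆ W := fun y hy => hy.2
  have hsm : ContDiffOn ℝ ∞ φ φ.source := fun y hy =>
    (hat y (hW y (hφs hy)).1).contDiffWithinAt
  refine ⟨φ, ⟨(hat y₀ hy₀).mem_toOpenPartialHomeomorph_source hL (by simp), hyW⟩,
    fun y hy => (hW y (hφs hy)).1, fun y => rfl, hsm, fun x hx => ?_⟩
  have hxs := φ.map_target hx
  obtain ⟨hxU, L', hL'⟩ := hW _ (hφs hxs)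
  refine (φ.contDiffAt_symm (f₀' := L') hx ?_ (hat _ hxU)).contDiffWithinAt
  rw [hL']
  exact ((hat _ hxU).differentiableAt (by simp)).hasFDerivAt

theorem mem_contDiffGroupoid_of_contDiffOn {m : ℕ} {φ : OpenPartialHomeomorph (Euc m) (Euc m)}
    (h : ContDiffOn ℝ ∞ φ φ.source) (h' : ContDiffOn ℝ ∞ φ.symm φ.target) :
    φ ∈ contDiffGroupoid ∞ (𝓡 m) := by
  refine mem_groupoid_of_pregroupoid.2 ⟨?_, ?_⟩
  · simpa [contDiffPregroupoid] using h
  · simpa [contDiffPregroupoid] using h'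

/-- Composing a chart with a local diffeomorphism of Euclidean space. -/
theorem trans_mem_maximalAtlas {m : ℕ} {M : Type*} [TopologicalSpace M] [ChartedSpace (Euc m) M]
    [IsManifold (𝓡 m) ∞ M] {e : OpenPartialHomeomorph M (Euc m)}
    (he : e ∈ IsManifold.maximalAtlas (𝓡 m) ∞ M) {φ : OpenPartialHomeomorph (Euc m) (Euc m)}
    (h : ContDiffOn ℝ ∞ φ φ.source) (h' : ContDiffOn ℝ ∞ φ.symm φ.target) :
    e.trans φ ∈ IsManifold.maximalAtlas (𝓡 m) ∞ M := by
  have hφ := mem_contDiffGroupoid_of_contDiffOn h h'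
  have he' := mem_maximalAtlas_iff.1 he
  refine mem_maximalAtlas_iff.2 fun e' hm => ⟨?_, ?_⟩
  · rw [OpenPartialHomeomorph.trans_symm_eq_symm_trans_symm, OpenPartialHomeomorph.trans_assoc]
    exact (contDiffGroupoid ∞ (𝓡 m)).trans ((contDiffGroupoid ∞ (𝓡 m)).symm hφ) (he' e' hm).1
  · rw [← OpenPartialHomeomorph.trans_assoc]
    exact (contDiffGroupoid ∞ (𝓡 m)).trans (he' e' hm).2 hφ

end LocalDiffeo

section Slice

variable {n : ℕ}

theorem sliceIncl_castSucc (z : Euc n) (i : Fin n) : sliceIncl z i.castSucc = z i := by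
  simp [sliceIncl]

theorem sliceIncl_last (z : Euc n) : sliceIncl z (Fin.last n) = 0 := by
  simp [sliceIncl]

variable (n) in
/-- The inclusion of the slice as a continuous linear map. -/
def sliceInclL : Euc n →L[ℝ] Euc (n + 1) :=
  LinearMap.toContinuousLinearMap
    { toFun := sliceIncl
      map_add' := fun z w => by
        ext i
        refine Fin.lastCases ?_ (fun i => ?_) i
        · simp [sliceIncl_last]
        · simp [sliceIncl_castSucc]
      map_smul' := fun c z => by
        ext i
        refine Fin.lastCases ?_ (fun i => ?_) i
        · simp [sliceIncl_last]
        · simp [sliceIncl_castSucc] }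

theorem sliceInclL_apply (z : Euc n) : sliceInclL n z = sliceIncl z := rfl

variable (n) in
/-- The projection to the slice. -/
def sliceProj : Euc (n + 1) →L[ℝ] Euc n :=
  LinearMap.toContinuousLinearMap
    { toFun := fun y => WithLp.toLp 2 fun i => y i.castSucc
      map_add' := fun y w => by ext i; simp
      map_smul' := fun c y => by ext i; simp }

theorem sliceProj_apply (y : Euc (n + 1)) (i : Fin n) : sliceProj n y i = y i.castSucc := rfl

theorem sliceProj_sliceIncl (z : Euc n) : sliceProj n (sliceIncl z) = z := by
  ext i; rw [sliceProj_apply, sliceIncl_castSucc]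

variable (n) in
/-- The last coordinate vector. -/
def vert : Euc (n + 1) := EuclideanSpace.single (Fin.last n) 1

theorem vert_last : vert n (Fin.last n) = 1 := by simp [vert]

theorem vert_castSucc (i : Fin n) : vert n i.castSucc = 0 := by
  simp [vert, PiLp.single_apply, Fin.castSucc_ne_last]

theorem sliceProj_vert : sliceProj n (vert n) = 0 := by
  ext i; rw [sliceProj_apply, vert_castSucc]; rfl

theorem eq_sliceIncl_add (y : Euc (n + 1)) :
    y = sliceIncl (sliceProj n y) + y (Fin.last n) • vert n := by
  ext i
  refine Fin.lastCases ?_ (fun i => ?_) i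
  · simp [sliceIncl_last, vert_last]
  · simp [sliceIncl_castSucc, vert_castSucc, sliceProj_apply]

theorem eq_sliceIncl_of_last {y : Euc (n + 1)} (h : y (Fin.last n) = 0) :
    y = sliceIncl (sliceProj n y) := by
  conv_lhs => rw [eq_sliceIncl_add y, h, zero_smul, add_zero]

theorem sliceIncl_single (i : Fin n) :
    sliceIncl (EuclideanSpace.single i 1) = EuclideanSpace.single i.castSucc 1 := by
  ext j
  refine Fin.lastCases ?_ (fun j => ?_) j
  · simp [sliceIncl_last, PiLp.single_apply, (Fin.castSucc_ne_last i).symm]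
  · simp [sliceIncl_castSucc, PiLp.single_apply]

theorem contDiff_sliceIncl {r : WithTop ℕ∞} : ContDiff ℝ r (sliceIncl : Euc n → Euc (n + 1)) :=
  (sliceInclL n).contDiff

theorem hasFDerivAt_sliceIncl (z : Euc n) : HasFDerivAt sliceIncl (sliceInclL n) z :=
  (sliceInclL n).hasFDerivAt

theorem fderiv_comp_sliceIncl {F : Type*} [NormedAddCommGroup F] [NormedSpace ℝ F]
    {f : Euc (n + 1) → F} {z : Euc n} (hf : DifferentiableAt ℝ f (sliceIncl z)) (v : Euc n) :
    fderiv ℝ (fun x => f (sliceIncl x)) z v = fderiv ℝ f (sliceIncl z) (sliceIncl v) := by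
  exact congrArg (fun L : Euc n →L[ℝ] F => L v)
    (hf.hasFDerivAt.comp z (hasFDerivAt_sliceIncl z)).fderiv

theorem quad_sliceIncl (g : Matrix (Fin (n + 1)) (Fin (n + 1)) ℝ) (v w : Euc n) :
    quad g (sliceIncl v) (sliceIncl w) = quad (g.submatrix Fin.castSucc Fin.castSucc) v w := by
  simp [quad, Fin.sum_univ_castSucc, sliceIncl_castSucc, sliceIncl_last]

theorem quad_vert (g : Matrix (Fin (n + 1)) (Fin (n + 1)) ℝ) : quad g (vert n) (vert n) =
    g (Fin.last n) (Fin.last n) := quad_single _ _ _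

theorem quad_sliceIncl_vert (g : Matrix (Fin (n + 1)) (Fin (n + 1)) ℝ) (v : Euc n) :
    quad g (sliceIncl v) (vert n) = ∑ i, v i * g i.castSucc (Fin.last n) := by
  simp [quad, Fin.sum_univ_castSucc, sliceIncl_castSucc, sliceIncl_last, vert_castSucc, vert_last]

end Slice

section MetricInCharts

variable {n : ℕ} {M : Type*} [EMetricSpace M] [ChartedSpace (Euc (n + 1)) M]
  [IsManifold (𝓡 (n + 1)) ∞ M]
  [RiemannianBundle (fun x : M => TangentSpace (𝓡 (n + 1)) x)]

theorem chartVec_single (e : Chart n M) (y : Euc (n + 1))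
    (i : Fin (n + 1)) : chartVec e y (EuclideanSpace.single i 1) = coordVec e i y := rfl

theorem frameGram_single {m : ℕ} (g : Matrix (Fin m) (Fin m) ℝ) :
    frameGram g (fun i => EuclideanSpace.single i 1) = g := by
  ext i j; exact quad_single g i j

theorem det_metricCoord_pos {e : Chart n M}
    (he : e ∈ smoothAtlas n M) {y : Euc (n + 1)} (hy : y ∈ e.target) :
    0 < (metricCoord e y).det := by
  have h := det_frameGram_pos he hy (b := fun i => EuclideanSpace.single i 1)
    (EuclideanSpace.orthonormal_single (𝕜 := ℝ)).linearIndependent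
  rwa [frameGram_single] at h

theorem linearIndependent_sliceIncl {k : ℕ} {b : Fin k → Euc n} (hb : LinearIndependent ℝ b) :
    LinearIndependent ℝ (fun i => sliceIncl (b i)) :=
  hb.map' (sliceInclL n).toLinearMap (LinearMap.ker_eq_bot.2 fun z w h => by
    have := congrArg (sliceProj n) (show sliceIncl z = sliceIncl w from h)
    rwa [sliceProj_sliceIncl, sliceProj_sliceIncl] at this)

theorem det_inducedMetric_pos {e : Chart n M}
    (he : e ∈ smoothAtlas n M) {z : Euc n} (hz : sliceIncl z ∈ e.target) :
    0 < (inducedMetric e z).det := by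
  have h := det_frameGram_pos he hz (b := fun i => sliceIncl (EuclideanSpace.single i 1))
    (linearIndependent_sliceIncl (EuclideanSpace.orthonormal_single (𝕜 := ℝ)).linearIndependent)
  have h2 : frameGram (metricCoord e (sliceIncl z))
      (fun i => sliceIncl (EuclideanSpace.single i 1)) = inducedMetric e z := by
    ext i j
    change quad _ (sliceIncl (EuclideanSpace.single i 1)) (sliceIncl (EuclideanSpace.single j 1)) = _
    rw [sliceIncl_single, sliceIncl_single, quad_single]; rfl
  rwa [h2] at h

theorem quad_metricCoord_change {e e' : Chart n M}
    (he : e ∈ smoothAtlas n M)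
    (he' : e' ∈ smoothAtlas n M) {y : Euc (n + 1)}
    (hy : y ∈ e.target) (hy' : e.symm y ∈ e'.source) (v w : Euc (n + 1)) :
    quad (metricCoord e y) v w = quad (metricCoord e' (coordMap e e' id y))
      (fderiv ℝ (coordMap e e' id) y v) (fderiv ℝ (coordMap e e' id) y w) := by
  have h1 := mfderiv_chartVec he he' (G := id) hy mdifferentiableAt_id hy'
  simp only [mfderiv_id] at h1
  rw [← inner_chartVec, ← inner_chartVec]
  refine Eq.trans ?_ (inner_tangent_congr (n := n) (e'.left_inv hy' :
    e'.symm (coordMap e e' id y) = e.symm y) _ _).symm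
  rw [← h1 v, ← h1 w]; rfl

/-- The components of a vector with given covariant components. -/
theorem chartVec_inv_metricCoord {e : Chart n M}
    (he : e ∈ smoothAtlas n M) {y : Euc (n + 1)} (hy : y ∈ e.target)
    (v : TangentSpace (𝓡 (n + 1)) (e.symm y)) :
    chartVec e y (WithLp.toLp 2 fun i => ∑ j, (metricCoord e y)⁻¹ i j * inner ℝ (coordVec e j y) v) =
      v := by
  obtain ⟨w, rfl⟩ : ∃ w, chartVec e y w = v := ⟨_, chartVec_chartComp he hy v⟩
  congr 1
  have h1 : (fun j => inner ℝ (coordVec e j y) (chartVec e y w)) = (metricCoord e y).mulVec w := by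
    ext j
    rw [← chartVec_single, inner_chartVec]
    simp [quad, Matrix.mulVec, dotProduct, PiLp.single_apply]
  ext i
  have h2 : (metricCoord e y)⁻¹.mulVec ((metricCoord e y).mulVec w) = w := by
    rw [Matrix.mulVec_mulVec, Matrix.nonsing_inv_mul _
      (isUnit_iff_ne_zero.2 (det_metricCoord_pos he hy).ne'), Matrix.one_mulVec]
  refine Eq.trans ?_ (congrFun h2 i)
  rw [← h1]; rfl

theorem vecComp_chartVec {e : Chart n M}
    (he : e ∈ smoothAtlas n M) {y : Euc (n + 1)} (hy : y ∈ e.target)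
    {ν : (p : M) → TangentSpace (𝓡 (n + 1)) p} {w : Euc (n + 1)}
    (h : ν (e.symm y) = chartVec e y w) (i : Fin (n + 1)) : vecComp e ν y i = w i := by
  have h1 := chartVec_inv_metricCoord he hy (ν (e.symm y))
  rw [h] at h1
  have h2 := chartVec_injective he hy h1
  rw [← h2, vecComp, h]

variable {A : Set M} {e : Chart n M}

theorem IsSliceChart.mem_regPart (he : IsSliceChart A e) {z : Euc n} (hz : sliceIncl z ∈ e.target) :
    e.symm (sliceIncl z) ∈ regPart n A :=
  ⟨(he.2 _ (e.map_target hz)).2 (by rw [e.right_inv hz, sliceIncl_last]), e, he, e.map_target hz⟩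

theorem IsSliceChart.exists_eq (he : IsSliceChart A e) {p : M} (hp : p ∈ e.source) (hpA : p ∈ A) :
    ∃ z : Euc n, sliceIncl z ∈ e.target ∧ e.symm (sliceIncl z) = p := by
  have h1 := eq_sliceIncl_of_last ((he.2 p hp).1 hpA)
  exact ⟨sliceProj n (e p), h1 ▸ e.map_source hp, by rw [← h1, e.left_inv hp]⟩

variable {ν : (p : M) → TangentSpace (𝓡 (n + 1)) p}

/-- The unit normal in a slice chart. -/
theorem IsUnitNormal.eq_chartVec (hν : IsUnitNormal A ν) (he : IsSliceChart A e) {z : Euc n}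
    (hz : sliceIncl z ∈ e.target) {c : ℝ}
    (hc : inner ℝ (coordVec e (Fin.last n) (sliceIncl z)) (ν (e.symm (sliceIncl z))) = c) :
    ν (e.symm (sliceIncl z)) = chartVec e (sliceIncl z)
      (c • WithLp.toLp 2 fun i => (metricCoord e (sliceIncl z))⁻¹ i (Fin.last n)) ∧
    c ^ 2 * (metricCoord e (sliceIncl z))⁻¹ (Fin.last n) (Fin.last n) = 1 := by
  have h1 := chartVec_inv_metricCoord he.1 hz (ν (e.symm (sliceIncl z)))
  simp only [Fin.sum_univ_castSucc, hν.normal e he z hz, mul_zero, Finset.sum_const_zero, zero_add,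
    hc] at h1
  have h2 : (WithLp.toLp 2 fun i => (metricCoord e (sliceIncl z))⁻¹ i (Fin.last n) * c) =
      c • (WithLp.toLp 2 fun i => (metricCoord e (sliceIncl z))⁻¹ i (Fin.last n) : Euc (n + 1)) := by
    ext i; simp [mul_comm]
  rw [h2] at h1
  refine ⟨h1.symm, ?_⟩
  have h3 := hν.norm_eq_one _ (he.mem_regPart hz)
  have h4 : inner ℝ (chartVec e (sliceIncl z)
      (c • WithLp.toLp 2 fun i => (metricCoord e (sliceIncl z))⁻¹ i (Fin.last n)))
      (ν (e.symm (sliceIncl z))) = (1 : ℝ) := by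
    rw [h1, real_inner_self_eq_norm_sq, h3, one_pow]
  rw [chartVec_eq_sum, sum_inner, Fin.sum_univ_castSucc] at h4
  simp only [real_inner_smul_left, hν.normal e he z hz, mul_zero, Finset.sum_const_zero, zero_add,
    hc, PiLp.smul_apply, smul_eq_mul] at h4
  linarith

end MetricInCharts

section Lapse

variable {n : ℕ} {M : Type*} [EMetricSpace M] [ChartedSpace (Euc (n + 1)) M]
  [IsManifold (𝓡 (n + 1)) ∞ M]
  [RiemannianBundle (fun x : M => TangentSpace (𝓡 (n + 1)) x)]

/-- A slice chart whose last coordinate vector is `u ν` on the slice and is orthogonal to the other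
ones to first order. -/
structure IsLapseChart (A S : Set M) (ν : (p : M) → TangentSpace (𝓡 (n + 1)) p) (u : M → ℝ)
    (e : Chart n M) : Prop where
  slice : IsSliceChart A e
  disj : ∀ p ∈ e.source, p ∉ S
  coordVec_last : ∀ z, sliceIncl z ∈ e.target → coordVec e (Fin.last n) (sliceIncl z) =
    u (e.symm (sliceIncl z)) • ν (e.symm (sliceIncl z))
  dcross : ∀ z, sliceIncl z ∈ e.target → ∀ i : Fin n,
    pd (Fin.last n) (fun y => metricCoord e y i.castSucc (Fin.last n)) (sliceIncl z) = 0

/-- The quadratic map with given first and second normal derivatives along the slice. -/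
def lapseMap (U : Euc n → Euc (n + 1)) (b : Euc n → Euc n) (y : Euc (n + 1)) : Euc (n + 1) :=
  sliceIncl (sliceProj n y) + y (Fin.last n) • U (sliceProj n y) +
    (y (Fin.last n) ^ 2 / 2) • sliceIncl (b (sliceProj n y))

theorem fderiv_lapseMap {U : Euc n → Euc (n + 1)} {b : Euc n → Euc n} {y : Euc (n + 1)}
    (hU : DifferentiableAt ℝ U (sliceProj n y)) (hb : DifferentiableAt ℝ b (sliceProj n y)) :
    DifferentiableAt ℝ (lapseMap U b) y ∧ ∀ v, fderiv ℝ (lapseMap U b) y v = sliceIncl (sliceProj n v) +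
      (y (Fin.last n) • fderiv ℝ U (sliceProj n y) (sliceProj n v) + v (Fin.last n) • U (sliceProj n y)) +
      ((y (Fin.last n) ^ 2 / 2) • sliceIncl (fderiv ℝ b (sliceProj n y) (sliceProj n v)) +
        (y (Fin.last n) * v (Fin.last n)) • sliceIncl (b (sliceProj n y))) := by
  have hl : HasFDerivAt (fun y : Euc (n + 1) => y (Fin.last n))
      (EuclideanSpace.proj (Fin.last n) : Euc (n + 1) →L[ℝ] ℝ) y :=
    (EuclideanSpace.proj (Fin.last n) : Euc (n + 1) →L[ℝ] ℝ).hasFDerivAt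
  have h1 : HasFDerivAt (fun y => sliceIncl (sliceProj n y)) ((sliceInclL n).comp (sliceProj n)) y :=
    ((sliceInclL n).comp (sliceProj n)).hasFDerivAt
  have h2 : HasFDerivAt (fun y => U (sliceProj n y)) ((fderiv ℝ U (sliceProj n y)).comp (sliceProj n)) y :=
    hU.hasFDerivAt.comp y (sliceProj n).hasFDerivAt
  have h3 : HasFDerivAt (fun y => sliceIncl (b (sliceProj n y)))
      ((sliceInclL n).comp ((fderiv ℝ b (sliceProj n y)).comp (sliceProj n))) y :=
    (sliceInclL n).hasFDerivAt.comp y (hb.hasFDerivAt.comp y (sliceProj n).hasFDerivAt)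
  have h4 : HasFDerivAt (fun y => sliceIncl (sliceProj n y) + y (Fin.last n) • U (sliceProj n y) +
      (y (Fin.last n) ^ 2 * (2⁻¹ : ℝ)) • sliceIncl (b (sliceProj n y))) _ y := (h1.add (hl.smul h2)).add (((hl.pow 2).mul_const (2⁻¹ : ℝ)).smul h3)
  have he : lapseMap U b = fun y => sliceIncl (sliceProj n y) + y (Fin.last n) • U (sliceProj n y) +
      (y (Fin.last n) ^ 2 * (2⁻¹ : ℝ)) • sliceIncl (b (sliceProj n y)) := by
    funext y; rw [lapseMap, div_eq_mul_inv]
  rw [he]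
  refine ⟨h4.differentiableAt, fun v => ?_⟩
  rw [h4.fderiv]
  ext i
  simp [sliceInclL_apply]
  ring

variable [IsContMDiffRiemannianBundle (𝓡 (n + 1)) ∞ (Euc (n + 1))
    (fun x : M => TangentSpace (𝓡 (n + 1)) x)]
  {A S : Set M} {ν : (p : M) → TangentSpace (𝓡 (n + 1)) p} {u : M → ℝ}

theorem continuousOn_coordVec {e : Chart n M}
    (he : e ∈ smoothAtlas n M) (k : Fin (n + 1)) :
    ContinuousOn (fun x => (⟨e.symm x, coordVec e k x⟩ : TangentBundle (𝓡 (n + 1)) M)) e.target := by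
  have h1 := (mem_atlas_contMDiffOn_symm he).contMDiffOn_tangentMapWithin (m := ∞) (by simp)
    e.open_target.uniqueMDiffOn
  have h3 : ContMDiff (𝓡 (n + 1)) ((𝓡 (n + 1)).prod 𝓘(ℝ, Euc (n + 1))) ∞
      (fun x : Euc (n + 1) => (⟨x, EuclideanSpace.single k (1 : ℝ)⟩ :
        TangentBundle (𝓡 (n + 1)) (Euc (n + 1)))) :=
    contMDiff_vectorSpace_iff_contDiff
      (V := fun _ : Euc (n + 1) => EuclideanSpace.single k (1 : ℝ)).2 contDiff_const
  refine (h1.comp h3.contMDiffOn fun x hx => hx).continuousOn.congr fun x hx => ?_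
  simp only [Function.comp_apply, tangentMapWithin]
  rw [mfderivWithin_of_isOpen e.open_target hx]
  rfl

/-- The unit normal has smooth components in slice charts. -/
theorem IsUnitNormal.exists_smooth_components (hν : IsUnitNormal A ν)
    {e : Chart n M} (he : IsSliceChart A e) {z₀ : Euc n}
    (hz₀ : sliceIncl z₀ ∈ e.target) : ∃ w : Euc n → Euc (n + 1), ∀ᶠ z in 𝓝 z₀,
      ContDiffAt ℝ ∞ w z ∧ ν (e.symm (sliceIncl z)) = chartVec e (sliceIncl z) (w z) ∧
      w z (Fin.last n) ≠ 0 := by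
  have hT : IsOpen {z : Euc n | sliceIncl z ∈ e.target} :=
    e.open_target.preimage (sliceInclL n).continuous
  set c : Euc n → ℝ := fun z =>
    inner ℝ (coordVec e (Fin.last n) (sliceIncl z)) (ν (e.symm (sliceIncl z))) with hc
  have : IsContinuousRiemannianBundle (Euc (n + 1)) (fun p : M => TangentSpace (𝓡 (n + 1)) p) := by
    obtain ⟨g, hg, h⟩ := IsContMDiffRiemannianBundle.exists_contMDiff (IB := 𝓡 (n + 1)) (n := ∞)
      (F := Euc (n + 1)) (E := fun p : M => TangentSpace (𝓡 (n + 1)) p)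
    exact ⟨g, hg.continuous, h⟩
  have hcont : ContinuousAt c z₀ := by
    have h1 := ContinuousWithinAt.inner_bundle (E := fun p : M => TangentSpace (𝓡 (n + 1)) p)
      (F := Euc (n + 1)) (b := fun z : Euc n => e.symm (sliceIncl z))
      (s := {z : Euc n | sliceIncl z ∈ e.target}) (x := z₀)
      (v := fun z => coordVec e (Fin.last n) (sliceIncl z))
      (w := fun z => ν (e.symm (sliceIncl z)))
      (((continuousOn_coordVec he.1 (Fin.last n)).comp (sliceInclL n).continuous.continuousOn
        fun z hz => hz) z₀ hz₀)
      ((hν.continuousOn.comp (e.continuousOn_symm.comp (sliceInclL n).continuous.continuousOn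
        fun z hz => hz) fun z hz => he.mem_regPart hz) z₀ hz₀)
    exact h1.continuousAt (hT.mem_nhds hz₀)
  set α : Euc n → ℝ := fun z => (metricCoord e (sliceIncl z))⁻¹ (Fin.last n) (Fin.last n)
  have hcα : ∀ z, sliceIncl z ∈ e.target → c z ^ 2 * α z = 1 := fun z hz =>
    (hν.eq_chartVec he hz rfl).2
  set s : ℝ := (SignType.sign (c z₀) : ℝ) with hs
  have hc0 : c z₀ ≠ 0 := fun h => by simpa [h] using hcα z₀ hz₀
  have hs2 : s * s = 1 := by
    rcases lt_or_gt_of_ne hc0 with h | h <;> simp [hs, h]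
  have hpos : ∀ᶠ z in 𝓝 z₀, 0 < s * c z := by
    refine (continuousAt_const.mul hcont).eventually (lt_mem_nhds ?_)
    rcases lt_or_gt_of_ne hc0 with h | h <;> simp [hs, h]
  set w : Euc n → Euc (n + 1) := fun z =>
    (s * Real.sqrt (α z)⁻¹) • WithLp.toLp 2 fun i => (metricCoord e (sliceIncl z))⁻¹ i (Fin.last n)
  refine ⟨w, ?_⟩
  filter_upwards [hpos, hT.mem_nhds hz₀] with z hzs hzt
  have hα : 0 < α z := by
    by_contra h
    have := hcα z hzt
    nlinarith [sq_nonneg (c z)]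
  have hcz : c z = s * Real.sqrt (α z)⁻¹ := by
    have h1 : s * c z = Real.sqrt (α z)⁻¹ := by
      rw [eq_comm, Real.sqrt_eq_iff_mul_self_eq_of_pos hzs]
      have := hcα z hzt
      field_simp
      linear_combination (s * s) * this + hs2
    rw [← h1, ← mul_assoc, hs2, one_mul]
  have hinv : ∀ i j, ContDiffAt ℝ ∞ (fun z : Euc n => (metricCoord e (sliceIncl z))⁻¹ i j) z :=
    fun i j => ContDiffAt.comp (g := fun y => (metricCoord e y)⁻¹ i j) z
      (ContDiffAt.matrix_inv_apply (fun a b => contDiffAt_metricCoord he.1 hzt a b)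
        (det_metricCoord_pos he.1 hzt).ne' i j) contDiff_sliceIncl.contDiffAt
  refine ⟨?_, ?_, ?_⟩
  · have h1 : ContDiffAt ℝ ∞ (fun z : Euc n => (WithLp.toLp 2 fun i =>
        (metricCoord e (sliceIncl z))⁻¹ i (Fin.last n) : Euc (n + 1))) z :=
      contDiffAt_euclidean.2 fun i => hinv i _
    have h2 : ContDiffAt ℝ ∞ (fun z => Real.sqrt (α z)⁻¹) z :=
      ((hinv _ _).inv hα.ne').sqrt (inv_ne_zero hα.ne')
    exact (contDiffAt_const.mul h2).smul h1
  · have h1 := (hν.eq_chartVec he hzt rfl).1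
    rw [h1]; congr 2
  · simp only [w, PiLp.smul_apply, smul_eq_mul]
    refine mul_ne_zero (mul_ne_zero (left_ne_zero_of_mul (hs2.trans_ne one_ne_zero)) ?_) hα.ne'
    exact (Real.sqrt_pos.2 (inv_pos.2 hα)).ne'


theorem isOpen_sliceDomain (hS : IsClosed S) (e : Chart n M) :
    IsOpen (sliceDomain e S) :=
  (e.symm.isOpen_inter_preimage hS.isOpen_compl).preimage (sliceInclL n).continuous

theorem contDiffAt_dirMatrix {e : Chart n M}
    (he : e ∈ smoothAtlas n M) {z : Euc n} (hz : sliceIncl z ∈ e.target)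
    {U : Euc n → Euc (n + 1)} (hU : ContDiffAt ℝ ∞ U z) (i j : Fin (n + 1)) :
    ContDiffAt ℝ ∞ (fun x => dirMatrix (metricCoord e) (sliceIncl x) (U x) i j) z := by
  have h1 : ContDiffAt ℝ ∞ (fun x => fderiv ℝ (fun y => metricCoord e y i j) (sliceIncl x)) z :=
    ContDiffAt.comp (g := fderiv ℝ fun y => metricCoord e y i j) z
      ((contDiffAt_metricCoord he hz i j).fderiv_right (m := ∞) (by simp)) contDiff_sliceIncl.contDiffAt
  exact h1.clm_apply hU

/-- Lapse charts exist around every point of the hypersurface outside `S`. -/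
theorem IsPositiveJacobi.exists_lapseChart (hν : IsUnitNormal A ν) (hS : IsClosed S)
    (hsing : singPart n A ⊆ S) (hu : IsPositiveJacobi A S ν u) {p : M} (hp : p ∈ A) (hpS : p ∉ S) :
    ∃ e, IsLapseChart A S ν u e ∧ p ∈ e.source := by
  obtain ⟨-, e₀, he₀, hpe⟩ : p ∈ regPart n A := by_contra fun h => hpS (hsing ⟨hp, h⟩)
  obtain ⟨z₀, hz₀, rfl⟩ := he₀.exists_eq hpe hp
  obtain ⟨w, hw⟩ := hν.exists_smooth_components he₀ hz₀
  have hm := he₀.1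
  set T : Set (Euc (n + 1)) := e₀.target ∩ e₀.symm ⁻¹' Sᶜ
  have hTo : IsOpen T := e₀.symm.isOpen_inter_preimage hS.isOpen_compl
  have hDo : IsOpen (sliceDomain e₀ S) := isOpen_sliceDomain hS e₀
  obtain ⟨N, hN, hNo, hzN⟩ := eventually_nhds_iff.1
    (hw.and (hDo.mem_nhds (show z₀ ∈ sliceDomain e₀ S from ⟨hz₀, hpS⟩)))
  set g := metricCoord e₀
  set U : Euc n → Euc (n + 1) := fun z => sliceFun e₀ u z • w z
  have hupos : ∀ z ∈ N, 0 < sliceFun e₀ u z := fun z hz =>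
    hu.pos _ ⟨(he₀.mem_regPart (hN z hz).2.1).1, (hN z hz).2.2⟩
  have hU : ∀ z ∈ N, ContDiffAt ℝ ∞ U z := fun z hz =>
    ((hu.smooth e₀ he₀).contDiffAt (hDo.mem_nhds (hN z hz).2)).smul (hN z hz).1.1
  have hUl : ∀ z ∈ N, U z (Fin.last n) ≠ 0 := fun z hz =>
    mul_ne_zero (hupos z hz).ne' (hN z hz).1.2.2
  have hg : ∀ z ∈ N, ∀ i j, ContDiffAt ℝ ∞ (fun x : Euc n => g (sliceIncl x) i j) z :=
    fun z hz i j => (contDiffAt_metricCoord hm (hN z hz).2.1 i j).comp z contDiff_sliceIncl.contDiffAt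
  set r : Fin n → Euc n → ℝ := fun i z =>
    quad (g (sliceIncl z)) (fderiv ℝ U z (EuclideanSpace.single i 1)) (U z) +
      quad (dirMatrix g (sliceIncl z) (U z)) (EuclideanSpace.single i.castSucc 1) (U z) with hr
  have hrc : ∀ z ∈ N, ∀ i, ContDiffAt ℝ ∞ (r i) z := fun z hz i =>
    (ContDiffAt.quad (hg z hz) (((hU z hz).fderiv_right (m := ∞) (by simp)).clm_apply contDiffAt_const)
      (hU z hz)).add (ContDiffAt.quad (contDiffAt_dirMatrix hm (hN z hz).2.1 (hU z hz))
        contDiffAt_const (hU z hz))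
  set b : Euc n → Euc n := fun z => WithLp.toLp 2 fun i => ∑ j, -((inducedMetric e₀ z)⁻¹ i j * r j z)
    with hb
  have hbc : ∀ z ∈ N, ContDiffAt ℝ ∞ b z := fun z hz => contDiffAt_euclidean.2 fun i =>
    show ContDiffAt ℝ ∞ (fun x => ∑ j, -((inducedMetric e₀ x)⁻¹ i j * r j x)) z from
    ContDiffAt.sum fun j _ => ((ContDiffAt.matrix_inv_apply (A := fun x => inducedMetric e₀ x)
      (fun a b => hg z hz _ _)
      (det_inducedMetric_pos hm (hN z hz).2.1).ne' i j).mul (hrc z hz j)).neg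
  have hbeq : ∀ z ∈ N, ∀ i : Fin n, quad (g (sliceIncl z)) (EuclideanSpace.single i.castSucc 1)
      (sliceIncl (b z)) = -r i z := fun z hz i => by
    have h1 : (inducedMetric e₀ z).mulVec ((inducedMetric e₀ z)⁻¹.mulVec fun j => -r j z) =
        fun j => -r j z := by
      rw [Matrix.mulVec_mulVec, Matrix.mul_nonsing_inv _
        (isUnit_iff_ne_zero.2 (det_inducedMetric_pos hm (hN z hz).2.1).ne'), Matrix.one_mulVec]
    rw [← congrFun h1 i, ← sliceIncl_single, quad_sliceIncl]
    simp [quad, PiLp.single_apply, Matrix.mulVec, dotProduct, hb, inducedMetric, g]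
  set Θ := lapseMap U b with hΘ
  set N' : Set (Euc (n + 1)) := sliceProj n ⁻¹' N
  have hN'o : IsOpen N' := hNo.preimage (sliceProj n).continuous
  have hΘc : ContDiffOn ℝ ∞ Θ N' := fun y hy => by
    have h1 : ContDiffAt ℝ ∞ (fun y => U (sliceProj n y)) y :=
      ContDiffAt.comp (g := U) y (hU _ hy) (sliceProj n).contDiff.contDiffAt
    have h2 : ContDiffAt ℝ ∞ (fun y => sliceIncl (b (sliceProj n y))) y :=
      contDiff_sliceIncl.contDiffAt.comp y
        (ContDiffAt.comp (g := b) y (hbc _ hy) (sliceProj n).contDiff.contDiffAt)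
    have h3 : ContDiff ℝ ∞ (fun y : Euc (n + 1) => y (Fin.last n)) := by fun_prop
    have h4 : ContDiff ℝ ∞ (fun y => sliceIncl (sliceProj n y)) :=
      contDiff_sliceIncl.comp (sliceProj n).contDiff
    exact ((h4.contDiffAt.add (h3.contDiffAt.smul h1)).add
      (((h3.pow 2).div_const 2).contDiffAt.smul h2)).contDiffWithinAt
  have hΘd : ∀ y ∈ N', DifferentiableAt ℝ Θ y ∧ ∀ v, fderiv ℝ Θ y v = _ := fun y hy =>
    fderiv_lapseMap ((hU _ hy).differentiableAt (by simp)) ((hbc _ hy).differentiableAt (by simp))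
  have hΘs : ∀ z, Θ (sliceIncl z) = sliceIncl z := fun z => by
    simp [hΘ, lapseMap, sliceIncl_last, sliceProj_sliceIncl]
  set W := N' ∩ Θ ⁻¹' T
  have hWo : IsOpen W := hΘc.continuousOn.isOpen_inter_preimage hN'o hTo
  have hsN : ∀ {z}, z ∈ N → sliceIncl z ∈ N' := fun {z} hz => by
    rw [mem_preimage, sliceProj_sliceIncl]; exact hz
  have hzW : sliceIncl z₀ ∈ W := ⟨hsN hzN, by
    rw [mem_preimage, hΘs]; exact ⟨hz₀, hpS⟩⟩
  have hΘs' : ∀ z ∈ N, ∀ v, fderiv ℝ Θ (sliceIncl z) v =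
      sliceIncl (sliceProj n v) + v (Fin.last n) • U z := fun z hz v => by
    rw [(hΘd _ (hsN hz)).2 v]
    simp [sliceIncl_last, sliceProj_sliceIncl]
  obtain ⟨L, hL⟩ : ∃ L : Euc (n + 1) ≃L[ℝ] Euc (n + 1),
      (L : Euc (n + 1) →L[ℝ] Euc (n + 1)) = fderiv ℝ Θ (sliceIncl z₀) := by
    have hinj : Function.Injective (fderiv ℝ Θ (sliceIncl z₀)).toLinearMap := by
      rw [← LinearMap.ker_eq_bot, LinearMap.ker_eq_bot']
      intro v hv
      have h1 : sliceIncl (sliceProj n v) + v (Fin.last n) • U z₀ = 0 := (hΘs' z₀ hzN v).symm.trans hv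
      have h2 := congrArg (fun y : Euc (n + 1) => y (Fin.last n)) h1
      simp only [PiLp.add_apply, sliceIncl_last, PiLp.smul_apply, smul_eq_mul, zero_add,
        PiLp.zero_apply] at h2
      have h3 := (mul_eq_zero.1 h2).resolve_right (hUl z₀ hzN)
      rw [h3, zero_smul, add_zero] at h1
      rw [eq_sliceIncl_of_last h3, h1]
    exact ⟨(LinearEquiv.ofInjectiveEndo _ hinj).toContinuousLinearEquiv, by ext v; rfl⟩
  obtain ⟨φ, hzφ, hφW, hφΘ, hφc, hφc'⟩ := exists_localDiffeo hWo (hΘc.mono inter_subset_left) hzW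
    (L := L) (by rw [hL]; exact (hΘd _ (hsN hzN)).1.hasFDerivAt)
  set e := e₀.trans φ.symm with he
  have hem : e ∈ smoothAtlas n M :=
    trans_mem_maximalAtlas hm (φ := φ.symm) hφc' (by simpa using hφc)
  have hsymm : ∀ y, e.symm y = e₀.symm (Θ y) := fun y => by rw [← hφΘ]; rfl
  have het : ∀ y ∈ e.target, y ∈ φ.source := fun y hy => by
    rw [he, OpenPartialHomeomorph.trans_target] at hy; exact hy.1
  have htW : ∀ y ∈ e.target, sliceProj n y ∈ N ∧ Θ y ∈ T := fun y hy => hφW (het y hy)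
  have hsrc : ∀ q ∈ e.source, e q ∈ e.target ∧ e₀ q = Θ (e q) ∧ q ∈ e₀.source := fun q hq => by
    have h1 := e.map_source hq
    have h2 : q ∈ e₀.source := by
      rw [he, OpenPartialHomeomorph.trans_source] at hq; exact hq.1
    refine ⟨h1, ?_, h2⟩
    have h3 := e.left_inv hq
    rw [hsymm] at h3
    rw [← e₀.right_inv (htW _ h1).2.1, h3]
  have hcoord : ∀ y ∈ e.target, coordMap e e₀ id =ᶠ[𝓝 y] Θ := fun y hy => by
    filter_upwards [e.open_target.mem_nhds hy] with x hx
    change e₀ (e.symm x) = Θ x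
    rw [hsymm, e₀.right_inv (htW x hx).2.1]
  have hsrc₀ : ∀ y ∈ e.target, e.symm y ∈ e₀.source := fun y hy => (hsrc _ (e.map_target hy)).2.2
  have hslice : IsSliceChart A e := by
    refine ⟨hem, fun q hq => ?_⟩
    obtain ⟨h1, h2, h3⟩ := hsrc q hq
    rw [he₀.2 q h3, h2]
    have h4 : Θ (e q) (Fin.last n) = e q (Fin.last n) * U (sliceProj n (e q)) (Fin.last n) := by
      simp [hΘ, lapseMap, sliceIncl_last]
    rw [h4, mul_eq_zero, or_iff_left (hUl _ (htW _ h1).1)]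
  refine ⟨e, ⟨hslice, fun q hq hqS => ?_, fun z hz => ?_, fun z hz i => ?_⟩, ?_⟩
  · obtain ⟨h1, h2, h3⟩ := hsrc q hq
    have h4 := (htW _ h1).2.2
    rw [← h2, mem_preimage, e₀.left_inv h3] at h4
    exact h4 hqS
  · have hzN' : z ∈ N := by simpa [sliceProj_sliceIncl] using (htW _ hz).1
    have h1 := mfderiv_chartVec hem hm (G := id) hz mdifferentiableAt_id (hsrc₀ _ hz) (vert n)
    simp only [mfderiv_id] at h1
    have hpt : e.symm (sliceIncl z) = e₀.symm (sliceIncl z) := by rw [hsymm, hΘs]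
    have h2 : coordMap e e₀ id (sliceIncl z) = sliceIncl z := by
      rw [(hcoord _ hz).self_of_nhds, hΘs]
    have h3 : fderiv ℝ (coordMap e e₀ id) (sliceIncl z) (vert n) = U z := by
      rw [(hcoord _ hz).fderiv_eq, hΘs' z hzN', sliceProj_vert, vert_last, one_smul]
      change sliceInclL n 0 + _ = _
      rw [map_zero, zero_add]
    rw [h2, h3] at h1
    have h4 : (chartVec e₀ (sliceIncl z) (U z) : Euc (n + 1)) =
        (u (e₀.symm (sliceIncl z)) • ν (e₀.symm (sliceIncl z)) : TangentSpace (𝓡 (n + 1)) _) := by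
      rw [(hN z hzN').1.2.1, ← chartVec_smul]; rfl
    have h5 : ∀ q q' : M, q = q' → ((u q • ν q : TangentSpace (𝓡 (n + 1)) q) : Euc (n + 1)) =
        (u q' • ν q' : TangentSpace (𝓡 (n + 1)) q') := by rintro q _ rfl; rfl
    exact (h1.trans h4).trans (h5 _ _ hpt.symm)
  · have hzN' : z ∈ N := by simpa [sliceProj_sliceIncl] using (htW _ hz).1
    have hd : DifferentiableAt ℝ (fun y => metricCoord e y i.castSucc (Fin.last n)) (sliceIncl z) :=
      (contDiffAt_metricCoord hem hz _ _).differentiableAt (by simp)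
    refine fderiv_eq_of_hasDerivAt_line hd ?_
    set β := fderiv ℝ U z (EuclideanSpace.single i 1)
    set b' := fderiv ℝ b z (EuclideanSpace.single i 1)
    have hline : (fun t : ℝ => metricCoord e (sliceIncl z + t • vert n) i.castSucc (Fin.last n)) =ᶠ[𝓝 0]
        fun t => quad (g (sliceIncl z + t • U z + (t ^ 2 / 2) • sliceIncl (b z)))
          (EuclideanSpace.single i.castSucc 1 + t • β + (t ^ 2 / 2) • sliceIncl b')
          (U z + t • sliceIncl (b z)) := by
      have hc : ContinuousAt (fun t : ℝ => sliceIncl z + t • vert n) 0 := by fun_prop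
      have hev := hc.eventually (p := fun y => y ∈ e.target)
        (by simpa using e.open_target.eventually_mem hz)
      filter_upwards [hev] with t ht
      have hp1 : sliceProj n (sliceIncl z + t • vert n) = z := by
        rw [map_add, map_smul, sliceProj_vert, smul_zero, add_zero, sliceProj_sliceIncl]
      have hl1 : (sliceIncl z + t • vert n : Euc (n + 1)) (Fin.last n) = t := by
        simp [sliceIncl_last, vert_last]
      have hy' : sliceIncl z + t • vert n ∈ N' := (htW _ ht).1
      rw [← quad_single (metricCoord e _), quad_metricCoord_change hem hm ht (hsrc₀ _ ht),
        (hcoord _ ht).self_of_nhds, (hcoord _ ht).fderiv_eq, (hΘd _ hy').2, (hΘd _ hy').2, hp1, hl1]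
      have h6 : sliceProj n (EuclideanSpace.single i.castSucc 1) = EuclideanSpace.single i 1 := by
        rw [← sliceIncl_single, sliceProj_sliceIncl]
      have h7 : (EuclideanSpace.single i.castSucc 1 : Euc (n + 1)) (Fin.last n) = 0 := by
        rw [← sliceIncl_single, sliceIncl_last]
      have h8 : sliceIncl (0 : Euc n) = 0 := map_zero (sliceInclL n)
      have h9 : Θ (sliceIncl z + t • vert n) = sliceIncl z + t • U z + (t ^ 2 / 2) • sliceIncl (b z) := by
        rw [hΘ, lapseMap, hp1, hl1]
      change quad (g (Θ _)) _ _ = _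
      rw [h9, h6, h7]
      have h10 : sliceProj n (EuclideanSpace.single (Fin.last n) 1) = 0 := sliceProj_vert
      have h11 : (EuclideanSpace.single (Fin.last n) 1 : Euc (n + 1)) (Fin.last n) = 1 := vert_last
      rw [h10, h11, h8, sliceIncl_single]
      simp [h8, β, b']
    refine HasDerivAt.congr_of_eventuallyEq ?_ hline
    have hid : ∀ c : Euc (n + 1), HasDerivAt (fun t : ℝ => t • c) c 0 := fun c => by
      simpa using (hasDerivAt_id (0 : ℝ)).smul_const c
    have hsq : ∀ c : Euc (n + 1), HasDerivAt (fun t : ℝ => (t ^ 2 / 2) • c) 0 0 := fun c => by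
      simpa using (((hasDerivAt_id (0 : ℝ)).pow 2).div_const 2).smul_const c
    have hq := HasDerivAt.quad (t := 0)
      (g := fun t : ℝ => g (sliceIncl z + t • U z + (t ^ 2 / 2) • sliceIncl (b z)))
      (g' := dirMatrix g (sliceIncl z) (U z))
      (v := fun t : ℝ => EuclideanSpace.single i.castSucc 1 + t • β + (t ^ 2 / 2) • sliceIncl b')
      (w := fun t : ℝ => U z + t • sliceIncl (b z))
      (v' := β) (w' := sliceIncl (b z)) (fun k l => ?_) ?_ ?_
    · refine hq.congr_deriv ?_
      have h12 := hbeq z hzN' i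
      simp only [hr] at h12
      simp only [zero_smul, add_zero, ne_eq, OfNat.ofNat_ne_zero, not_false_eq_true, zero_pow,
        zero_div]
      rw [h12]; ring
    · have h13 : HasDerivAt (fun t : ℝ => sliceIncl z + t • U z + (t ^ 2 / 2) • sliceIncl (b z))
          (U z) 0 :=
          (((hid (U z)).const_add (sliceIncl z)).add (hsq (sliceIncl (b z)))).congr_deriv (add_zero _)
      have h14 : HasFDerivAt (fun x => g x k l) (fderiv ℝ (fun x => g x k l) (sliceIncl z))
          (sliceIncl z + (0 : ℝ) • U z + ((0 : ℝ) ^ 2 / 2) • sliceIncl (b z)) := by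
        simpa using ((contDiffAt_metricCoord hm (hN z hzN').2.1 k l).differentiableAt
          (by simp)).hasFDerivAt
      exact h14.comp_hasDerivAt (0 : ℝ) h13
    · exact (((hid β).const_add (EuclideanSpace.single i.castSucc (1 : ℝ))).add
        (hsq (sliceIncl b'))).congr_deriv (add_zero _)
    · simpa using (hid (sliceIncl (b z))).const_add (U z)
  · rw [he, OpenPartialHomeomorph.trans_source]
    refine ⟨hpe, ?_⟩
    rw [mem_preimage, e₀.right_inv hz₀]
    have := φ.map_source hzφ
    rwa [hφΘ, hΘs] at this

end Lapse

section Frames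

variable {k : ℕ} {h : Matrix (Fin k) (Fin k) ℝ} {b : Fin k → Euc k}

/-- The components of an orthonormal frame give the inverse metric. -/
theorem sum_frame_mul (hb : frameGram h b = 1) (j l : Fin k) :
    ∑ i, b i j * b i l = h⁻¹ j l := by
  set B : Matrix (Fin k) (Fin k) ℝ := Matrix.of fun i j => b i j
  have h1 : B * (h * B.transpose) = 1 := by
    rw [← hb]
    ext i j
    simp only [Matrix.mul_apply, frameGram, quad, Matrix.of_apply, B, Matrix.transpose_apply,
      Finset.mul_sum, mul_assoc]
  have h2 : h * (B.transpose * B) = 1 := by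
    rw [← Matrix.mul_assoc]; exact mul_eq_one_comm.1 h1
  rw [Matrix.inv_eq_right_inv h2]
  rfl

theorem sum_quad_frame (hb : frameGram h b = 1) (N : Matrix (Fin k) (Fin k) ℝ) :
    ∑ i, quad N (b i) (b i) = (h⁻¹ * N).trace := by
  simp only [Matrix.trace, Matrix.diag_apply, Matrix.mul_apply, ← sum_frame_mul hb, quad,
    Finset.sum_mul]
  rw [Finset.sum_comm]
  refine (Finset.sum_congr rfl fun i _ => ?_).trans Finset.sum_comm
  rw [Finset.sum_comm]
  refine (Finset.sum_congr rfl fun j _ => Finset.sum_congr rfl fun l _ => ?_)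
  ring

theorem det_ne_zero_of_frame (hb : frameGram h b = 1) : h.det ≠ 0 := by
  set B : Matrix (Fin k) (Fin k) ℝ := Matrix.of fun i j => b i j
  have h1 : B * h * B.transpose = 1 := by
    rw [← hb, Matrix.mul_assoc]
    ext i j
    simp only [Matrix.mul_apply, frameGram, quad, Matrix.of_apply, B, Matrix.transpose_apply,
      Finset.mul_sum, mul_assoc]
  intro h0
  have := congrArg Matrix.det h1
  simp [Matrix.det_mul, h0] at this

theorem sum_quad_frame_map (hb : frameGram h b = 1) (L : Euc k →L[ℝ] Euc k) :
    ∑ i, quad h (L (b i)) (b i) = ∑ j, L (EuclideanSpace.single j 1) j := by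
  have hL : ∀ i l, L (b i) l = ∑ j, b i j * L (EuclideanSpace.single j 1) l := fun i l => by
    have h1 : b i = ∑ j, b i j • (EuclideanSpace.single j 1 : Euc k) := by
      ext m; simp [Pi.single_apply]
    conv_lhs => rw [h1, map_sum]
    simp
  have h2 : h * h⁻¹ = 1 := Matrix.mul_nonsing_inv _ (isUnit_iff_ne_zero.2 (det_ne_zero_of_frame hb))
  have h3 : ∀ i, quad h (L (b i)) (b i) =
      ∑ l, ∑ m, ∑ j, L (EuclideanSpace.single j 1) l * (h l m * (b i m * b i j)) := fun i => by
    simp only [quad, hL, Finset.sum_mul]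
    exact Finset.sum_congr rfl fun l _ => Finset.sum_congr rfl fun m _ =>
      Finset.sum_congr rfl fun j _ => by ring
  simp only [h3]
  rw [Finset.sum_comm]
  refine Finset.sum_congr rfl fun l _ => ?_
  rw [Finset.sum_comm]
  have h4 : ∀ m, ∑ i, ∑ j, L (EuclideanSpace.single j 1) l * (h l m * (b i m * b i j)) =
      ∑ j, L (EuclideanSpace.single j 1) l * (h l m * h⁻¹ m j) := fun m => by
    rw [Finset.sum_comm]
    simp only [← Finset.mul_sum, sum_frame_mul hb]
  simp only [h4]
  rw [Finset.sum_comm]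
  have h5 : ∀ j, ∑ m, h l m * h⁻¹ m j = (1 : Matrix (Fin k) (Fin k) ℝ) l j := fun j => by
    rw [← h2, Matrix.mul_apply]
  simp only [← Finset.mul_sum, h5, Matrix.one_apply]
  simp

end Frames

section LapseMetric

variable {n : ℕ}

/-- The tangential part of a metric. -/
def slab (g : Euc (n + 1) → Matrix (Fin (n + 1)) (Fin (n + 1)) ℝ) (y : Euc (n + 1)) :
    Matrix (Fin n) (Fin n) ℝ := (g y).submatrix Fin.castSucc Fin.castSucc

/-- A metric which agrees to first order along the slice with `h + u² dt²`. -/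
structure IsLapseMetric (g : Euc (n + 1) → Matrix (Fin (n + 1)) (Fin (n + 1)) ℝ)
    (T : Set (Euc (n + 1))) (u : Euc n → ℝ) : Prop where
  isOpen : IsOpen T
  smooth : ∀ y ∈ T, ∀ i j, ContDiffAt ℝ ∞ (fun x => g x i j) y
  symm : ∀ y i j, g y i j = g y j i
  det_ne_zero : ∀ y ∈ T, (g y).det ≠ 0
  det_pos : ∀ y ∈ T, 0 < (slab g y).det
  cross : ∀ z, sliceIncl z ∈ T → ∀ i : Fin n, g (sliceIncl z) i.castSucc (Fin.last n) = 0
  dcross : ∀ z, sliceIncl z ∈ T → ∀ i : Fin n,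
    pd (Fin.last n) (fun y => g y i.castSucc (Fin.last n)) (sliceIncl z) = 0
  lapse : ∀ z, sliceIncl z ∈ T → g (sliceIncl z) (Fin.last n) (Fin.last n) = u z ^ 2
  smooth_lapse : ∀ z, sliceIncl z ∈ T → ContDiffAt ℝ ∞ u z
  pos : ∀ z, sliceIncl z ∈ T → 0 < u z

end LapseMetric

section Lapse

variable {n : ℕ} {M : Type*} [EMetricSpace M] [ChartedSpace (Euc (n + 1)) M]
  [IsManifold (𝓡 (n + 1)) ∞ M]
  [RiemannianBundle (fun x : M => TangentSpace (𝓡 (n + 1)) x)]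
  {A S : Set M} {ν : (p : M) → TangentSpace (𝓡 (n + 1)) p} {u : M → ℝ}
  {e : Chart n M}

theorem slab_metricCoord (e : Chart n M) (z : Euc n) :
    slab (metricCoord e) (sliceIncl z) = inducedMetric e z := rfl

theorem det_slab_pos (he : e ∈ smoothAtlas n M) {y : Euc (n + 1)}
    (hy : y ∈ e.target) : 0 < (slab (metricCoord e) y).det := by
  have h := det_frameGram_pos he hy (b := fun i => sliceIncl (EuclideanSpace.single i 1))
    (linearIndependent_sliceIncl (EuclideanSpace.orthonormal_single (𝕜 := ℝ)).linearIndependent)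
  have h2 : frameGram (metricCoord e y)
      (fun i => sliceIncl (EuclideanSpace.single i 1)) = slab (metricCoord e) y := by
    ext i j
    change quad _ (sliceIncl (EuclideanSpace.single i 1)) (sliceIncl (EuclideanSpace.single j 1)) = _
    rw [sliceIncl_single, sliceIncl_single, quad_single]; rfl
  rwa [h2] at h

theorem IsLapseChart.isLapseMetric [IsContMDiffRiemannianBundle (𝓡 (n + 1)) ∞ (Euc (n + 1))
    (fun x : M => TangentSpace (𝓡 (n + 1)) x)] (he : IsLapseChart A S ν u e)
    (hν : IsUnitNormal A ν) (hS : IsClosed S) (hu : IsPositiveJacobi A S ν u) :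
    IsLapseMetric (metricCoord e) e.target (sliceFun e u) := by
  have hd : ∀ z, sliceIncl z ∈ e.target → z ∈ sliceDomain e S := fun z hz =>
    ⟨hz, he.disj _ (e.map_target hz)⟩
  refine ⟨e.open_target, fun y hy i j => contDiffAt_metricCoord he.slice.1 hy i j,
    fun y i j => metricCoord_symm e y i j, fun y hy => (det_metricCoord_pos he.slice.1 hy).ne',
    fun y hy => det_slab_pos he.slice.1 hy,
    fun z hz i => ?_, he.dcross, fun z hz => ?_, fun z hz => ?_, fun z hz => ?_⟩
  · change inner ℝ (coordVec e i.castSucc (sliceIncl z)) (coordVec e (Fin.last n) (sliceIncl z)) = 0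
    rw [he.coordVec_last z hz, inner_smul_right, hν.normal e he.slice z hz, mul_zero]
  · change inner ℝ (coordVec e (Fin.last n) (sliceIncl z)) (coordVec e (Fin.last n) (sliceIncl z)) = _
    rw [he.coordVec_last z hz, inner_smul_right, real_inner_smul_left, real_inner_self_eq_norm_sq,
      hν.norm_eq_one _ (he.slice.mem_regPart hz), sliceFun]
    ring
  · exact (hu.smooth e he.slice).contDiffAt ((isOpen_sliceDomain hS e).mem_nhds (hd z hz))
  · exact hu.pos _ ⟨(he.slice.mem_regPart hz).1, (hd z hz).2⟩

end Lapse

section AlmostEverywhere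

variable {n : ℕ} {M : Type*} [EMetricSpace M] [ChartedSpace (Euc (n + 1)) M]
  [IsManifold (𝓡 (n + 1)) ∞ M]
  [RiemannianBundle (fun x : M => TangentSpace (𝓡 (n + 1)) x)]
  {e : Chart n M}

/-- A frame spans the plane. -/
theorem IsFrame.eq_sum {ξ : Gr n M} {β : Fin n → Euc (n + 1)} (h : IsFrame e ξ β)
    (he : e ∈ smoothAtlas n M) (hξ : ξ.1 ∈ e.source) {c : Euc (n + 1)}
    (hc : InPlane e ξ c) : c = ∑ i, quad (metricCoord e (e ξ.1)) (β i) c • β i := by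
  have h1 := planeCoord_eq_sum he hξ h.mem (by rw [h.gram]; simp) c
  rw [h.gram] at h1
  have h2 : planeCoord e ξ c = c := by
    obtain ⟨y, hy, P, rfl⟩ := Gr.exists_eq_mk hξ
    rw [planeCoord_mk hy, Submodule.starProjection_eq_self_iff.2 (InPlane.chartVec_mem he hy hc),
      chartComp_chartVec he hy]
  rw [h2] at h1
  refine h1.trans (Finset.sum_congr rfl fun i _ => ?_)
  simp [Matrix.one_apply]

variable (V : Varifold n M)

theorem Varifold.ae_mem_spt [CompactSpace M] [MeasurableSpace M] [BorelSpace M] :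
    ∀ᵐ ξ ∂(V : Measure (Gr n M)), ξ.1 ∈ V.spt := by
  have hm : Measurable (fun ξ : Gr n M => ξ.1) := Gr.continuous_fst.measurable
  have h : ∀ᵐ p ∂((V : Measure (Gr n M)).map fun ξ : Gr n M => ξ.1), p ∈ V.spt := by
    rw [ae_iff]
    exact Measure.measure_compl_support
  exact ae_of_ae_map hm.aemeasurable h

theorem Varifold.measure_pos_of_mem_spt [MeasurableSpace M] [BorelSpace M] {p : M} (hp : p ∈ V.spt)
    {U : Set M} (hU : IsOpen U) (hpU : p ∈ U) : 0 < (V : Measure (Gr n M)) {ξ | ξ.1 ∈ U} := by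
  have h := (Measure.mem_support_iff_forall p).1 hp U (hU.mem_nhds hpU)
  rwa [Measure.map_apply Gr.continuous_fst.measurable hU.measurableSet] at h

theorem Varifold.ae_of_locally [CompactSpace M] {U : Set M} {P : Gr n M → Prop}
    (h : ∀ p ∈ U, ∃ W ∈ 𝓝 p, ∀ᵐ ξ ∂(V : Measure (Gr n M)), ξ.1 ∈ W → P ξ) :
    ∀ᵐ ξ ∂(V : Measure (Gr n M)), ξ.1 ∈ U → P ξ := by
  choose! W hW hP using h
  obtain ⟨t, ht, htc, hcov⟩ := TopologicalSpace.countable_cover_nhdsWithin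
    (fun p hp => mem_nhdsWithin_of_mem_nhds (hW p hp))
  have h2 : ∀ᵐ ξ ∂(V : Measure (Gr n M)), ∀ p ∈ t, ξ.1 ∈ W p → P ξ :=
    (ae_ball_iff htc).2 fun p hp => hP p (ht hp)
  filter_upwards [h2] with ξ hξ hU
  obtain ⟨p, hp, hpW⟩ := mem_iUnion₂.1 (hcov hU)
  exact hξ p hp hpW

/-- A smooth nonnegative function with compact support in `U` which is one near a compact set. -/
theorem exists_smooth_cutoff {m : ℕ} {K U : Set (Euc m)} (hK : IsCompact K) (hU : IsOpen U)
    (hKU : K ⊆ U) : ∃ χ : Euc m → ℝ, ContDiff ℝ ∞ χ ∧ HasCompactSupport χ ∧ tsupport χ ⊆ U ∧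
      (∀ y, 0 ≤ χ y) ∧ ∀ y ∈ K, ∀ᶠ x in 𝓝 y, χ x = 1 := by
  obtain ⟨L, hL, hKL, hLU⟩ := exists_compact_between hK hU hKU
  obtain ⟨L', hL', hLL', hLU'⟩ := exists_compact_between hL hU hLU
  obtain ⟨χ, h1, h2, h3, h4⟩ := exists_contMDiff_support_eq_eq_one_iff (𝓡 m)
    (s := interior L') (t := L) isOpen_interior hL.isClosed hLL'
  have hsup : tsupport χ ⊆ L' := closure_minimal (h3 ▸ interior_subset) hL'.isClosed
  refine ⟨χ, h1.contDiff, HasCompactSupport.of_support_subset_isCompact hL' (h3 ▸ interior_subset),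
    hsup.trans hLU', fun y => (h2 (mem_range_self y)).1, fun y hy => ?_⟩
  filter_upwards [isOpen_interior.mem_nhds (hKL hy)] with x hx
  exact (h4 x).1 (interior_subset hx)

variable {V}

theorem IsFrame.exists_slice {ξ : Gr n M} {β : Fin n → Euc (n + 1)} (h : IsFrame e ξ β)
    (ht : ∀ c, InPlane e ξ c → c (Fin.last n) = 0) :
    ∃ b : Fin n → Euc n, (∀ i, β i = sliceIncl (b i)) ∧
      frameGram (slab (metricCoord e) (e ξ.1)) b = 1 := by
  have h1 : ∀ i, β i = sliceIncl (sliceProj n (β i)) := fun i => eq_sliceIncl_of_last (ht _ (h.mem i))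
  refine ⟨fun i => sliceProj n (β i), h1, ?_⟩
  rw [← h.gram]
  ext i j
  simp only [frameGram, Matrix.of_apply]
  conv_rhs => rw [h1 i, h1 j, quad_sliceIncl]
  rfl

theorem HasFDerivAt.eval_last (y : Euc (n + 1)) : HasFDerivAt (fun y : Euc (n + 1) => y (Fin.last n))
    (EuclideanSpace.proj (Fin.last n) : Euc (n + 1) →L[ℝ] ℝ) y :=
  (EuclideanSpace.proj (Fin.last n) : Euc (n + 1) →L[ℝ] ℝ).hasFDerivAt

theorem IsLapseMetric.quad_vert_left {g : Euc (n + 1) → Matrix (Fin (n + 1)) (Fin (n + 1)) ℝ}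
    {T : Set (Euc (n + 1))} {u : Euc n → ℝ} (hg : IsLapseMetric g T u) {z : Euc n}
    (hz : sliceIncl z ∈ T) (v : Euc (n + 1)) :
    quad (g (sliceIncl z)) (vert n) v = u z ^ 2 * v (Fin.last n) := by
  conv_lhs => rw [eq_sliceIncl_add v]
  rw [quad_add_right, quad_smul_right, quad_vert, hg.lapse z hz, quad_symm (hg.symm _),
    quad_sliceIncl_vert]
  simp only [hg.cross z hz, mul_zero, Finset.sum_const_zero]
  ring

variable [CompactSpace M] [IsContMDiffRiemannianBundle (𝓡 (n + 1)) ∞ (Euc (n + 1))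
    (fun x : M => TangentSpace (𝓡 (n + 1)) x)] [MeasurableSpace M] [BorelSpace M] {u : Euc n → ℝ}

/-- Almost all planes of a stationary varifold are tangent to the regular part of its support. -/
theorem Varifold.IsStationary.ae_tangent (hV : V.IsStationary) (he : IsSliceChart V.spt e)
    (hg : IsLapseMetric (metricCoord e) e.target u) : ∀ᵐ ξ ∂(V : Measure (Gr n M)), ξ.1 ∈ e.source →
      ∀ c, InPlane e ξ c → c (Fin.last n) = 0 := by
  refine V.ae_of_locally fun p hp => ?_
  obtain ⟨χ, hχ, hχc, hχt, hχ0, hχ1⟩ := exists_smooth_cutoff (isCompact_singleton (x := e p))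
    e.open_target (singleton_subset_iff.2 (e.map_source hp))
  set Y : Euc (n + 1) → Euc (n + 1) := fun y => (χ y * y (Fin.last n)) • vert n
  have hlast : ContDiff ℝ ∞ fun y : Euc (n + 1) => y (Fin.last n) := by fun_prop
  have hYs : ContDiff ℝ ∞ Y := (hχ.mul hlast).smul contDiff_const
  have hsupp : tsupport Y ⊆ tsupport χ := closure_mono fun y hy h0 => hy (by
    change (χ y * _) • _ = (0 : Euc (n + 1))
    rw [h0, zero_mul, zero_smul])
  obtain ⟨D, -, hDi, hD0, hD1, hD2⟩ := hV.exists_integral_frameDiv he.1 hYs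
    (hχc.of_isClosed_subset (isClosed_tsupport _) hsupp) (hsupp.trans hχt)
  have hval : ∀ ξ : Gr n M, ξ.1 ∈ V.spt → ξ.1 ∈ e.source → ∀ β, IsFrame e ξ β →
      D ξ = χ (e ξ.1) * (u (sliceProj n (e ξ.1)) ^ 2 * ∑ i, β i (Fin.last n) ^ 2) ∧
        0 < u (sliceProj n (e ξ.1)) := by
    intro ξ hξ hξe β hβ
    have hl : e ξ.1 (Fin.last n) = 0 := (he.2 _ hξe).1 hξ
    have hy := e.map_source hξe
    rw [hD1 ξ hξe β hβ]
    set y := e ξ.1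
    have hys := eq_sliceIncl_of_last hl
    have hd : ∀ v, fderiv ℝ Y y v = (χ y * v (Fin.last n)) • vert n := fun v => by
      have h1 := (((hχ.differentiable (by simp)) y).hasFDerivAt.mul
        (HasFDerivAt.eval_last y)).smul_const (vert n)
      refine (congrArg (fun L : Euc (n + 1) →L[ℝ] Euc (n + 1) => L v) h1.fderiv).trans ?_
      simp [hl]
    have hY0 : Y y = 0 := by simp only [Y, hl, mul_zero, zero_smul]
    have hdm : ∀ v w, quad (dirMatrix (metricCoord e) y 0) v w = 0 := fun v w => by
      simp [quad, dirMatrix]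
    refine ⟨?_, hg.pos _ (hys ▸ hy)⟩
    rw [frameDiv, Finset.mul_sum, Finset.mul_sum]
    refine Finset.sum_congr rfl fun i _ => ?_
    rw [hY0, hdm, hd, quad_smul_left]
    have h2 := hg.quad_vert_left (z := sliceProj n y) (hys ▸ hy) (β i)
    rw [← hys] at h2
    rw [h2]; ring
  have hnn : ∀ᵐ ξ ∂(V : Measure (Gr n M)), 0 ≤ D ξ := by
    filter_upwards [V.ae_mem_spt] with ξ hξ
    by_cases hξe : ξ.1 ∈ e.source
    · obtain ⟨β, hβ⟩ := exists_isFrame he.1 hξe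
      rw [(hval ξ hξ hξe β hβ).1]
      exact mul_nonneg (hχ0 _) (mul_nonneg (sq_nonneg _) (Finset.sum_nonneg fun i _ => sq_nonneg _))
    · rw [hD2 ξ fun h => hξe ?_]
      obtain ⟨y, hy, hyξ⟩ := h
      exact hyξ ▸ e.map_target (hχt (hsupp hy))
  have hz := (integral_eq_zero_iff_of_nonneg_ae hnn hDi).1 hD0
  refine ⟨e.source ∩ e ⁻¹' {x | χ x = 1}, inter_mem (e.open_source.mem_nhds hp)
    ((e.continuousAt hp).preimage_mem_nhds (hχ1 _ rfl)), ?_⟩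
  filter_upwards [hz, V.ae_mem_spt] with ξ hξ0 hξ hξW c hc
  obtain ⟨β, hβ⟩ := exists_isFrame he.1 hξW.1
  obtain ⟨h1, h2⟩ := hval ξ hξ hξW.1 β hβ
  have h3 : χ (e ξ.1) = 1 := hξW.2
  rw [h3, one_mul] at h1
  have h4 := (mul_eq_zero.1 (h1.symm.trans hξ0)).resolve_left (pow_pos h2 2).ne'
  have h5 := (Finset.sum_eq_zero_iff_of_nonneg fun i _ => sq_nonneg _).1 h4
  rw [hβ.eq_sum he.1 hξW.1 hc]
  simp only [WithLp.ofLp_sum, Finset.sum_apply, PiLp.smul_apply, smul_eq_mul]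
  exact Finset.sum_eq_zero fun i hi => by rw [pow_eq_zero_iff two_ne_zero |>.1 (h5 i hi), mul_zero]

/-- The normal derivative of the tangential part of the metric. -/
def normalSlab (g : Euc (n + 1) → Matrix (Fin (n + 1)) (Fin (n + 1)) ℝ) (y : Euc (n + 1)) :
    Matrix (Fin n) (Fin n) ℝ := (dirMatrix g y (vert n)).submatrix Fin.castSucc Fin.castSucc

theorem quad_dirMatrix_smul {m : ℕ} (g : Euc m → Matrix (Fin m) (Fin m) ℝ) (y : Euc m) (c : ℝ)
    (x v w : Euc m) : quad (dirMatrix g y (c • x)) v w = c * quad (dirMatrix g y x) v w := by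
  simp only [quad, dirMatrix, Matrix.of_apply, map_smul, smul_eq_mul, Finset.mul_sum]
  exact Finset.sum_congr rfl fun i _ => Finset.sum_congr rfl fun j _ => by ring

/-- The regular part of the support of a stationary varifold has vanishing mean curvature. -/
theorem Varifold.IsStationary.trace_normalSlab (hV : V.IsStationary) (he : IsSliceChart V.spt e)
    (hg : IsLapseMetric (metricCoord e) e.target u) {z₀ : Euc n} (hz₀ : sliceIncl z₀ ∈ e.target) :
    ((slab (metricCoord e) (sliceIncl z₀))⁻¹ * normalSlab (metricCoord e) (sliceIncl z₀)).trace =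
      0 := by
  set H : Euc (n + 1) → ℝ := fun y =>
    ((slab (metricCoord e) y)⁻¹ * normalSlab (metricCoord e) y).trace with hH
  change H (sliceIncl z₀) = 0
  by_contra hne
  have hcont : ∀ y ∈ e.target, ContinuousAt H y := fun y hy => by
    have h1 : ∀ i j, ContinuousAt (fun x => (slab (metricCoord e) x)⁻¹ i j) y := fun i j =>
      (ContDiffAt.matrix_inv_apply (r := ∞) (A := slab (metricCoord e))
        (fun i j => hg.smooth y hy _ _) (hg.det_pos y hy).ne' i j).continuousAt
    have h2 : ∀ i j, ContinuousAt (fun x => normalSlab (metricCoord e) x i j) y := fun i j =>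
      (((hg.smooth y hy i.castSucc j.castSucc).fderiv_right (m := ∞) (by simp)).clm_apply
        contDiffAt_const).continuousAt
    simp only [hH, Matrix.trace, Matrix.diag_apply, Matrix.mul_apply]
    exact tendsto_finsetSum _ fun i _ => tendsto_finsetSum _ fun j _ => (h1 i j).mul (h2 j i)
  set s : ℝ := (SignType.sign (H (sliceIncl z₀)) : ℝ) with hs
  have hs0 : s ≠ 0 := by
    rcases lt_or_gt_of_ne hne with h | h <;> simp [hs, h]
  have hpos : ∀ᶠ y in 𝓝 (sliceIncl z₀), y ∈ e.target ∧ 0 < s * H y := by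
    refine (e.open_target.eventually_mem hz₀).and
      ((continuousAt_const.mul (hcont _ hz₀)).eventually (lt_mem_nhds ?_))
    rcases lt_or_gt_of_ne hne with h | h <;> simp [hs, h]
  obtain ⟨N, hN, hNo, hzN⟩ := eventually_nhds_iff.1 hpos
  obtain ⟨χ, hχ, hχc, hχt, hχ0, hχ1⟩ := exists_smooth_cutoff (isCompact_singleton (x := sliceIncl z₀))
    hNo (singleton_subset_iff.2 hzN)
  set Y : Euc (n + 1) → Euc (n + 1) := fun y => (χ y * s) • vert n
  have hYs : ContDiff ℝ ∞ Y := (hχ.mul contDiff_const).smul contDiff_const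
  have hsupp : tsupport Y ⊆ tsupport χ := closure_mono fun y hy h0 => hy (by
    change (χ y * _) • _ = (0 : Euc (n + 1))
    rw [h0, zero_mul, zero_smul])
  obtain ⟨D, -, hDi, hD0, hD1, hD2⟩ := hV.exists_integral_frameDiv he.1 hYs
    (hχc.of_isClosed_subset (isClosed_tsupport _) hsupp)
    (hsupp.trans (hχt.trans fun y hy => (hN y hy).1))
  have hval : ∀ᵐ ξ ∂(V : Measure (Gr n M)), ξ.1 ∈ e.source →
      D ξ = χ (e ξ.1) * (1 / 2 * (s * H (e ξ.1))) := by
    filter_upwards [V.ae_mem_spt, hV.ae_tangent he hg] with ξ hξ hξt hξe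
    have hl : e ξ.1 (Fin.last n) = 0 := (he.2 _ hξe).1 hξ
    have hy := e.map_source hξe
    obtain ⟨β, hβ⟩ := exists_isFrame he.1 hξe
    obtain ⟨b, hβb, hb⟩ := hβ.exists_slice (hξt hξe)
    rw [hD1 ξ hξe β hβ]
    set y := e ξ.1
    have hys := eq_sliceIncl_of_last hl
    have hd : ∀ v, fderiv ℝ Y y v = (fderiv ℝ χ y v * s) • vert n := fun v => by
      have h1 := (((hχ.differentiable (by simp)) y).hasFDerivAt.mul_const s).smul_const (vert n)
      refine (congrArg (fun L : Euc (n + 1) →L[ℝ] Euc (n + 1) => L v) h1.fderiv).trans ?_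
      simp [mul_comm]
    have h2 : ∀ v, quad (metricCoord e y) (vert n) (sliceIncl v) = 0 := fun v => by
      have := hg.quad_vert_left (z := sliceProj n y) (hys ▸ hy) (sliceIncl v)
      rwa [← hys, sliceIncl_last, mul_zero] at this
    rw [frameDiv, hH]
    simp only
    rw [← sum_quad_frame hb, Finset.mul_sum, Finset.mul_sum, Finset.mul_sum]
    refine Finset.sum_congr rfl fun i _ => ?_
    rw [hd, quad_smul_left, hβb, h2, quad_dirMatrix_smul, quad_sliceIncl]
    simp only [normalSlab]
    ring
  have hnn : ∀ᵐ ξ ∂(V : Measure (Gr n M)), 0 ≤ D ξ := by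
    filter_upwards [hval] with ξ hξ
    by_cases hξe : ξ.1 ∈ e.source
    · rw [hξ hξe]
      by_cases h0 : χ (e ξ.1) = 0
      · rw [h0, zero_mul]
      · exact mul_nonneg (hχ0 _) (mul_nonneg (by norm_num)
          (hN _ (hχt (subset_tsupport _ h0))).2.le)
    · rw [hD2 ξ fun h => hξe ?_]
      obtain ⟨y, hy, hyξ⟩ := h
      exact hyξ ▸ e.map_target (hN _ (hχt (hsupp hy))).1
  have hz := (integral_eq_zero_iff_of_nonneg_ae hnn hDi).1 hD0
  have hUo : IsOpen (e.source ∩ e ⁻¹' {x | ∀ᶠ y in 𝓝 x, χ y = 1}) :=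
    e.isOpen_inter_preimage isOpen_setOfPred_eventually_nhds
  refine (V.measure_pos_of_mem_spt (he.mem_regPart hz₀).1 hUo ⟨e.map_target hz₀, ?_⟩).ne' ?_
  · rw [mem_preimage, e.right_inv hz₀]; exact hχ1 _ rfl
  · refine measure_mono_null (t := {ξ | ¬ (ξ.1 ∈ e.source → χ (e ξ.1) ≠ 1)}) (fun ξ hξ h => ?_) ?_
    · have h1 : ∀ᶠ y in 𝓝 (e ξ.1), χ y = 1 := hξ.2
      exact h hξ.1 h1.self_of_nhds
    · change ∀ᵐ ξ ∂(V : Measure (Gr n M)), _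
      filter_upwards [hz, hval] with ξ hξ0 hξ hξe h1
      have h2 : 0 < s * H (e ξ.1) := (hN _ (hχt (subset_tsupport _ (by
        rw [Function.mem_support, h1]; exact one_ne_zero)))).2
      have h3 := (hξ hξe).symm.trans hξ0
      rw [h1, one_mul] at h3
      change 1 / 2 * _ = (0 : ℝ) at h3
      linarith

end AlmostEverywhere

section PartialDerivatives

variable {m : ℕ}

theorem hasDerivAt_line {f : Euc m → ℝ} {y : Euc m} (hf : DifferentiableAt ℝ f y) (i : Fin m) :
    HasDerivAt (fun t : ℝ => f (y + t • EuclideanSpace.single i 1)) (pd i f y) 0 := by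
  have h1 : HasDerivAt (fun t : ℝ => y + t • (EuclideanSpace.single i 1 : Euc m))
      (EuclideanSpace.single i 1) 0 := by
    simpa using ((hasDerivAt_id (0 : ℝ)).smul_const (EuclideanSpace.single i 1 : Euc m)).const_add y
  have h2 : HasFDerivAt f (fderiv ℝ f y) (y + (0 : ℝ) • (EuclideanSpace.single i 1 : Euc m)) := by
    simpa using hf.hasFDerivAt
  exact h2.comp_hasDerivAt (0 : ℝ) h1

theorem pd_eq_of_hasDerivAt {f : Euc m → ℝ} {y : Euc m} {i : Fin m} {c : ℝ}
    (hf : DifferentiableAt ℝ f y)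
    (h : HasDerivAt (fun t : ℝ => f (y + t • EuclideanSpace.single i 1)) c 0) : pd i f y = c :=
  fderiv_eq_of_hasDerivAt_line hf h

theorem pd_mul {f g : Euc m → ℝ} {y : Euc m} (hf : DifferentiableAt ℝ f y)
    (hg : DifferentiableAt ℝ g y) (i : Fin m) :
    pd i (fun x => f x * g x) y = pd i f y * g y + f y * pd i g y := by
  refine pd_eq_of_hasDerivAt (hf.mul hg) ?_
  exact ((hasDerivAt_line hf i).mul (hasDerivAt_line hg i)).congr_deriv (by simp)

theorem pd_sum {ι : Type*} {s : Finset ι} {f : ι → Euc m → ℝ} {y : Euc m}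
    (hf : ∀ k ∈ s, DifferentiableAt ℝ (f k) y) (i : Fin m) :
    pd i (fun x => ∑ k ∈ s, f k x) y = ∑ k ∈ s, pd i (f k) y :=
  pd_eq_of_hasDerivAt (DifferentiableAt.fun_sum hf)
    (HasDerivAt.fun_sum fun k hk => hasDerivAt_line (hf k hk) i)

theorem pd_congr {f g : Euc m → ℝ} {y : Euc m} (h : f =ᶠ[𝓝 y] g) (i : Fin m) :
    pd i f y = pd i g y := by rw [pd, pd, h.fderiv_eq]

theorem ContDiffAt.pd {f : Euc m → ℝ} {y : Euc m} (hf : ContDiffAt ℝ ∞ f y) (i : Fin m) :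
    ContDiffAt ℝ ∞ (pd i f) y :=
  (hf.fderiv_right (m := ∞) (by simp)).clm_apply contDiffAt_const

theorem hasDerivAt_inv_line {g : Euc m → Matrix (Fin m) (Fin m) ℝ} {y : Euc m} {k : ℕ}
    {c : Fin k → Fin m} (hg : ∀ i j, DifferentiableAt ℝ (fun x => g x i j) y) (i : Fin m)
    (h0 : ((g y).submatrix c c).det ≠ 0) (a b : Fin k) :
    HasDerivAt (fun t : ℝ => ((g (y + t • EuclideanSpace.single i 1)).submatrix c c)⁻¹ a b)
      (-(((g y).submatrix c c)⁻¹ *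
        (dirMatrix g y (EuclideanSpace.single i 1)).submatrix c c * ((g y).submatrix c c)⁻¹) a b) 0 := by
  have h1 := HasDerivAt.matrix_inv_apply (t := 0)
    (A := fun t : ℝ => (g (y + t • EuclideanSpace.single i 1)).submatrix c c)
    (A' := (dirMatrix g y (EuclideanSpace.single i 1)).submatrix c c)
    (fun a b => hasDerivAt_line (hg (c a) (c b)) i) (by simpa using h0) a b
  simpa using h1

theorem christoffel_symm {g : Euc m → Matrix (Fin m) (Fin m) ℝ} (hg : ∀ y i j, g y i j = g y j i)
    (k i j : Fin m) (y : Euc m) : christoffel g k i j y = christoffel g k j i y := by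
  have h1 : (fun x => g x i j) = fun x => g x j i := funext fun x => hg x i j
  simp only [christoffel, h1]
  congr 1
  exact Finset.sum_congr rfl fun l _ => by ring

theorem inv_apply_symm {g : Matrix (Fin m) (Fin m) ℝ} (hg : ∀ i j, g i j = g j i) (i j : Fin m) :
    g⁻¹ i j = g⁻¹ j i := by
  have h : g.transpose = g := by ext i j; exact hg j i
  conv_lhs => rw [← h, ← Matrix.transpose_nonsing_inv]
  rfl

theorem contDiffAt_christoffel {g : Euc m → Matrix (Fin m) (Fin m) ℝ} {y : Euc m}
    (hg : ∀ i j, ContDiffAt ℝ ∞ (fun x => g x i j) y) (h0 : (g y).det ≠ 0) (k i j : Fin m) :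
    ContDiffAt ℝ ∞ (christoffel g k i j) y :=
  contDiffAt_const.mul (ContDiffAt.sum fun l _ => (ContDiffAt.matrix_inv_apply hg h0 k l).mul
    ((((hg l j).pd i).add ((hg l i).pd j)).sub ((hg i j).pd l)))

end PartialDerivatives

section LapseMetric

variable {n : ℕ} {g : Euc (n + 1) → Matrix (Fin (n + 1)) (Fin (n + 1)) ℝ}
  {T : Set (Euc (n + 1))} {u : Euc n → ℝ} {z : Euc n}

namespace IsLapseMetric

theorem smooth_slab (hg : IsLapseMetric g T u) (hz : sliceIncl z ∈ T) (i j : Fin n) :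
    ContDiffAt ℝ ∞ (fun w => slab g (sliceIncl w) i j) z :=
  (hg.smooth _ hz i.castSucc j.castSucc).comp z contDiff_sliceIncl.contDiffAt

theorem smooth_slab_inv (hg : IsLapseMetric g T u) (hz : sliceIncl z ∈ T) (i j : Fin n) :
    ContDiffAt ℝ ∞ (fun w => (slab g (sliceIncl w))⁻¹ i j) z :=
  ContDiffAt.matrix_inv_apply (A := fun w => slab g (sliceIncl w)) (fun i j => hg.smooth_slab hz i j)
    (hg.det_pos _ hz).ne' i j

theorem eventually_mem (hg : IsLapseMetric g T u) (hz : sliceIncl z ∈ T) :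
    ∀ᶠ w in 𝓝 z, sliceIncl w ∈ T :=
  (hg.isOpen.preimage (sliceInclL n).continuous).mem_nhds hz

theorem inv_block (hg : IsLapseMetric g T u) (hz : sliceIncl z ∈ T) :
    (∀ i j : Fin n, (g (sliceIncl z))⁻¹ i.castSucc j.castSucc = (slab g (sliceIncl z))⁻¹ i j) ∧
    (∀ i : Fin n, (g (sliceIncl z))⁻¹ i.castSucc (Fin.last n) = 0) ∧
    (g (sliceIncl z))⁻¹ (Fin.last n) (Fin.last n) = (u z ^ 2)⁻¹ := by
  set h := slab g (sliceIncl z)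
  let N : Matrix (Fin (n + 1)) (Fin (n + 1)) ℝ := Matrix.of fun a b =>
    Fin.lastCases (motive := fun _ => ℝ)
      (Fin.lastCases (motive := fun _ => ℝ) (u z ^ 2)⁻¹ (fun _ => 0) b)
      (fun i => Fin.lastCases (motive := fun _ => ℝ) 0 (fun j => h⁻¹ i j) b) a
  have hh : h * h⁻¹ = 1 := Matrix.mul_nonsing_inv _ (isUnit_iff_ne_zero.2 (hg.det_pos _ hz).ne')
  have hu := (hg.pos z hz).ne'
  have hN : g (sliceIncl z) * N = 1 := by
    ext a b
    rw [Matrix.mul_apply, Fin.sum_univ_castSucc]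
    refine Fin.lastCases ?_ (fun i => ?_) a <;> refine Fin.lastCases ?_ (fun j => ?_) b
    · simp [N, hg.symm _ (Fin.last n), hg.cross z hz, hg.lapse z hz, hu]
    · simp [N, hg.symm _ (Fin.last n), hg.cross z hz, (Fin.castSucc_ne_last j).symm]
    · simp [N, hg.cross z hz, Fin.castSucc_ne_last i]
    · have := congrFun (congrFun hh i) j
      rw [Matrix.mul_apply] at this
      simp only [N, Matrix.of_apply, Fin.lastCases_castSucc, Fin.lastCases_last, hg.cross z hz,
        zero_mul, add_zero]
      refine this.trans ?_
      simp [Matrix.one_apply]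
  rw [Matrix.inv_eq_right_inv hN]
  exact ⟨fun i j => by simp [N], fun i => by simp [N], by simp [N]⟩

theorem inv_cross' (hg : IsLapseMetric g T u) (hz : sliceIncl z ∈ T) (i : Fin n) :
    (g (sliceIncl z))⁻¹ (Fin.last n) i.castSucc = 0 := by
  rw [inv_apply_symm (hg.symm _)]; exact (hg.inv_block hz).2.1 i

theorem pd_cross (hg : IsLapseMetric g T u) (hz : sliceIncl z ∈ T) (i : Fin n) (k : Fin (n + 1)) :
    pd k (fun y => g y i.castSucc (Fin.last n)) (sliceIncl z) = 0 := by
  refine Fin.lastCases (hg.dcross z hz i) (fun j => ?_) k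
  have h1 := fderiv_comp_sliceIncl ((hg.smooth _ hz i.castSucc (Fin.last n)).differentiableAt (by simp))
    (EuclideanSpace.single j 1)
  rw [sliceIncl_single] at h1
  rw [pd, ← h1]
  have h2 : (fun w => g (sliceIncl w) i.castSucc (Fin.last n)) =ᶠ[𝓝 z] fun _ => 0 := by
    filter_upwards [hg.eventually_mem hz] with w hw using hg.cross w hw i
  rw [h2.fderiv_eq]; simp

theorem pd_cross' (hg : IsLapseMetric g T u) (hz : sliceIncl z ∈ T) (i : Fin n) (k : Fin (n + 1)) :
    pd k (fun y => g y (Fin.last n) i.castSucc) (sliceIncl z) = 0 := by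
  rw [← hg.pd_cross hz i k]
  exact congrArg (fun f => pd k f (sliceIncl z)) (funext fun y => hg.symm y _ _)

theorem pd_lapse (hg : IsLapseMetric g T u) (hz : sliceIncl z ∈ T) (j : Fin n) :
    pd j.castSucc (fun y => g y (Fin.last n) (Fin.last n)) (sliceIncl z) = 2 * u z * pd j u z := by
  have h1 := fderiv_comp_sliceIncl
    ((hg.smooth _ hz (Fin.last n) (Fin.last n)).differentiableAt (by simp))
    (EuclideanSpace.single j 1)
  rw [sliceIncl_single] at h1
  rw [pd, ← h1]
  have h2 : (fun w => g (sliceIncl w) (Fin.last n) (Fin.last n)) =ᶠ[𝓝 z] fun w => u w * u w := by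
    filter_upwards [hg.eventually_mem hz] with w hw
    rw [hg.lapse w hw, sq]
  have hu := (hg.smooth_lapse z hz).differentiableAt (by simp)
  rw [h2.fderiv_eq]
  refine (pd_mul hu hu j).trans (by ring)

/-- The gradient of the lapse. -/
def grad (g : Euc (n + 1) → Matrix (Fin (n + 1)) (Fin (n + 1)) ℝ) (u : Euc n → ℝ) (i : Fin n)
    (w : Euc n) : ℝ := ∑ j, (slab g (sliceIncl w))⁻¹ i j * pd j u w

theorem christoffel_last_last (hg : IsLapseMetric g T u) (hz : sliceIncl z ∈ T) (i : Fin n) :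
    christoffel g i.castSucc (Fin.last n) (Fin.last n) (sliceIncl z) = -(u z * grad g u i z) := by
  rw [christoffel, Fin.sum_univ_castSucc, (hg.inv_block hz).2.1]
  simp only [(hg.inv_block hz).1, hg.pd_cross hz, hg.pd_lapse hz, grad, Finset.mul_sum]
  rw [zero_mul, add_zero, Finset.mul_sum, ← Finset.sum_neg_distrib]
  exact Finset.sum_congr rfl fun j _ => by ring

theorem christoffel_last (hg : IsLapseMetric g T u) (hz : sliceIncl z ∈ T) (i : Fin n) :
    christoffel g (Fin.last n) (Fin.last n) i.castSucc (sliceIncl z) = pd i u z / u z := by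
  rw [christoffel, Fin.sum_univ_castSucc, (hg.inv_block hz).2.2]
  simp only [hg.inv_cross' hz, hg.pd_cross' hz, hg.pd_lapse hz]
  have := (hg.pos z hz).ne'
  simp only [zero_mul, Finset.sum_const_zero]
  field_simp
  ring

theorem christoffel_mixed (hg : IsLapseMetric g T u) (hz : sliceIncl z ∈ T) (i j : Fin n) :
    christoffel g i.castSucc (Fin.last n) j.castSucc (sliceIncl z) =
      1 / 2 * ((slab g (sliceIncl z))⁻¹ * normalSlab g (sliceIncl z)) i j := by
  rw [christoffel, Fin.sum_univ_castSucc, (hg.inv_block hz).2.1]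
  simp only [(hg.inv_block hz).1, hg.pd_cross hz, hg.pd_cross' hz, Matrix.mul_apply]
  rw [zero_mul, add_zero]
  congr 1
  refine Finset.sum_congr rfl fun l _ => ?_
  rw [add_zero, sub_zero]; rfl

theorem christoffel_normal (hg : IsLapseMetric g T u) (hz : sliceIncl z ∈ T) (i j : Fin n) :
    christoffel g (Fin.last n) i.castSucc j.castSucc (sliceIncl z) =
      -(normalSlab g (sliceIncl z) i j / (2 * u z ^ 2)) := by
  rw [christoffel, Fin.sum_univ_castSucc, (hg.inv_block hz).2.2]
  simp only [hg.inv_cross' hz, hg.pd_cross' hz]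
  have := (hg.pos z hz).ne'
  simp only [zero_mul, Finset.sum_const_zero]
  change 1 / 2 * (0 + (u z ^ 2)⁻¹ * (0 + 0 - normalSlab g (sliceIncl z) i j)) = _
  field_simp
  ring

/-- The second normal derivative of the tangential part of the metric. -/
def _root_.normalSlab₂ (g : Euc (n + 1) → Matrix (Fin (n + 1)) (Fin (n + 1)) ℝ) (y : Euc (n + 1)) :
    Matrix (Fin n) (Fin n) ℝ :=
  Matrix.of fun i j => pd (Fin.last n) (pd (Fin.last n) fun x => g x i.castSucc j.castSucc) y

theorem sum_inv_antisymm {h : Matrix (Fin n) (Fin n) ℝ} (hs : ∀ i j, h i j = h j i)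
    (a : Fin n → Fin n → ℝ) (b : Fin n → Fin n → ℝ) :
    ∑ i, ∑ l, h i l * (a i l + b i l - a l i) = ∑ i, ∑ l, h i l * b i l := by
  have h1 : ∑ i, ∑ l, h i l * a l i = ∑ i, ∑ l, h i l * a i l := by
    rw [Finset.sum_comm]
    exact Finset.sum_congr rfl fun i _ => Finset.sum_congr rfl fun l _ => by rw [hs]
  have h2 : ∑ i, ∑ l, h i l * (a i l + b i l - a l i) =
      ∑ i, ∑ l, h i l * a i l + ∑ i, ∑ l, h i l * b i l - ∑ i, ∑ l, h i l * a l i := by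
    simp only [← Finset.sum_add_distrib, ← Finset.sum_sub_distrib]
    exact Finset.sum_congr rfl fun i _ => Finset.sum_congr rfl fun l _ => by ring
  rw [h2, h1]; ring

theorem christoffel_trace (hg : ∀ y i j, g y i j = g y j i) (k : Fin (n + 1)) (y : Euc (n + 1)) :
    ∑ i : Fin n, christoffel g i.castSucc k i.castSucc y =
      1 / 2 * ∑ i : Fin n, ∑ l : Fin n, (g y)⁻¹ i.castSucc l.castSucc *
        pd k (fun x => g x l.castSucc i.castSucc) y +
      1 / 2 * ∑ i : Fin n, (g y)⁻¹ i.castSucc (Fin.last n) *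
        (pd k (fun x => g x (Fin.last n) i.castSucc) y +
          pd i.castSucc (fun x => g x (Fin.last n) k) y -
          pd (Fin.last n) (fun x => g x k i.castSucc) y) := by
  simp only [christoffel, Fin.sum_univ_castSucc, mul_add, Finset.sum_add_distrib, ← Finset.mul_sum]
  congr 2
  rw [← sum_inv_antisymm (fun i j : Fin n => inv_apply_symm (hg y) i.castSucc j.castSucc)
    (fun i l => pd i.castSucc (fun x => g x l.castSucc k) y)
    (fun i l => pd k (fun x => g x l.castSucc i.castSucc) y)]
  refine Finset.sum_congr rfl fun i _ => Finset.sum_congr rfl fun l _ => ?_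
  have h1 : (fun x => g x k i.castSucc) = fun x => g x i.castSucc k := funext fun x => hg x _ _
  rw [h1]; ring

theorem christoffel_trace_last (hg : IsLapseMetric g T u) (hz : sliceIncl z ∈ T) :
    ∑ i : Fin n, christoffel g i.castSucc (Fin.last n) i.castSucc (sliceIncl z) =
      1 / 2 * ((slab g (sliceIncl z))⁻¹ * normalSlab g (sliceIncl z)).trace := by
  rw [christoffel_trace hg.symm]
  simp only [(hg.inv_block hz).1, (hg.inv_block hz).2.1, zero_mul, Finset.sum_const_zero, mul_zero,
    add_zero, Matrix.trace, Matrix.diag_apply, Matrix.mul_apply]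
  rfl

theorem christoffel_trace_castSucc (hg : IsLapseMetric g T u) (hz : sliceIncl z ∈ T) (j : Fin n) :
    ∑ i : Fin n, christoffel g i.castSucc i.castSucc j.castSucc (sliceIncl z) =
      1 / 2 * ∑ i, ∑ l, (slab g (sliceIncl z))⁻¹ i l *
        pd j.castSucc (fun x => g x l.castSucc i.castSucc) (sliceIncl z) := by
  rw [Finset.sum_congr rfl fun i _ => christoffel_symm hg.symm i.castSucc i.castSucc j.castSucc _,
    christoffel_trace hg.symm]
  simp only [(hg.inv_block hz).1, (hg.inv_block hz).2.1, zero_mul, Finset.sum_const_zero, mul_zero,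
    add_zero]

theorem dirMatrix_cross (hg : IsLapseMetric g T u) (hz : sliceIncl z ∈ T) (i : Fin n) :
    dirMatrix g (sliceIncl z) (vert n) i.castSucc (Fin.last n) = 0 ∧
      dirMatrix g (sliceIncl z) (vert n) (Fin.last n) i.castSucc = 0 :=
  ⟨hg.pd_cross hz i (Fin.last n), hg.pd_cross' hz i (Fin.last n)⟩

theorem inv_dirMatrix_block (hg : IsLapseMetric g T u) (hz : sliceIncl z ∈ T) (i j : Fin n) :
    ((g (sliceIncl z))⁻¹ * dirMatrix g (sliceIncl z) (vert n) * (g (sliceIncl z))⁻¹)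
        i.castSucc j.castSucc =
      ((slab g (sliceIncl z))⁻¹ * normalSlab g (sliceIncl z) * (slab g (sliceIncl z))⁻¹) i j ∧
    ((g (sliceIncl z))⁻¹ * dirMatrix g (sliceIncl z) (vert n) * (g (sliceIncl z))⁻¹)
        i.castSucc (Fin.last n) = 0 := by
  simp only [Matrix.mul_apply, Fin.sum_univ_castSucc, (hg.inv_block hz).1, (hg.inv_block hz).2.1,
    hg.inv_cross' hz, (hg.dirMatrix_cross hz _).1, mul_zero, zero_mul, add_zero,
    Finset.sum_const_zero, and_true]
  rfl

theorem pd_christoffel_trace (hg : IsLapseMetric g T u) (hz : sliceIncl z ∈ T) :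
    ∑ i : Fin n, pd (Fin.last n) (christoffel g i.castSucc (Fin.last n) i.castSucc) (sliceIncl z) =
      1 / 2 * (((slab g (sliceIncl z))⁻¹ * normalSlab₂ g (sliceIncl z)).trace -
        ((slab g (sliceIncl z))⁻¹ * normalSlab g (sliceIncl z) *
          ((slab g (sliceIncl z))⁻¹ * normalSlab g (sliceIncl z))).trace) := by
  have hch : ∀ i : Fin n, DifferentiableAt ℝ
      (christoffel g i.castSucc (Fin.last n) i.castSucc) (sliceIncl z) := fun i =>
    (contDiffAt_christoffel (hg.smooth _ hz) (hg.det_ne_zero _ hz) _ _ _).differentiableAt (by simp)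
  rw [← pd_sum fun i _ => hch i]
  refine pd_eq_of_hasDerivAt (DifferentiableAt.fun_sum fun i _ => hch i) ?_
  simp only [christoffel_trace hg.symm]
  have hd : ∀ i j, DifferentiableAt ℝ (fun x => g x i j) (sliceIncl z) := fun i j =>
    (hg.smooth _ hz i j).differentiableAt (by simp)
  have hinv : ∀ a b, HasDerivAt (fun t : ℝ =>
      (g (sliceIncl z + t • EuclideanSpace.single (Fin.last n) 1))⁻¹ a b)
      (-((g (sliceIncl z))⁻¹ * dirMatrix g (sliceIncl z) (vert n) * (g (sliceIncl z))⁻¹) a b) 0 :=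
    fun a b => by
      have := hasDerivAt_inv_line (c := id) hd (Fin.last n) (by simpa using hg.det_ne_zero _ hz) a b
      simp only [Matrix.submatrix_id_id] at this
      exact this
  have hp : ∀ k i j, HasDerivAt (fun t : ℝ => pd k (fun x => g x i j)
      (sliceIncl z + t • EuclideanSpace.single (Fin.last n) 1))
      (pd (Fin.last n) (pd k fun x => g x i j) (sliceIncl z)) 0 := fun k i j =>
    hasDerivAt_line (((hg.smooth _ hz i j).pd k).differentiableAt (by simp)) _
  have h1 := ((HasDerivAt.fun_sum fun (i : Fin n) (_ : i ∈ Finset.univ) => HasDerivAt.fun_sum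
    fun (l : Fin n) (_ : l ∈ Finset.univ) => (hinv i.castSucc l.castSucc).mul
      (hp (Fin.last n) l.castSucc i.castSucc)).const_mul (1 / 2 : ℝ)).add
    ((HasDerivAt.fun_sum fun (i : Fin n) (_ : i ∈ Finset.univ) =>
      (hinv i.castSucc (Fin.last n)).mul (((hp (Fin.last n) (Fin.last n) i.castSucc).add
        (hp i.castSucc (Fin.last n) (Fin.last n))).sub
        (hp (Fin.last n) (Fin.last n) i.castSucc))).const_mul (1 / 2 : ℝ))
  refine h1.congr_deriv ?_
  simp only [zero_smul, add_zero, (hg.inv_dirMatrix_block hz _ _).1,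
    (hg.inv_block hz).1, (hg.inv_block hz).2.1]
  have h2 : ∀ i : Fin n, ((g (sliceIncl z))⁻¹ * dirMatrix g (sliceIncl z) (vert n) *
      (g (sliceIncl z))⁻¹) i.castSucc (Fin.last n) = 0 := fun i => (hg.inv_dirMatrix_block hz i i).2
  simp only [h2, neg_zero, zero_mul, add_zero, Finset.sum_const_zero, mul_zero]
  rw [← Matrix.mul_assoc, Matrix.trace, Matrix.trace, ← Finset.sum_sub_distrib]
  congr 1
  refine Finset.sum_congr rfl fun i _ => ?_
  rw [Matrix.diag_apply, Matrix.diag_apply, Matrix.mul_apply, Matrix.mul_apply,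
    ← Finset.sum_sub_distrib]
  refine Finset.sum_congr rfl fun l _ => ?_
  change -_ * normalSlab g (sliceIncl z) l i + _ * normalSlab₂ g (sliceIncl z) l i = _
  ring

/-- The volume density of the slice. -/
def density (g : Euc (n + 1) → Matrix (Fin (n + 1)) (Fin (n + 1)) ℝ) (w : Euc n) : ℝ :=
  Real.sqrt (slab g (sliceIncl w)).det

theorem density_pos (hg : IsLapseMetric g T u) (hz : sliceIncl z ∈ T) : 0 < density g z :=
  Real.sqrt_pos.2 (hg.det_pos _ hz)

theorem smooth_density (hg : IsLapseMetric g T u) (hz : sliceIncl z ∈ T) :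
    ContDiffAt ℝ ∞ (density g) z :=
  (contDiffAt_det (A := fun w => slab g (sliceIncl w)) fun i j => hg.smooth_slab hz i j).sqrt
    (hg.det_pos _ hz).ne'

theorem smooth_grad (hg : IsLapseMetric g T u) (hz : sliceIncl z ∈ T) (i : Fin n) :
    ContDiffAt ℝ ∞ (grad g u i) z :=
  ContDiffAt.sum fun j _ => (hg.smooth_slab_inv hz i j).mul ((hg.smooth_lapse z hz).pd j)

theorem pd_slab (hg : IsLapseMetric g T u) (hz : sliceIncl z ∈ T) (a b j : Fin n) :
    pd j (fun w => slab g (sliceIncl w) a b) z =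
      pd j.castSucc (fun x => g x a.castSucc b.castSucc) (sliceIncl z) := by
  have h1 := fderiv_comp_sliceIncl
    ((hg.smooth _ hz a.castSucc b.castSucc).differentiableAt (by simp)) (EuclideanSpace.single j 1)
  rw [sliceIncl_single] at h1
  exact h1

theorem pd_density (hg : IsLapseMetric g T u) (hz : sliceIncl z ∈ T) (j : Fin n) :
    pd j (density g) z = density g z * (1 / 2 * ∑ i, ∑ l, (slab g (sliceIncl z))⁻¹ i l *
        pd j.castSucc (fun x => g x l.castSucc i.castSucc) (sliceIncl z)) := by
  have hdet := hg.det_pos _ hz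
  have h1 := hasDerivAt_det_of_ne_zero (t := 0)
    (A := fun t : ℝ => slab g (sliceIncl (z + t • EuclideanSpace.single j 1)))
    (A' := Matrix.of fun a b => pd j (fun w => slab g (sliceIncl w) a b) z)
    (fun a b => hasDerivAt_line ((hg.smooth_slab hz a b).differentiableAt (by simp)) j)
    (by simpa using hdet.ne')
  have h2 := h1.sqrt (by simpa using hdet.ne')
  refine pd_eq_of_hasDerivAt ((hg.smooth_density hz).differentiableAt (by simp))
    (h2.congr_deriv ?_)
  simp only [zero_smul, add_zero, density]
  have h3 : ((slab g (sliceIncl z))⁻¹ *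
      Matrix.of fun a b => pd j (fun w => slab g (sliceIncl w) a b) z).trace =
      ∑ i, ∑ l, (slab g (sliceIncl z))⁻¹ i l *
        pd j.castSucc (fun x => g x l.castSucc i.castSucc) (sliceIncl z) := by
    simp only [Matrix.trace, Matrix.diag_apply, Matrix.mul_apply, Matrix.of_apply, hg.pd_slab hz]
  rw [h3]
  have h4 := Real.mul_self_sqrt hdet.le
  have h5 := (Real.sqrt_pos.2 hdet).ne'
  field_simp
  rw [sq, h4, mul_comm]

theorem laplaceBeltrami_eq (hg : IsLapseMetric g T u) (hz : sliceIncl z ∈ T) :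
    laplaceBeltrami (fun w => slab g (sliceIncl w)) u z = ∑ i, (pd i (grad g u i) z +
      (1 / 2 * ∑ a, ∑ l, (slab g (sliceIncl z))⁻¹ a l *
        pd i.castSucc (fun x => g x l.castSucc a.castSucc) (sliceIncl z)) * grad g u i z) := by
  rw [laplaceBeltrami, Finset.mul_sum]
  refine Finset.sum_congr rfl fun i _ => ?_
  have h1 := pd_mul ((hg.smooth_density hz).differentiableAt (by simp))
    ((hg.smooth_grad hz i).differentiableAt (by simp)) i
  rw [hg.pd_density hz] at h1
  have h2 := (hg.density_pos hz).ne'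
  refine (congrArg ((density g z)⁻¹ * ·) h1).trans ?_
  rw [mul_add, mul_assoc, inv_mul_cancel_left₀ h2, inv_mul_cancel_left₀ h2]
  ring

/-- The Ricci curvature in the normal direction. -/
theorem ricciCoord_last (hg : IsLapseMetric g T u) (hz : sliceIncl z ∈ T)
    (hK : ((slab g (sliceIncl z))⁻¹ * normalSlab g (sliceIncl z)).trace = 0) :
    ricciCoord g (Fin.last n) (Fin.last n) (sliceIncl z) =
      -(u z * laplaceBeltrami (fun w => slab g (sliceIncl w)) u z) -
      1 / 2 * ((slab g (sliceIncl z))⁻¹ * normalSlab₂ g (sliceIncl z)).trace +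
      1 / 4 * ((slab g (sliceIncl z))⁻¹ * normalSlab g (sliceIncl z) *
        ((slab g (sliceIncl z))⁻¹ * normalSlab g (sliceIncl z))).trace := by
  have hu := (hg.pos z hz).ne'
  have hpd : ∀ i : Fin n, pd i.castSucc (christoffel g i.castSucc (Fin.last n) (Fin.last n))
      (sliceIncl z) = -(pd i u z * grad g u i z + u z * pd i (grad g u i) z) := fun i => by
    have h1 := fderiv_comp_sliceIncl ((contDiffAt_christoffel (hg.smooth _ hz)
      (hg.det_ne_zero _ hz) i.castSucc (Fin.last n) (Fin.last n)).differentiableAt (by simp))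
      (EuclideanSpace.single i 1)
    rw [sliceIncl_single] at h1
    rw [pd, ← h1]
    have h2 : (fun w => christoffel g i.castSucc (Fin.last n) (Fin.last n) (sliceIncl w)) =ᶠ[𝓝 z]
        fun w => -(u w * grad g u i w) := by
      filter_upwards [hg.eventually_mem hz] with w hw using hg.christoffel_last_last hw i
    rw [h2.fderiv_eq, fderiv_fun_neg]
    exact congrArg Neg.neg (pd_mul ((hg.smooth_lapse z hz).differentiableAt (by simp))
      ((hg.smooth_grad hz i).differentiableAt (by simp)) i)
  have hmix : ∀ k i j, christoffel g k i j (sliceIncl z) = christoffel g k j i (sliceIncl z) :=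
    fun k i j => christoffel_symm hg.symm k i j _
  have hq1 : ∑ i : Fin n, ∑ j : Fin n, christoffel g i.castSucc i.castSucc j.castSucc (sliceIncl z) *
      christoffel g j.castSucc (Fin.last n) (Fin.last n) (sliceIncl z) =
      -(u z * ∑ j, (1 / 2 * ∑ a, ∑ l, (slab g (sliceIncl z))⁻¹ a l *
        pd j.castSucc (fun x => g x l.castSucc a.castSucc) (sliceIncl z)) * grad g u j z) := by
    rw [Finset.sum_comm, Finset.mul_sum, ← Finset.sum_neg_distrib]
    refine Finset.sum_congr rfl fun j _ => ?_
    rw [← Finset.sum_mul, hg.christoffel_trace_castSucc hz, hg.christoffel_last_last hz]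
    ring
  have hq2 : ∑ i : Fin n, ∑ j : Fin n, christoffel g i.castSucc (Fin.last n) j.castSucc (sliceIncl z) *
      christoffel g j.castSucc (Fin.last n) i.castSucc (sliceIncl z) =
      1 / 4 * ((slab g (sliceIncl z))⁻¹ * normalSlab g (sliceIncl z) *
        ((slab g (sliceIncl z))⁻¹ * normalSlab g (sliceIncl z))).trace := by
    rw [Matrix.trace, Finset.mul_sum]
    refine Finset.sum_congr rfl fun i _ => ?_
    rw [Matrix.diag_apply, Matrix.mul_apply, Finset.mul_sum]
    refine Finset.sum_congr rfl fun j _ => ?_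
    rw [hg.christoffel_mixed hz, hg.christoffel_mixed hz]
    ring
  have hq3 : ∑ i : Fin n, christoffel g i.castSucc i.castSucc (Fin.last n) (sliceIncl z) *
      christoffel g (Fin.last n) (Fin.last n) (Fin.last n) (sliceIncl z) = 0 := by
    rw [← Finset.sum_mul, Finset.sum_congr rfl fun (i : Fin n) _ =>
      hmix i.castSucc i.castSucc (Fin.last n), hg.christoffel_trace_last hz, hK]
    ring
  rw [ricciCoord]
  simp only [Fin.sum_univ_castSucc, sub_self, add_zero, Finset.sum_add_distrib,
    Finset.sum_sub_distrib, hpd, hg.pd_christoffel_trace hz, hg.laplaceBeltrami_eq hz, hq1, hq2, hq3,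
    Finset.sum_neg_distrib]
  have hq4 : ∑ i : Fin n, christoffel g i.castSucc (Fin.last n) (Fin.last n) (sliceIncl z) *
      christoffel g (Fin.last n) (Fin.last n) i.castSucc (sliceIncl z) =
      -∑ i, pd i u z * grad g u i z := by
    rw [← Finset.sum_neg_distrib]
    refine Finset.sum_congr rfl fun i _ => ?_
    rw [hg.christoffel_last_last hz, hg.christoffel_last hz]
    field_simp
  rw [hq4]
  simp only [← Finset.mul_sum]
  ring

end IsLapseMetric

end LapseMetric

section JacobiMetric

variable {n : ℕ} {g : Euc (n + 1) → Matrix (Fin (n + 1)) (Fin (n + 1)) ℝ}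
  {T : Set (Euc (n + 1))} {u : Euc n → ℝ} {z : Euc n}

/-- A lapse metric for which the volume density of the parallel slices agrees to second order
with that of the central slice. -/
structure IsJacobiMetric (g : Euc (n + 1) → Matrix (Fin (n + 1)) (Fin (n + 1)) ℝ)
    (T : Set (Euc (n + 1))) (u : Euc n → ℝ) : Prop extends IsLapseMetric g T u where
  expansion : ∀ z, sliceIncl z ∈ T → ∃ C, ∀ᶠ y in 𝓝 (sliceIncl z),
    |(slab g y).det - (slab g (sliceIncl (sliceProj n y))).det| ≤ C * |y (Fin.last n)| ^ 3

theorem IsLapseMetric.deriv_det (hg : IsLapseMetric g T u) (hz : sliceIncl z ∈ T)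
    (hK : ((slab g (sliceIncl z))⁻¹ * normalSlab g (sliceIncl z)).trace = 0)
    (hJ : ((slab g (sliceIncl z))⁻¹ * normalSlab₂ g (sliceIncl z)).trace =
      ((slab g (sliceIncl z))⁻¹ * normalSlab g (sliceIncl z) *
        ((slab g (sliceIncl z))⁻¹ * normalSlab g (sliceIncl z))).trace) :
    deriv (fun t : ℝ => (slab g (sliceIncl z + t • vert n)).det) 0 = 0 ∧
      deriv (deriv fun t : ℝ => (slab g (sliceIncl z + t • vert n)).det) 0 = 0 := by
  have hc : ContinuousAt (fun t : ℝ => sliceIncl z + t • vert n) 0 := by fun_prop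
  have hev : ∀ᶠ t : ℝ in 𝓝 0, sliceIncl z + t • vert n ∈ T :=
    hc.eventually (p := fun y => y ∈ T) (by simpa using hg.isOpen.eventually_mem hz)
  have h1 : ∀ i j, ∀ᶠ t : ℝ in 𝓝 0, HasDerivAt (fun s : ℝ => slab g (sliceIncl z + s • vert n) i j)
      (normalSlab g (sliceIncl z + t • vert n) i j) t := fun i j => by
    filter_upwards [hev] with t ht
    have h2 := ((hg.smooth _ ht i.castSucc j.castSucc).differentiableAt (by simp)).hasFDerivAt
    have h3 : HasDerivAt (fun s : ℝ => sliceIncl z + s • vert n) (vert n) t := by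
      simpa using ((hasDerivAt_id t).smul_const (vert n)).const_add (sliceIncl z)
    exact h2.comp_hasDerivAt t h3
  have h2 : ∀ i j, HasDerivAt (fun s : ℝ => normalSlab g (sliceIncl z + s • vert n) i j)
      (normalSlab₂ g (sliceIncl z) i j) 0 := fun i j =>
    hasDerivAt_line (((hg.smooth _ hz i.castSucc j.castSucc).pd (Fin.last n)).differentiableAt
      (by simp)) (Fin.last n)
  have h0 : (slab g (sliceIncl z + (0 : ℝ) • vert n)).det ≠ 0 := by
    simpa using (hg.det_pos _ hz).ne'
  refine ⟨?_, ?_⟩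
  · have := (hasDerivAt_det_of_ne_zero (fun i j => (h1 i j).self_of_nhds) h0).deriv
    rw [this, zero_smul, add_zero, hK, mul_zero]
  · rw [deriv_deriv_det h1 h2 h0, zero_smul, add_zero, hK, hJ]
    ring

theorem IsLapseMetric.isJacobiMetric (hg : IsLapseMetric g T u)
    (hK : ∀ z, sliceIncl z ∈ T →
      ((slab g (sliceIncl z))⁻¹ * normalSlab g (sliceIncl z)).trace = 0)
    (hJ : ∀ z, sliceIncl z ∈ T → ((slab g (sliceIncl z))⁻¹ * normalSlab₂ g (sliceIncl z)).trace =
      ((slab g (sliceIncl z))⁻¹ * normalSlab g (sliceIncl z) *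
        ((slab g (sliceIncl z))⁻¹ * normalSlab g (sliceIncl z))).trace) :
    IsJacobiMetric g T u := by
  refine ⟨hg, fun z hz => ?_⟩
  set f : ℝ × Euc n → ℝ := fun q => (slab g (sliceIncl q.2 + q.1 • vert n)).det with hf
  have hmap : ContDiff ℝ ∞ fun q : ℝ × Euc n => sliceIncl q.2 + q.1 • vert n :=
    (contDiff_sliceIncl.comp contDiff_snd).add (contDiff_fst.smul contDiff_const)
  have h0 : sliceIncl z + (0 : ℝ) • vert n = sliceIncl z := by rw [zero_smul, add_zero]
  have hfs : ContDiffAt ℝ ∞ f (0, z) :=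
    contDiffAt_det (A := fun q : ℝ × Euc n => slab g (sliceIncl q.2 + q.1 • vert n)) fun i j =>
      ContDiffAt.comp (g := fun y => g y i.castSucc j.castSucc) ((0 : ℝ), z)
        (hg.smooth _ (by rw [h0]; exact hz) _ _) hmap.contDiffAt
  obtain ⟨C, hC, ε, hε, U, hU, hb⟩ := taylor_two_uniform_at (contDiffAt_infty.1 hfs 3)
  refine ⟨C, ?_⟩
  have h1 : ∀ᶠ y in 𝓝 (sliceIncl z), sliceProj n y ∈ U ∧ sliceIncl (sliceProj n y) ∈ T := by
    refine (sliceProj n).continuous.continuousAt.eventually (p := fun w => w ∈ U ∧ sliceIncl w ∈ T) ?_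
    rw [sliceProj_sliceIncl]
    exact Filter.Eventually.and hU (hg.eventually_mem hz)
  have h2 : ∀ᶠ y : Euc (n + 1) in 𝓝 (sliceIncl z), |y (Fin.last n)| < ε := by
    have hc : Continuous fun y : Euc (n + 1) => |y (Fin.last n)| := by fun_prop
    exact hc.continuousAt.eventually (gt_mem_nhds (by
      simpa [sliceIncl_last] using hε))
  filter_upwards [h1, h2] with y hy1 hy2
  have h3 := (hb _ hy1.1 _ hy2).1
  obtain ⟨h4, h5⟩ := hg.deriv_det hy1.2 (hK _ hy1.2) (hJ _ hy1.2)
  simp only [hf] at h3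
  rw [h4, h5, ← eq_sliceIncl_add, zero_smul, add_zero] at h3
  simpa using h3

end JacobiMetric

section LapseChart

theorem sum_inv_mul {k : ℕ} {h N : Matrix (Fin k) (Fin k) ℝ} (hh : ∀ i j, h i j = h j i)
    (hN : ∀ i j, N i j = N j i) :
    ∑ i, ∑ j, ∑ a, ∑ b, h i a * h j b * N i j * N a b = (h * N * (h * N)).trace := by
  rw [← Matrix.mul_assoc, Matrix.trace]
  refine Finset.sum_congr rfl fun i _ => ?_
  rw [Matrix.diag_apply, Matrix.mul_apply]
  refine Finset.sum_congr rfl fun j _ => ?_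
  rw [Matrix.mul_apply, Finset.sum_comm, Finset.sum_mul]
  refine Finset.sum_congr rfl fun b _ => ?_
  rw [Matrix.mul_apply, Finset.sum_mul, Finset.sum_mul]
  refine Finset.sum_congr rfl fun a _ => ?_
  rw [hh j b, hN j i]; ring

variable {n : ℕ} {M : Type*} [EMetricSpace M] [ChartedSpace (Euc (n + 1)) M]
  [IsManifold (𝓡 (n + 1)) ∞ M]
  [RiemannianBundle (fun x : M => TangentSpace (𝓡 (n + 1)) x)]
  [IsContMDiffRiemannianBundle (𝓡 (n + 1)) ∞ (Euc (n + 1))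
    (fun x : M => TangentSpace (𝓡 (n + 1)) x)]
  {A S : Set M} {ν : (p : M) → TangentSpace (𝓡 (n + 1)) p} {u : M → ℝ}
  {e : Chart n M} {z : Euc n}

theorem IsLapseChart.vecComp_eq (he : IsLapseChart A S ν u e)
    (hg : IsLapseMetric (metricCoord e) e.target (sliceFun e u)) (hz : sliceIncl z ∈ e.target)
    (i : Fin (n + 1)) : vecComp e ν (sliceIncl z) i = (sliceFun e u z)⁻¹ * vert n i := by
  refine vecComp_chartVec he.slice.1 hz (w := (sliceFun e u z)⁻¹ • vert n) ?_ i
  rw [chartVec_smul]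
  have h1 := he.coordVec_last z hz
  rw [← chartVec_single] at h1
  change chartVec e (sliceIncl z) (vert n) = sliceFun e u z • _ at h1
  rw [h1, smul_smul, inv_mul_cancel₀ (hg.pos z hz).ne', one_smul]

theorem IsLapseChart.ricciNormal_eq (he : IsLapseChart A S ν u e)
    (hg : IsLapseMetric (metricCoord e) e.target (sliceFun e u)) (hz : sliceIncl z ∈ e.target) :
    ricciNormal e ν (sliceIncl z) = ricciCoord (metricCoord e) (Fin.last n) (Fin.last n)
      (sliceIncl z) / sliceFun e u z ^ 2 := by
  simp only [ricciNormal, he.vecComp_eq hg hz, Fin.sum_univ_castSucc, vert_castSucc, vert_last,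
    mul_zero, Finset.sum_const_zero, zero_add, zero_mul]
  have := (hg.pos z hz).ne'
  field_simp

theorem IsLapseChart.secondFF_eq (he : IsLapseChart A S ν u e) (hν : IsUnitNormal A ν)
    (hg : IsLapseMetric (metricCoord e) e.target (sliceFun e u)) (hz : sliceIncl z ∈ e.target)
    (i j : Fin n) : secondFF e ν z i j =
      -(normalSlab (metricCoord e) (sliceIncl z) i j / (2 * sliceFun e u z)) := by
  have h1 : inner ℝ (coordVec e (Fin.last n) (sliceIncl z)) (ν (e.symm (sliceIncl z))) =
      sliceFun e u z := by
    rw [he.coordVec_last z hz, real_inner_smul_left, real_inner_self_eq_norm_sq,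
      hν.norm_eq_one _ (he.slice.mem_regPart hz), sliceFun]
    ring
  rw [secondFF, Fin.sum_univ_castSucc, h1]
  simp only [hν.normal e he.slice z hz, mul_zero, Finset.sum_const_zero, zero_add,
    hg.christoffel_normal hz]
  have := (hg.pos z hz).ne'
  field_simp

theorem IsLapseChart.secondFFNormSq_eq (he : IsLapseChart A S ν u e) (hν : IsUnitNormal A ν)
    (hg : IsLapseMetric (metricCoord e) e.target (sliceFun e u)) (hz : sliceIncl z ∈ e.target) :
    secondFFNormSq e ν z = (4 * sliceFun e u z ^ 2)⁻¹ *
      ((slab (metricCoord e) (sliceIncl z))⁻¹ * normalSlab (metricCoord e) (sliceIncl z) *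
        ((slab (metricCoord e) (sliceIncl z))⁻¹ * normalSlab (metricCoord e) (sliceIncl z))).trace := by
  have hh : ∀ i j, (slab (metricCoord e) (sliceIncl z))⁻¹ i j =
      (slab (metricCoord e) (sliceIncl z))⁻¹ j i := inv_apply_symm fun i j => hg.symm _ _ _
  have hN : ∀ i j, normalSlab (metricCoord e) (sliceIncl z) i j =
      normalSlab (metricCoord e) (sliceIncl z) j i := fun i j =>
    congrArg (fun f => pd (Fin.last n) f (sliceIncl z)) (funext fun y => hg.symm y _ _)
  have hu := (hg.pos z hz).ne'
  rw [← sum_inv_mul hh hN, secondFFNormSq, Finset.mul_sum]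
  simp only [he.secondFF_eq hν hg hz, Finset.mul_sum, ← slab_metricCoord]
  refine Finset.sum_congr rfl fun i _ => Finset.sum_congr rfl fun j _ =>
    Finset.sum_congr rfl fun k _ => Finset.sum_congr rfl fun l _ => ?_
  field_simp
  ring

/-- The metric of a lapse chart in the support of a stationary varifold. -/
theorem IsLapseChart.isJacobiMetric [CompactSpace M] [MeasurableSpace M] [BorelSpace M]
    {V : Varifold n M} (hV : V.IsStationary) (he : IsLapseChart V.spt S ν u e)
    (hν : IsUnitNormal V.spt ν) (hS : IsClosed S) (hu : IsPositiveJacobi V.spt S ν u) :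
    IsJacobiMetric (metricCoord e) e.target (sliceFun e u) := by
  have hg := he.isLapseMetric hν hS hu
  have hK := fun z (hz : sliceIncl z ∈ e.target) => hV.trace_normalSlab he.slice hg hz
  refine hg.isJacobiMetric hK fun z hz => ?_
  have hj := hu.jacobi e he.slice z ⟨hz, he.disj _ (e.map_target hz)⟩
  have hpos := (hg.pos z hz).ne'
  rw [jacobiOp, he.ricciNormal_eq hg hz, he.secondFFNormSq_eq hν hg hz,
    hg.ricciCoord_last hz (hK z hz)] at hj
  change -laplaceBeltrami (fun w => slab (metricCoord e) (sliceIncl w)) (sliceFun e u) z - _ = 0 at hj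
  field_simp at hj
  linarith

end LapseChart

section SecondVariation

variable {n : ℕ}

/-- Time and space derivatives commute. -/
theorem hasDerivAt_fderiv_comm {E G : Type*} [NormedAddCommGroup E] [NormedSpace ℝ E]
    [NormedAddCommGroup G] [NormedSpace ℝ G] {f : ℝ × E → G} {t : ℝ} {z : E}
    (hf : ContDiffAt ℝ 2 f (t, z)) (b : E) :
    HasDerivAt (fun s => fderiv ℝ f (s, z) (0, b))
      (fderiv ℝ (fun w => fderiv ℝ f (t, w) (1, 0)) z b) t := by
  have hd : HasFDerivAt (fderiv ℝ f) (fderiv ℝ (fderiv ℝ f) (t, z)) (t, z) :=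
    ((hf.fderiv_right (m := 1) (by norm_num)).differentiableAt (by simp)).hasFDerivAt
  have h1 : HasDerivAt (fun s : ℝ => (s, z)) ((1, 0) : ℝ × E) t :=
    (hasDerivAt_id t).prodMk (hasDerivAt_const t z)
  have h2 : HasFDerivAt (fun w : E => (t, w)) (ContinuousLinearMap.inr ℝ ℝ E) z :=
    hasFDerivAt_prodMk_right t z
  have h3 : HasDerivAt (fun s => fderiv ℝ f (s, z) (0, b))
      (fderiv ℝ (fderiv ℝ f) (t, z) (1, 0) (0, b)) t :=
    (ContinuousLinearMap.apply ℝ G ((0, b) : ℝ × E)).hasFDerivAt.comp_hasDerivAt t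
      (hd.comp_hasDerivAt t h1)
  have h4 : HasFDerivAt (fun w => fderiv ℝ f (t, w) (1, 0))
      ((ContinuousLinearMap.apply ℝ G ((1, 0) : ℝ × E)).comp
        ((fderiv ℝ (fderiv ℝ f) (t, z)).comp (ContinuousLinearMap.inr ℝ ℝ E))) z :=
    (ContinuousLinearMap.apply ℝ G ((1, 0) : ℝ × E)).hasFDerivAt.comp z (hd.comp z h2)
  have h5 := (hf.isSymmSndFDerivAt (by simp)).eq (0, b) (1, 0)
  rw [h4.fderiv]
  exact h3.congr_deriv h5.symm

/-- A function vanishing at `0` is divisible by `t`. -/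
theorem exists_eq_mul_of_hasDerivAt {σ : ℝ → ℝ} {c : ℝ} (h : HasDerivAt σ c 0) (h0 : σ 0 = 0) :
    ∃ s : ℝ → ℝ, Tendsto s (𝓝 0) (𝓝 c) ∧ ∀ t, σ t = t * s t := by
  refine ⟨dslope σ 0, ?_, fun t => ?_⟩
  · have := (continuousAt_dslope_same.2 h.differentiableAt).tendsto
    rwa [dslope_same, h.deriv] at this
  · have := sub_smul_dslope σ 0 t
    rw [h0, sub_zero, sub_zero, smul_eq_mul] at this
    exact this.symm

theorem isLittleO_sq_mul {f k : ℝ → ℝ} (hk : Tendsto k (𝓝 0) (𝓝 0)) (hf : ∀ t, f t = t ^ 2 * k t) :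
    f =o[𝓝 0] fun t : ℝ => t ^ 2 := by
  have h1 : f = fun t => t ^ 2 * k t := funext hf
  have h2 := (Asymptotics.isBigO_refl (fun t : ℝ => t ^ 2) (𝓝 0)).mul_isLittleO
    ((Asymptotics.isLittleO_one_iff ℝ).2 hk)
  rw [h1]
  simpa using h2

theorem deriv_deriv_of_sq {J ρ : ℝ → ℝ} {E : ℝ} (hJ : ContDiffAt ℝ 2 J 0) (hρ : ContDiffAt ℝ 2 ρ 0)
    (hJ0 : J 0 = 1) (hρ0 : ρ 0 = 1)
    (h : (fun t => J t ^ 2 - ρ t ^ 2 - t ^ 2 * E) =o[𝓝 0] fun t : ℝ => t ^ 2) :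
    deriv (deriv J) 0 = E + deriv (deriv ρ) 0 := by
  have hsum : Tendsto (fun t => J t + ρ t) (𝓝 0) (𝓝 2) := by
    have h1 := hJ.continuousAt.tendsto.add hρ.continuousAt.tendsto
    rwa [hJ0, hρ0, one_add_one_eq_two] at h1
  have h1 : (fun t => J t - ρ t - t ^ 2 / 2 * E) =o[𝓝 0] fun t : ℝ => t ^ 2 := by
    have h2 : (fun t => t ^ 2 * (E * (1 - (J t + ρ t) / 2))) =o[𝓝 0] fun t : ℝ => t ^ 2 :=
      isLittleO_sq_mul (by
        have := (tendsto_const_nhds (x := E)).mul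
          ((tendsto_const_nhds (x := (1 : ℝ))).sub (hsum.div_const 2))
        simpa using this) fun t => rfl
    have h3 : (fun t => (J t + ρ t)⁻¹) =O[𝓝 0] fun _ => (1 : ℝ) :=
      (hsum.inv₀ (by norm_num)).isBigO_one ℝ
    have h4 := h3.mul_isLittleO (h.add h2)
    simp only [one_mul] at h4
    refine h4.congr' ?_ .rfl
    filter_upwards [hsum.eventually_ne (by norm_num : (2 : ℝ) ≠ 0)] with t ht
    field_simp
    ring
  have h5 := taylor_two_isLittleO hρ
  refine (deriv_eq_of_expansion hJ (a := 1) (b := deriv ρ 0) (c := E + deriv (deriv ρ) 0) ?_).2.2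
  refine (h1.add h5).congr_left fun t => ?_
  simp only [smul_eq_mul, hρ0]
  ring

theorem quad_eq_slab {g : Matrix (Fin (n + 1)) (Fin (n + 1)) ℝ} (v w : Euc (n + 1)) :
    quad g v w = quad (g.submatrix Fin.castSucc Fin.castSucc) (sliceProj n v) (sliceProj n w) +
      w (Fin.last n) * ∑ k : Fin n, v k.castSucc * g k.castSucc (Fin.last n) +
      v (Fin.last n) * ∑ k : Fin n, w k.castSucc * g (Fin.last n) k.castSucc +
      v (Fin.last n) * w (Fin.last n) * g (Fin.last n) (Fin.last n) := by
  simp only [quad, Fin.sum_univ_castSucc, sliceProj_apply, Matrix.submatrix_apply,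
    Finset.sum_add_distrib, Finset.mul_sum]
  have h1 : ∀ k : Fin n, w (Fin.last n) * (v k.castSucc * g k.castSucc (Fin.last n)) =
    v k.castSucc * g k.castSucc (Fin.last n) * w (Fin.last n) := fun k => by ring
  have h2 : ∀ k : Fin n, v (Fin.last n) * (w k.castSucc * g (Fin.last n) k.castSucc) =
    v (Fin.last n) * g (Fin.last n) k.castSucc * w k.castSucc := fun k => by ring
  simp only [h1, h2]
  ring

theorem det_frameGram_eq {k : ℕ} (h : Matrix (Fin k) (Fin k) ℝ) (a : Fin k → Euc k) :
    (frameGram h a).det = h.det * (Matrix.of fun i j => a i j).det ^ 2 := by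
  have h1 : frameGram h a = (Matrix.of fun i j => a i j) * h *
      (Matrix.of fun i j => a i j).transpose := by
    ext i j
    simp only [frameGram, quad, Matrix.of_apply, Matrix.mul_apply, Matrix.transpose_apply,
      Finset.sum_mul]
    exact Finset.sum_comm
  rw [h1, Matrix.det_mul, Matrix.det_mul, Matrix.det_transpose]
  ring

variable {g : Euc (n + 1) → Matrix (Fin (n + 1)) (Fin (n + 1)) ℝ}
  {T : Set (Euc (n + 1))} {u : Euc n → ℝ} {z : Euc n}

/-- The tangential part of a family of maps of the slice into space. -/
def tangFam (Ψ : ℝ × Euc n → Euc (n + 1)) (q : ℝ × Euc n) : Euc n := sliceProj n (Ψ q)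

/-- The Jacobian matrix in the space variables. -/
def spaceJac (η : ℝ × Euc n → Euc n) (q : ℝ × Euc n) : Matrix (Fin n) (Fin n) ℝ :=
  Matrix.of fun i j => fderiv ℝ η q (0, EuclideanSpace.single j 1) i

/-- The volume density of the tangential part of a family of maps. -/
def volFam (r : Euc n → ℝ) (η : ℝ × Euc n → Euc n) (q : ℝ × Euc n) : ℝ :=
  r (η q) * (spaceJac η q).det

/-- The normal part of the velocity of a family of maps of the slice into space. -/
def normalSpeed (Ψ : ℝ × Euc n → Euc (n + 1)) (w : Euc n) : ℝ :=
  fderiv ℝ Ψ (0, w) (1, 0) (Fin.last n)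

theorem hasFDerivAt_eval {m : ℕ} {X : Type*} [NormedAddCommGroup X] [NormedSpace ℝ X]
    {f : X → Euc m} {x : X} (hf : DifferentiableAt ℝ f x) (i : Fin m) :
    HasFDerivAt (fun x => f x i) ((EuclideanSpace.proj i : Euc m →L[ℝ] ℝ).comp (fderiv ℝ f x)) x :=
  (EuclideanSpace.proj i : Euc m →L[ℝ] ℝ).hasFDerivAt.comp x hf.hasFDerivAt

theorem HasDerivAt.eval {m : ℕ} {f : ℝ → Euc m} {f' : Euc m} {t : ℝ} (hf : HasDerivAt f f' t)
    (i : Fin m) : HasDerivAt (fun s => f s i) (f' i) t :=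
  (EuclideanSpace.proj i : Euc m →L[ℝ] ℝ).hasFDerivAt.comp_hasDerivAt t hf

theorem ContDiffAt.eval {m : ℕ} {X : Type*} [NormedAddCommGroup X] [NormedSpace ℝ X]
    {f : X → Euc m} {x : X} {r : WithTop ℕ∞} (hf : ContDiffAt ℝ r f x) (i : Fin m) :
    ContDiffAt ℝ r (fun x => f x i) x := contDiffAt_euclidean.1 hf i

theorem spaceJac_tangFam {Ψ : ℝ × Euc n → Euc (n + 1)} {q : ℝ × Euc n}
    (hΨ : DifferentiableAt ℝ Ψ q) (b : Euc n) (i : Fin n) :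
    fderiv ℝ Ψ q (0, b) i.castSucc = ∑ j, spaceJac (tangFam Ψ) q i j * b j := by
  have h1 : HasFDerivAt (tangFam Ψ) ((sliceProj n).comp (fderiv ℝ Ψ q)) q :=
    (sliceProj n).hasFDerivAt.comp q hΨ.hasFDerivAt
  have h2 : b = ∑ j, b j • (EuclideanSpace.single j 1 : Euc n) := by
    ext m; simp [Pi.single_apply]
  have h3 : ((0 : ℝ), b) = ∑ j, b j • ((0 : ℝ), (EuclideanSpace.single j 1 : Euc n)) := by
    ext1
    · simp [Prod.fst_sum]
    · rw [Prod.snd_sum]; exact h2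
  have h4 : fderiv ℝ Ψ q (0, b) i.castSucc = fderiv ℝ (tangFam Ψ) q (0, b) i := by
    rw [h1.fderiv]; rfl
  rw [h4, h3, map_sum, WithLp.ofLp_sum, Finset.sum_apply]
  refine Finset.sum_congr rfl fun j _ => ?_
  rw [map_smul, PiLp.smul_apply, smul_eq_mul, mul_comm]
  rfl

theorem IsLapseMetric.fderiv_cross (hg : IsLapseMetric g T u) (hz : sliceIncl z ∈ T) (i : Fin n) :
    fderiv ℝ (fun y => g y i.castSucc (Fin.last n)) (sliceIncl z) = 0 := by
  ext v
  have h1 : v = ∑ j, v j • (EuclideanSpace.single j 1 : Euc (n + 1)) := by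
    ext m; simp [Pi.single_apply]
  rw [h1, map_sum]
  refine (Finset.sum_eq_zero fun j _ => ?_).trans (zero_apply _).symm
  rw [map_smul]
  exact (congrArg (v j • ·) (hg.pd_cross hz i j)).trans (smul_zero _)

/-- The second variation of the area density. -/
theorem IsJacobiMetric.deriv_deriv_sqrt_det (hg : IsJacobiMetric g T u) (hz : sliceIncl z ∈ T)
    {b : Fin n → Euc n} (hb : frameGram (slab g (sliceIncl z)) b = 1)
    {Ψ : ℝ × Euc n → Euc (n + 1)} (hΨ : ContDiffAt ℝ ∞ Ψ (0, z))
    (hΨ0 : ∀ᶠ w in 𝓝 z, Ψ (0, w) = sliceIncl w) :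
    deriv (deriv fun t : ℝ => Real.sqrt (frameGram (g (Ψ (t, z)))
      fun i => fderiv ℝ Ψ (t, z) (0, b i)).det) 0 =
    u z ^ 2 * ∑ i, fderiv ℝ (normalSpeed Ψ) z (b i) ^ 2 +
      (IsLapseMetric.density g z)⁻¹ *
        deriv (deriv fun t => volFam (IsLapseMetric.density g) (tangFam Ψ) (t, z)) 0 := by
  have hΨz : Ψ (0, z) = sliceIncl z := hΨ0.self_of_nhds
  have hline : ContDiff ℝ ∞ (fun t : ℝ => (t, z)) := contDiff_id.prodMk contDiff_const
  have hΨt : ContDiffAt ℝ ∞ (fun t : ℝ => Ψ (t, z)) 0 :=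
    ContDiffAt.comp (g := Ψ) (0 : ℝ) hΨ hline.contDiffAt
  have hv : ∀ b : Euc n, ContDiffAt ℝ ∞ (fun t : ℝ => fderiv ℝ Ψ (t, z) (0, b)) 0 := fun b =>
    ContDiffAt.comp (g := fun q => fderiv ℝ Ψ q (0, b)) (0 : ℝ)
      ((hΨ.fderiv_right (m := ∞) (by simp)).clm_apply contDiffAt_const) hline.contDiffAt
  have hgt : ∀ k l, ContDiffAt ℝ ∞ (fun t : ℝ => g (Ψ (t, z)) k l) 0 := fun k l =>
    ContDiffAt.comp (g := fun y => g y k l) (0 : ℝ) (by rw [hΨz]; exact hg.smooth _ hz k l) hΨt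
  have hd0 : HasFDerivAt (fun w => Ψ (0, w)) (sliceInclL n) z :=
    (hasFDerivAt_sliceIncl z).congr_of_eventuallyEq hΨ0
  have hv0 : ∀ b : Euc n, fderiv ℝ Ψ (0, z) (0, b) = sliceIncl b := fun b => by
    have h1 := (hΨ.differentiableAt (by simp)).hasFDerivAt.comp z
      (hasFDerivAt_prodMk_right (0 : ℝ) z)
    exact congrArg (fun L : Euc n →L[ℝ] Euc (n + 1) => L b) (h1.unique hd0)
  have hη : ContDiffAt ℝ ∞ (tangFam Ψ) (0, z) := (sliceProj n).contDiff.contDiffAt.comp _ hΨ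
  have hη0 : tangFam Ψ (0, z) = z := by rw [tangFam, hΨz, sliceProj_sliceIncl]
  have hηt : ContDiffAt ℝ ∞ (fun t : ℝ => tangFam Ψ (t, z)) 0 :=
    ContDiffAt.comp (g := tangFam Ψ) (0 : ℝ) hη hline.contDiffAt
  have hM : ∀ i j, ContDiffAt ℝ ∞ (fun t : ℝ => spaceJac (tangFam Ψ) (t, z) i j) 0 := fun i j =>
    ContDiffAt.comp (g := fun q => spaceJac (tangFam Ψ) q i j) (0 : ℝ)
      (((hη.fderiv_right (m := ∞) (by simp)).clm_apply contDiffAt_const).eval i) hline.contDiffAt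
  have hX : HasDerivAt (fun t : ℝ => Ψ (t, z)) (fderiv ℝ Ψ (0, z) (1, 0)) 0 :=
    (hΨ.differentiableAt (by simp)).hasFDerivAt.comp_hasDerivAt (0 : ℝ)
      ((hasDerivAt_id (0 : ℝ)).prodMk (hasDerivAt_const (0 : ℝ) z))
  set r := IsLapseMetric.density g with hr
  have hrz : 0 < r z := hg.density_pos hz
  have hr2 : ∀ w, sliceIncl w ∈ T → (slab g (sliceIncl w)).det = r w ^ 2 := fun w hw =>
    (Real.sq_sqrt (hg.det_pos _ hw).le).symm
  set ρ : ℝ → ℝ := fun t => (r z)⁻¹ * volFam r (tangFam Ψ) (t, z) with hρdef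
  have hρ : ContDiffAt ℝ ∞ ρ 0 := contDiffAt_const.mul
    ((ContDiffAt.comp (g := r) (0 : ℝ) (by rw [hη0]; exact hg.smooth_density hz) hηt).mul
      (contDiffAt_det hM))
  have hM0 : spaceJac (tangFam Ψ) (0, z) = 1 := by
    ext i j
    have h1 := spaceJac_tangFam (hΨ.differentiableAt (by simp)) (EuclideanSpace.single j 1) i
    rw [hv0, sliceIncl_castSucc] at h1
    simp only [PiLp.single_apply, mul_ite, mul_one, mul_zero, Finset.sum_ite_eq', Finset.mem_univ,
      if_true] at h1
    rw [← h1, Matrix.one_apply]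
  have hρ0 : ρ 0 = 1 := by
    simp only [hρdef, volFam, hM0, hη0, Matrix.det_one, mul_one]
    exact inv_mul_cancel₀ hrz.ne'
  set B : ℝ → Matrix (Fin n) (Fin n) ℝ := fun t =>
    frameGram (g (Ψ (t, z))) fun i => fderiv ℝ Ψ (t, z) (0, b i) with hB
  have hBs : ContDiffAt ℝ ∞ (fun t => (B t).det) 0 :=
    contDiffAt_det fun i j => ContDiffAt.quad hgt (hv (b i)) (hv (b j))
  have hB0 : B 0 = 1 := by
    rw [← hb]; ext i j
    simp only [hB, frameGram, Matrix.of_apply, hv0, hΨz, quad_sliceIncl]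
    rfl
  have hJ : ContDiffAt ℝ ∞ (fun t => Real.sqrt (B t).det) 0 := hBs.sqrt (by rw [hB0]; simp)
  have hpos : ∀ᶠ t in 𝓝 0, 0 < (B t).det :=
    hBs.continuousAt.eventually (lt_mem_nhds (by simp [hB0]))
  set s : Fin n → ℝ := fun i => fderiv ℝ (normalSpeed Ψ) z (b i) with hs
  have hσ : ∀ i, HasDerivAt (fun t : ℝ => fderiv ℝ Ψ (t, z) (0, b i) (Fin.last n)) (s i) 0 :=
    fun i => by
    refine (hasDerivAt_fderiv_comm (contDiffAt_infty.1 hΨ 2) (b i)).eval (Fin.last n) |>.congr_deriv ?_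
    have h1 : DifferentiableAt ℝ (fun w => fderiv ℝ Ψ (0, w) (1, 0)) z :=
      (ContDiffAt.comp (g := fun q => fderiv ℝ Ψ q (1, 0)) z
        ((hΨ.fderiv_right (m := ∞) (by simp)).clm_apply contDiffAt_const)
        (contDiffAt_const.prodMk contDiffAt_id)).differentiableAt (n := ∞) (by simp)
    exact (congrArg (fun L : Euc n →L[ℝ] ℝ => L (b i)) (hasFDerivAt_eval h1 (Fin.last n)).fderiv).symm
  choose sσ hsσ hσs using fun i => exists_eq_mul_of_hasDerivAt (hσ i)
    (by rw [hv0]; exact sliceIncl_last _)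
  obtain ⟨sτ, hsτ, hτs⟩ := exists_eq_mul_of_hasDerivAt (hX.eval (Fin.last n))
    (by rw [hΨz]; exact sliceIncl_last _)
  have hc : ∀ k : Fin n, HasDerivAt (fun t : ℝ => g (Ψ (t, z)) k.castSucc (Fin.last n)) 0 0 :=
    fun k => by
    have h1 : HasFDerivAt (fun y => g y k.castSucc (Fin.last n)) (0 : Euc (n + 1) →L[ℝ] ℝ)
        (Ψ (0, z)) := by
      rw [hΨz, ← hg.fderiv_cross hz k]
      exact ((hg.smooth _ hz _ _).differentiableAt (by simp)).hasFDerivAt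
    have h2 := h1.comp_hasDerivAt (0 : ℝ) hX
    exact h2
  choose sc hsc hcs using fun k => exists_eq_mul_of_hasDerivAt (hc k)
    (by rw [hΨz]; exact hg.cross z hz k)
  set A : ℝ → Matrix (Fin n) (Fin n) ℝ := fun t =>
    frameGram (slab g (Ψ (t, z))) fun i => sliceProj n (fderiv ℝ Ψ (t, z) (0, b i)) with hA
  have hAc : ∀ i j, Tendsto (fun t => A t i j) (𝓝 0) (𝓝 ((1 : Matrix (Fin n) (Fin n) ℝ) i j)) :=
    fun i j => by
    have h1 : ContDiffAt ℝ ∞ (fun t => A t i j) 0 := ContDiffAt.quad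
      (g := fun t : ℝ => slab g (Ψ (t, z))) (fun k l => hgt _ _)
      ((sliceProj n).contDiff.contDiffAt.comp (0 : ℝ) (hv (b i)))
      ((sliceProj n).contDiff.contDiffAt.comp (0 : ℝ) (hv (b j)))
    have h2 : A 0 i j = (1 : Matrix (Fin n) (Fin n) ℝ) i j := by
      rw [← hb]
      simp only [hA, frameGram, Matrix.of_apply, hv0, hΨz, sliceProj_sliceIncl]
    rw [← h2]; exact h1.continuousAt.tendsto
  have hvc : ∀ i (k : Fin n), Tendsto (fun t : ℝ => fderiv ℝ Ψ (t, z) (0, b i) k.castSucc) (𝓝 0)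
      (𝓝 (b i k)) := fun i k => by
    have h1 := ((hv (b i)).eval k.castSucc).continuousAt.tendsto
    rwa [hv0, sliceIncl_castSucc] at h1
  have hdiff : ∀ i j, (fun t => B t i j - A t i j -
      t ^ 2 * (Matrix.of fun i j => u z ^ 2 * (s i * s j) : Matrix (Fin n) (Fin n) ℝ) i j) =o[𝓝 0]
        fun t : ℝ => t ^ 2 := fun i j => by
    refine isLittleO_sq_mul (k := fun t => sσ j t * (∑ k : Fin n,
      fderiv ℝ Ψ (t, z) (0, b i) k.castSucc * sc k t) + sσ i t * (∑ k : Fin n,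
      fderiv ℝ Ψ (t, z) (0, b j) k.castSucc * sc k t) +
      (sσ i t * sσ j t * g (Ψ (t, z)) (Fin.last n) (Fin.last n) - u z ^ 2 * (s i * s j))) ?_
      fun t => ?_
    · have h1 : ∀ i, Tendsto (fun t : ℝ => ∑ k : Fin n,
          fderiv ℝ Ψ (t, z) (0, b i) k.castSucc * sc k t) (𝓝 0) (𝓝 (∑ k : Fin n, b i k * 0)) :=
        fun i => tendsto_finsetSum _ fun k _ => (hvc i k).mul (hsc k)
      have h2 := (hgt (Fin.last n) (Fin.last n)).continuousAt.tendsto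
      rw [hΨz, hg.lapse z hz] at h2
      have h3 := (((hsσ j).mul (h1 i)).add ((hsσ i).mul (h1 j))).add
        ((((hsσ i).mul (hsσ j)).mul h2).sub (tendsto_const_nhds (x := u z ^ 2 * (s i * s j))))
      convert h3 using 2
      simp only [mul_zero, Finset.sum_const_zero]; ring
    · have h1 : ∀ k : Fin n, g (Ψ (t, z)) (Fin.last n) k.castSucc = t * sc k t := fun k => by
        rw [hg.symm, hcs]
      simp only [hB, hA, frameGram, Matrix.of_apply]
      rw [quad_eq_slab]
      simp only [hσs, hcs, h1, slab]
      have h2 : ∀ i, ∑ k : Fin n, fderiv ℝ Ψ (t, z) (0, b i) k.castSucc * (t * sc k t) =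
          t * ∑ k : Fin n, fderiv ℝ Ψ (t, z) (0, b i) k.castSucc * sc k t := fun i => by
        rw [Finset.mul_sum]; exact Finset.sum_congr rfl fun k _ => by ring
      rw [h2, h2]; ring
  have hdet := det_sub_det_isLittleO hAc hdiff
  have htr : (Matrix.adjugate (1 : Matrix (Fin n) (Fin n) ℝ) *
      Matrix.of fun i j => u z ^ 2 * (s i * s j)).trace = u z ^ 2 * ∑ i, s i ^ 2 := by
    rw [Matrix.adjugate_one, one_mul, Matrix.trace, Finset.mul_sum]
    exact Finset.sum_congr rfl fun i _ => by simp [sq]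
  rw [htr] at hdet
  set P : Matrix (Fin n) (Fin n) ℝ := Matrix.of fun i j => b i j
  have hP : r z ^ 2 * P.det ^ 2 = 1 := by
    rw [← hr2 z hz, ← det_frameGram_eq, hb, Matrix.det_one]
  have hΨd : ∀ᶠ t : ℝ in 𝓝 0, DifferentiableAt ℝ Ψ (t, z) := by
    have h1 : ∀ᶠ q in 𝓝 ((0 : ℝ), z), DifferentiableAt ℝ Ψ q :=
      ((contDiffAt_infty.1 hΨ 1).eventually (by simp)).mono fun q hq => hq.differentiableAt (by simp)
    exact hline.continuous.continuousAt.eventually h1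
  have hdetA : ∀ᶠ t : ℝ in 𝓝 0, (A t).det = (slab g (Ψ (t, z))).det *
      (P.det * (spaceJac (tangFam Ψ) (t, z)).det) ^ 2 := by
    filter_upwards [hΨd] with t ht
    have h1 : (Matrix.of fun i j => sliceProj n (fderiv ℝ Ψ (t, z) (0, b i)) j) =
        P * (spaceJac (tangFam Ψ) (t, z)).transpose := by
      ext i j
      simp only [Matrix.of_apply, Matrix.mul_apply, Matrix.transpose_apply, sliceProj_apply, P]
      rw [spaceJac_tangFam ht]
      exact Finset.sum_congr rfl fun k _ => mul_comm _ _
    rw [hA]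
    simp only
    rw [det_frameGram_eq, h1, Matrix.det_mul, Matrix.det_transpose]
  obtain ⟨C, hC⟩ := hg.expansion z hz
  have hlo : (fun t : ℝ => (slab g (Ψ (t, z))).det - r (tangFam Ψ (t, z)) ^ 2) =o[𝓝 0]
      fun t : ℝ => t ^ 2 := by
    have h1 : ∀ᶠ t : ℝ in 𝓝 0, |(slab g (Ψ (t, z))).det - r (tangFam Ψ (t, z)) ^ 2| ≤
        |t ^ 2 * (t * (C * sτ t ^ 3))| := by
      have h2 := hΨt.continuousAt
      have h3 : ∀ᶠ t : ℝ in 𝓝 0, sliceIncl (tangFam Ψ (t, z)) ∈ T :=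
        hηt.continuousAt.eventually (p := fun w => sliceIncl w ∈ T)
          (by simpa only [hη0] using hg.eventually_mem hz)
      have h4 : ∀ᶠ t : ℝ in 𝓝 0, _ := h2.eventually (by simpa only [hΨz] using hC)
      filter_upwards [h3, h4] with t ht ht'
      rw [← hr2 _ ht]
      refine ht'.trans ?_
      rw [hτs, ← abs_pow]
      refine (le_abs_self _).trans (le_of_eq ?_)
      rw [abs_mul, abs_abs, ← abs_mul]
      congr 1; ring
    refine Asymptotics.IsBigO.trans_isLittleO (.of_bound 1 ?_)
      (isLittleO_sq_mul (k := fun t => t * (C * sτ t ^ 3)) ?_ fun t => rfl)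
    · filter_upwards [h1] with t ht
      rw [one_mul]; exact ht
    · have h2 := (tendsto_id (x := 𝓝 (0 : ℝ))).mul ((tendsto_const_nhds (x := C)).mul (hsτ.pow 3))
      simpa using h2
  have hbd : (fun t : ℝ => (P.det * (spaceJac (tangFam Ψ) (t, z)).det) ^ 2) =O[𝓝 0]
      fun _ => (1 : ℝ) :=
    (((continuousAt_const (y := P.det)).mul (contDiffAt_det hM).continuousAt).pow 2).tendsto.isBigO_one ℝ
  have hfin : (fun t => Real.sqrt (B t).det ^ 2 - ρ t ^ 2 - t ^ 2 * (u z ^ 2 * ∑ i, s i ^ 2)) =o[𝓝 0]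
      fun t : ℝ => t ^ 2 := by
    have h1 := hdet.add (hbd.mul_isLittleO hlo |>.congr_right fun t => one_mul _)
    refine h1.congr' ?_ .rfl
    filter_upwards [hpos, hdetA] with t ht1 ht2
    rw [ht2, Real.sq_sqrt ht1.le]
    simp only [hρdef, volFam]
    have h2 : (r z)⁻¹ ^ 2 = P.det ^ 2 := by
      have := hrz.ne'
      field_simp
      linarith
    rw [mul_pow, mul_pow, h2]
    ring
  have hres := deriv_deriv_of_sq (contDiffAt_infty.1 hJ 2) (contDiffAt_infty.1 hρ 2)
    (by rw [hB0]; simp) hρ0 hfin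
  refine hres.trans ?_
  congr 1
  have hd : deriv ρ = fun t => (r z)⁻¹ * deriv (fun t => volFam r (tangFam Ψ) (t, z)) t :=
    funext fun t => deriv_const_mul_field _
  rw [hd, deriv_const_mul_field]

end SecondVariation

section Divergence

variable {m : ℕ}

theorem fderiv_eq_sum_pd (f : Euc m → ℝ) (y v : Euc m) : fderiv ℝ f y v = ∑ j, v j * pd j f y := by
  have h1 : v = ∑ j, v j • (EuclideanSpace.single j 1 : Euc m) := by
    ext m; simp [Pi.single_apply]
  conv_lhs => rw [h1, map_sum]
  exact Finset.sum_congr rfl fun j _ => by rw [map_smul]; rfl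

theorem pd_add {f g : Euc m → ℝ} {y : Euc m} (hf : DifferentiableAt ℝ f y)
    (hg : DifferentiableAt ℝ g y) (i : Fin m) :
    pd i (fun x => f x + g x) y = pd i f y + pd i g y :=
  pd_eq_of_hasDerivAt (hf.add hg) ((hasDerivAt_line hf i).add (hasDerivAt_line hg i))

theorem pd_sub {f g : Euc m → ℝ} {y : Euc m} (hf : DifferentiableAt ℝ f y)
    (hg : DifferentiableAt ℝ g y) (i : Fin m) :
    pd i (fun x => f x - g x) y = pd i f y - pd i g y :=
  pd_eq_of_hasDerivAt (hf.sub hg) ((hasDerivAt_line hf i).sub (hasDerivAt_line hg i))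

theorem pd_comm {f : Euc m → ℝ} {y : Euc m} (hf : ContDiffAt ℝ ∞ f y) (i j : Fin m) :
    pd i (pd j f) y = pd j (pd i f) y := by
  have hd : HasFDerivAt (fderiv ℝ f) (fderiv ℝ (fderiv ℝ f) y) y :=
    ((hf.fderiv_right (m := ∞) (by simp)).differentiableAt (by simp)).hasFDerivAt
  have h1 : ∀ k : Fin m, HasFDerivAt (pd k f)
      ((ContinuousLinearMap.apply ℝ ℝ (EuclideanSpace.single k 1 : Euc m)).comp
        (fderiv ℝ (fderiv ℝ f) y)) y := fun k =>
    (ContinuousLinearMap.apply ℝ ℝ (EuclideanSpace.single k 1 : Euc m)).hasFDerivAt.comp y hd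
  rw [pd, pd, (h1 j).fderiv, (h1 i).fderiv]
  exact ((contDiffAt_infty.1 hf 2).isSymmSndFDerivAt (by simp)).eq _ _

/-- The divergence of a vector field. -/
def divField (W : Euc m → Euc m) (w : Euc m) : ℝ := ∑ i, pd i (fun x => W x i) w

/-- The time derivative of a family of maps. -/
def velocityFam {E : Type*} [NormedAddCommGroup E] [NormedSpace ℝ E] (η : ℝ × E → Euc m)
    (q : ℝ × E) : Euc m := fderiv ℝ η q (1, 0)

/-- The vector field whose divergence is the second derivative of the volume density of a family of
maps. -/
def accelField (r : Euc m → ℝ) (η : ℝ × Euc m → Euc m) (w : Euc m) : Euc m :=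
  WithLp.toLp 2 fun i => r w * velocityFam (velocityFam η) (0, w) i +
    (∑ j, (pd j r w * velocityFam η (0, w) j + r w * pd j (fun x => velocityFam η (0, x) j) w)) *
      velocityFam η (0, w) i -
    r w * ∑ j, velocityFam η (0, w) j * pd j (fun x => velocityFam η (0, x) i) w

theorem ContDiffAt.velocityFam {E : Type*} [NormedAddCommGroup E] [NormedSpace ℝ E]
    {η : ℝ × E → Euc m} {q : ℝ × E} (h : ContDiffAt ℝ ∞ η q) :
    ContDiffAt ℝ ∞ (_root_.velocityFam η) q :=
  (h.fderiv_right (m := ∞) (by simp)).clm_apply contDiffAt_const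

theorem ContDiffAt.comp_prodMk {E G : Type*} [NormedAddCommGroup E] [NormedSpace ℝ E]
    [NormedAddCommGroup G] [NormedSpace ℝ G] {f : ℝ × E → G} {t : ℝ} {z : E}
    (h : ContDiffAt ℝ ∞ f (t, z)) :
    ContDiffAt ℝ ∞ (fun w => f (t, w)) z ∧ ContDiffAt ℝ ∞ (fun s => f (s, z)) t :=
  ⟨ContDiffAt.comp (g := f) z h (contDiffAt_const.prodMk contDiffAt_id),
    ContDiffAt.comp (g := f) t h (contDiffAt_id.prodMk contDiffAt_const)⟩

theorem contDiffAt_accelField {r : Euc m → ℝ} {η : ℝ × Euc m → Euc m} {z : Euc m}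
    (hr : ContDiffAt ℝ ∞ r z) (hη : ContDiffAt ℝ ∞ η (0, z)) :
    ContDiffAt ℝ ∞ (accelField r η) z := by
  have h1 : ∀ i, ContDiffAt ℝ ∞ (fun w => velocityFam η (0, w) i) z := fun i =>
    hη.velocityFam.comp_prodMk.1.eval i
  have h2 : ∀ i, ContDiffAt ℝ ∞ (fun w => velocityFam (velocityFam η) (0, w) i) z := fun i =>
    hη.velocityFam.velocityFam.comp_prodMk.1.eval i
  exact contDiffAt_euclidean.2 fun i => ((hr.mul (h2 i)).add
    ((ContDiffAt.sum fun j _ => ((hr.pd j).mul (h1 j)).add (hr.mul ((h1 j).pd j))).mul (h1 i))).sub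
    (hr.mul (ContDiffAt.sum fun j _ => (h1 j).mul ((h1 i).pd j)))

theorem hasDerivAt_spaceJac {n : ℕ} {η : ℝ × Euc n → Euc n} {t : ℝ} {z : Euc n}
    (h : ContDiffAt ℝ 2 η (t, z)) (i j : Fin n) :
    HasDerivAt (fun s => spaceJac η (s, z) i j) (spaceJac (velocityFam η) (t, z) i j) t := by
  refine ((hasDerivAt_fderiv_comm h (EuclideanSpace.single j 1)).eval i).congr_deriv ?_
  have hv : DifferentiableAt ℝ (velocityFam η) (t, z) :=
    ((h.fderiv_right (m := 1) (by norm_num)).clm_apply contDiffAt_const).differentiableAt (by simp)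
  have h1 := hv.hasFDerivAt.comp z (hasFDerivAt_prodMk_right t z)
  exact congrArg (fun L : Euc n →L[ℝ] Euc n => L (EuclideanSpace.single j 1) i) h1.fderiv

theorem spaceJac_eq_pd {n : ℕ} {η : ℝ × Euc n → Euc n} {t : ℝ} {z : Euc n}
    (h : ContDiffAt ℝ ∞ η (t, z)) (i j : Fin n) :
    spaceJac η (t, z) i j = pd j (fun w => η (t, w) i) z := by
  have h1 := hasFDerivAt_eval (h.comp_prodMk.1.differentiableAt (by simp)) i
  have h2 := (h.differentiableAt (by simp)).hasFDerivAt.comp z (hasFDerivAt_prodMk_right t z)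
  have h3 : fderiv ℝ (fun w => η (t, w)) z = _ := h2.fderiv
  rw [pd, h1.fderiv, h3]
  rfl

theorem deriv_deriv_mul {f g : ℝ → ℝ} {t : ℝ} (hf : ContDiffAt ℝ ∞ f t) (hg : ContDiffAt ℝ ∞ g t) :
    deriv (deriv fun s => f s * g s) t =
      deriv (deriv f) t * g t + 2 * (deriv f t * deriv g t) + f t * deriv (deriv g) t := by
  have hev : ∀ {f : ℝ → ℝ}, ContDiffAt ℝ ∞ f t → ∀ᶠ s in 𝓝 t, DifferentiableAt ℝ f s := fun hf =>
    ((contDiffAt_infty.1 hf 1).eventually (by simp)).mono fun q hq => hq.differentiableAt (by simp)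
  have h1 : deriv (fun s => f s * g s) =ᶠ[𝓝 t] fun s => deriv f s * g s + f s * deriv g s := by
    filter_upwards [hev hf, hev hg] with s h1 h2 using deriv_fun_mul h1 h2
  have h2 : ∀ {f : ℝ → ℝ}, ContDiffAt ℝ ∞ f t → HasDerivAt (deriv f) (deriv (deriv f) t) t :=
    fun hf => (((hf.fderiv_right (m := ∞) (by simp)).clm_apply
      contDiffAt_const).differentiableAt (by simp)).hasDerivAt
  rw [h1.deriv_eq]
  have hf' := (hf.differentiableAt (by simp)).hasDerivAt
  have hg' := (hg.differentiableAt (by simp)).hasDerivAt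
  refine (((h2 hf).mul hg').add (hf'.mul (h2 hg))).deriv.trans ?_
  ring

theorem deriv_deriv_comp {r : Euc m → ℝ} {γ : ℝ → Euc m} {t : ℝ} {γ₁ : ℝ → Euc m} {γ₂ : Euc m}
    (hr : ContDiffAt ℝ ∞ r (γ t)) (h1 : ∀ᶠ s in 𝓝 t, HasDerivAt γ (γ₁ s) s)
    (h2 : HasDerivAt γ₁ γ₂ t) : deriv (fun s => r (γ s)) t = ∑ i, γ₁ t i * pd i r (γ t) ∧
      deriv (deriv fun s => r (γ s)) t =
      ∑ i, ((∑ j, γ₁ t j * pd j (pd i r) (γ t)) * γ₁ t i + γ₂ i * pd i r (γ t)) := by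
  have hr' : ∀ᶠ s in 𝓝 t, DifferentiableAt ℝ r (γ s) :=
    h1.self_of_nhds.continuousAt.eventually
      (((contDiffAt_infty.1 hr 1).eventually (by simp)).mono fun q hq => hq.differentiableAt (by simp))
  have h3 : deriv (fun s => r (γ s)) =ᶠ[𝓝 t] fun s => ∑ i, γ₁ s i * pd i r (γ s) := by
    filter_upwards [h1, hr'] with s hs hs'
    rw [← fderiv_eq_sum_pd]
    exact (hs'.hasFDerivAt.comp_hasDerivAt s hs).deriv
  refine ⟨h3.self_of_nhds, ?_⟩
  rw [h3.deriv_eq]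
  have h4 : ∀ i, HasDerivAt (fun s => pd i r (γ s)) (∑ j, γ₁ t j * pd j (pd i r) (γ t)) t := fun i => by
    rw [← fderiv_eq_sum_pd]
    exact ((hr.pd i).differentiableAt (by simp)).hasFDerivAt.comp_hasDerivAt t h1.self_of_nhds
  refine (HasDerivAt.fun_sum fun i (_ : i ∈ Finset.univ) => (h2.eval i).mul (h4 i)).deriv.trans ?_
  exact Finset.sum_congr rfl fun i _ => by ring

theorem deriv_deriv_volFam {n : ℕ} {r : Euc n → ℝ} {η : ℝ × Euc n → Euc n} {z : Euc n}
    (hr : ContDiffAt ℝ ∞ r z) (hη : ContDiffAt ℝ ∞ η (0, z)) (h0 : ∀ᶠ w in 𝓝 z, η (0, w) = w) :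
    deriv (deriv fun t => volFam r η (t, z)) 0 = divField (accelField r η) z := by
  have hz := h0.self_of_nhds
  have hX : ∀ i, ContDiffAt ℝ ∞ (fun w => velocityFam η (0, w) i) z := fun i =>
    hη.velocityFam.comp_prodMk.1.eval i
  have hZ : ∀ i, ContDiffAt ℝ ∞ (fun w => velocityFam (velocityFam η) (0, w) i) z := fun i =>
    hη.velocityFam.velocityFam.comp_prodMk.1.eval i
  have hev : ∀ {ζ : ℝ × Euc n → Euc n}, ContDiffAt ℝ ∞ ζ (0, z) →
      ∀ᶠ s in 𝓝 (0 : ℝ), HasDerivAt (fun s => ζ (s, z)) (velocityFam ζ (s, z)) s := fun {ζ} hζ => by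
    have h1 : ∀ᶠ q in 𝓝 ((0 : ℝ), z), DifferentiableAt ℝ ζ q :=
      ((contDiffAt_infty.1 hζ 1).eventually (by simp)).mono fun q hq => hq.differentiableAt (by simp)
    have h2 : ContinuousAt (fun s : ℝ => (s, z)) 0 := by fun_prop
    filter_upwards [h2.eventually h1] with s hs
    exact hs.hasFDerivAt.comp_hasDerivAt s ((hasDerivAt_id s).prodMk (hasDerivAt_const s z))
  have hr' : ContDiffAt ℝ ∞ r (η (0, z)) := by rwa [hz]
  obtain ⟨hR1, hR2⟩ := deriv_deriv_comp (γ := fun s => η (s, z))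
    (γ₁ := fun s => velocityFam η (s, z)) hr' (hev hη) (hev hη.velocityFam).self_of_nhds
  have hJ1 : spaceJac η (0, z) = 1 := by
    ext i j
    have h1 : (fun w => η (0, w) i) =ᶠ[𝓝 z] fun w => w i := by
      filter_upwards [h0] with w hw; rw [hw]
    rw [spaceJac_eq_pd hη, pd_congr h1]
    rw [pd, show fderiv ℝ (fun w : Euc n => w i) z = (EuclideanSpace.proj i : Euc n →L[ℝ] ℝ) from
      (EuclideanSpace.proj i : Euc n →L[ℝ] ℝ).hasFDerivAt.fderiv]
    simp [Matrix.one_apply, Pi.single_apply]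
  have hJ : ∀ i j, spaceJac (velocityFam η) (0, z) i j =
      pd j (fun w => velocityFam η (0, w) i) z := spaceJac_eq_pd hη.velocityFam
  have hJ' : ∀ i j, spaceJac (velocityFam (velocityFam η)) (0, z) i j =
      pd j (fun w => velocityFam (velocityFam η) (0, w) i) z := spaceJac_eq_pd hη.velocityFam.velocityFam
  have hev2 : ∀ i j, ∀ᶠ s in 𝓝 (0 : ℝ), HasDerivAt (fun s => spaceJac η (s, z) i j)
      (spaceJac (velocityFam η) (s, z) i j) s := fun i j => by
    have h1 : ContinuousAt (fun s : ℝ => (s, z)) 0 := by fun_prop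
    filter_upwards [h1.eventually ((contDiffAt_infty.1 hη 2).eventually (by simp))] with s hs
    exact hasDerivAt_spaceJac hs i j
  have hdet0 : (spaceJac η (0, z)).det ≠ 0 := by rw [hJ1]; simp
  have hD1 := (hasDerivAt_det_of_ne_zero (A := fun s => spaceJac η (s, z))
    (fun i j => (hev2 i j).self_of_nhds) hdet0).deriv
  have hD2 := deriv_deriv_det (A := fun s => spaceJac η (s, z))
    (A₁ := fun s => spaceJac (velocityFam η) (s, z)) hev2
    (fun i j => hasDerivAt_spaceJac (contDiffAt_infty.1 hη.velocityFam 2) i j) hdet0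
  simp only [hJ1, Matrix.det_one, inv_one, one_mul, Matrix.trace, Matrix.diag_apply,
    Matrix.mul_apply, hJ, hJ', hz] at hR1 hR2 hD1 hD2
  have hRs : ContDiffAt ℝ ∞ (fun s => r (η (s, z))) 0 :=
    ContDiffAt.comp (g := r) 0 hr' hη.comp_prodMk.2
  have hDs : ContDiffAt ℝ ∞ (fun s => (spaceJac η (s, z)).det) 0 := contDiffAt_det fun i j => by
    have h1 : ContDiffAt ℝ ∞ (fun q => fderiv ℝ η q (0, EuclideanSpace.single j 1)) (0, z) :=
      (hη.fderiv_right (m := ∞) (by simp)).clm_apply contDiffAt_const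
    exact h1.comp_prodMk.2.eval i
  have hV := deriv_deriv_mul hRs hDs
  rw [hR1, hR2, hD1, hD2, hJ1, hz, Matrix.det_one, two_mul] at hV
  refine hV.trans ?_
  have hd : ∀ {f : Euc n → ℝ}, ContDiffAt ℝ ∞ f z → DifferentiableAt ℝ f z := fun h =>
    h.differentiableAt (by simp)
  have hpd : ∀ i, pd i (fun x => accelField r η x i) z =
      pd i r z * velocityFam (velocityFam η) (0, z) i +
        r z * pd i (fun x => velocityFam (velocityFam η) (0, x) i) z +
      ((∑ j, (pd i (pd j r) z * velocityFam η (0, z) j +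
          pd j r z * pd i (fun x => velocityFam η (0, x) j) z +
          (pd i r z * pd j (fun x => velocityFam η (0, x) j) z +
          r z * pd i (pd j (fun x => velocityFam η (0, x) j)) z))) * velocityFam η (0, z) i +
        (∑ j, (pd j r z * velocityFam η (0, z) j + r z * pd j (fun x => velocityFam η (0, x) j) z)) *
          pd i (fun x => velocityFam η (0, x) i) z) -
      (pd i r z * (∑ j, velocityFam η (0, z) j * pd j (fun x => velocityFam η (0, x) i) z) +
        r z * ∑ j, (pd i (fun x => velocityFam η (0, x) j) z *
          pd j (fun x => velocityFam η (0, x) i) z +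
          velocityFam η (0, z) j * pd i (pd j (fun x => velocityFam η (0, x) i)) z)) := fun i => by
    have h1 : ContDiffAt ℝ ∞ (fun x => ∑ j, (pd j r x * velocityFam η (0, x) j +
        r x * pd j (fun x => velocityFam η (0, x) j) x)) z :=
      ContDiffAt.sum fun j _ => ((hr.pd j).mul (hX j)).add (hr.mul ((hX j).pd j))
    have h2 : ContDiffAt ℝ ∞ (fun x => ∑ j, velocityFam η (0, x) j *
        pd j (fun x => velocityFam η (0, x) i) x) z :=
      ContDiffAt.sum fun j _ => (hX j).mul ((hX i).pd j)
    refine (pd_sub (hd ((hr.mul (hZ i)).add (h1.mul (hX i)))) (hd (hr.mul h2)) i).trans ?_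
    rw [pd_add (hd (hr.mul (hZ i))) (hd (h1.mul (hX i))), pd_mul (hd hr) (hd (hZ i)),
      pd_mul (hd h1) (hd (hX i)), pd_mul (hd hr) (hd h2),
      pd_sum (fun j _ => hd (((hr.pd j).mul (hX j)).add (hr.mul ((hX j).pd j)))),
      pd_sum (fun j _ => hd ((hX j).mul ((hX i).pd j)))]
    have h3 : ∀ j, pd i (fun x => pd j r x * velocityFam η (0, x) j +
        r x * pd j (fun x => velocityFam η (0, x) j) x) z = _ := fun j =>
      (pd_add (hd ((hr.pd j).mul (hX j))) (hd (hr.mul ((hX j).pd j))) i).trans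
        (congrArg₂ _ (pd_mul (hd (hr.pd j)) (hd (hX j)) i) (pd_mul (hd hr) (hd ((hX j).pd j)) i))
    have h4 : ∀ j, pd i (fun x => velocityFam η (0, x) j *
        pd j (fun x => velocityFam η (0, x) i) x) z = _ := fun j =>
      pd_mul (hd (hX j)) (hd ((hX i).pd j)) i
    simp only [h3, h4]
  rw [divField, Finset.sum_congr rfl fun i _ => hpd i]
  have e0 : ∑ i, ∑ j, pd j (pd i r) z * velocityFam η (0, z) j * velocityFam η (0, z) i =
      ∑ i, ∑ j, pd i (pd j r) z * velocityFam η (0, z) j * velocityFam η (0, z) i :=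
    Finset.sum_congr rfl fun i _ => Finset.sum_congr rfl fun j _ => by rw [pd_comm hr]
  have e1 := Finset.sum_comm (s := Finset.univ) (t := Finset.univ) (f := fun i j : Fin n =>
    pd j r z * pd i (fun x => velocityFam η (0, x) j) z * velocityFam η (0, z) i)
  have e2 := Finset.sum_comm (s := Finset.univ) (t := Finset.univ) (f := fun i j : Fin n =>
    r z * pd i (pd j (fun x => velocityFam η (0, x) j)) z * velocityFam η (0, z) i)
  have e3 : ∑ i, ∑ j, r z * velocityFam η (0, z) j * pd i (pd j (fun x => velocityFam η (0, x) i)) z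
      = ∑ i, ∑ j, r z * velocityFam η (0, z) j * pd j (pd i (fun x => velocityFam η (0, x) i)) z :=
    Finset.sum_congr rfl fun i _ => Finset.sum_congr rfl fun j _ => by rw [pd_comm (hX i)]
  have e4 := Finset.sum_comm (s := Finset.univ) (t := Finset.univ) (f := fun i j : Fin n =>
    pd j r z * pd i (fun x => velocityFam η (0, x) i) z * velocityFam η (0, z) j)
  simp only [Finset.sum_add_distrib, Finset.sum_sub_distrib, Finset.mul_sum, Finset.sum_mul, mul_add,
    add_mul, mul_sub, sq, mul_one]
  simp only [mul_assoc, mul_comm, mul_left_comm] at e0 e1 e2 e3 e4 ⊢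
  linarith
end Divergence

section SliceDivergence

variable {n : ℕ} {g : Euc (n + 1) → Matrix (Fin (n + 1)) (Fin (n + 1)) ℝ}
  {T : Set (Euc (n + 1))} {u : Euc n → ℝ} {z : Euc n}

theorem divField_congr {W W' : Euc n → Euc n} (h : W =ᶠ[𝓝 z] W') : divField W z = divField W' z :=
  Finset.sum_congr rfl fun i _ => pd_congr (h.mono fun w hw => by rw [hw]) i

theorem divField_sub {W W' : Euc n → Euc n} (h : ContDiffAt ℝ ∞ W z) (h' : ContDiffAt ℝ ∞ W' z) :
    divField (fun w => W w - W' w) z = divField W z - divField W' z := by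
  rw [divField, divField, divField, ← Finset.sum_sub_distrib]
  exact Finset.sum_congr rfl fun i _ => pd_sub ((h.eval i).differentiableAt (by simp))
    ((h'.eval i).differentiableAt (by simp)) i

theorem IsLapseMetric.frameDiv_slice (hg : IsLapseMetric g T u) (hz : sliceIncl z ∈ T)
    {Y : Euc (n + 1) → Euc (n + 1)} {W : Euc n → Euc n} (hW : ContDiffAt ℝ ∞ W z)
    (hY : Y =ᶠ[𝓝 (sliceIncl z)] fun y => sliceIncl (W (sliceProj n y))) {b : Fin n → Euc n}
    (hb : frameGram (slab g (sliceIncl z)) b = 1) :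
    frameDiv g Y (sliceIncl z) (fun i => sliceIncl (b i)) =
      (density g z)⁻¹ * divField (fun w => density g w • W w) z := by
  have hY0 : Y (sliceIncl z) = sliceIncl (W z) := by
    rw [hY.self_of_nhds]; exact congrArg (fun x => sliceIncl (W x)) (sliceProj_sliceIncl z)
  have hYd : ∀ v : Euc n, fderiv ℝ Y (sliceIncl z) (sliceIncl v) = sliceIncl (fderiv ℝ W z v) := by
    intro v
    have h1 : HasFDerivAt W (fderiv ℝ W z) (sliceProj n (sliceIncl z)) := by
      rw [sliceProj_sliceIncl]; exact (hW.differentiableAt (by simp)).hasFDerivAt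
    have h2 := (sliceInclL n).hasFDerivAt.comp (sliceIncl z)
      (h1.comp (sliceIncl z) (sliceProj n).hasFDerivAt)
    rw [hY.fderiv_eq]
    refine (congrArg (fun L : Euc (n + 1) →L[ℝ] Euc (n + 1) => L (sliceIncl v)) h2.fderiv).trans ?_
    change sliceIncl (fderiv ℝ W z (sliceProj n (sliceIncl v))) = _
    rw [sliceProj_sliceIncl]
  have hr := (hg.density_pos hz).ne'
  have h1 := sum_quad_frame_map hb (fderiv ℝ W z)
  have h2 := sum_quad_frame hb ((dirMatrix g (sliceIncl z) (sliceIncl (W z))).submatrix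
    Fin.castSucc Fin.castSucc)
  simp only [frameDiv, hYd, hY0, quad_sliceIncl, Finset.sum_add_distrib, ← Finset.mul_sum]
  rw [h2]
  refine (congrArg₂ _ h1 rfl).trans ?_
  have hd : ∀ j, pd j (fun w => (density g w • W w) j) z = _ := fun j =>
    pd_mul ((hg.smooth_density hz).differentiableAt (by simp))
      ((hW.eval j).differentiableAt (by simp)) j
  have hpd : ∀ j, pd j (fun w => W w j) z = fderiv ℝ W z (EuclideanSpace.single j 1) j := fun j => by
    rw [pd, (hasFDerivAt_eval (hW.differentiableAt (by simp)) j).fderiv]; rfl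
  have hdir : ∀ i l : Fin n, dirMatrix g (sliceIncl z) (sliceIncl (W z)) l.castSucc i.castSucc =
      ∑ j, W z j * pd j.castSucc (fun x => g x l.castSucc i.castSucc) (sliceIncl z) := fun i l => by
    refine (fderiv_eq_sum_pd _ _ _).trans ?_
    rw [Fin.sum_univ_castSucc, sliceIncl_last, zero_mul, add_zero]
    simp only [sliceIncl_castSucc]
  rw [divField, Finset.sum_congr rfl fun j _ => hd j, Finset.sum_congr rfl fun j _ =>
    congrArg₂ _ (congrArg (· * _) (hg.pd_density hz j)) rfl, Finset.sum_add_distrib, mul_add, add_comm]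
  simp only [hpd, ← Finset.mul_sum, inv_mul_cancel_left₀ hr, mul_assoc]
  congr 1
  simp only [Matrix.trace, Matrix.diag_apply, Matrix.mul_apply, Matrix.submatrix_apply, hdir,
    Finset.mul_sum, Finset.sum_mul, inv_mul_cancel_left₀ hr]
  refine (Finset.sum_congr rfl fun i _ => Finset.sum_comm).trans (Finset.sum_comm.trans ?_)
  exact Finset.sum_congr rfl fun j _ => Finset.sum_congr rfl fun i _ =>
    Finset.sum_congr rfl fun l _ => by field_simp

end SliceDivergence

section Integral

variable {n : ℕ} {M : Type*} [EMetricSpace M] [ChartedSpace (Euc (n + 1)) M]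
  [IsManifold (𝓡 (n + 1)) ∞ M]
  [RiemannianBundle (fun x : M => TangentSpace (𝓡 (n + 1)) x)]
  [IsContMDiffRiemannianBundle (𝓡 (n + 1)) ∞ (Euc (n + 1))
    (fun x : M => TangentSpace (𝓡 (n + 1)) x)] [CompactSpace M]
  [MeasurableSpace M] [BorelSpace M]
  {V : Varifold n M} {e : Chart n M} {u : Euc n → ℝ}

theorem Varifold.IsStationary.ae_exists_frame (hV : V.IsStationary) (he : IsSliceChart V.spt e)
    (hg : IsLapseMetric (metricCoord e) e.target u) :
    ∀ᵐ ξ ∂(V : Measure (Gr n M)), ξ.1 ∈ e.source → e ξ.1 = sliceIncl (sliceProj n (e ξ.1)) ∧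
      ∃ b : Fin n → Euc n, IsFrame e ξ (fun i => sliceIncl (b i)) ∧
        frameGram (slab (metricCoord e) (e ξ.1)) b = 1 := by
  filter_upwards [hV.ae_tangent he hg, V.ae_mem_spt] with ξ ht hξ hs
  obtain ⟨β, hβ⟩ := exists_isFrame he.1 hs
  obtain ⟨b, hb, hb'⟩ := hβ.exists_slice (ht hs)
  exact ⟨eq_sliceIncl_of_last ((he.2 _ hs).1 hξ), b, by rwa [← funext hb], hb'⟩

theorem Varifold.IsStationary.exists_integral_divField (hV : V.IsStationary)
    (he : IsSliceChart V.spt e) (hg : IsLapseMetric (metricCoord e) e.target u)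
    {W : Euc n → Euc n} (hW : ContDiff ℝ ∞ W) (hc : HasCompactSupport W)
    (hWe : ∀ z ∈ tsupport W, sliceIncl z ∈ e.target) :
    ∃ D : Gr n M → ℝ, Integrable D (V : Measure (Gr n M)) ∧ ∫ ξ, D ξ ∂(V : Measure (Gr n M)) = 0 ∧
      (∀ᵐ ξ ∂(V : Measure (Gr n M)), ξ.1 ∈ e.source →
        D ξ = (IsLapseMetric.density (metricCoord e) (sliceProj n (e ξ.1)))⁻¹ *
          divField (fun w => IsLapseMetric.density (metricCoord e) w • W w)
            (sliceProj n (e ξ.1))) ∧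
      ∀ ξ : Gr n M, ξ.1 ∉ e.source → D ξ = 0 := by
  obtain ⟨χ, hχ, hχc, hχe, -, hχ1⟩ := exists_smooth_cutoff
    (hc.isCompact.image (sliceInclL n).continuous) e.open_target (by rintro _ ⟨z, hz, rfl⟩; exact hWe z hz)
  have hsub : tsupport (fun y => χ y • sliceIncl (W (sliceProj n y))) ⊆ tsupport χ :=
    tsupport_smul_subset_left χ fun y => sliceIncl (W (sliceProj n y))
  obtain ⟨D, -, hDi, hD0, hDe, hDs⟩ := hV.exists_integral_frameDiv he.1
    (Y := fun y => χ y • sliceIncl (W (sliceProj n y)))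
    (hχ.smul ((sliceInclL n).contDiff.comp (hW.comp (sliceProj n).contDiff)))
    (hχc.mono' (subset_closure.trans hsub)) (hsub.trans hχe)
  refine ⟨D, hDi, hD0, ?_, fun ξ hξ => hDs ξ ?_⟩
  · filter_upwards [hV.ae_exists_frame he hg] with ξ h hs
    obtain ⟨h1, b, hb, hb'⟩ := h hs
    have ht := e.map_source hs
    rw [hDe ξ hs _ hb]
    generalize sliceProj n (e ξ.1) = z at h1 ⊢
    rw [h1] at hb' ht ⊢
    refine hg.frameDiv_slice ht hW.contDiffAt ?_ hb'
    by_cases hz : z ∈ tsupport W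
    · filter_upwards [hχ1 _ ⟨z, hz, rfl⟩] with y hy
      rw [hy, one_smul]
    · have h2 : ∀ᶠ y in 𝓝 (sliceIncl z), sliceProj n y ∉ tsupport W := by
        refine (sliceProj n).continuous.continuousAt.eventually (p := fun w => w ∉ tsupport W) ?_
        rw [sliceProj_sliceIncl]
        exact (isClosed_tsupport W).isOpen_compl.mem_nhds hz
      filter_upwards [h2] with y hy
      rw [image_eq_zero_of_notMem_tsupport hy]
      exact (congrArg (χ y • ·) (map_zero (sliceInclL n))).trans
        ((smul_zero _).trans (map_zero (sliceInclL n)).symm)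
  · rintro ⟨y, hy, h⟩
    exact hξ (h ▸ e.map_target (hχe (hsub hy)))

end Integral

variable {n : ℕ} {M : Type*} [EMetricSpace M] [ChartedSpace (Euc (n + 1)) M]
  [IsManifold (𝓡 (n + 1)) ∞ M]
  [RiemannianBundle (fun x : M => TangentSpace (𝓡 (n + 1)) x)]

/-- The restriction of a deformation to the slice of a chart, in coordinates. -/
def sliceFam (e : Chart n M) (F : ℝ → M → M) (ζ : M → ℝ)
    (q : ℝ × Euc n) : Euc (n + 1) :=
  coordFam e F (q.1 * ζ (e.symm (sliceIncl q.2)), sliceIncl q.2)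

section SecondVariation

variable {e : Chart n M} {F : ℝ → M → M} {ζ ζ' : M → ℝ} {z : Euc n}

theorem contDiffAt_sliceFam (he : e ∈ smoothAtlas n M)
    (hF : IsVariation n F) (hζ : ContMDiff (𝓡 (n + 1)) 𝓘(ℝ, ℝ) ∞ ζ) (hz : sliceIncl z ∈ e.target) :
    ContDiffAt ℝ ∞ (sliceFam e F ζ) (0, z) := by
  have h1 : ContDiffAt ℝ ∞ (fun w : Euc n => ζ (e.symm (sliceIncl w))) z :=
    (contDiffAt_comp_chart_symm he hζ.contMDiffAt hz).comp z contDiff_sliceIncl.contDiffAt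
  have h2 : ContDiffAt ℝ ∞ (fun q : ℝ × Euc n => ζ (e.symm (sliceIncl q.2))) (0, z) :=
    ContDiffAt.comp (g := fun w : Euc n => ζ (e.symm (sliceIncl w))) ((0 : ℝ), z) h1 contDiffAt_snd
  have h3 : ContDiffAt ℝ ∞ (coordFam e F) (0 * ζ (e.symm (sliceIncl z)), sliceIncl z) := by
    rw [zero_mul]
    exact hF.contDiffAt_coordFam he (by simp) hz (by rw [hF.zero]; exact e.map_target hz)
  exact ContDiffAt.comp (g := coordFam e F) ((0 : ℝ), z) h3
    ((contDiffAt_fst.mul h2).prodMk (contDiff_sliceIncl.contDiffAt.comp ((0 : ℝ), z) contDiffAt_snd))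

theorem sliceFam_zero (hF : IsVariation n F) (hz : sliceIncl z ∈ e.target) :
    sliceFam e F ζ (0, z) = sliceIncl z := by
  rw [sliceFam, zero_mul, hF.coordFam_zero hz]

theorem eventually_sliceIncl_mem (hz : sliceIncl z ∈ e.target) :
    ∀ᶠ w : Euc n in 𝓝 z, sliceIncl w ∈ e.target :=
  (e.open_target.preimage (sliceInclL n).continuous).mem_nhds hz

theorem eventually_sliceFam_mem (he : e ∈ smoothAtlas n M)
    (hF : IsVariation n F) (hz : sliceIncl z ∈ e.target) (c : ℝ) :
    ∀ᶠ t in 𝓝 (0 : ℝ), |t * c| < 1 ∧ F (t * c) (e.symm (sliceIncl z)) ∈ e.source := by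
  have h1 : Continuous fun t : ℝ => (t * c, (sliceIncl z : Euc (n + 1))) := by fun_prop
  have h2 := hF.eventually_mem he hz
  have h3 := h1.tendsto 0
  rw [zero_mul] at h3
  exact (h3.eventually h2).mono fun t ht => ⟨ht.1, ht.2.2⟩

theorem secondVar_eq_sliceFam [IsContMDiffRiemannianBundle (𝓡 (n + 1)) ∞ (Euc (n + 1))
      (fun x : M => TangentSpace (𝓡 (n + 1)) x)] {u : Euc n → ℝ}
    (he : e ∈ smoothAtlas n M)
    (hF : IsVariation n F) (hζ : ContMDiff (𝓡 (n + 1)) 𝓘(ℝ, ℝ) ∞ ζ)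
    (hg : IsJacobiMetric (metricCoord e) e.target u) {ξ : Gr n M} (hs : ξ.1 ∈ e.source)
    (hz : e ξ.1 = sliceIncl z) {b : Fin n → Euc n} (hb : IsFrame e ξ (fun i => sliceIncl (b i)))
    (hb' : frameGram (slab (metricCoord e) (sliceIncl z)) b = 1) :
    secondVar F ζ ξ = u z ^ 2 * ∑ i, fderiv ℝ (normalSpeed (sliceFam e F ζ)) z (b i) ^ 2 +
      (IsLapseMetric.density (metricCoord e) z)⁻¹ *
        divField (accelField (IsLapseMetric.density (metricCoord e)) (tangFam (sliceFam e F ζ))) z := by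
  have ht : sliceIncl z ∈ e.target := hz ▸ e.map_source hs
  have hp : e.symm (sliceIncl z) = ξ.1 := by rw [← hz, e.left_inv hs]
  have hΨ := contDiffAt_sliceFam he hF hζ ht
  have hΨ0 : ∀ᶠ w in 𝓝 z, sliceFam e F ζ (0, w) = sliceIncl w :=
    (eventually_sliceIncl_mem ht).mono fun w hw => sliceFam_zero hF hw
  have hη : ContDiffAt ℝ ∞ (tangFam (sliceFam e F ζ)) (0, z) :=
    (sliceProj n).contDiff.contDiffAt.comp ((0 : ℝ), z) hΨ
  have hη0 : ∀ᶠ w in 𝓝 z, tangFam (sliceFam e F ζ) (0, w) = w :=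
    hΨ0.mono fun w hw => by rw [tangFam, hw, sliceProj_sliceIncl]
  rw [← deriv_deriv_volFam (hg.smooth_density ht) hη hη0, ← hg.deriv_deriv_sqrt_det ht hb' hΨ hΨ0]
  refine Filter.EventuallyEq.deriv_eq (Filter.EventuallyEq.deriv ?_)
  have hΨd : ∀ᶠ t in 𝓝 (0 : ℝ), DifferentiableAt ℝ (sliceFam e F ζ) (t, z) := by
    have hc : ContinuousAt (fun s : ℝ => (s, z)) 0 := by fun_prop
    exact hc.eventually (((contDiffAt_infty.1 hΨ 1).eventually (by simp)).mono
      fun q hq => hq.differentiableAt (by simp))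
  filter_upwards [eventually_sliceFam_mem he hF ht (ζ ξ.1), hΨd] with t ht1 ht2
  obtain ⟨ht3, ht4⟩ := ht1
  rw [hp] at ht4
  have hG : ContMDiffAt (𝓡 (n + 1)) (𝓡 (n + 1)) ∞ (deform F ζ t) ξ.1 :=
    ContMDiffAt.comp ξ.1 (g := fun x : ℝ × M => F x.1 x.2) (f := fun p : M => (t * ζ p, p))
      (hF.continuousAt ht3 _) ((contMDiffAt_const.mul hζ.contMDiffAt).prodMk contMDiffAt_id)
  have h1 := planeJac_eq_sqrt (G := deform F ζ t) he he hs ht4 (hG.mdifferentiableAt (by simp)) hb.mem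
    (by rw [hb.gram]; simp)
  rw [h1, hb.gram, Matrix.det_one, div_one, hz]
  have hcd : ContDiffAt ℝ ∞ (coordMap e e (deform F ζ t)) (sliceIncl z) :=
    ContMDiffAt.contDiffAt_coordMap he he ht (by rw [hp]; exact hG) (by rw [hp]; exact ht4)
  have h2 : ∀ i, fderiv ℝ (coordMap e e (deform F ζ t)) (sliceIncl z) (sliceIncl (b i)) =
      fderiv ℝ (sliceFam e F ζ) (t, z) (0, b i) := fun i => by
    rw [← fderiv_comp_sliceIncl (hcd.differentiableAt (by simp))]
    have h3 := ht2.hasFDerivAt.comp z (hasFDerivAt_prodMk_right t z)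
    exact congrArg (fun L : Euc n →L[ℝ] Euc (n + 1) => L (b i)) h3.fderiv
  simp only [h2]
  rfl

theorem sliceFam_eventuallyEq (he : e ∈ smoothAtlas n M)
    (hz : sliceIncl z ∈ e.target) (h : ζ =ᶠ[𝓝 (e.symm (sliceIncl z))] ζ') (t : ℝ) :
    sliceFam e F ζ =ᶠ[𝓝 (t, z)] sliceFam e F ζ' := by
  have h1 : ContinuousAt (fun q : ℝ × Euc n => e.symm (sliceIncl q.2)) (t, z) :=
    ContinuousAt.comp (g := e.symm) (f := fun q : ℝ × Euc n => (sliceIncl q.2 : Euc (n + 1)))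
      (e.continuousAt_symm hz) ((sliceInclL n).continuous.comp continuous_snd).continuousAt
  filter_upwards [h1.eventually h] with q hq
  rw [sliceFam, hq, sliceFam]

theorem normalSpeed_sliceFam_zero (he : e ∈ smoothAtlas n M)
    (hF : IsVariation n F) (hz : sliceIncl z ∈ e.target) :
    normalSpeed (sliceFam e F fun _ => 0) z = 0 := by
  have h1 := (contDiffAt_sliceFam (ζ := fun _ => 0) he hF contMDiff_const hz).differentiableAt (by simp)
  have h2 := h1.hasFDerivAt.comp_hasDerivAt (0 : ℝ)
    ((hasDerivAt_id (0 : ℝ)).prodMk (hasDerivAt_const (0 : ℝ) z))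
  have h3 : (sliceFam e F fun _ => 0) ∘ (fun t : ℝ => (id t, z)) =
      fun _ => coordFam e F (0, sliceIncl z) := by
    funext t; simp [sliceFam]
  rw [normalSpeed, h2.unique (h3 ▸ hasDerivAt_const (0 : ℝ) (coordFam e F (0, sliceIncl z)))]
  rfl

theorem contDiffAt_normalSpeed {Ψ : ℝ × Euc n → Euc (n + 1)} (h : ContDiffAt ℝ ∞ Ψ (0, z)) :
    ContDiffAt ℝ ∞ (normalSpeed Ψ) z :=
  h.velocityFam.comp_prodMk.1.eval (Fin.last n)

end SecondVariation

variable {n : ℕ} {M : Type*} [EMetricSpace M] [ChartedSpace (Euc (n + 1)) M]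
  [IsManifold (𝓡 (n + 1)) ∞ M]
  [RiemannianBundle (fun x : M => TangentSpace (𝓡 (n + 1)) x)]
  [IsContMDiffRiemannianBundle (𝓡 (n + 1)) ∞ (Euc (n + 1))
    (fun x : M => TangentSpace (𝓡 (n + 1)) x)]

/-- The change of charts along the slice. -/
def sliceTrans (e e' : Chart n M) (w : Euc n) : Euc n :=
  sliceProj n (coordMap e e' id (sliceIncl w))

section Transition

variable {A S : Set M} {ν : (p : M) → TangentSpace (𝓡 (n + 1)) p} {u : M → ℝ}
  {e e' : Chart n M} {F : ℝ → M → M} {ζ ζ' : M → ℝ} {z : Euc n}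

theorem IsSliceChart.coordMap_slice (he : IsSliceChart A e) (he' : IsSliceChart A e')
    (hz : sliceIncl z ∈ e.target) (hz' : e.symm (sliceIncl z) ∈ e'.source) :
    coordMap e e' id (sliceIncl z) = sliceIncl (sliceTrans e e' z) :=
  eq_sliceIncl_of_last ((he'.2 _ hz').1
    ((he.2 _ (e.map_target hz)).2 (by rw [e.right_inv hz, sliceIncl_last])))

theorem contDiffAt_coordMap_id (he : e ∈ smoothAtlas n M)
    (he' : e' ∈ smoothAtlas n M) {y : Euc (n + 1)} (hy : y ∈ e.target)
    (hy' : e.symm y ∈ e'.source) : ContDiffAt ℝ ∞ (coordMap e e' id) y :=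
  ContMDiffAt.contDiffAt_coordMap he he' hy contMDiffAt_id hy'

theorem eventually_symm_sliceIncl_mem (hz : sliceIncl z ∈ e.target)
    (hz' : e.symm (sliceIncl z) ∈ e'.source) :
    ∀ᶠ w in 𝓝 z, sliceIncl w ∈ e.target ∧ e.symm (sliceIncl w) ∈ e'.source :=
  (eventually_sliceIncl_mem hz).and (((e.continuousAt_symm hz).comp
    (sliceInclL n).continuous.continuousAt).eventually (e'.open_source.mem_nhds hz'))

theorem contDiffAt_sliceTrans (he : e ∈ smoothAtlas n M)
    (he' : e' ∈ smoothAtlas n M) (hz : sliceIncl z ∈ e.target)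
    (hz' : e.symm (sliceIncl z) ∈ e'.source) : ContDiffAt ℝ ∞ (sliceTrans e e') z :=
  (sliceProj n).contDiff.contDiffAt.comp z
    ((contDiffAt_coordMap_id he he' hz hz').comp z contDiff_sliceIncl.contDiffAt)

theorem IsSliceChart.fderiv_coordMap_sliceIncl (he : IsSliceChart A e) (he' : IsSliceChart A e')
    (hz : sliceIncl z ∈ e.target) (hz' : e.symm (sliceIncl z) ∈ e'.source) (v : Euc n) :
    fderiv ℝ (coordMap e e' id) (sliceIncl z) (sliceIncl v) =
      sliceIncl (fderiv ℝ (sliceTrans e e') z v) := by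
  rw [← fderiv_comp_sliceIncl
    ((contDiffAt_coordMap_id he.1 he'.1 hz hz').differentiableAt (by simp))]
  have h1 : (fun w : Euc n => coordMap e e' id (sliceIncl w)) =ᶠ[𝓝 z]
      fun w => sliceInclL n (sliceTrans e e' w) := by
    filter_upwards [eventually_symm_sliceIncl_mem hz hz'] with w hw
    exact he.coordMap_slice he' hw.1 hw.2
  have h2 := (sliceInclL n).hasFDerivAt.comp z
    ((contDiffAt_sliceTrans he.1 he'.1 hz hz').differentiableAt (by simp)).hasFDerivAt
  rw [h1.fderiv_eq]
  exact congrArg (fun L : Euc n →L[ℝ] Euc (n + 1) => L v) h2.fderiv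

theorem IsLapseChart.fderiv_coordMap_vert (he : IsLapseChart A S ν u e)
    (he' : IsLapseChart A S ν u e') (hz : sliceIncl z ∈ e.target)
    (hz' : e.symm (sliceIncl z) ∈ e'.source) :
    fderiv ℝ (coordMap e e' id) (sliceIncl z) (vert n) = vert n := by
  have hs := he.slice.coordMap_slice he'.slice hz hz'
  have ht : sliceIncl (sliceTrans e e' z) ∈ e'.target := hs ▸ e'.map_source hz'
  have hp : e'.symm (sliceIncl (sliceTrans e e' z)) = e.symm (sliceIncl z) := by
    rw [← hs]; exact e'.left_inv hz'
  have h1 := mfderiv_chartVec he.slice.1 he'.slice.1 (G := id) hz mdifferentiableAt_id hz' (vert n)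
  simp only [mfderiv_id] at h1
  have h2 : (chartVec e (sliceIncl z) (vert n) : Euc (n + 1)) =
      u (e.symm (sliceIncl z)) • (ν (e.symm (sliceIncl z)) : Euc (n + 1)) :=
    (chartVec_single e _ _).trans (he.coordVec_last z hz)
  have h3 : (chartVec e' (sliceIncl (sliceTrans e e' z)) (vert n) : Euc (n + 1)) =
      u (e'.symm (sliceIncl (sliceTrans e e' z))) •
        (ν (e'.symm (sliceIncl (sliceTrans e e' z))) : Euc (n + 1)) :=
    (chartVec_single e' _ _).trans (he'.coordVec_last _ ht)
  rw [hp] at h3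
  have h4 := congrArg (fun y => (chartVec e' y (fderiv ℝ (coordMap e e' id) (sliceIncl z) (vert n)) :
    Euc (n + 1))) hs
  exact chartVec_injective he'.slice.1 ht (h4.symm.trans (h1.symm.trans (h2.trans h3.symm)))

theorem IsLapseChart.normalSpeed_sliceTrans (he : IsLapseChart A S ν u e)
    (he' : IsLapseChart A S ν u e') (hF : IsVariation n F)
    (hζ : ContMDiff (𝓡 (n + 1)) 𝓘(ℝ, ℝ) ∞ ζ) (hz : sliceIncl z ∈ e.target)
    (hz' : e.symm (sliceIncl z) ∈ e'.source) :
    normalSpeed (sliceFam e' F ζ) (sliceTrans e e' z) = normalSpeed (sliceFam e F ζ) z := by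
  have hs := he.slice.coordMap_slice he'.slice hz hz'
  have ht : sliceIncl (sliceTrans e e' z) ∈ e'.target := hs ▸ e'.map_source hz'
  have hp : e'.symm (sliceIncl (sliceTrans e e' z)) = e.symm (sliceIncl z) := by
    rw [← hs]; exact e'.left_inv hz'
  have hd : ∀ {e : Chart n M} {z : Euc n},
      IsLapseChart A S ν u e → sliceIncl z ∈ e.target →
      HasDerivAt (fun t => sliceFam e F ζ (t, z)) (velocityFam (sliceFam e F ζ) (0, z)) 0 :=
    fun {e z} he hz => by
      have h1 := (contDiffAt_sliceFam he.slice.1 hF hζ hz).differentiableAt (by simp)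
      exact h1.hasFDerivAt.comp_hasDerivAt (0 : ℝ)
        ((hasDerivAt_id (0 : ℝ)).prodMk (hasDerivAt_const (0 : ℝ) z))
  have hτ : HasFDerivAt (coordMap e e' id) (fderiv ℝ (coordMap e e' id) (sliceIncl z))
      (sliceFam e F ζ (0, z)) := by
    rw [sliceFam_zero hF hz]
    exact ((contDiffAt_coordMap_id he.slice.1 he'.slice.1 hz hz').differentiableAt
      (by simp)).hasFDerivAt
  have h1 := hτ.comp_hasDerivAt (0 : ℝ) (hd he hz)
  have h2 : (fun t => sliceFam e' F ζ (t, sliceTrans e e' z)) =ᶠ[𝓝 (0 : ℝ)]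
      coordMap e e' id ∘ fun t => sliceFam e F ζ (t, z) := by
    filter_upwards [eventually_sliceFam_mem he.slice.1 hF hz (ζ (e.symm (sliceIncl z)))] with t ht
    simp only [Function.comp, sliceFam, coordFam, coordMap, hp, id, e.left_inv ht.2]
  have h3 := (hd he' ht).unique (h1.congr_of_eventuallyEq h2)
  have h4 := congrArg (fun v : Euc (n + 1) => v (Fin.last n)) h3
  refine h4.trans ?_
  change fderiv ℝ (coordMap e e' id) (sliceIncl z) (velocityFam (sliceFam e F ζ) (0, z)) (Fin.last n) =
    velocityFam (sliceFam e F ζ) (0, z) (Fin.last n)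
  generalize velocityFam (sliceFam e F ζ) (0, z) = v
  conv_lhs => rw [eq_sliceIncl_add v]
  rw [map_add, map_smul, he.fderiv_coordMap_vert he' hz hz',
    he.slice.fderiv_coordMap_sliceIncl he'.slice hz hz']
  simp [sliceIncl_last, vert_last]

/-- The energy density of the normal speed of a deformation in a lapse chart. -/
def chartEnergy (e : Chart n M) (u : M → ℝ) (F : ℝ → M → M) (ζ : M → ℝ)
    (z : Euc n) : ℝ :=
  sliceFun e u z ^ 2 * ∑ j, ∑ l, (slab (metricCoord e) (sliceIncl z))⁻¹ j l *
    (pd j (normalSpeed (sliceFam e F ζ)) z * pd l (normalSpeed (sliceFam e F ζ)) z)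

theorem chartEnergy_eq_sum {b : Fin n → Euc n}
    (hb : frameGram (slab (metricCoord e) (sliceIncl z)) b = 1) :
    chartEnergy e u F ζ z =
      sliceFun e u z ^ 2 * ∑ i, fderiv ℝ (normalSpeed (sliceFam e F ζ)) z (b i) ^ 2 := by
  simp only [chartEnergy, fderiv_eq_sum_pd, ← sum_frame_mul hb, sq (∑ j, _), Finset.sum_mul_sum]
  congr 1
  simp only [Finset.sum_mul]
  refine (Finset.sum_congr rfl fun j _ => Finset.sum_comm).trans (Finset.sum_comm.trans ?_)
  exact Finset.sum_congr rfl fun i _ => Finset.sum_congr rfl fun j _ =>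
    Finset.sum_congr rfl fun l _ => by ring

theorem IsLapseChart.chartEnergy_sliceTrans (he : IsLapseChart A S ν u e)
    (he' : IsLapseChart A S ν u e') (hF : IsVariation n F)
    (hζ : ContMDiff (𝓡 (n + 1)) 𝓘(ℝ, ℝ) ∞ ζ) (hz : sliceIncl z ∈ e.target)
    (hz' : e.symm (sliceIncl z) ∈ e'.source) {b : Fin n → Euc n}
    (hb : frameGram (slab (metricCoord e) (sliceIncl z)) b = 1) :
    chartEnergy e' u F ζ (sliceTrans e e' z) = chartEnergy e u F ζ z := by
  have hs := he.slice.coordMap_slice he'.slice hz hz'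
  have ht : sliceIncl (sliceTrans e e' z) ∈ e'.target := hs ▸ e'.map_source hz'
  have hp : e'.symm (sliceIncl (sliceTrans e e' z)) = e.symm (sliceIncl z) := by
    rw [← hs]; exact e'.left_inv hz'
  have hb' : frameGram (slab (metricCoord e') (sliceIncl (sliceTrans e e' z)))
      (fun i => fderiv ℝ (sliceTrans e e') z (b i)) = 1 := by
    rw [← hb]
    ext i j
    change quad _ _ _ = quad _ _ _
    rw [slab, slab, ← quad_sliceIncl, ← quad_sliceIncl,
      quad_metricCoord_change he.slice.1 he'.slice.1 hz hz', hs,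
      he.slice.fderiv_coordMap_sliceIncl he'.slice hz hz',
      he.slice.fderiv_coordMap_sliceIncl he'.slice hz hz']
  have hn : normalSpeed (sliceFam e F ζ) =ᶠ[𝓝 z]
      normalSpeed (sliceFam e' F ζ) ∘ sliceTrans e e' := by
    filter_upwards [eventually_symm_sliceIncl_mem hz hz'] with w hw
    exact (he.normalSpeed_sliceTrans he' hF hζ hw.1 hw.2).symm
  have hd := ((contDiffAt_normalSpeed (contDiffAt_sliceFam he'.slice.1 hF hζ ht)).differentiableAt
    (by simp)).hasFDerivAt.comp z
    ((contDiffAt_sliceTrans he.slice.1 he'.slice.1 hz hz').differentiableAt (by simp)).hasFDerivAt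
  rw [chartEnergy_eq_sum hb, chartEnergy_eq_sum hb', sliceFun, sliceFun, hp, hn.fderiv_eq, hd.fderiv]
  rfl

theorem chartEnergy_congr (he : e ∈ smoothAtlas n M)
    (hz : sliceIncl z ∈ e.target) (h : ζ =ᶠ[𝓝 (e.symm (sliceIncl z))] ζ') :
    chartEnergy e u F ζ z = chartEnergy e u F ζ' z := by
  have h1 : normalSpeed (sliceFam e F ζ) =ᶠ[𝓝 z] normalSpeed (sliceFam e F ζ') := by
    filter_upwards [eventually_sliceIncl_mem hz, ((e.continuousAt_symm hz).comp
      (sliceInclL n).continuous.continuousAt).eventually h.eventually_nhds] with w hw hw'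
    rw [normalSpeed, (sliceFam_eventuallyEq he hw hw' 0).fderiv_eq, normalSpeed]
  simp only [chartEnergy, fun j => pd_congr h1 j]

/-- The energy density of the normal speed of a deformation. -/
def lapseEnergy (A S : Set M) (ν : (p : M) → TangentSpace (𝓡 (n + 1)) p) (u : M → ℝ)
    (F : ℝ → M → M) (ζ : M → ℝ) (p : M) : ℝ := by
  classical
  exact if h : ∃ e, IsLapseChart A S ν u e ∧ p ∈ e.source then
    chartEnergy h.choose u F ζ (sliceProj n (h.choose p)) else 0

theorem lapseEnergy_congr {p : M} (hp : p ∈ A) (h : ζ =ᶠ[𝓝 p] ζ') :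
    lapseEnergy A S ν u F ζ p = lapseEnergy A S ν u F ζ' p := by
  unfold lapseEnergy
  split_ifs with he
  · have h1 := he.choose_spec
    have h2 := eq_sliceIncl_of_last ((h1.1.slice.2 p h1.2).1 hp)
    refine chartEnergy_congr h1.1.slice.1 (h2 ▸ he.choose.map_source h1.2) ?_
    rwa [← h2, he.choose.left_inv h1.2]
  · rfl

theorem IsLapseChart.lapseEnergy_eq (he : IsLapseChart A S ν u e) (hF : IsVariation n F)
    (hζ : ContMDiff (𝓡 (n + 1)) 𝓘(ℝ, ℝ) ∞ ζ) {p : M} (hp : p ∈ e.source) (hz : e p = sliceIncl z)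
    {b : Fin n → Euc n} (hb : frameGram (slab (metricCoord e) (sliceIncl z)) b = 1) :
    lapseEnergy A S ν u F ζ p = chartEnergy e u F ζ z := by
  have hex : ∃ e, IsLapseChart A S ν u e ∧ p ∈ e.source := ⟨e, he, hp⟩
  have h1 := hex.choose_spec
  have h2 : e.symm (sliceIncl z) = p := by rw [← hz, e.left_inv hp]
  have h3 : sliceTrans e hex.choose z = sliceProj n (hex.choose p) := by
    rw [sliceTrans, coordMap, h2]; rfl
  rw [lapseEnergy, dif_pos hex, ← h3]
  exact he.chartEnergy_sliceTrans h1.1 hF hζ (hz ▸ e.map_source hp) (by rw [h2]; exact h1.2) hb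

end Transition

section EnergyIdentity

variable {n : ℕ} {M : Type*} [EMetricSpace M] [CompactSpace M] [MeasurableSpace M] [BorelSpace M]
  [ChartedSpace (Euc (n + 1)) M] [IsManifold (𝓡 (n + 1)) ∞ M]
  [RiemannianBundle (fun x : M => TangentSpace (𝓡 (n + 1)) x)]
  [IsContMDiffRiemannianBundle (𝓡 (n + 1)) ∞ (Euc (n + 1))
    (fun x : M => TangentSpace (𝓡 (n + 1)) x)]
  {V : Varifold n M} {S : Set M} {ν : (p : M) → TangentSpace (𝓡 (n + 1)) p} {u : M → ℝ}
  {e : Chart n M} {F : ℝ → M → M} {ζ ζ' : M → ℝ}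

/-- The field whose divergence is the tangential part of the second variation. -/
def tangField (e : Chart n M) (F : ℝ → M → M) (ζ : M → ℝ) :
    Euc n → Euc n :=
  accelField (IsLapseMetric.density (metricCoord e)) (tangFam (sliceFam e F ζ))

theorem IsLapseChart.ae_secondVar (hV : V.IsStationary) (he : IsLapseChart V.spt S ν u e)
    (hν : IsUnitNormal V.spt ν) (hS : IsClosed S) (hu : IsPositiveJacobi V.spt S ν u)
    (hF : IsVariation n F) : ∀ᵐ ξ ∂(V : Measure (Gr n M)), ξ.1 ∈ e.source →
      sliceIncl (sliceProj n (e ξ.1)) ∈ e.target ∧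
      ∀ ζ : M → ℝ, ContMDiff (𝓡 (n + 1)) 𝓘(ℝ, ℝ) ∞ ζ → 0 ≤ lapseEnergy V.spt S ν u F ζ ξ.1 ∧
        secondVar F ζ ξ = lapseEnergy V.spt S ν u F ζ ξ.1 +
          (IsLapseMetric.density (metricCoord e) (sliceProj n (e ξ.1)))⁻¹ *
            divField (tangField e F ζ) (sliceProj n (e ξ.1)) := by
  have hg := he.isJacobiMetric hV hν hS hu
  filter_upwards [hV.ae_exists_frame he.slice hg.toIsLapseMetric] with ξ h hs
  obtain ⟨hz, b, hb, hb'⟩ := h hs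
  generalize sliceProj n (e ξ.1) = z at hz ⊢
  rw [hz] at hb'
  refine ⟨hz ▸ e.map_source hs, fun ζ hζ => ?_⟩
  rw [he.lapseEnergy_eq hF hζ hs hz hb', chartEnergy_eq_sum hb']
  exact ⟨by positivity, secondVar_eq_sliceFam he.slice.1 hF hζ hg hs hz hb hb'⟩

theorem tangField_congr {z : Euc n} (he : e ∈ smoothAtlas n M)
    (hz : sliceIncl z ∈ e.target) (h : ζ =ᶠ[𝓝 (e.symm (sliceIncl z))] ζ') :
    tangField e F ζ z = tangField e F ζ' z := by
  have h1 : tangFam (sliceFam e F ζ) =ᶠ[𝓝 (0, z)] tangFam (sliceFam e F ζ') := by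
    filter_upwards [sliceFam_eventuallyEq he hz h 0] with q hq
    rw [tangFam, hq, tangFam]
  have h2 : velocityFam (tangFam (sliceFam e F ζ)) =ᶠ[𝓝 (0, z)]
      velocityFam (tangFam (sliceFam e F ζ')) := by
    filter_upwards [h1.eventuallyEq_nhds] with q hq
    rw [velocityFam, hq.fderiv_eq, velocityFam]
  have h3 : ∀ᶠ w in 𝓝 z, velocityFam (tangFam (sliceFam e F ζ)) (0, w) =
      velocityFam (tangFam (sliceFam e F ζ')) (0, w) :=
    (Continuous.prodMk_right (0 : ℝ)).continuousAt.eventually h2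
  have h4 : ∀ i j, pd j (fun x => velocityFam (tangFam (sliceFam e F ζ)) (0, x) i) z =
      pd j (fun x => velocityFam (tangFam (sliceFam e F ζ')) (0, x) i) z := fun i j =>
    pd_congr (h3.mono fun w hw => by rw [hw]) j
  have h5 : velocityFam (velocityFam (tangFam (sliceFam e F ζ))) (0, z) =
      velocityFam (velocityFam (tangFam (sliceFam e F ζ'))) (0, z) := by
    rw [velocityFam, h2.fderiv_eq]; rfl
  simp only [tangField, accelField, h4, h5, h3.self_of_nhds]

theorem contDiffAt_tangField {g : Euc n → ℝ} {z : Euc n} (he : e ∈ smoothAtlas n M)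
    (hg : IsLapseMetric (metricCoord e) e.target g) (hF : IsVariation n F)
    (hζ : ContMDiff (𝓡 (n + 1)) 𝓘(ℝ, ℝ) ∞ ζ) (hz : sliceIncl z ∈ e.target) :
    ContDiffAt ℝ ∞ (tangField e F ζ) z :=
  contDiffAt_accelField (hg.smooth_density hz)
    ((sliceProj n).contDiff.contDiffAt.comp ((0 : ℝ), z) (contDiffAt_sliceFam he hF hζ hz))

/-- The second variation is the energy of the normal speed, up to a term of integral zero. -/
def HasEnergyIdentity (V : Varifold n M) (S : Set M) (ν : (p : M) → TangentSpace (𝓡 (n + 1)) p)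
    (u : M → ℝ) (F : ℝ → M → M) (ζ : M → ℝ) : Prop :=
  ∃ D : Gr n M → ℝ, Integrable D (V : Measure (Gr n M)) ∧ ∫ ξ, D ξ ∂(V : Measure (Gr n M)) = 0 ∧
    ∀ᵐ ξ ∂(V : Measure (Gr n M)), 0 ≤ lapseEnergy V.spt S ν u F ζ ξ.1 ∧
      secondVar F ζ ξ = lapseEnergy V.spt S ν u F ζ ξ.1 + D ξ

theorem secondVar_congr_of_eventuallyEq (hF : IsVariation n F)
    (hζ : ContMDiff (𝓡 (n + 1)) 𝓘(ℝ, ℝ) ∞ ζ) (hζ' : ContMDiff (𝓡 (n + 1)) 𝓘(ℝ, ℝ) ∞ ζ') {ξ : Gr n M}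
    (h : ζ =ᶠ[𝓝 ξ.1] ζ') : secondVar F ζ ξ = secondVar F ζ' ξ :=
  secondVar_congr hF hζ hζ' h.self_of_nhds fun v => by rw [dfun, h.mfderiv_eq]; rfl

/-- Two functions that agree outside a compact part of a lapse chart have second variations and
energies that differ by the same amount, up to a term of integral zero. -/
theorem HasEnergyIdentity.of_eventuallyEq (hV : V.IsStationary) (he : IsLapseChart V.spt S ν u e)
    (hν : IsUnitNormal V.spt ν) (hS : IsClosed S) (hu : IsPositiveJacobi V.spt S ν u)
    (hF : IsVariation n F) (hζ : ContMDiff (𝓡 (n + 1)) 𝓘(ℝ, ℝ) ∞ ζ)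
    (hζ' : ContMDiff (𝓡 (n + 1)) 𝓘(ℝ, ℝ) ∞ ζ') {K : Set (Euc (n + 1))} (hK : IsCompact K)
    (hKe : K ⊆ e.target) (hζK : ∀ p, p ∉ e.symm '' K → ζ =ᶠ[𝓝 p] ζ')
    (h : HasEnergyIdentity V S ν u F ζ') : HasEnergyIdentity V S ν u F ζ := by
  have hg := (he.isJacobiMetric hV hν hS hu).toIsLapseMetric
  set r := IsLapseMetric.density (metricCoord e) with hr
  set W : Euc n → Euc n := fun w => (sliceInclL n ⁻¹' e.target).indicator
    (fun w => (r w)⁻¹ • (tangField e F ζ w - tangField e F ζ' w)) w with hW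
  have hWof : ∀ {w}, sliceIncl w ∈ e.target →
      W w = (r w)⁻¹ • (tangField e F ζ w - tangField e F ζ' w) := fun {w} hw =>
    indicator_of_mem (s := sliceInclL n ⁻¹' e.target) hw _
  have hW0 : ∀ w, w ∉ sliceInclL n ⁻¹' K → W w = 0 := fun w hw => by
    by_cases ht : sliceIncl w ∈ e.target
    · rw [hWof ht, tangField_congr he.slice.1 ht (hζK _ ?_), sub_self, smul_zero]
      rintro ⟨y, hy, hyw⟩
      refine hw (?_ : sliceIncl w ∈ K)
      rwa [← e.symm.injOn (hKe hy) ht hyw]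
    · exact indicator_of_notMem (s := sliceInclL n ⁻¹' e.target) ht _
  have hKc : IsClosed (sliceInclL n ⁻¹' K) := hK.isClosed.preimage (sliceInclL n).continuous
  have hKK : IsCompact (sliceInclL n ⁻¹' K) := by
    refine (hK.image (sliceProj n).continuous).of_isClosed_subset hKc fun w hw => ?_
    exact ⟨sliceIncl w, hw, sliceProj_sliceIncl w⟩
  have hWs : ContDiff ℝ ∞ W := contDiff_iff_contDiffAt.2 fun w => by
    by_cases hw : w ∈ sliceInclL n ⁻¹' K
    · have ht : sliceIncl w ∈ e.target := hKe hw
      have h1 : W =ᶠ[𝓝 w] fun w => (r w)⁻¹ • (tangField e F ζ w - tangField e F ζ' w) := by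
        filter_upwards [hg.eventually_mem ht] with x hx using hWof hx
      refine ContDiffAt.congr_of_eventuallyEq ?_ h1
      exact ((hg.smooth_density ht).inv (hg.density_pos ht).ne').smul
        ((contDiffAt_tangField he.slice.1 hg hF hζ ht).sub
          (contDiffAt_tangField he.slice.1 hg hF hζ' ht))
    · exact contDiffAt_const.congr_of_eventuallyEq
        (Filter.eventually_of_mem (hKc.isOpen_compl.mem_nhds hw) hW0)
  have hWsub : tsupport W ⊆ sliceInclL n ⁻¹' K :=
    closure_minimal (fun w hw => by_contra fun h => hw (hW0 w h)) hKc
  obtain ⟨D, hDi, hD0, hDe, hDs⟩ := hV.exists_integral_divField he.slice hg hWs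
    (HasCompactSupport.intro hKK hW0) fun z hz => hKe (hWsub hz)
  obtain ⟨D', hDi', hD0', hD'⟩ := h
  refine ⟨fun ξ => D' ξ + D ξ, hDi'.add hDi, by rw [integral_add hDi' hDi, hD0, hD0', add_zero], ?_⟩
  filter_upwards [hD', hDe, he.ae_secondVar hV hν hS hu hF, V.ae_mem_spt] with ξ h1 h2 h3 h4
  by_cases hs : ξ.1 ∈ e.source
  · obtain ⟨hz, h5⟩ := h3 hs
    have h6 := h2 hs
    obtain ⟨h7, h8⟩ := h5 ζ hζ
    obtain ⟨-, h9⟩ := h5 ζ' hζ'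
    refine ⟨h7, ?_⟩
    have h10 : (fun w => r w • W w) =ᶠ[𝓝 (sliceProj n (e ξ.1))]
        fun w => tangField e F ζ w - tangField e F ζ' w := by
      filter_upwards [hg.eventually_mem hz] with w hw
      rw [hWof hw, smul_inv_smul₀ (hg.density_pos hw).ne']
    rw [divField_congr h10, divField_sub (contDiffAt_tangField he.slice.1 hg hF hζ hz)
      (contDiffAt_tangField he.slice.1 hg hF hζ' hz)] at h6
    rw [h6, h8]
    linarith [h1.2]
  · have h5 : ζ =ᶠ[𝓝 ξ.1] ζ' := hζK _ fun ⟨y, hy, h⟩ => hs (h ▸ e.map_target (hKe hy))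
    rw [hDs ξ hs, add_zero, secondVar_congr_of_eventuallyEq hF hζ hζ' h5, lapseEnergy_congr h4 h5]
    exact h1

theorem hasEnergyIdentity_of_eventuallyEq_zero (hF : IsVariation n F)
    (hζ : ContMDiff (𝓡 (n + 1)) 𝓘(ℝ, ℝ) ∞ ζ) (h : ∀ p ∈ V.spt, ζ =ᶠ[𝓝 p] fun _ => 0) :
    HasEnergyIdentity V S ν u F ζ := by
  refine ⟨0, integrable_zero _ _ _, by simp, ?_⟩
  filter_upwards [V.ae_mem_spt] with ξ hξ
  have h1 : lapseEnergy V.spt S ν u F (fun _ => 0) ξ.1 = 0 := by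
    rw [lapseEnergy]
    split_ifs with he
    · have hc := he.choose_spec
      have hz := eq_sliceIncl_of_last ((hc.1.slice.2 _ hc.2).1 hξ)
      have ht := hz ▸ he.choose.map_source hc.2
      have h2 : normalSpeed (sliceFam he.choose F fun _ => 0) =ᶠ[𝓝 (sliceProj n (he.choose ξ.1))]
          fun _ => 0 := by
        filter_upwards [eventually_sliceIncl_mem ht] with w hw
        exact normalSpeed_sliceFam_zero hc.1.slice.1 hF hw
      have h3 : ∀ j, pd j (normalSpeed (sliceFam he.choose F fun _ => 0))
          (sliceProj n (he.choose ξ.1)) = 0 := fun j => (pd_congr h2 j).trans (by simp [pd])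
      simp [chartEnergy, h3]
    · rfl
  rw [lapseEnergy_congr hξ (h _ hξ), secondVar_congr_of_eventuallyEq hF hζ contMDiff_const (h _ hξ), h1]
  refine ⟨le_rfl, ?_⟩
  have h2 : (fun t => planeJac (deform F (fun _ => 0) t) ξ) = fun _ => planeJac (F 0) ξ := by
    funext t
    congr 1
    funext p
    rw [deform, mul_zero]
  simp [secondVar, h2]

theorem hasEnergyIdentity (hV : V.IsStationary) (hν : IsUnitNormal V.spt ν) (hS : IsClosed S)
    (hsing : singPart n V.spt ⊆ S) (hu : IsPositiveJacobi V.spt S ν u) (hF : IsVariation n F)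
    (hζ : ContMDiff (𝓡 (n + 1)) 𝓘(ℝ, ℝ) ∞ ζ) (hζS : ∀ p ∈ S, ∀ᶠ q in 𝓝 p, ζ q = 0) :
    HasEnergyIdentity V S ν u F ζ := by
  have hbump : ∀ p : M, p ∈ tsupport ζ ∩ V.spt → ∃ U : Set M, IsOpen U ∧ p ∈ U ∧ ∀ ζ : M → ℝ,
      ContMDiff (𝓡 (n + 1)) 𝓘(ℝ, ℝ) ∞ ζ → ∃ ζ' : M → ℝ, ContMDiff (𝓡 (n + 1)) 𝓘(ℝ, ℝ) ∞ ζ' ∧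
        (∀ q ∈ U, ζ' =ᶠ[𝓝 q] fun _ => 0) ∧
        (∀ q, (ζ =ᶠ[𝓝 q] fun _ => 0) → ζ' =ᶠ[𝓝 q] fun _ => 0) ∧
        (HasEnergyIdentity V S ν u F ζ' → HasEnergyIdentity V S ν u F ζ) := by
    rintro p ⟨hp, hpV⟩
    have hpS : p ∉ S := fun h => (notMem_tsupport_iff_eventuallyEq.2 (hζS p h)) hp
    obtain ⟨e, he, hpe⟩ := hu.exists_lapseChart hν hS hsing hpV hpS
    obtain ⟨κ, hκ, hκc, hκe, -, hκ1⟩ := exists_smooth_cutoff (isCompact_singleton (x := e p))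
      e.open_target (singleton_subset_iff.2 (e.map_source hpe))
    have hθ := contMDiff_chartExtend he.slice.1 hκ hκc hκe
    have h1 : ∀ᶠ q in 𝓝 p, chartExtend e κ q = 1 := by
      filter_upwards [(e.continuousAt hpe).eventually (hκ1 _ rfl), e.open_source.mem_nhds hpe]
        with q hq hqe
      rw [chartExtend_of_mem hqe, hq]
    obtain ⟨U, hU, hUo, hpU⟩ := mem_nhds_iff.1 h1
    refine ⟨U, hUo, hpU, fun ζ hζ => ⟨fun q => ζ q * (1 - chartExtend e κ q),
      hζ.mul (contMDiff_const.sub hθ), fun q hq => ?_, fun q hq => ?_, fun h => ?_⟩⟩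
    · filter_upwards [hUo.mem_nhds hq] with x hx
      rw [hU hx, sub_self, mul_zero]
    · filter_upwards [hq] with x hx
      rw [hx, zero_mul]
    · refine h.of_eventuallyEq hV he hν hS hu hF hζ (hζ.mul (contMDiff_const.sub hθ)) hκc.isCompact
        hκe fun q hq => ?_
      filter_upwards [chartExtend_eventuallyEq_zero hκc hκe hq] with x hx
      change ζ x = ζ x * (1 - chartExtend e κ x)
      rw [hx, sub_zero, mul_one]
  choose! U hUo hpU hUζ using hbump
  have hcpt : IsCompact (tsupport ζ ∩ V.spt) :=
    ((isClosed_tsupport ζ).inter Measure.isClosed_support).isCompact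
  obtain ⟨t, htK, htc⟩ := hcpt.elim_nhds_subcover U fun p hp => (hUo p hp).mem_nhds (hpU p hp)
  have key : ∀ t : Finset M, (∀ p ∈ t, p ∈ tsupport ζ ∩ V.spt) → ∀ ξ : M → ℝ,
      ContMDiff (𝓡 (n + 1)) 𝓘(ℝ, ℝ) ∞ ξ → (∀ q ∈ V.spt, q ∉ ⋃ p ∈ t, U p → ξ =ᶠ[𝓝 q] fun _ => 0) →
      HasEnergyIdentity V S ν u F ξ := by
    classical
    intro t
    induction t using Finset.induction_on with
    | empty =>
      exact fun _ ξ hξ h => hasEnergyIdentity_of_eventuallyEq_zero hF hξ fun q hq => h q hq (by simp)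
    | insert p t _ ih =>
      intro hK ξ hξ h
      obtain ⟨ξ', hξ', h1, h2, h3⟩ := hUζ p (hK p (Finset.mem_insert_self _ _)) ξ hξ
      refine h3 (ih (fun q hq => hK q (Finset.mem_insert_of_mem hq)) ξ' hξ' fun q hq hqt => ?_)
      by_cases hqU : q ∈ U p
      · exact h1 q hqU
      · refine h2 q (h q hq ?_)
        simpa [hqU] using hqt
  refine key t htK ζ hζ fun q hq hqt => ?_
  refine notMem_tsupport_iff_eventuallyEq.1 fun hqs => hqt (htc ⟨hqs, hq⟩)

theorem HasEnergyIdentity.integral_secondVar_nonneg (hF : IsVariation n F)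
    (hζ : ContMDiff (𝓡 (n + 1)) 𝓘(ℝ, ℝ) ∞ ζ) (h : HasEnergyIdentity V S ν u F ζ) :
    0 ≤ ∫ ξ, secondVar F ζ ξ ∂(V : Measure (Gr n M)) := by
  obtain ⟨D, hDi, hD0, hD⟩ := h
  have h1 := integral_sub (integrable_firstVar_secondVar hF hζ V).2 hDi
  rw [hD0, sub_zero] at h1
  rw [← h1]
  refine integral_nonneg_of_ae ?_
  filter_upwards [hD] with ξ hξ
  change 0 ≤ secondVar F ζ ξ - D ξ
  linarith [hξ.1, hξ.2]

end EnergyIdentity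

end

theorem mainTheorem9 {n : ℕ} {M : Type*} [EMetricSpace M] [CompactSpace M]
    [MeasurableSpace M] [BorelSpace M]
    [ChartedSpace (Euc (n + 1)) M] [IsManifold (𝓡 (n + 1)) ∞ M]
    [RiemannianBundle (fun x : M => TangentSpace (𝓡 (n + 1)) x)]
    [IsContMDiffRiemannianBundle (𝓡 (n + 1)) ∞ (Euc (n + 1))
      (fun x : M => TangentSpace (𝓡 (n + 1)) x)]
    [IsRiemannianManifold (𝓡 (n + 1)) M]
    (d : MetricSpace (Gr n M))
    (hd : d.toPseudoMetricSpace.toUniformSpace.toTopologicalSpace = Gr.topology)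
    (V : Varifold n M) (hV : V.IsMinimalOptimal)
    (ν : (p : M) → TangentSpace (𝓡 (n + 1)) p) (hν : IsUnitNormal V.spt ν)
    (S : Set M) (hS : IsClosed S) (hsing : singPart n V.spt ⊆ S) (hcodim : HasCodimSeven n S)
    (u : M → ℝ) (hu : IsPositiveJacobi V.spt S ν u) :
    V.IsStable d := by
  intro h
  obtain ⟨F, hF, hlt⟩ := Varifold.IsUnstable.exists_variation hV.mem h
  obtain ⟨ζ, hζ, hζS, hδ⟩ := hV.stationary.exists_cutoff hF hS hcodim (half_pos (neg_pos.2 hlt))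
  have h1 := (hasEnergyIdentity hV.stationary hν hS hsing hu hF hζ hζS).integral_secondVar_nonneg hF hζ
  have h2 := (abs_le.1 hδ).1
  linarith
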